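/- Let $(M,g)$ be a Kähler manifold of complex dimension $n$, with Kähler form $\frac{\sqrt{-1}}{2\pi}\sum g_{i\bar j}\,dz_i\wedge d\bar z_j$ in local holomorphic coordinates. A holomorphic coordinate system around $x\in M$ is *normal up to order $N$* if at $x$ one has $g_{i\bar j}=\delta_{ij}$ and $\partial_{k_1}\cdots\partial_{k_r}g_{i\bar j}=\bar\partial_{l_1}\cdots\bar\partial_{l_r}g_{i\bar j}=0$ for all indices and all $1\le r\le N$. A *pointed stable graph* $\Gamma=(V\cup\{f\},E)$ is a finite digraph (loops and multiple edges allowed) with a distinguished vertex $f$, such that every ordinary vertex $v\in V$ has indegree and outdegree at least $2$. Its weight is $|E|-|V|$. $\dot{\rm Aut}(\Gamma)$ is the group of automorphisms of $\Gamma$ (acting on vertices and on edges) fixing $f$, and $A(\Gamma_-)$ is the adjacency matrix of the graph $\Gamma_-$ obtained by removing $f$. For functions $f_1,f_2\in C^\infty(M)$ (smooth and complex valued) and a normal coordinate system at $x$, let $D_\Gamma(f_1,f_2)|_x$ be the following contraction at $x$. Every edge carries a pair of contracted indices, an unbarred index $i$ at its source and the barred index $\bar i$ at its target, and one sums over the values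 $1,\dots,n$ of all of them. Every ordinary vertex contributes the partial derivative $g_{i\bar j\alpha}$ of the metric whose unbarred indices are those of its outgoing edges and whose barred indices are those of its incoming edges. The edges entering $f$ contribute the corresponding derivative $\bar\partial_{i_1}\cdots\bar\partial_{i_r}f_1$, and the edges leaving $f$ the corresponding derivative $\partial_{j_1}\cdots\partial_{j_s}f_2$. For $f_1,f_2\in C^\infty(M)$ put $$f_1\star f_2=\sum_{k\ge0}h^kC_k(f_1,f_2),\qquad C_k(f_1,f_2)(x)=\sum_{\Gamma}\frac{\det(A(\Gamma_-)-I)}{|\dot{\rm Aut}(\Gamma)|}\,D_\Gamma(f_1,f_2)\Big|_x ,$$ where $\Gamma$ runs over the isomorphism classes of strongly connected pointed stable graphs of weight $k$ and $D_\Gamma$ is evaluated in a coordinate system around $x$ that is normal up to order $3k$. Extend $\star$ to a $\mathbb C[[h]]$-bilinear product of formal power series. **Proposition.** Coordinate systems that are normal up to any given order exist around every point of $M$. The value $C_k(f_1,f_2)(x)$ is the same for all coordinate systems around $x$ that are normal up to some order $N\ge 3k$. The product $\star$ maps $C^\infty(M)[[h]]\times C^\infty(M)[[h]]$ to $C^\infty(M)[[h]]$,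 and it is associative: for all $f_1,f_2,f_3\in C^\infty(M)[[h]]$, $$f_1\star(f_2\star f_3)=(f_1\star f_2)\star f_3 .$$ -/

import Mathlib

open scoped Manifold ContDiff

noncomputable section

namespace BerezinStar

/-! ### Pointed digraphs -/

/-- A digraph (loops and multiple edges allowed) with `p` ordinary vertices, one distinguished
vertex `f`, and `q` edges. The vertex set is `Option (Fin p)`, where `none` is the
distinguished vertex `f`; the edge `e` goes from `src e` to `tgt e`. -/
@[ext]
structure PointedGraph (p q : ℕ) where
  src : Fin q → Option (Fin p)
  tgt : Fin q → Option (Fin p)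

namespace PointedGraph

variable {p q : ℕ}

/-- A pair of bijections of the ordinary vertices and of the edges which is compatible with
sources and targets. The distinguished vertex is fixed. -/
def IsIso (G H : PointedGraph p q) (s : Equiv.Perm (Fin p) × Equiv.Perm (Fin q)) : Prop :=
  (∀ e, H.src (s.2 e) = (G.src e).map s.1) ∧ (∀ e, H.tgt (s.2 e) = (G.tgt e).map s.1)

/-- The automorphisms of a pointed graph fixing the distinguished vertex. As usual for
multigraphs (and for graphs as contraction schemes), an automorphism acts on the vertices and
on the edges, so that the graph with one vertex and `k` loops has `k!` automorphisms. -/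
def Aut (G : PointedGraph p q) : Set (Equiv.Perm (Fin p) × Equiv.Perm (Fin q)) :=
  {s | G.IsIso G s}

/-- Isomorphism of pointed graphs. -/
def isoSetoid (p q : ℕ) : Setoid (PointedGraph p q) where
  r G H := ∃ s, G.IsIso H s
  iseqv :=
    { refl := fun G => ⟨(1, 1), fun e => by simp, fun e => by simp⟩
      symm := by
        rintro G H ⟨⟨a, b⟩, h1, h2⟩
        refine ⟨(a.symm, b.symm), fun e => ?_, fun e => ?_⟩
        · have := h1 (b.symm e)
          simp only [Equiv.apply_symm_apply] at this
          simp [this, Option.map_map, Function.comp_def]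
        · have := h2 (b.symm e)
          simp only [Equiv.apply_symm_apply] at this
          simp [this, Option.map_map, Function.comp_def]
      trans := by
        rintro G H K ⟨⟨a, b⟩, h1, h2⟩ ⟨⟨c, d⟩, h3, h4⟩
        refine ⟨(c * a, d * b), fun e => ?_, fun e => ?_⟩
        · simpa [h1, Option.map_map] using h3 (b e)
        · simpa [h2, Option.map_map] using h4 (b e) }

/-- Isomorphism classes of pointed graphs. -/
def IsoClass (p q : ℕ) : Type := Quotient (isoSetoid p q)

instance : Finite (PointedGraph p q) :=
  Finite.of_injective (fun G => (G.src, G.tgt)) fun G H h => by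
    cases G; cases H; simpa using h

instance : Finite (IsoClass p q) := Quotient.finite _

instance : Fintype (IsoClass p q) := Fintype.ofFinite _

/-- The edges leaving `v`. -/
def outEdges (G : PointedGraph p q) (v : Option (Fin p)) : List (Fin q) :=
  (List.finRange q).filter fun e => G.src e = v

/-- The edges entering `v`. -/
def inEdges (G : PointedGraph p q) (v : Option (Fin p)) : List (Fin q) :=
  (List.finRange q).filter fun e => G.tgt e = v

/-- Every ordinary vertex has indegree and outdegree at least two. -/
def Stable (G : PointedGraph p q) : Prop :=
  ∀ v : Fin p, 2 ≤ (G.inEdges (some v)).length ∧ 2 ≤ (G.outEdges (some v)).length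

/-- There is a directed path from every vertex to every vertex (`f` included). -/
def StronglyConnected (G : PointedGraph p q) : Prop :=
  ∀ u v, Relation.ReflTransGen (fun a b => ∃ e, G.src e = a ∧ G.tgt e = b) u v

/-- The adjacency matrix `A(Γ₋)` of the graph with the distinguished vertex removed: the entry
at `(i, j)` is the number of edges from `i` to `j`. -/
def adj (G : PointedGraph p q) : Matrix (Fin p) (Fin p) ℤ := fun i j =>
  (((List.finRange q).filter fun e => G.src e = some i ∧ G.tgt e = some j).length : ℤ)

/-- The coefficient `det (A(Γ₋) - I) / |Aut Γ|`. -/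
def coefficient (G : PointedGraph p q) : ℂ :=
  (((G.adj - 1).det : ℤ) : ℂ) / ((Nat.card G.Aut : ℕ) : ℂ)

/-- A stable pointed graph of weight `k` (that is, with `k` more edges than ordinary vertices)
has at most `k` ordinary vertices. -/
theorem Stable.card_le {p k : ℕ} {G : PointedGraph p (p + k)} (h : G.Stable) : p ≤ k := by
  have key : ∀ v : Fin p, 2 ≤ (Finset.univ.filter fun e => G.tgt e = some v).card := fun v => by
    have h1 := (h v).1
    rw [inEdges] at h1
    have : ((List.finRange (p + k)).filter fun e => decide (G.tgt e = some v)).toFinset =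
        Finset.univ.filter fun e => G.tgt e = some v := by ext; simp
    rw [← this, List.toFinset_card_of_nodup ((List.nodup_finRange _).filter _)]
    exact h1
  have hs : ∑ v : Fin p, (Finset.univ.filter fun e => G.tgt e = some v).card ≤ p + k := by
    rw [← Finset.card_biUnion]
    · exact (Finset.card_le_univ _).trans (by simp)
    · intro a _ b _ hab
      refine Finset.disjoint_left.2 fun e he he' => hab ?_
      simp only [Finset.mem_filter, Finset.mem_univ, true_and] at he he'
      exact Option.some.inj (he.symm.trans he')
  have h2 := Finset.sum_le_sum fun v (_ : v ∈ Finset.univ) => key v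
  simp only [Finset.sum_const, Finset.card_univ, Fintype.card_fin, smul_eq_mul] at h2
  omega

end PointedGraph

/-! ### Wirtinger derivatives -/

variable {n : ℕ}

/-- `∂u/∂zᵢ`. -/
def dz (i : Fin n) (u : (Fin n → ℂ) → ℂ) (z : Fin n → ℂ) : ℂ :=
  (1 / 2) * (fderiv ℝ u z (Pi.single i 1) - Complex.I * fderiv ℝ u z (Pi.single i Complex.I))

/-- `∂u/∂z̄ᵢ`. -/
def dzbar (i : Fin n) (u : (Fin n → ℂ) → ℂ) (z : Fin n → ℂ) : ℂ :=
  (1 / 2) * (fderiv ℝ u z (Pi.single i 1) + Complex.I * fderiv ℝ u z (Pi.single i Complex.I))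

/-- `∂_{i₁} ⋯ ∂_{iᵣ} u` for a list of indices. -/
def iterDz (l : List (Fin n)) (u : (Fin n → ℂ) → ℂ) : (Fin n → ℂ) → ℂ := l.foldr dz u

/-- `∂̄_{i₁} ⋯ ∂̄_{iᵣ} u` for a list of indices. -/
def iterDzbar (l : List (Fin n)) (u : (Fin n → ℂ) → ℂ) : (Fin n → ℂ) → ℂ := l.foldr dzbar u

/-! ### Kähler metrics -/

/-- The holomorphic coordinate systems of a complex manifold. -/
def holoCharts (n : ℕ) (M : Type*) [TopologicalSpace M] [ChartedSpace (Fin n → ℂ) M] :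
    Set (OpenPartialHomeomorph M (Fin n → ℂ)) :=
  IsManifold.maximalAtlas 𝓘(ℂ, Fin n → ℂ) ω M

/-- Smooth (in the real sense) complex valued functions. -/
def SmoothFun (n : ℕ) {M : Type*} [TopologicalSpace M] [ChartedSpace (Fin n → ℂ) M]
    (f : M → ℂ) : Prop :=
  ContMDiff 𝓘(ℝ, Fin n → ℂ) 𝓘(ℝ, ℂ) ∞ f

/-- The components `g_{i j̄} = ⟨∂/∂zᵢ, ∂/∂zⱼ⟩` of a family of sesquilinear forms on the tangent
spaces (linear in the first argument, conjugate linear in the second), in the chart `φ`. -/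
def components {n : ℕ} {M : Type*} [TopologicalSpace M] [ChartedSpace (Fin n → ℂ) M]
    (b : ∀ x : M, TangentSpace 𝓘(ℂ, Fin n → ℂ) x →ₗ[ℂ]
      TangentSpace 𝓘(ℂ, Fin n → ℂ) x →ₗ⋆[ℂ] ℂ)
    (φ : OpenPartialHomeomorph M (Fin n → ℂ)) (i j : Fin n) (z : Fin n → ℂ) : ℂ :=
  b (φ.symm z)
    (mfderiv 𝓘(ℂ, Fin n → ℂ) 𝓘(ℂ, Fin n → ℂ) φ.symm z (Pi.single i 1 : Fin n → ℂ))
    (mfderiv 𝓘(ℂ, Fin n → ℂ) 𝓘(ℂ, Fin n → ℂ) φ.symm z (Pi.single j 1 : Fin n → ℂ))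

/-- A Kähler metric on a complex manifold of dimension `n`: a smooth positive definite Hermitian
form on the (holomorphic) tangent spaces whose Kähler form
`(√-1 / 2π) ∑ g_{i j̄} dzᵢ ∧ dz̄ⱼ` is closed. -/
structure KahlerMetric (n : ℕ) (M : Type*) [TopologicalSpace M]
    [ChartedSpace (Fin n → ℂ) M] where
  form : ∀ x : M, TangentSpace 𝓘(ℂ, Fin n → ℂ) x →ₗ[ℂ]
    TangentSpace 𝓘(ℂ, Fin n → ℂ) x →ₗ⋆[ℂ] ℂ
  hermitian : ∀ x u v, form x v u = starRingEnd ℂ (form x u v)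
  posDef : ∀ x u, u ≠ 0 → 0 < (form x u u).re
  smooth : ∀ φ ∈ holoCharts n M, ∀ i j, ContDiffOn ℝ ∞ (components form φ i j) φ.target
  closed : ∀ φ ∈ holoCharts n M, ∀ i j k, ∀ z ∈ φ.target,
    dz k (components form φ i j) z = dz i (components form φ k j) z

section StarProduct

variable {M : Type*} [TopologicalSpace M] [ChartedSpace (Fin n → ℂ) M]

/-- The function `g_{i j̄}` in the chart `φ`. -/
def KahlerMetric.comp (g : KahlerMetric n M) (φ : OpenPartialHomeomorph M (Fin n → ℂ))
    (i j : Fin n) : (Fin n → ℂ) → ℂ :=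
  components g.form φ i j

/-- `φ` is a normal coordinate system around `x` up to order `N`: at `x` one has
`g_{i j̄} = δ_{ij}` and `g_{i j̄ k₁ ⋯ kᵣ} = g_{i j̄ l̄₁ ⋯ l̄ᵣ} = 0` for `1 ≤ r ≤ N`. -/
structure IsNormalAt (g : KahlerMetric n M) (N : ℕ) (x : M)
    (φ : OpenPartialHomeomorph M (Fin n → ℂ)) : Prop where
  mem_charts : φ ∈ holoCharts n M
  mem_source : x ∈ φ.source
  metric_eq : ∀ i j, g.comp φ i j (φ x) = if i = j then 1 else 0
  holo_eq_zero : ∀ i j, ∀ l : List (Fin n), 1 ≤ l.length → l.length ≤ N →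
    iterDz l (g.comp φ i j) (φ x) = 0
  antiholo_eq_zero : ∀ i j, ∀ l : List (Fin n), 1 ≤ l.length → l.length ≤ N →
    iterDzbar l (g.comp φ i j) (φ x) = 0

/-- The partial derivative `g_{i j̄ I J̄}` (derivatives in the directions `I` and `J̄` of
`g_{i j̄}`) at the point `x` in the chart `φ`, for the lists `i :: I` of unbarred and `j :: J` of
barred indices. Every vertex of a stable graph has indices of both kinds. -/
def vertexFactor (g : KahlerMetric n M) (φ : OpenPartialHomeomorph M (Fin n → ℂ)) (x : M) :
    List (Fin n) → List (Fin n) → ℂ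
  | i :: I, j :: J => iterDz I (iterDzbar J (g.comp φ i j)) (φ x)
  | _, _ => 0

/-- The partition function `D_Γ(f₁, f₂)` at the centre `x` of the normal coordinate system `φ`.
Every edge `e` carries a pair of contracted indices `a e`, unbarred at the source of `e` and
barred at its target. An ordinary vertex stands for the corresponding partial derivative of the
metric; the edges entering the distinguished vertex act on `f₁` and the edges leaving it act on
`f₂`. -/
def partitionFunction (g : KahlerMetric n M) (φ : OpenPartialHomeomorph M (Fin n → ℂ)) (x : M)
    {p q : ℕ} (G : PointedGraph p q) (f₁ f₂ : M → ℂ) : ℂ :=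
  ∑ a : Fin q → Fin n,
    (∏ v : Fin p, vertexFactor g φ x ((G.outEdges (some v)).map a)
      ((G.inEdges (some v)).map a)) *
    iterDzbar ((G.inEdges none).map a) (f₁ ∘ φ.symm) (φ x) *
    iterDz ((G.outEdges none).map a) (f₂ ∘ φ.symm) (φ x)

open Classical in
/-- The coefficient of `h ^ k` in the graph formula for the star product, in the coordinate
system `φ` at `x`: the sum over the isomorphism classes of strongly connected stable pointed
graphs of weight `k` of `det (A(Γ₋) - I) / |Aut Γ| • D_Γ(f₁, f₂)`. Such a graph has at most `k`
ordinary vertices (`PointedGraph.Stable.card_le`). The summand depends only on the class. -/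
def graphSum (g : KahlerMetric n M) (φ : OpenPartialHomeomorph M (Fin n → ℂ)) (x : M) (k : ℕ)
    (f₁ f₂ : M → ℂ) : ℂ :=
  ∑ p ∈ Finset.range (k + 1), ∑ c : PointedGraph.IsoClass p (p + k),
    if (Quotient.out c).Stable ∧ (Quotient.out c).StronglyConnected then
      (Quotient.out c).coefficient * partitionFunction g φ x (Quotient.out c) f₁ f₂
    else 0

open Classical in
/-- The coefficient `C_k(f₁, f₂)` of `h ^ k` in `f₁ ⋆ f₂`: the graph formula at `x`, evaluated
in a coordinate system around `x` which is normal up to order `3 k`. -/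
def starCoeff (g : KahlerMetric n M) (k : ℕ) (f₁ f₂ : M → ℂ) (x : M) : ℂ :=
  if H : ∃ φ, IsNormalAt g (3 * k) x φ then graphSum g H.choose x k f₁ f₂ else 0

/-- Formal power series in `h` whose coefficients are smooth functions on `M`. -/
def SmoothSeries (n : ℕ) {M : Type*} [TopologicalSpace M] [ChartedSpace (Fin n → ℂ) M]
    (F : PowerSeries (M → ℂ)) : Prop :=
  ∀ k, SmoothFun n (PowerSeries.coeff k F)

/-- The `ℂ[[h]]`-bilinear extension of `f₁ ⋆ f₂ = ∑ h ^ k C_k(f₁, f₂)` to formal power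
series. -/
def star (g : KahlerMetric n M) (F₁ F₂ : PowerSeries (M → ℂ)) : PowerSeries (M → ℂ) :=
  PowerSeries.mk fun m => ∑ s ∈ Finset.HasAntidiagonal.antidiagonal m, ∑ t ∈ Finset.HasAntidiagonal.antidiagonal s.2,
    starCoeff g s.1 (PowerSeries.coeff t.1 F₁) (PowerSeries.coeff t.2 F₂)

end StarProduct

end BerezinStar

end

/-!
The proof compares three kinds of sums of contractions over directed graphs with a distinguished
vertex.

*Labelled graphs.* By the orbit-stabiliser theorem, a sum over isomorphism classes with weights
`1 / |Aut Γ|` is a sum over all graphs with `p` labelled vertices and `q` labelled edges with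
weights `1 / (p! q!)` (`sum_isoClass`, `graphSum_eq`).

*Arbitrary coordinates.* The graph formula extends to a sum `locSum` which makes sense in any
coordinates: the edges are contracted with the inverse metric, and all strongly connected graphs
contribute, stable or not, with derivatives of the metric of positive order at the vertices. In
coordinates normal up to order `3 k` at a point the two sums of weight `k` agree there
(`graphSum_eq_locSum`), since derivatives of the metric in only holomorphic or only antiholomorphic
directions vanish. The point is that `locSum` does not depend on the coordinates
(`locSum_pullMetric`, `locSum_chart_eq`). A change of coordinates `T` is joined to its linearisation
at a point by a straight path. For affine maps the claim is the invariance of contractions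
(`locSum_linear_change`). Along the path the vector field of the flow vanishes up to first order at
the point, and the derivative of the sum consists of graphs with the vector field inserted at a
vertex. There the field acts on the tensor at this vertex; moreover it acts on the metric at
vertices with a single incoming edge. Contracting this edge leads from terms of the second kind to
terms of the first kind. It changes `det (A(Γ₋) - I)` by the factor `-1` (`DG.sgn_split`), so that
all terms cancel (`sum_dgsum_lie`, `der_locSum_eq_zero`). Hence the coefficients of the star product
are given by `locSum` in any chart (`starCoeff_eq`), which shows that they do not depend on the
normal coordinates and that they are smooth.

*Three-pointed graphs.* For the associativity it is enough to consider the centre of coordinates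
which are normal up to a high order. There, for the purpose of differentiating in the
antiholomorphic directions, the inverse metric is constant, so that by the Leibniz rule the
derivatives of the inner product in `(f₁ ⋆ f₂) ⋆ f₃` fall on `f₁`, on `f₂` or on the vertices. This
composes two graphs to a graph with three distinguished points (`it_graphTotal`, `graphTotal_comp`),
and the signs multiply since the adjacency matrix of the composition is block triangular
(`tsgn_glue`). The graphs which arise are characterised by properties of their directed paths which
do not change when all edges are reversed (`DG.Good`, `DG.glue_good`, `DG.Good_rev`), and each of
them arises from exactly one pair of graphs (`sum_tsum`). Reversal exchanges the roles of `f₁` and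
`f₃`, and hence the two bracketings (`sum_graphTotal_assoc`).

*Normal coordinates* exist (`exists_isNormalAt`): if `κ` is a matrix which normalises the metric at
the point, take polynomials `W b` whose derivatives `∂ᵢ (W b)` agree with `∑ j, g_{i j̄} κ_{j b}` in
all holomorphic derivatives up to order `N` at the point. They exist because the Kähler form is
closed. In these coordinates the metric is the identity up to functions whose holomorphic
derivatives of order at most `N` vanish (`sub_one_mem_of_factorization`), a condition which may be
checked in the old coordinates (`mem_jetIdeal_of_map`), and the antiholomorphic derivatives are
complex conjugate to these.
-/

namespace BerezinStar

open Finset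

set_option linter.unusedSectionVars false
set_option linter.unusedSimpArgs false

/-! ### Labels of the edges in a fibre -/

section Fibres

variable {E E' X Y ι : Type*} [Fintype E] [Fintype E'] [DecidableEq X] [DecidableEq Y]

/-- The multiset of the labels `a e` of those `e` for which `f e = x`. For the source (target) map
`f` of a graph these are the labels of the edges leaving (entering) `x`. -/
def fib (f : E → X) (x : X) (a : E → ι) : Multiset ι :=
  (univ.filter fun e => f e = x).val.map a

theorem card_fib (f : E → X) (x : X) (a : E → ι) :
    Multiset.card (fib f x a) = (univ.filter fun e => f e = x).card := by
  simp [fib, Finset.card]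

theorem fib_equiv (σ : E' ≃ E) (f : E → X) (x : X) (a : E → ι) :
    fib (f ∘ σ) x (a ∘ σ) = fib f x a := by
  have : (univ.filter fun e => f e = x) =
      (univ.filter fun e => (f ∘ σ) e = x).map σ.toEmbedding := by
    ext b
    simp only [mem_filter, mem_univ, true_and, mem_map, Function.comp]
    constructor
    · intro h; exact ⟨σ.symm b, by simpa using h, by simp⟩
    · rintro ⟨a, h, rfl⟩; simpa using h
  rw [fib, fib, this, Finset.map_val, Multiset.map_map]
  rfl

theorem fib_injective {i : X → Y} (hi : Function.Injective i) (f : E → X) (x : X) (a : E → ι) :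
    fib (fun e => i (f e)) (i x) a = fib f x a := by
  simp only [fib, hi.eq_iff]

theorem fib_congr {f : E → X} {g : E → Y} {x : X} {y : Y} (h : ∀ e, f e = x ↔ g e = y)
    (a : E → ι) : fib f x a = fib g y a := by
  simp only [fib, h]

theorem fib_eq_zero {f : E → X} {x : X} (h : ∀ e, f e ≠ x) (a : E → ι) : fib f x a = 0 := by
  simp [fib, h]

theorem fib_sum (f : E ⊕ E' → X) (x : X) (a : E ⊕ E' → ι) :
    fib f x a = fib (f ∘ Sum.inl) x (a ∘ Sum.inl) + fib (f ∘ Sum.inr) x (a ∘ Sum.inr) := by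
  have : (univ.filter fun e => f e = x) =
      (univ.filter fun e => (f ∘ Sum.inl) e = x).disjSum
        (univ.filter fun e => (f ∘ Sum.inr) e = x) := by
    ext b; cases b <;> simp
  rw [fib, this, Finset.val_disjSum, Multiset.disjSum, Multiset.map_add, Multiset.map_map,
    Multiset.map_map]
  rfl

theorem fib_option (f : Option E → X) (x : X) (a : Option E → ι) :
    fib f x a = (if f none = x then {a none} else 0) +
      fib (fun e => f (some e)) x (fun e => a (some e)) := by
  rw [← fib_equiv ((Equiv.sumComm _ _).trans (Equiv.optionEquivSumPUnit.{0} E).symm), fib_sum]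
  congr 1
  simp only [fib]
  split_ifs with h <;> simp [h, Function.comp_def]

theorem fib_subtype (f : E → X) (x : X) (a : E → ι) :
    fib f x a = (univ : Finset {e // f e = x}).val.map fun e : {e // f e = x} => a e := by
  have : (univ.filter fun e => f e = x) =
      (univ : Finset {e // f e = x}).map (Function.Embedding.subtype _) := by
    ext; simp
  rw [fib, this, Finset.map_val, Multiset.map_map]
  rfl

theorem univ_map_equiv (σ : E' ≃ E) (a : E → ι) :
    (univ : Finset E').val.map (a ∘ σ) = (univ : Finset E).val.map a := by
  have := fib_equiv σ (fun _ => ()) () a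
  simpa [fib] using this

theorem univ_map_option (a : Option E → ι) :
    (univ : Finset (Option E)).val.map a =
      a none ::ₘ (univ : Finset E).val.map fun e => a (some e) := by
  have := fib_option (fun _ => ()) () a
  simpa [fib] using this

end Fibres

/-! ### Iterated commuting derivations -/

section IteratedDerivations

variable {κ R : Type*} [CommRing R] [Algebra ℂ R]

/-- The iterated derivative of `x` along a multiset of indices, for a family `d` of derivations
which commute with each other. The multiset is enumerated by an arbitrary list, which for commuting
derivations is immaterial (`it_coe`). -/
noncomputable def it (d : κ → Derivation ℂ R R) (m : Multiset κ) (x : R) : R :=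
  m.toList.foldr (fun i y => d i y) x

variable {d : κ → Derivation ℂ R R}

theorem it_coe (hd : ∀ i j x, d i (d j x) = d j (d i x)) (l : List κ) (x : R) :
    it d (l : Multiset κ) x = l.foldr (fun i y => d i y) x := by
  have : LeftCommutative (fun i (y : R) => d i y) := ⟨fun i j y => hd i j y⟩
  exact List.Perm.foldr_eq (Multiset.coe_eq_coe.1 (by simp)) x

@[simp] theorem it_zero (x : R) : it d 0 x = x := by simp [it]

theorem it_cons (hd : ∀ i j x, d i (d j x) = d j (d i x)) (i : κ) (m : Multiset κ) (x : R) :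
    it d (i ::ₘ m) x = d i (it d m x) := by
  induction m using Quotient.inductionOn with
  | h l => rw [Multiset.quot_mk_to_coe, Multiset.cons_coe, it_coe hd, it_coe hd]; rfl

theorem it_singleton (hd : ∀ i j x, d i (d j x) = d j (d i x)) (i : κ) (x : R) :
    it d {i} x = d i x := by
  rw [← Multiset.cons_zero, it_cons hd, it_zero]

theorem it_cons' (hd : ∀ i j x, d i (d j x) = d j (d i x)) (i : κ) (m : Multiset κ) (x : R) :
    it d (i ::ₘ m) x = it d m (d i x) := by
  induction m using Multiset.induction_on with
  | empty => rw [it_cons hd]; simp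
  | cons j m ih => rw [Multiset.cons_swap, it_cons hd, ih, it_cons hd]

theorem it_add_index (hd : ∀ i j x, d i (d j x) = d j (d i x)) (m m' : Multiset κ) (x : R) :
    it d (m + m') x = it d m (it d m' x) := by
  induction m using Multiset.induction_on with
  | empty => simp
  | cons i m ih => rw [Multiset.cons_add, it_cons hd, it_cons hd, ih]

variable (d) in
/-- The iterated derivative as a linear map. -/
noncomputable def itLin (m : Multiset κ) : R →ₗ[ℂ] R where
  toFun := it d m
  map_add' x y := by
    unfold it
    induction m.toList with
    | nil => rfl
    | cons i l ih => simp only [List.foldr_cons, ih, map_add]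
  map_smul' c x := by
    unfold it
    induction m.toList with
    | nil => rfl
    | cons i l ih => simp only [List.foldr_cons, ih, RingHom.id_apply, Derivation.map_smul]

theorem it_add (m : Multiset κ) (x y : R) : it d m (x + y) = it d m x + it d m y :=
  map_add (itLin d m) x y

theorem it_smul (m : Multiset κ) (c : ℂ) (x : R) : it d m (c • x) = c • it d m x :=
  map_smul (itLin d m) c x

theorem it_map_zero (m : Multiset κ) : it d m 0 = 0 := map_zero (itLin d m)

theorem it_sum {α : Type*} (m : Multiset κ) (s : Finset α) (f : α → R) :
    it d m (∑ i ∈ s, f i) = ∑ i ∈ s, it d m (f i) := map_sum (itLin d m) f s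

theorem it_comm_derivation (δ : Derivation ℂ R R) (h : ∀ i x, δ (d i x) = d i (δ x))
    (m : Multiset κ) (x : R) : δ (it d m x) = it d m (δ x) := by
  unfold it
  induction m.toList with
  | nil => rfl
  | cons i l ih => simp only [List.foldr_cons, h, ih]

/-- The Leibniz rule for iterated derivatives. -/
theorem it_mul (hd : ∀ i j x, d i (d j x) = d j (d i x)) (m : Multiset κ) (x y : R) :
    it d m (x * y) = (m.antidiagonal.map fun p => it d p.1 x * it d p.2 y).sum := by
  induction m using Multiset.induction_on with
  | empty => simp
  | cons i m ih =>
    rw [it_cons hd, ih, map_multiset_sum, Multiset.map_map, Multiset.antidiagonal_cons,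
      Multiset.map_add, Multiset.sum_add, Multiset.map_map, Multiset.map_map, add_comm,
      ← Multiset.sum_map_add]
    refine congrArg _ (Multiset.map_congr rfl fun p _ => ?_)
    simp [it_cons hd]
    ring

/-- Iterated derivatives of products in which one factor is constant for the derivations. -/
theorem it_const_mul (hd : ∀ i j x, d i (d j x) = d j (d i x)) (m : Multiset κ) (c x : R)
    (hc : ∀ i ∈ m, d i c = 0) : it d m (c * x) = c * it d m x := by
  induction m using Multiset.induction_on with
  | empty => simp
  | cons i m ih =>
    rw [it_cons hd, ih fun j hj => hc j (Multiset.mem_cons_of_mem hj), it_cons hd]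
    simp [hc i]

theorem leibniz_prod {X : Type*} [DecidableEq X] (δ : Derivation ℂ R R) (s : Finset X)
    (Ψ : X → R) : δ (∏ x ∈ s, Ψ x) = ∑ x ∈ s, δ (Ψ x) * ∏ y ∈ s.erase x, Ψ y := by
  induction s using Finset.induction_on with
  | empty => simp
  | insert a s ha ih =>
    rw [prod_insert ha, Derivation.leibniz, ih, sum_insert ha, erase_insert ha, add_comm,
      smul_eq_mul, smul_eq_mul, mul_comm, mul_sum]
    congr 1
    refine sum_congr rfl fun x hx => ?_
    have hxa : a ≠ x := fun h => ha (h ▸ hx)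
    rw [erase_insert_of_ne hxa, prod_insert fun h => ha (mem_of_mem_erase h)]
    ring

/-- The Leibniz rule for a product of several factors, the derivatives being labelled by a finite
type: each derivative falls on one of the factors. -/
theorem it_prod (hd : ∀ i j x, d i (d j x) = d j (d i x)) {X : Type*} [Fintype X]
    [DecidableEq X] (Ψ : X → R) (S : Type) [Fintype S] [DecidableEq S] (c : S → κ) :
    it d (univ.val.map c) (∏ x, Ψ x) = ∑ t : S → X, ∏ x, it d (fib t x c) (Ψ x) := by
  refine Fintype.induction_empty_option (P := fun S _ => ∀ [DecidableEq S], ∀ c : S → κ,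
    it d (univ.val.map c) (∏ x, Ψ x) = ∑ t : S → X, ∏ x, it d (fib t x c) (Ψ x))
    ?_ ?_ ?_ S c
  · intro α β _ e ih _ c
    let _ := Fintype.ofEquiv β e.symm
    classical
    rw [← univ_map_equiv e, ih (c ∘ e)]
    refine Fintype.sum_equiv (Equiv.arrowCongr e (Equiv.refl X)) _ _ fun t => ?_
    refine Finset.prod_congr rfl fun x _ => ?_
    rw [← fib_equiv e ((Equiv.arrowCongr e (Equiv.refl X)) t)]
    congr 2
    ext; simp
  · intro _ c
    simp [fib]
  · intro α _ ih _ c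
    classical
    rw [univ_map_option, it_cons hd, ih, map_sum,
      ← (Equiv.piOptionEquivProd (β := fun _ : Option α => X)).symm.sum_comp,
      Fintype.sum_prod_type, sum_comm]
    refine Finset.sum_congr rfl fun t _ => ?_
    rw [leibniz_prod]
    refine Finset.sum_congr rfl fun x _ => ?_
    rw [← Finset.mul_prod_erase _ _ (mem_univ x)]
    congr 1
    · rw [fib_option]
      simp [Equiv.piOptionEquivProd, it_cons hd]
    · refine Finset.prod_congr rfl fun y hy => ?_
      rw [fib_option]
      have : x ≠ y := (ne_of_mem_erase hy).symm
      simp [Equiv.piOptionEquivProd, this]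

/-- Iterated derivatives for linear combinations of derivations with constant coefficients. -/
theorem it_linear_change {κ' R' : Type*} [CommRing R'] [Algebra ℂ R'] [Fintype κ]
    {d' : κ' → Derivation ℂ R' R'} (hd : ∀ i j x, d i (d j x) = d j (d i x))
    (hd' : ∀ i j x, d' i (d' j x) = d' j (d' i x)) (π : R →ₗ[ℂ] R') (L : κ' → κ → ℂ)
    (h : ∀ i x, d' i (π x) = ∑ k, L i k • π (d k x)) (S : Type) [Fintype S] [DecidableEq S]
    (a : S → κ') (x : R) :
    it d' (univ.val.map a) (π x) =
      ∑ c : S → κ, (∏ e, L (a e) (c e)) • π (it d (univ.val.map c) x) := by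
  refine Fintype.induction_empty_option (P := fun S _ => ∀ [DecidableEq S], ∀ a : S → κ',
    it d' (univ.val.map a) (π x) =
      ∑ c : S → κ, (∏ e, L (a e) (c e)) • π (it d (univ.val.map c) x)) ?_ ?_ ?_ S a
  · intro α β _ e ih _ c
    let _ := Fintype.ofEquiv β e.symm
    classical
    rw [← univ_map_equiv e, ih (c ∘ e)]
    refine Fintype.sum_equiv (Equiv.arrowCongr e (Equiv.refl κ)) _ _ fun t => ?_
    rw [← univ_map_equiv e ((Equiv.arrowCongr e (Equiv.refl κ)) t), ← e.prod_comp]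
    congr 2
    · simp
    · congr 3
      ext; simp
  · intro _ c
    simp
  · intro α _ ih _ c
    classical
    rw [univ_map_option, it_cons hd', ih, map_sum,
      ← (Equiv.piOptionEquivProd (β := fun _ : Option α => κ)).symm.sum_comp,
      Fintype.sum_prod_type, sum_comm]
    refine Finset.sum_congr rfl fun t _ => ?_
    rw [Derivation.map_smul, h, smul_sum]
    refine Finset.sum_congr rfl fun k _ => ?_
    rw [smul_smul, Fintype.prod_option, univ_map_option, it_cons hd]
    simp [Equiv.piOptionEquivProd, mul_comm]

end IteratedDerivations

/-! ### Sums over labelled strongly connected graphs -/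

section Graphs

variable {V E V' E' ι : Type*}

/-- Pointed digraphs with ordinary vertices `V`, distinguished vertex `none` and edges `E`, given
by their source and target maps. -/
abbrev DG (V E : Type*) := (E → Option V) × (E → Option V)

theorem reflTransGen_lift {α β : Type*} {r : α → α → Prop} {p : β → β → Prop} (f : α → β)
    (h : ∀ a b, r a b → p (f a) (f b)) {a b : α} (hab : Relation.ReflTransGen r a b) :
    Relation.ReflTransGen p (f a) (f b) := by
  induction hab with
  | refl => exact .refl
  | tail _ hbc ih => exact ih.tail (h _ _ hbc)

namespace DG

/-- There is a directed path from every vertex to every vertex, the distinguished one included. -/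
def SC (G : DG V E) : Prop :=
  ∀ u v, Relation.ReflTransGen (fun a b => ∃ e, G.1 e = a ∧ G.2 e = b) u v

/-- There is an edge between two ordinary vertices. -/
def Step (G : DG V E) (u v : V) : Prop := ∃ e, G.1 e = some u ∧ G.2 e = some v

/-- The graph with all edges reversed. -/
def rev (G : DG V E) : DG V E := (G.2, G.1)

/-- Strong connectedness in terms of paths through ordinary vertices. -/
theorem SC_iff (G : DG V E) : G.SC ↔
    (∀ v, ∃ u, (∃ e, G.1 e = none ∧ G.2 e = some u) ∧ Relation.ReflTransGen G.Step u v) ∧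
    (∀ v, ∃ u, (∃ e, G.1 e = some u ∧ G.2 e = none) ∧ Relation.ReflTransGen G.Step v u) := by
  constructor
  · intro h
    constructor
    · intro v
      have key : ∀ x, Relation.ReflTransGen (fun a b => ∃ e, G.1 e = a ∧ G.2 e = b) none x →
          ∀ v, x = some v → ∃ u, (∃ e, G.1 e = none ∧ G.2 e = some u) ∧
            Relation.ReflTransGen G.Step u v := by
        intro x hx
        induction hx with
        | refl => intro v hv; cases hv
        | @tail y z _ hyz ih =>
          rintro v rfl
          obtain ⟨e, he1, he2⟩ := hyz
          cases y with
          | none => exact ⟨v, ⟨e, he1, he2⟩, .refl⟩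
          | some y =>
            obtain ⟨u, hu, huy⟩ := ih y rfl
            exact ⟨u, hu, huy.tail ⟨e, he1, he2⟩⟩
      exact key _ (h none (some v)) v rfl
    · intro v
      have key : ∀ x, Relation.ReflTransGen (fun a b => ∃ e, G.1 e = a ∧ G.2 e = b) x none →
          ∀ v, x = some v → ∃ u, (∃ e, G.1 e = some u ∧ G.2 e = none) ∧
            Relation.ReflTransGen G.Step v u := by
        intro x hx
        induction hx using Relation.ReflTransGen.head_induction_on with
        | refl => intro v hv; cases hv
        | @head z y hzy _ ih =>
          rintro v rfl
          obtain ⟨e, he1, he2⟩ := hzy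
          cases y with
          | none => exact ⟨v, ⟨e, he1, he2⟩, .refl⟩
          | some y =>
            obtain ⟨u, hu, huy⟩ := ih y rfl
            exact ⟨u, hu, huy.head ⟨e, he1, he2⟩⟩
      exact key _ (h (some v) none) v rfl
  · rintro ⟨h1, h2⟩
    have lift : ∀ u v, Relation.ReflTransGen G.Step u v →
        Relation.ReflTransGen (fun a b => ∃ e, G.1 e = a ∧ G.2 e = b) (some u) (some v) :=
      fun u v h => reflTransGen_lift some (fun _ _ h => h) h
    have a1 : ∀ x, Relation.ReflTransGen (fun a b => ∃ e, G.1 e = a ∧ G.2 e = b) none x := by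
      rintro (_ | v)
      · exact .refl
      · obtain ⟨u, hu, huv⟩ := h1 v
        exact (lift _ _ huv).head hu
    have a2 : ∀ x, Relation.ReflTransGen (fun a b => ∃ e, G.1 e = a ∧ G.2 e = b) x none := by
      rintro (_ | v)
      · exact .refl
      · obtain ⟨u, hu, huv⟩ := h2 v
        exact (lift _ _ huv).tail hu
    exact fun u v => (a2 u).trans (a1 v)

theorem SC_rev (G : DG V E) : G.rev.SC ↔ G.SC := by
  have key : ∀ G : DG V E, G.SC → G.rev.SC := fun G h u v => by
    have := (Relation.reflTransGen_swap).2 (h v u)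
    exact reflTransGen_lift id (fun a b ⟨e, h1, h2⟩ => ⟨e, h2, h1⟩) this
  exact ⟨key _, key _⟩

theorem SC.exists_out {G : DG V E} (h : G.SC) (v : V) : ∃ e, G.1 e = some v := by
  obtain ⟨u, ⟨e, he, -⟩, hu⟩ := ((SC_iff G).1 h).2 v
  rcases hu.cases_head with rfl | ⟨c, ⟨e', he', -⟩, -⟩
  · exact ⟨e, he⟩
  · exact ⟨e', he'⟩

theorem SC.exists_in {G : DG V E} (h : G.SC) (v : V) : ∃ e, G.2 e = some v :=
  SC.exists_out (G := G.rev) ((SC_rev G).2 h) v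

/-- Transport of graphs along bijections of the vertices and of the edges. -/
def relabel (σ : V ≃ V') (τ : E ≃ E') : DG V E ≃ DG V' E' :=
  (Equiv.arrowCongr τ σ.optionCongr).prodCongr (Equiv.arrowCongr τ σ.optionCongr)

@[simp] theorem relabel_fst (σ : V ≃ V') (τ : E ≃ E') (G : DG V E) (e : E) :
    (relabel σ τ G).1 (τ e) = (G.1 e).map σ := by
  simp [relabel]

@[simp] theorem relabel_snd (σ : V ≃ V') (τ : E ≃ E') (G : DG V E) (e : E) :
    (relabel σ τ G).2 (τ e) = (G.2 e).map σ := by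
  simp [relabel]

section Fin

variable [Fintype V] [DecidableEq V] [Fintype E] [DecidableEq E]
  [Fintype V'] [DecidableEq V'] [Fintype E'] [DecidableEq E']

/-- The adjacency matrix of the ordinary vertices. -/
def adjM (G : DG V E) : Matrix V V ℤ := fun i j =>
  ((univ.filter fun e => G.1 e = some i ∧ G.2 e = some j).card : ℤ)

/-- The integer `det (A(Γ₋) - I)`. -/
def sgn (G : DG V E) : ℤ := (G.adjM - 1).det

theorem sgn_rev (G : DG V E) : G.rev.sgn = G.sgn := by
  have : G.rev.adjM - 1 = (G.adjM - 1).transpose := by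
    ext i j
    simp only [Matrix.sub_apply, Matrix.transpose_apply, adjM, rev, Matrix.one_apply,
      eq_comm (a := i), and_comm]
  rw [sgn, this, Matrix.det_transpose, sgn]

theorem SC.of_relabel {σ : V ≃ V'} {τ : E ≃ E'} {G : DG V E} {G' : DG V' E'}
    (h1 : ∀ e, G'.1 (τ e) = (G.1 e).map σ) (h2 : ∀ e, G'.2 (τ e) = (G.2 e).map σ)
    (h : G.SC) : G'.SC := by
  intro u v
  have := reflTransGen_lift (p := fun a b => ∃ e, G'.1 e = a ∧ G'.2 e = b)
    (Option.map σ) (by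
      rintro a b ⟨e, rfl, rfl⟩
      exact ⟨τ e, h1 e, h2 e⟩) (h (u.map σ.symm) (v.map σ.symm))
  simpa using this

theorem SC_relabel (σ : V ≃ V') (τ : E ≃ E') (G : DG V E) :
    (relabel σ τ G).SC ↔ G.SC := by
  refine ⟨fun h => SC.of_relabel (σ := σ.symm) (τ := τ.symm) (G := relabel σ τ G) ?_ ?_ h,
    SC.of_relabel (relabel_fst σ τ G) (relabel_snd σ τ G)⟩ <;>
  · intro e
    obtain ⟨e, rfl⟩ := τ.surjective e
    simp

theorem sgn_relabel (σ : V ≃ V') (τ : E ≃ E') (G : DG V E) :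
    (relabel σ τ G).sgn = G.sgn := by
  have : (relabel σ τ G).adjM - 1 = Matrix.reindex σ σ (G.adjM - 1) := by
    ext i j
    obtain ⟨i, rfl⟩ := σ.surjective i
    obtain ⟨j, rfl⟩ := σ.surjective j
    simp only [Matrix.sub_apply, Matrix.reindex_apply, Matrix.submatrix_apply,
      Equiv.symm_apply_apply, Matrix.one_apply, σ.injective.eq_iff, adjM]
    congr 2
    refine (Finset.card_equiv τ fun e => ?_).symm
    have : ∀ (x : Option V) i, x.map σ = some (σ i) ↔ x = some i := by
      intro x i; cases x <;> simp
    simp [this]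
  rw [sgn, this, Matrix.det_reindex_self, sgn]

theorem card_le_of_three_le (G : DG V E) (h : ∀ v : V, 3 ≤ (univ.filter fun e => G.1 e = some v).card
    + (univ.filter fun e => G.2 e = some v).card) :
    3 * Fintype.card V ≤ 2 * Fintype.card E := by
  have hs : ∀ f : E → Option V,
      ∑ v : V, (univ.filter fun e => f e = some v).card ≤ Fintype.card E := fun f => by
    rw [← Finset.card_biUnion]
    · exact Finset.card_le_univ _
    · intro a _ b _ hab
      refine Finset.disjoint_left.2 fun e he he' => hab ?_
      simp only [mem_filter, mem_univ, true_and] at he he'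
      exact Option.some.inj (he.symm.trans he')
  have h2 := Finset.sum_le_sum fun v (_ : v ∈ univ) => h v
  rw [Finset.sum_add_distrib] at h2
  simp only [sum_const, card_univ, smul_eq_mul] at h2
  have := hs G.1
  have := hs G.2
  omega

end Fin
end DG

section Contraction

variable [Fintype V] [DecidableEq V] [Fintype E] [DecidableEq E]
  [Fintype V'] [DecidableEq V'] [Fintype E'] [DecidableEq E'] [Fintype ι]
  {K : Type*} [CommRing K]

/-- The contraction of the tensors `Ψ v`, placed at the vertices of `G`, along the edges of `G`.
Each edge carries an unbarred index at its source and a barred index at its target, which are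
contracted with `M`. -/
def contraction (M : ι → ι → K) (Ψ : Option V → Multiset ι → Multiset ι → K) (G : DG V E) : K :=
  ∑ a : E → ι, ∑ b : E → ι, (∏ e, M (a e) (b e)) * ∏ v, Ψ v (fib G.1 v a) (fib G.2 v b)

/-- The tensor `F` at the distinguished vertex and `Φ` at the ordinary vertices. -/
def vfac (Φ F : Multiset ι → Multiset ι → K) : Option V → Multiset ι → Multiset ι → K
  | none => F
  | some _ => Φ

theorem sum_relabel {A : Type*} [AddCommMonoid A] (τ : E ≃ E') (f : (E' → ι) → A) :
    ∑ a : E → ι, f (a ∘ τ.symm) = ∑ a : E' → ι, f a :=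
  Fintype.sum_equiv (Equiv.arrowCongr τ (Equiv.refl ι)) _ _ fun _ => rfl

theorem fib_relabel (σ : V ≃ V') (τ : E ≃ E') (f : E → Option V) (v : Option V) (a : E → ι) :
    fib (fun e' => (f (τ.symm e')).map σ) (v.map σ) (a ∘ τ.symm) = fib f v a := by
  rw [← fib_injective (Option.map_injective σ.injective) f v a,
    ← fib_equiv τ.symm (fun e => (f e).map σ)]
  rfl

theorem contraction_relabel (M : ι → ι → K) (Ψ : Option V → Multiset ι → Multiset ι → K)
    (Ψ' : Option V' → Multiset ι → Multiset ι → K) (σ : V ≃ V') (τ : E ≃ E')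
    (h : ∀ v, Ψ' (v.map σ) = Ψ v) (G : DG V E) :
    contraction M Ψ' (DG.relabel σ τ G) = contraction M Ψ G := by
  unfold contraction
  rw [← sum_relabel τ]
  refine sum_congr rfl fun a _ => ?_
  rw [← sum_relabel τ]
  refine sum_congr rfl fun b _ => ?_
  rw [← τ.prod_comp, ← σ.optionCongr.prod_comp]
  congr 1
  · simp
  · refine prod_congr rfl fun v _ => ?_
    have := h v
    rw [Equiv.optionCongr_apply, h]
    congr 1
    · exact fib_relabel σ τ G.1 v a
    · exact fib_relabel σ τ G.2 v b

theorem contraction_rev (M : ι → ι → K) (Ψ : Option V → Multiset ι → Multiset ι → K)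
    (G : DG V E) :
    contraction (fun i j => M j i) (fun v I J => Ψ v J I) G.rev = contraction M Ψ G := by
  unfold contraction
  rw [sum_comm]
  rfl

theorem contraction_one [DecidableEq ι] (Ψ : Option V → Multiset ι → Multiset ι → K)
    (G : DG V E) :
    contraction (fun i j => if i = j then 1 else 0) Ψ G =
      ∑ a : E → ι, ∏ v, Ψ v (fib G.1 v a) (fib G.2 v a) := by
  unfold contraction
  refine sum_congr rfl fun a _ => ?_
  rw [Fintype.sum_eq_single a]
  · simp
  · intro b hb
    obtain ⟨e, he⟩ := Function.ne_iff.1 hb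
    rw [prod_eq_zero (mem_univ e), zero_mul]
    simp [he.symm]

theorem map_contraction {K' : Type*} [CommRing K'] (π : K →+* K') (M : ι → ι → K)
    (Ψ : Option V → Multiset ι → Multiset ι → K) (G : DG V E) :
    π (contraction M Ψ G) = contraction (fun i j => π (M i j)) (fun v I J => π (Ψ v I J)) G := by
  simp [contraction, map_sum, map_prod]

/-- A contraction vanishes if an ordinary vertex has one edge going out and one coming in, and the
tensors at the ordinary vertices vanish for such a pair of indices. -/
theorem contraction_eq_zero {M : ι → ι → K} {Ψ : Option V → Multiset ι → Multiset ι → K}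
    {G : DG V E} (v : Option V)
    (h : ∀ a b, Ψ v (fib G.1 v a) (fib G.2 v b) = 0) : contraction M Ψ G = 0 := by
  unfold contraction
  refine sum_eq_zero fun a _ => sum_eq_zero fun b _ => ?_
  rw [prod_eq_zero (mem_univ v) (h a b), mul_zero]

open Classical in
variable (V E) in
/-- The sum of the contractions of all strongly connected graphs with vertices `V` and edges `E`,
with the weights `det (A(Γ₋) - I)`. -/
noncomputable def gsum (M : ι → ι → K) (Φ F : Multiset ι → Multiset ι → K) : K :=
  ∑ G : DG V E, if G.SC then (G.sgn : K) * contraction M (vfac Φ F) G else 0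

/-- The graph sum of weight `k`. If the tensor `Φ` vanishes for pairs of single indices, strongly
connected graphs with more than `2 * k` ordinary vertices do not contribute. -/
noncomputable def graphTotal [Algebra ℂ K] (k : ℕ) (M : ι → ι → K)
    (Φ F : Multiset ι → Multiset ι → K) : K :=
  ∑ p ∈ range (2 * k + 1), ((p.factorial * (p + k).factorial : ℕ) : ℂ)⁻¹ •
    gsum (Fin p) (Fin (p + k)) M Φ F

theorem map_gsum {K' : Type*} [CommRing K'] (π : K →+* K') (M : ι → ι → K)
    (Φ F : Multiset ι → Multiset ι → K) :
    π (gsum V E M Φ F) = gsum V E (fun i j => π (M i j)) (fun I J => π (Φ I J))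
      fun I J => π (F I J) := by
  simp only [gsum, map_sum]
  refine sum_congr rfl fun G _ => ?_
  split_ifs
  · rw [map_mul, map_contraction, map_intCast]
    congr 2
    ext v I J
    cases v <;> rfl
  · simp

theorem map_graphTotal {K' : Type*} [CommRing K'] [Algebra ℂ K] [Algebra ℂ K'] (π : K →ₐ[ℂ] K')
    (k : ℕ) (M : ι → ι → K) (Φ F : Multiset ι → Multiset ι → K) :
    π (graphTotal k M Φ F) = graphTotal k (fun i j => π (M i j)) (fun I J => π (Φ I J))
      fun I J => π (F I J) := by
  simp only [graphTotal, map_sum, map_smul]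
  exact sum_congr rfl fun p _ => congrArg _ (map_gsum (π : K →+* K') M Φ F)

theorem gsum_rev (M : ι → ι → K) (Φ F : Multiset ι → Multiset ι → K) :
    gsum V E (fun i j => M j i) (fun I J => Φ J I) (fun I J => F J I) = gsum V E M Φ F := by
  classical
  unfold gsum
  refine (Fintype.sum_equiv (Equiv.prodComm _ _) _ _ fun G => ?_).symm
  change _ = if (DG.rev G).SC then ((DG.rev G).sgn : K) * contraction _ _ (DG.rev G) else 0
  simp only [DG.SC_rev, DG.sgn_rev]
  rw [← contraction_rev M]
  congr 3
  ext v I J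
  cases v <;> rfl

theorem graphTotal_rev [Algebra ℂ K] (k : ℕ) (M : ι → ι → K)
    (Φ F : Multiset ι → Multiset ι → K) :
    graphTotal k (fun i j => M j i) (fun I J => Φ J I) (fun I J => F J I) =
      graphTotal k M Φ F := by
  unfold graphTotal
  exact sum_congr rfl fun p _ => congrArg _ (gsum_rev M Φ F)

end Contraction
end Graphs

/-! ### Subdividing an edge bundle -/

theorem reflTransGen_flatLift {α β : Type*} {r : α → α → Prop} {p : β → β → Prop} (f : α → β)
    (h : ∀ a b, r a b → Relation.ReflTransGen p (f a) (f b)) {a b : α}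
    (hab : Relation.ReflTransGen r a b) : Relation.ReflTransGen p (f a) (f b) := by
  induction hab with
  | refl => exact .refl
  | tail _ hbc ih => exact ih.trans (h _ _ hbc)

theorem map_some_ne {α : Type*} (x : Option α) : x.map some ≠ some none := by
  cases x <;> simp

theorem map_some_injective {α : Type*} : Function.Injective (Option.map (some : α → Option α)) :=
  Option.map_injective (Option.some_injective _)

theorem map_some_join {α : Type*} {x : Option (Option α)} (h : x ≠ some none) :
    x.join.map some = x := by
  rcases x with _ | _ | x <;> simp_all

namespace DG

variable {V E : Type*} [DecidableEq E]

/-- The graph in which the edges `A`, which start at `v`, are made to start at a new vertex, to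
which a single new edge leads from `v`. Contracting the new edge gives back `G`. -/
def split (v : Option V) (A : Finset E) (G : DG V E) : DG (Option V) (Option E) :=
  (fun e => e.elim (v.map some) fun e => if e ∈ A then some none else (G.1 e).map some,
    fun e => e.elim (some none) fun e => (G.2 e).map some)

@[simp] theorem split_fst_none (v : Option V) (A : Finset E) (G : DG V E) :
    (split v A G).1 none = v.map some := rfl

@[simp] theorem split_fst_some (v : Option V) (A : Finset E) (G : DG V E) (e : E) :
    (split v A G).1 (some e) = if e ∈ A then some none else (G.1 e).map some := rfl

@[simp] theorem split_snd_none (v : Option V) (A : Finset E) (G : DG V E) :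
    (split v A G).2 none = some none := rfl

@[simp] theorem split_snd_some (v : Option V) (A : Finset E) (G : DG V E) (e : E) :
    (split v A G).2 (some e) = (G.2 e).map some := rfl

/-- Contracting the new edge of `split v A G` and, conversely, splitting off at least one edge
preserve strong connectedness. If `A` is empty, no edge leaves the new vertex. -/
theorem SC_split {v : Option V} {A : Finset E} {G : DG V E} (hA : ∀ e ∈ A, G.1 e = v)
    (hne : A.Nonempty) : (split v A G).SC ↔ G.SC := by
  constructor
  · intro h x y
    let κ : Option (Option V) → Option V := fun z => z.elim none fun w => w.elim v some
    have hκ : ∀ x : Option V, κ (x.map some) = x := by intro x; cases x <;> rfl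
    have := reflTransGen_flatLift (p := fun a b => ∃ e, G.1 e = a ∧ G.2 e = b) κ (by
      rintro a b ⟨e, rfl, rfl⟩
      cases e with
      | none => rw [split_fst_none, split_snd_none, hκ]; exact .refl
      | some e =>
        refine .single ⟨e, ?_, by rw [split_snd_some, hκ]⟩
        rw [split_fst_some]
        split_ifs with he
        · exact hA e he
        · exact (hκ _).symm) (h (x.map some) (y.map some))
    rwa [hκ, hκ] at this
  · intro h
    have hv : Relation.ReflTransGen (fun a b => ∃ e, (split v A G).1 e = a ∧ (split v A G).2 e = b)
        (v.map some) (some none) := .single ⟨none, rfl, rfl⟩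
    have h1 : ∀ x y : Option V, Relation.ReflTransGen
        (fun a b => ∃ e, (split v A G).1 e = a ∧ (split v A G).2 e = b)
        (x.map some) (y.map some) := fun x y => by
      refine reflTransGen_flatLift (Option.map some) ?_ (h x y)
      rintro a b ⟨e, rfl, rfl⟩
      by_cases he : e ∈ A
      · rw [hA e he]
        exact hv.tail ⟨some e, by simp [he], by simp⟩
      · exact .single ⟨some e, by simp [he], by simp⟩
    obtain ⟨e, he⟩ := hne
    have h2 : Relation.ReflTransGen (fun a b => ∃ e, (split v A G).1 e = a ∧ (split v A G).2 e = b)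
        (some none) ((G.2 e).map some) := .single ⟨some e, by simp [he], by simp⟩
    have h3 : ∀ x, Relation.ReflTransGen
        (fun a b => ∃ e, (split v A G).1 e = a ∧ (split v A G).2 e = b) (v.map some) x := by
      rintro (_ | _ | x)
      · exact h1 v none
      · exact hv
      · exact h1 v (some x)
    have h4 : ∀ x, Relation.ReflTransGen
        (fun a b => ∃ e, (split v A G).1 e = a ∧ (split v A G).2 e = b) x (v.map some) := by
      rintro (_ | _ | x)
      · exact h1 none v
      · exact h2.trans (h1 _ _)
      · exact h1 (some x) v
    exact fun x y => (h4 x).trans (h3 y)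

variable [Fintype V] [DecidableEq V] [Fintype E]

/-- Splitting off a vertex changes the sign of `det (A(Γ₋) - I)`: the diagonal entry of the new
vertex is `-1`, and eliminating its row and its column gives the matrix of `G`. -/
theorem sgn_split {v : Option V} {A : Finset E} {G : DG V E} (hA : ∀ e ∈ A, G.1 e = v) :
    (split v A G).sgn = -G.sgn := by
  -- The column `c` records the new edge, which leads from `v` to the new vertex, and the row `r`
  -- the edges `A`, which leave the new vertex.
  let c : Matrix V Unit ℤ := fun i _ => if v = some i then 1 else 0
  let r : Matrix Unit V ℤ := fun _ j => ((A.filter fun e => G.2 e = some j).card : ℤ)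
  have key : Matrix.reindex (Equiv.optionEquivSumPUnit V) (Equiv.optionEquivSumPUnit V)
      ((split v A G).adjM - 1) = Matrix.fromBlocks (G.adjM - 1 - c * r) c r (-1) := by
    have hmap : ∀ (x : Option V) i, x.map some = some (some i) ↔ x = some i := by
      intro x i; cases x <;> simp
    have hcard : ∀ (P : Option E → Prop) [DecidablePred P], (univ.filter P).card =
        (if P none then 1 else 0) + (univ.filter fun e => P (some e)).card := by
      intro P _
      simp only [Finset.card_filter, Fintype.sum_option]
    ext i j
    rcases i with i | i <;> rcases j with j | j <;>
      simp only [Matrix.reindex_apply, Matrix.submatrix_apply, Matrix.fromBlocks_apply₁₁,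
        Matrix.fromBlocks_apply₁₂, Matrix.fromBlocks_apply₂₁, Matrix.fromBlocks_apply₂₂,
        Equiv.optionEquivSumPUnit_symm_inl, Equiv.optionEquivSumPUnit_symm_inr,
        Matrix.sub_apply, adjM, hcard, split_fst_none, split_fst_some, split_snd_none,
        split_snd_some, hmap]
    · have h1 : (univ.filter fun e => (if e ∈ A then some none else Option.map some (G.1 e)) =
          some (some i) ∧ G.2 e = some j).card + (c * r) i j =
          ((univ.filter fun e => G.1 e = some i ∧ G.2 e = some j).card : ℤ) := by
        rw [← Finset.card_filter_add_card_filter_not (s := univ.filter fun e =>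
          G.1 e = some i ∧ G.2 e = some j) (fun e => e ∉ A), Nat.cast_add]
        congr 2
        · congr 1
          ext e
          simp only [mem_filter, mem_univ, true_and]
          by_cases he : e ∈ A <;> simp [he, hmap]
        · have hcr : (c * r) i j = (if v = some i then 1 else 0) *
              ((A.filter fun e => G.2 e = some j).card : ℤ) := by
            rw [Matrix.mul_apply]; simp [c, r]
          rw [hcr]
          split_ifs with hv
          · rw [one_mul]
            congr 2
            ext e
            simp only [mem_filter, mem_univ, true_and, not_not]
            constructor
            · rintro ⟨h1, h2⟩; exact ⟨⟨(hA e h1).trans hv, h2⟩, h1⟩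
            · rintro ⟨⟨-, h2⟩, h1⟩; exact ⟨h1, h2⟩
          · rw [zero_mul, eq_comm, Nat.cast_eq_zero, Finset.card_eq_zero,
              Finset.filter_eq_empty_iff]
            simp only [mem_filter, mem_univ, true_and, not_not]
            rintro e ⟨h1, -⟩ h2
            exact hv ((hA e h2).symm.trans h1)
      rw [← h1]
      simp [Matrix.one_apply]
      ring
    · simp [c, map_some_ne]
    · simp only [r]
      have h1 : (univ.filter fun e => (if e ∈ A then some none else Option.map some (G.1 e)) =
          some none ∧ G.2 e = some j) = A.filter fun e => G.2 e = some j := by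
        ext e
        by_cases he : e ∈ A <;> simp [he, map_some_ne]
      rw [h1]
      simp [map_some_ne]
    · simp [map_some_ne]
  -- The Schur complement of the lower right block `-1` is `(G.adjM - 1 - c * r) + c * r`.
  have h2 := congrArg Matrix.det key
  rw [Matrix.det_reindex_self] at h2
  have : Invertible (-1 : Matrix Unit Unit ℤ) := ⟨-1, by simp, by simp⟩
  rw [sgn, h2, Matrix.det_fromBlocks₂₂]
  have h3 : ⅟(-1 : Matrix Unit Unit ℤ) = -1 := invOf_eq_right_inv (by simp)
  rw [h3]
  simp [sgn, Matrix.det_neg]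

/-- A graph in which the vertex `none` is entered by the edge `none` only, which is not a loop,
is obtained by splitting off this vertex in a unique way. -/
theorem sum_split {A : Type*} [AddCommMonoid A] (f : DG (Option V) (Option E) → A) :
    ∑ G' ∈ univ.filter (fun G' : DG (Option V) (Option E) =>
        (univ.filter fun e => G'.2 e = some none) = {none} ∧ G'.1 none ≠ some none), f G' =
      ∑ G : DG V E, ∑ v : Option V, ∑ B ∈ (univ.filter fun e => G.1 e = v).powerset,
        f (split v B G) := by
  -- The inverse of `split` contracts the edge `none`, and remembers its source and the edges which
  -- left the vertex `none`.
  have hleft : ∀ (G' : DG (Option V) (Option E)) (_ : G' ∈ univ.filter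
      (fun G' : DG (Option V) (Option E) => (univ.filter fun e => G'.2 e = some none) = {none} ∧
        G'.1 none ≠ some none)), split (G'.1 none).join
      (univ.filter fun e => G'.1 (some e) = some none)
      ((fun e => if G'.1 (some e) = some none then (G'.1 none).join
        else (G'.1 (some e)).join, fun e => (G'.2 (some e)).join) : DG V E) = G' := by
    intro G' h
    simp only [mem_filter, mem_univ, true_and] at h
    have hin : ∀ e, G'.2 e = some none ↔ e = none := fun e => by
      have := congrArg (fun s => e ∈ s) h.1
      simpa using this
    refine Prod.ext (funext fun e => ?_) (funext fun e => ?_)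
    · cases e with
      | none => exact map_some_join h.2
      | some e =>
        by_cases he : G'.1 (some e) = some none
        · simp [he]
        · simp [he, map_some_join he]
    · cases e with
      | none => exact ((hin none).2 rfl).symm
      | some e => exact map_some_join (fun hh => by simpa using (hin _).1 hh)
  simp only [Finset.sum_sigma']
  refine Finset.sum_bij'
    (fun G' _ => ⟨((fun e => if G'.1 (some e) = some none then (G'.1 none).join
      else (G'.1 (some e)).join, fun e => (G'.2 (some e)).join)),
      ⟨(G'.1 none).join, univ.filter fun e => G'.1 (some e) = some none⟩⟩)
    (fun x _ => split x.2.1 x.2.2 x.1) ?_ ?_ ?_ ?_ ?_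
  · intro G' _
    simp only [mem_sigma, mem_univ, mem_powerset, true_and]
    intro e
    simp +contextual
  · rintro ⟨G, v, B⟩ -
    simp only [mem_filter, mem_univ, true_and]
    refine ⟨?_, map_some_ne v⟩
    ext e
    cases e <;> simp [map_some_ne]
  · exact hleft
  · rintro ⟨G, v, B⟩ h
    simp only [mem_sigma, mem_univ, mem_powerset, true_and] at h
    have hj : ∀ x : Option V, (x.map some).join = x := by intro x; cases x <;> rfl
    have hB : ∀ e, (split v B G).1 (some e) = some none ↔ e ∈ B := fun e => by
      rw [split_fst_some]; split_ifs with he <;> simp [he, map_some_ne]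
    simp only [hB, split_fst_none, split_snd_some, hj, Finset.filter_mem_eq_inter, univ_inter]
    congr 1
    refine Prod.ext (funext fun e => ?_) rfl
    by_cases he : e ∈ B
    · have := h he
      simp only [mem_filter, mem_univ, true_and] at this
      simp [he, this]
    · simp [he, hj]
  · intro G' h
    exact congrArg f (hleft G' h).symm

end DG

/-! ### Infinitesimal changes of coordinates -/

section Infinitesimal

variable {V E V' E' ι : Type*} {K : Type*} [CommRing K]

theorem fib_eq_map {X : Type*} [Fintype E] [DecidableEq X] {f : E → X} {x : X} {s : Finset E}
    (h : ∀ e, f e = x ↔ e ∈ s) (a : E → ι) : fib f x a = s.val.map a := by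
  unfold fib
  congr 2
  ext e
  simp [h]

theorem sum_antidiagonal_map [DecidableEq E] {A : Type*} [AddCommMonoid A] (s : Finset E)
    (a : E → ι) (F : Multiset ι × Multiset ι → A) :
    ((s.val.map a).antidiagonal.map F).sum =
      ∑ B ∈ s.powerset, F (B.val.map a, (s \ B).val.map a) := by
  induction s using Finset.induction_on generalizing F with
  | empty => simp
  | insert e s he ih =>
    rw [insert_val_of_notMem he, Multiset.map_cons, Multiset.antidiagonal_cons, Multiset.map_add,
      Multiset.sum_add, Multiset.map_map, Multiset.map_map, ih, ih, sum_powerset_insert he]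
    congr 1 <;> refine sum_congr rfl fun B hB => ?_
    · have : e ∉ B := fun h => he (mem_powerset.1 hB h)
      rw [insert_sdiff_of_notMem _ this, insert_val_of_notMem (by simp [he])]
      simp
    · have : e ∉ B := fun h => he (mem_powerset.1 hB h)
      have h2 : insert e s \ insert e B = s \ B := by
        rw [insert_sdiff_insert, sdiff_insert_of_notMem he]
      rw [h2, insert_val_of_notMem this]
      simp

variable [Fintype ι]

/-- The infinitesimal action on tensors of a holomorphic vector field; `ξ m A` are the derivatives
of its `m`-th component along `A`. The indices `I` are distributed over the field and the tensor as
in the Leibniz rule; the terms without derivatives of `ξ` describe the transport along the field. -/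
def lie (ξ : ι → Multiset ι → K) (Φ : Multiset ι → Multiset ι → K) (I J : Multiset ι) : K :=
  (I.antidiagonal.map fun p => ∑ m, ξ m p.1 * Φ (m ::ₘ p.2) J).sum

theorem lie_map [DecidableEq E] (ξ : ι → Multiset ι → K) (Φ : Multiset ι → Multiset ι → K)
    (s : Finset E) (a : E → ι) (J : Multiset ι) :
    lie ξ Φ (s.val.map a) J = ∑ B ∈ s.powerset, ∑ m, ξ m (B.val.map a) *
      Φ (m ::ₘ (s \ B).val.map a) J := by
  rw [lie, sum_antidiagonal_map]

theorem lie_add (ξ : ι → Multiset ι → K) (Φ Φ' : Multiset ι → Multiset ι → K) (I J : Multiset ι) :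
    lie ξ (fun I J => Φ I J + Φ' I J) I J = lie ξ Φ I J + lie ξ Φ' I J := by
  simp only [lie, mul_add, sum_add_distrib, Multiset.sum_map_add]

variable [DecidableEq ι]

/-- The tensor with the components `g i j` for single indices and `0` otherwise. -/
def singleTensor (g : ι → ι → K) (I J : Multiset ι) : K :=
  ∑ i, ∑ j, if I = {i} ∧ J = {j} then g i j else 0

theorem singleTensor_single (g : ι → ι → K) (i j : ι) : singleTensor g {i} {j} = g i j := by
  unfold singleTensor
  rw [Fintype.sum_eq_single i, Fintype.sum_eq_single j]
  · simp
  · intro j' h; simp [h.symm]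
  · intro i' h; simp [h.symm]

theorem singleTensor_eq_zero (g : ι → ι → K) {I J : Multiset ι}
    (h : Multiset.card I ≠ 1 ∨ Multiset.card J ≠ 1) : singleTensor g I J = 0 := by
  unfold singleTensor
  refine sum_eq_zero fun i _ => sum_eq_zero fun j _ => if_neg ?_
  rintro ⟨rfl, rfl⟩
  simp at h

theorem lie_singleTensor (ξ : ι → Multiset ι → K) (g : ι → ι → K) (I J : Multiset ι) :
    lie ξ (singleTensor g) I J = ∑ m, ξ m I * singleTensor g {m} J := by
  induction I using Quotient.inductionOn with
  | h l =>
    have h1 : (Quotient.mk _ l : Multiset ι) = (univ : Finset (Fin l.length)).val.map l.get := by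
      rw [Fin.univ_val_map, List.ofFn_get]; rfl
    rw [h1, lie_map, sum_eq_single univ]
    · simp
    · intro B _ hB
      refine sum_eq_zero fun m _ => ?_
      rw [singleTensor_eq_zero, mul_zero]
      left
      have : (univ \ B).Nonempty := by
        rw [nonempty_iff_ne_empty, ne_eq, sdiff_eq_empty_iff_subset]
        exact fun h => hB (univ_subset_iff.1 h)
      have h2 := this.card_pos
      rw [Multiset.card_cons, Multiset.card_map]
      change (univ \ B).card + 1 ≠ 1
      omega
    · simp

variable [Fintype V] [DecidableEq V] [Fintype E] [DecidableEq E]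
  [Fintype V'] [DecidableEq V'] [Fintype E'] [DecidableEq E']

theorem singleTensor_fib (g : ι → ι → K) (m : ι) {X : Type*} [DecidableEq X] (f : E → X) (x : X)
    (b : E → ι) : singleTensor g {m} (fib f x b) =
      ∑ e, if (univ.filter fun e' => f e' = x) = {e} then g m (b e) else 0 := by
  by_cases h : ∃ e, (univ.filter fun e' => f e' = x) = {e}
  · obtain ⟨e, he⟩ := h
    rw [fib, he, Fintype.sum_eq_single e]
    · simp [singleTensor_single]
    · intro e' h'
      rw [if_neg]
      rw [singleton_inj]
      exact h'.symm
  · rw [singleTensor_eq_zero, Fintype.sum_eq_zero]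
    · exact fun e => if_neg fun h' => h ⟨e, h'⟩
    · right
      rw [card_fib]
      exact fun h' => h (card_eq_one.1 h')

/-- The derivative of the contraction of the tensors `Ψ v`, if their derivatives are `Ψ' v`. -/
def dcontraction (M : ι → ι → K) (Ψ Ψ' : Option V → Multiset ι → Multiset ι → K) (G : DG V E) :
    K :=
  ∑ a : E → ι, ∑ b : E → ι, (∏ e, M (a e) (b e)) * ∑ v, Ψ' v (fib G.1 v a) (fib G.2 v b) *
    ∏ w ∈ univ.erase v, Ψ w (fib G.1 w a) (fib G.2 w b)

/-- The part of the derivative of the contraction in which the vector field `ξ` takes the place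
of the vertex `v`, entered by the edge `e` only. -/
def pointContraction (M g : ι → ι → K) (ξ : ι → Multiset ι → K)
    (Ψ : Option V → Multiset ι → Multiset ι → K) (v : V) (e : E) (G : DG V E) : K :=
  ∑ a : E → ι, ∑ b : E → ι, (∏ e, M (a e) (b e)) *
    ((∑ m, ξ m (fib G.1 (some v) a) * g m (b e)) *
      ∏ w ∈ univ.erase (some v), Ψ w (fib G.1 w a) (fib G.2 w b))

theorem pointContraction_relabel (M g : ι → ι → K) (ξ : ι → Multiset ι → K)
    (Ψ : Option V → Multiset ι → Multiset ι → K) (Ψ' : Option V' → Multiset ι → Multiset ι → K)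
    (σ : V ≃ V') (τ : E ≃ E') (h : ∀ v, Ψ' (v.map σ) = Ψ v) (v : V) (e : E) (G : DG V E) :
    pointContraction M g ξ Ψ' (σ v) (τ e) (DG.relabel σ τ G) = pointContraction M g ξ Ψ v e G := by
  unfold pointContraction
  rw [← sum_relabel τ]
  refine sum_congr rfl fun a _ => ?_
  rw [← sum_relabel τ]
  refine sum_congr rfl fun b _ => ?_
  rw [← τ.prod_comp]
  congr 1
  · simp
  · congr 1
    · refine sum_congr rfl fun m _ => ?_
      congr 1
      · exact congrArg _ (fib_relabel σ τ G.1 (some v) a)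
      · simp
    · have : univ.erase (some (σ v)) = (univ.erase (some v)).map σ.optionCongr.toEmbedding := by
        ext w
        obtain ⟨w, rfl⟩ := σ.optionCongr.surjective w
        cases w <;> simp
      rw [this, prod_map]
      refine prod_congr rfl fun w _ => ?_
      simp only [Equiv.coe_toEmbedding, Equiv.optionCongr_apply]
      rw [h]
      congr 1
      · exact fib_relabel σ τ G.1 w a
      · exact fib_relabel σ τ G.2 w b

/-- The tensor `lie ξ (singleTensor g)` vanishes unless it has exactly one barred index. Hence it
can take the place of a vertex only if this vertex is entered by exactly one edge. -/
theorem dcontraction_single (M g : ι → ι → K) (ξ : ι → Multiset ι → K)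
    (Ψ : Option V → Multiset ι → Multiset ι → K) (G : DG V E) :
    dcontraction M Ψ (vfac (lie ξ (singleTensor g)) fun _ _ => 0) G =
      ∑ v, ∑ e, if (univ.filter fun e' => G.2 e' = some v) = {e} then
        pointContraction M g ξ Ψ v e G else 0 := by
  unfold dcontraction
  simp only [Fintype.sum_option, vfac, zero_mul, zero_add, lie_singleTensor, singleTensor_fib]
  have h1 : ∀ (P : Prop) [Decidable P] (v : V) (e : E), (if P then
        pointContraction M g ξ Ψ v e G else 0) = ∑ a : E → ι, ∑ b : E → ι, (∏ e, M (a e) (b e)) *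
      ((∑ m, ξ m (fib G.1 (some v) a) * if P then g m (b e) else 0) *
      ∏ w ∈ univ.erase (some v), Ψ w (fib G.1 w a) (fib G.2 w b)) := by
    intro P _ v e
    split_ifs
    · rfl
    · simp
  simp only [h1]
  have h2 : ∀ f : V → E → (E → ι) → (E → ι) → K, ∑ v, ∑ e, ∑ a, ∑ b, f v e a b =
      ∑ a, ∑ b, ∑ v, ∑ e, f v e a b := by
    intro f
    rw [sum_congr rfl fun v _ => sum_comm, sum_comm]
    refine sum_congr rfl fun a _ => ?_
    rw [sum_congr rfl fun v _ => sum_comm, sum_comm]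
  rw [h2]
  refine sum_congr rfl fun a _ => sum_congr rfl fun b _ => ?_
  simp only [mul_sum, sum_mul]
  refine sum_congr rfl fun v _ => ?_
  rw [sum_comm]

/-- Contracting the single edge which enters the new vertex of `split v B G` with `M`, the inverse
of `g`, moves the vector field to the vertex `v`: its index takes the place of the edges `B`. Summed
over `B`, this is the action `lie ξ` of the field on the tensor at `v`. -/
theorem pointContraction_split {M g : ι → ι → K}
    (hMg : ∀ i m, ∑ j, M i j * g m j = if i = m then 1 else 0) (ξ : ι → Multiset ι → K)
    (Ψ : Option V → Multiset ι → Multiset ι → K)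
    (Ψ' : Option (Option V) → Multiset ι → Multiset ι → K) (h : ∀ v, Ψ' (v.map some) = Ψ v)
    (G : DG V E) (v : Option V) (B : Finset E) (hB : B ⊆ univ.filter fun e => G.1 e = v) :
    pointContraction M g ξ Ψ' none none (DG.split v B G) =
      ∑ a : E → ι, ∑ b : E → ι, (∏ e, M (a e) (b e)) * ((∑ m, ξ m (B.val.map a) *
        Ψ v (m ::ₘ ((univ.filter fun e => G.1 e = v) \ B).val.map a) (fib G.2 v b)) *
      ∏ w ∈ univ.erase v, Ψ w (fib G.1 w a) (fib G.2 w b)) := by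
  unfold pointContraction
  have hfa : ∀ a : Option E → ι, fib (DG.split v B G).1 (some none) a =
      B.val.map fun e => a (some e) := by
    intro a
    rw [fib_option]
    simp only [DG.split_fst_none, map_some_ne, if_false, zero_add, fib]
    congr 2
    ext e
    by_cases he : e ∈ B <;> simp [he, map_some_ne]
  have hfv : ∀ a : Option E → ι, fib (DG.split v B G).1 (v.map some) a =
      a none ::ₘ ((univ.filter fun e => G.1 e = v) \ B).val.map fun e => a (some e) := by
    intro a
    rw [fib_option]
    simp only [DG.split_fst_none, if_true, Multiset.singleton_add]
    congr 1
    refine fib_eq_map (fun e => ?_) _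
    by_cases he : e ∈ B <;> simp [he, (map_some_ne _).symm, map_some_injective.eq_iff]
  have hfw : ∀ (a : Option E → ι) (w), w ≠ v → fib (DG.split v B G).1 (w.map some) a =
      fib G.1 w fun e => a (some e) := by
    intro a w hw
    rw [fib_option]
    simp only [DG.split_fst_none, map_some_injective.eq_iff, hw.symm, if_false, zero_add]
    refine fib_congr (fun e => ?_) _
    by_cases he : e ∈ B
    · have := hB he
      simp only [mem_filter, mem_univ, true_and] at this
      simp [he, (map_some_ne _).symm, this, hw.symm]
    · simp [he, map_some_injective.eq_iff]
  have hft : ∀ (a : Option E → ι) (w : Option V), fib (DG.split v B G).2 (w.map some) a =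
      fib G.2 w fun e => a (some e) := by
    intro a w
    rw [fib_option]
    simp only [DG.split_snd_none, (map_some_ne _).symm, if_false, zero_add, DG.split_snd_some]
    exact fib_injective map_some_injective _ _ _
  have herase : (univ.erase (some none) : Finset (Option (Option V))) =
      univ.map ⟨Option.map some, map_some_injective⟩ := by
    ext w
    rcases w with _ | _ | w <;> simp
  simp only [herase, prod_map, Function.Embedding.coeFn_mk, h, hfa, hft,
    Fintype.prod_option (f := fun e : Option E => M _ _)]
  have hprod : ∀ a b : Option E → ι, ∏ w, Ψ w (fib (DG.split v B G).1 (w.map some) a)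
      (fib G.2 w fun e => b (some e)) =
      Ψ v (a none ::ₘ ((univ.filter fun e => G.1 e = v) \ B).val.map fun e => a (some e))
        (fib G.2 v fun e => b (some e)) * ∏ w ∈ univ.erase v, Ψ w (fib G.1 w fun e => a (some e))
        (fib G.2 w fun e => b (some e)) := by
    intro a b
    rw [← mul_prod_erase _ _ (mem_univ v), hfv]
    congr 1
    exact prod_congr rfl fun w hw => by rw [hfw _ _ (ne_of_mem_erase hw)]
  simp only [hprod]
  rw [← (Equiv.piOptionEquivProd (β := fun _ : Option E => ι)).symm.sum_comp,
    Fintype.sum_prod_type, sum_comm]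
  refine sum_congr rfl fun a _ => ?_
  have h2 : ∀ i : ι, ∑ b : Option E → ι, (M i (b none) * ∏ e, M (a e) (b (some e))) *
      ((∑ m, ξ m (B.val.map a) * g m (b none)) * (Ψ v
          (i ::ₘ ((univ.filter fun e => G.1 e = v) \ B).val.map a)
        (fib G.2 v fun e => b (some e)) * ∏ w ∈ univ.erase v, Ψ w (fib G.1 w a)
        (fib G.2 w fun e => b (some e)))) =
      ∑ b : E → ι, (∏ e, M (a e) (b e)) * (ξ i (B.val.map a) *
        Ψ v (i ::ₘ ((univ.filter fun e => G.1 e = v) \ B).val.map a) (fib G.2 v b) *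
      ∏ w ∈ univ.erase v, Ψ w (fib G.1 w a) (fib G.2 w b)) := by
    intro i
    rw [← (Equiv.piOptionEquivProd (β := fun _ : Option E => ι)).symm.sum_comp,
      Fintype.sum_prod_type, sum_comm]
    refine sum_congr rfl fun b _ => ?_
    -- The metric at the end of the new edge cancels against its inverse on this edge.
    have h3 : ∑ j, M i j * ∑ m, ξ m (B.val.map a) * g m j = ξ i (B.val.map a) := by
      simp only [mul_sum]
      rw [sum_comm]
      have : ∀ m, ∑ j, M i j * (ξ m (B.val.map a) * g m j) =
          ξ m (B.val.map a) * if i = m then 1 else 0 := fun m => by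
        rw [← hMg i m, mul_sum]
        exact sum_congr rfl fun j _ => by ring
      simp [this]
    rw [← h3, sum_mul, sum_mul, mul_sum]
    refine sum_congr rfl fun j _ => ?_
    simp only [Equiv.piOptionEquivProd, Equiv.coe_fn_symm_mk]
    ring
  refine Eq.trans (sum_congr rfl fun i _ => h2 i) ?_
  rw [sum_comm]
  refine sum_congr rfl fun b _ => ?_
  rw [sum_mul, mul_sum]

end Infinitesimal

/-! ### Invariance of graph sums under infinitesimal changes of coordinates -/

section InfinitesimalInvariance

variable {V E V' E' ι : Type*} {K : Type*} [CommRing K] [Fintype ι] [DecidableEq ι]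
  [Fintype V] [DecidableEq V] [Fintype E] [DecidableEq E]
  [Fintype V'] [DecidableEq V'] [Fintype E'] [DecidableEq E']

/-- In a strongly connected graph the only edge entering an ordinary vertex is not a loop, since
otherwise the vertex could not be reached. -/
theorem DG.SC.fst_ne {G : DG V E} (h : G.SC) {v : V} {e : E}
    (he : (univ.filter fun e' => G.2 e' = some v) = {e}) : G.1 e ≠ some v := by
  intro hv
  have hin : ∀ e', G.2 e' = some v → e' = e := fun e' h' => by
    have := congrArg (fun s => e' ∈ s) he
    simpa [h'] using this
  have key : ∀ x, Relation.ReflTransGen (fun a b => ∃ e, G.1 e = a ∧ G.2 e = b) x (some v) →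
      x = some v := by
    intro x hx
    induction hx using Relation.ReflTransGen.head_induction_on with
    | refl => rfl
    | head hab _ ih =>
      obtain ⟨e', rfl, h2⟩ := hab
      rw [hin e' (h2.trans ih), hv]
  cases key none (h none (some v))

open Classical in
variable (V E) in
/-- The derivative of `gsum`, if the derivatives of `Φ` and `F` are `Φ'` and `F'`. -/
noncomputable def dgsum (M : ι → ι → K) (Φ F Φ' F' : Multiset ι → Multiset ι → K) : K :=
  ∑ G : DG V E, if G.SC then
    (G.sgn : K) * dcontraction M (vfac Φ F) (vfac Φ' F') G else 0

theorem dgsum_add (M : ι → ι → K) (Φ F Φ₁ F₁ Φ₂ F₂ : Multiset ι → Multiset ι → K) :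
    dgsum V E M Φ F (fun I J => Φ₁ I J + Φ₂ I J) (fun I J => F₁ I J + F₂ I J) =
      dgsum V E M Φ F Φ₁ F₁ + dgsum V E M Φ F Φ₂ F₂ := by
  unfold dgsum
  rw [← sum_add_distrib]
  refine sum_congr rfl fun G _ => ?_
  split_ifs
  · rw [← mul_add]
    unfold dcontraction
    simp only [← sum_add_distrib, ← mul_add]
    congr 1
    refine sum_congr rfl fun a _ => sum_congr rfl fun b _ => ?_
    congr 1
    refine sum_congr rfl fun v _ => ?_
    rw [← add_mul]
    cases v <;> rfl
  · simp

open Classical in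
theorem dgsum_single_eq_sum (M g : ι → ι → K) (ξ : ι → Multiset ι → K)
    (Φ F : Multiset ι → Multiset ι → K) :
    dgsum V E M Φ F (lie ξ (singleTensor g)) (fun _ _ => 0) = ∑ v : V, ∑ e : E, ∑ G : DG V E,
      if G.SC ∧ (univ.filter fun e' => G.2 e' = some v) = {e} then
        (G.sgn : K) * pointContraction M g ξ (vfac Φ F) v e G else 0 := by
  unfold dgsum
  rw [sum_congr rfl fun v _ => sum_comm, sum_comm]
  refine sum_congr rfl fun G _ => ?_
  rw [dcontraction_single]
  by_cases h : G.SC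
  · simp only [h, true_and, if_true, mul_sum, mul_ite, mul_zero]
  · simp [h]

open Classical in
/-- Every graph in which the vertex `none` is entered by the edge `none` only arises by splitting
off this vertex. The sign of `sgn_split` turns the sum over these graphs into minus the sum in which
the vector field acts on the tensors at all vertices. -/
theorem sum_pointContraction_option {M g : ι → ι → K}
    (hMg : ∀ i m, ∑ j, M i j * g m j = if i = m then 1 else 0) {ξ : ι → Multiset ι → K}
    (hξ : ∀ m, ξ m 0 = 0) (Φ F : Multiset ι → Multiset ι → K) :
    ∑ G : DG (Option V) (Option E),
      (if G.SC ∧ (univ.filter fun e' => G.2 e' = some none) = {none} then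
        (G.sgn : K) * pointContraction M g ξ (vfac Φ F) none none G else 0) =
      -dgsum V E M Φ F (lie ξ Φ) (lie ξ F) := by
  have h1 : ∀ G : DG (Option V) (Option E),
      (G.SC ∧ (univ.filter fun e' => G.2 e' = some none) = {none}) ↔
      (((univ.filter fun e' => G.2 e' = some none) = {none} ∧ G.1 none ≠ some none) ∧ G.SC) :=
    fun G => ⟨fun h => ⟨⟨h.2, h.1.fst_ne h.2⟩, h.1⟩, fun h => ⟨h.2, h.1.1⟩⟩
  simp only [h1]
  rw [sum_congr rfl fun G _ => ite_and _ _ _ _, ← sum_filter]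
  have h2 := DG.sum_split (V := V) (E := E) fun G => if G.SC then
        (G.sgn : K) * pointContraction M g ξ (vfac Φ F) none none G else 0
  refine Eq.trans ?_ (h2.trans ?_)
  · congr! 
  unfold dgsum
  rw [← sum_neg_distrib]
  refine sum_congr rfl fun G _ => ?_
  have hterm : ∀ v : Option V, ∀ B ∈ (univ.filter fun e => G.1 e = v).powerset,
      (if (DG.split v B G).SC then ((DG.split v B G).sgn : K) *
        pointContraction M g ξ (vfac Φ F) none none (DG.split v B G) else 0) =
      if G.SC then -((G.sgn : K) * ∑ a : E → ι, ∑ b : E → ι, (∏ e, M (a e) (b e)) *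
        ((∑ m, ξ m (B.val.map a) * vfac Φ F v
          (m ::ₘ ((univ.filter fun e => G.1 e = v) \ B).val.map a) (fib G.2 v b)) *
        ∏ w ∈ univ.erase v, vfac Φ F w (fib G.1 w a) (fib G.2 w b))) else 0 := by
    intro v B hB
    rw [mem_powerset] at hB
    have hB' : ∀ e ∈ B, G.1 e = v := fun e he => by simpa using hB he
    -- For empty `B` the split graph is not strongly connected; the term for `G` vanishes as well,
    -- since the vector field vanishes at the point.
    rcases B.eq_empty_or_nonempty with rfl | hne
    · rw [pointContraction_split hMg ξ (vfac Φ F) _ (by intro v; cases v <;> rfl) G v _ hB]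
      simp [hξ]
    · rw [pointContraction_split hMg ξ (vfac Φ F) _ (by intro v; cases v <;> rfl) G v _ hB,
        DG.sgn_split hB', DG.SC_split hB' hne]
      push_cast
      simp only [neg_mul]
  rw [sum_congr rfl fun v _ => sum_congr rfl (hterm v)]
  split_ifs
  · unfold dcontraction
    simp only [sum_neg_distrib, ← mul_sum]
    congr 2
    have h3 : ∀ f : (v : Option V) → Finset E → (E → ι) → (E → ι) → K,
        ∑ v, ∑ B ∈ (univ.filter fun e => G.1 e = v).powerset, ∑ a, ∑ b, f v B a b =
        ∑ a, ∑ b, ∑ v, ∑ B ∈ (univ.filter fun e => G.1 e = v).powerset, f v B a b := by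
      intro f
      rw [sum_congr rfl fun v _ => sum_comm, sum_comm]
      refine sum_congr rfl fun a _ => ?_
      rw [sum_congr rfl fun v _ => sum_comm, sum_comm]
    rw [h3]
    refine sum_congr rfl fun a _ => sum_congr rfl fun b _ => ?_
    rw [← sum_congr rfl fun v _ => mul_sum _ _ _, ← mul_sum]
    congr 1
    refine sum_congr rfl fun v _ => ?_
    rw [← sum_mul, ← lie_map]
    congr 1
    cases v <;> rfl
  · simp

open Classical in
/-- The vertex at which the vector field sits and the edge entering it can be labelled in `(p + 1) *
(q + 1)` ways, all of which give the same contribution. -/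
theorem dgsum_single {M g : ι → ι → K}
    (hMg : ∀ i m, ∑ j, M i j * g m j = if i = m then 1 else 0) {ξ : ι → Multiset ι → K}
    (hξ : ∀ m, ξ m 0 = 0) (Φ F : Multiset ι → Multiset ι → K) (p q : ℕ) :
    dgsum (Fin (p + 1)) (Fin (q + 1)) M Φ F (lie ξ (singleTensor g)) (fun _ _ => 0) =
      -((((p + 1) * (q + 1) : ℕ) : K) * dgsum (Fin p) (Fin q) M Φ F (lie ξ Φ) (lie ξ F)) := by
  rw [dgsum_single_eq_sum]
  have key : ∀ (v : Fin (p + 1)) (e : Fin (q + 1)), ∑ G : DG (Fin (p + 1)) (Fin (q + 1)),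
      (if G.SC ∧ (univ.filter fun e' => G.2 e' = some v) = {e} then
        (G.sgn : K) * pointContraction M g ξ (vfac Φ F) v e G else 0) =
      -dgsum (Fin p) (Fin q) M Φ F (lie ξ Φ) (lie ξ F) := by
    intro v e
    rw [← sum_pointContraction_option hMg hξ]
    -- Relabel such that `v` and `e` become the new vertex and the new edge.
    refine Fintype.sum_equiv (DG.relabel (finSuccEquiv' v) (finSuccEquiv' e)) _ _ fun G => ?_
    have h1 := pointContraction_relabel M g ξ (vfac Φ F) (vfac Φ F) (finSuccEquiv' v)
      (finSuccEquiv' e) (by intro v; cases v <;> rfl) v e G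
    rw [finSuccEquiv'_at, finSuccEquiv'_at] at h1
    rw [h1, DG.sgn_relabel, DG.SC_relabel]
    have h2 : ((univ.filter fun e' => (DG.relabel (finSuccEquiv' v) (finSuccEquiv' e) G).2 e' =
        some none) = {none}) ↔ (univ.filter fun e' => G.2 e' = some v) = {e} := by
      have h3 : (univ.filter fun e' => (DG.relabel (finSuccEquiv' v) (finSuccEquiv' e) G).2 e' =
        some none) = (univ.filter fun e' => G.2 e' = some v).map
          (finSuccEquiv' e).toEmbedding := by
        ext e'
        obtain ⟨e', rfl⟩ := (finSuccEquiv' e).surjective e'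
        have : ∀ x : Option (Fin (p + 1)), x.map (finSuccEquiv' v) = some none ↔ x = some v := by
          intro x
          cases x with
          | none => simp
          | some x =>
            rw [Option.map_some, Option.some_inj, Option.some_inj, ← finSuccEquiv'_at v,
              (finSuccEquiv' v).injective.eq_iff]
        simp [this]
      rw [h3]
      have : ({none} : Finset (Option (Fin q))) =
          ({e} : Finset _).map (finSuccEquiv' e).toEmbedding := by simp
      rw [this, map_inj]
    simp only [h2]
  simp only [key, sum_const, card_univ, Fintype.card_fin, smul_neg, nsmul_eq_mul]
  push_cast
  ring

/-- Graphs with more than `2 * k` vertices do not contribute. By counting half-edges, one of the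
vertices is met by only two. The tensor there vanishes; if it is the vector field, it enters with at
most one derivative, and vanishes as well. -/
theorem dgsum_single_eq_zero {M g : ι → ι → K} {ξ : ι → Multiset ι → K}
    (hξ : ∀ m I, Multiset.card I ≤ 1 → ξ m I = 0) {Φ : Multiset ι → Multiset ι → K}
    (hΦ : ∀ I J, Multiset.card I = 1 → Multiset.card J = 1 → Φ I J = 0)
    (F : Multiset ι → Multiset ι → K) (h : 2 * Fintype.card E < 3 * Fintype.card V) :
    dgsum V E M Φ F (lie ξ (singleTensor g)) (fun _ _ => 0) = 0 := by
  classical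
  rw [dgsum_single_eq_sum]
  refine sum_eq_zero fun v _ => sum_eq_zero fun e _ => sum_eq_zero fun G _ => ?_
  split_ifs with hG
  · obtain ⟨w, hw⟩ : ∃ w : V, (univ.filter fun e => G.1 e = some w).card +
        (univ.filter fun e => G.2 e = some w).card < 3 := by
      by_contra! hcon
      exact absurd (G.card_le_of_three_le hcon) (not_le.2 h)
    have h1 : 0 < (univ.filter fun e => G.1 e = some w).card :=
      card_pos.2 (by obtain ⟨e, he⟩ := hG.1.exists_out w; exact ⟨e, by simpa using he⟩)
    have h2 : 0 < (univ.filter fun e => G.2 e = some w).card :=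
      card_pos.2 (by obtain ⟨e, he⟩ := hG.1.exists_in w; exact ⟨e, by simpa using he⟩)
    have h3 : pointContraction M g ξ (vfac Φ F) v e G = 0 := by
      unfold pointContraction
      refine sum_eq_zero fun a _ => sum_eq_zero fun b _ => ?_
      by_cases hvw : w = v
      · subst hvw
        rw [sum_eq_zero fun m _ => by rw [hξ m _ (by rw [card_fib]; omega), zero_mul]]
        simp
      · rw [prod_eq_zero (mem_erase.2 ⟨by simpa using hvw, mem_univ (some w)⟩), mul_zero, mul_zero]
        exact hΦ _ _ (by rw [card_fib]; omega) (by rw [card_fib]; omega)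
    rw [h3, mul_zero]
  · rfl

/-- Graph sums do not change under infinitesimal changes of coordinates of second order. The
terms in which the vector field is attached to a vertex with a single incoming edge cancel
against those of the graph in which this edge is contracted. -/
theorem sum_dgsum_lie [Algebra ℂ K] {M g : ι → ι → K}
    (hMg : ∀ i m, ∑ j, M i j * g m j = if i = m then 1 else 0) {ξ : ι → Multiset ι → K}
    (hξ : ∀ m I, Multiset.card I ≤ 1 → ξ m I = 0) {Φ : Multiset ι → Multiset ι → K}
    (hΦ : ∀ I J, Multiset.card I = 1 → Multiset.card J = 1 → Φ I J = 0)
    (F : Multiset ι → Multiset ι → K) (k : ℕ) :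
    ∑ p ∈ range (2 * k + 1), ((p.factorial * (p + k).factorial : ℕ) : ℂ)⁻¹ •
      dgsum (Fin p) (Fin (p + k)) M Φ F (lie ξ fun I J => Φ I J + singleTensor g I J) (lie ξ F)
      = 0 := by
  -- The vector field acts on the tensor `Φ`, or it acts on the metric itself, which is possible at
  -- vertices with a single incoming edge only.
  have h1 : ∀ p, dgsum (Fin p) (Fin (p + k)) M Φ F
      (lie ξ fun I J => Φ I J + singleTensor g I J) (lie ξ F) =
      dgsum (Fin p) (Fin (p + k)) M Φ F (lie ξ Φ) (lie ξ F) +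
      dgsum (Fin p) (Fin (p + k)) M Φ F (lie ξ (singleTensor g)) (fun _ _ => 0) := by
    intro p
    rw [← dgsum_add]
    congr 1
    · ext I J; exact lie_add ..
    · ext I J; simp
  simp only [h1, smul_add, sum_add_distrib]
  -- The second kind of terms with `p + 1` vertices cancels against the first kind with `p`
  -- vertices; the numbers of labellings fit together.
  have h2 : ∀ p, ((((p + 1).factorial * ((p + 1) + k).factorial : ℕ) : ℂ)⁻¹ •
      dgsum (Fin (p + 1)) (Fin ((p + 1) + k)) M Φ F (lie ξ (singleTensor g)) (fun _ _ => 0)) =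
      -((((p.factorial * (p + k).factorial : ℕ) : ℂ)⁻¹ •
      dgsum (Fin p) (Fin (p + k)) M Φ F (lie ξ Φ) (lie ξ F))) := by
    intro p
    have := dgsum_single hMg (fun m => hξ m 0 (by simp)) Φ F p (p + k)
    have e : (p + 1) + k = (p + k) + 1 := by ring
    rw [e, this, smul_neg, ← nsmul_eq_mul, ← Nat.cast_smul_eq_nsmul ℂ, smul_smul]
    congr 2
    rw [Nat.factorial_succ, Nat.factorial_succ]
    push_cast
    have : ((p : ℂ) + 1) ≠ 0 := Nat.cast_add_one_ne_zero p
    have : ((p : ℂ) + k + 1) ≠ 0 := by exact_mod_cast Nat.cast_add_one_ne_zero (R := ℂ) (p + k)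
    have := Nat.factorial_ne_zero p
    have := Nat.factorial_ne_zero (p + k)
    field_simp
  -- The telescoping sum ends since graphs with `2 * k + 1` vertices do not contribute.
  have h3 : dgsum (Fin (2 * k + 1)) (Fin ((2 * k + 1) + k)) M Φ F (lie ξ (singleTensor g))
      (fun _ _ => 0) = 0 := dgsum_single_eq_zero hξ hΦ F (by simp; omega)
  have h4 : dgsum (Fin 0) (Fin (0 + k)) M Φ F (lie ξ (singleTensor g)) (fun _ _ => 0) = 0 := by
    classical
    rw [dgsum_single_eq_sum]
    simp
  have h5 := h2 (2 * k)
  rw [h3, smul_zero, eq_comm, neg_eq_zero] at h5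
  rw [sum_range_succ, h5, sum_range_succ' (fun p => ((p.factorial * (p + k).factorial : ℕ) : ℂ)⁻¹ •
    dgsum (Fin p) (Fin (p + k)) M Φ F (lie ξ (singleTensor g)) fun _ _ => 0), h4]
  simp only [h2, sum_neg_distrib]
  simp

theorem derivation_gsum [Algebra ℂ K] (δ : Derivation ℂ K K) {M : ι → ι → K}
    (hM : ∀ i j, δ (M i j) = 0) (Φ F : Multiset ι → Multiset ι → K) :
    δ (gsum V E M Φ F) = dgsum V E M Φ F (fun I J => δ (Φ I J)) (fun I J => δ (F I J)) := by
  unfold gsum dgsum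
  rw [map_sum]
  refine sum_congr rfl fun G _ => ?_
  split_ifs
  · rw [Derivation.leibniz, Derivation.map_intCast, smul_zero, add_zero, smul_eq_mul]
    congr 1
    unfold contraction dcontraction
    rw [map_sum]
    refine sum_congr rfl fun a _ => ?_
    rw [map_sum]
    refine sum_congr rfl fun b _ => ?_
    rw [Derivation.leibniz, leibniz_prod, leibniz_prod,
      sum_eq_zero (s := (univ : Finset E)) fun e _ => by rw [hM, zero_mul], smul_zero, add_zero,
      smul_eq_mul]
    congr 1
    refine sum_congr rfl fun v _ => ?_
    cases v <;> rfl
  · simp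

theorem derivation_graphTotal [Algebra ℂ K] (δ : Derivation ℂ K K) {M : ι → ι → K}
    (hM : ∀ i j, δ (M i j) = 0) (k : ℕ) (Φ F : Multiset ι → Multiset ι → K) :
    δ (graphTotal k M Φ F) = ∑ p ∈ range (2 * k + 1),
      ((p.factorial * (p + k).factorial : ℕ) : ℂ)⁻¹ • dgsum (Fin p) (Fin (p + k)) M Φ F
        (fun I J => δ (Φ I J)) (fun I J => δ (F I J)) := by
  unfold graphTotal
  rw [map_sum]
  exact sum_congr rfl fun p _ => by rw [Derivation.map_smul, derivation_gsum δ hM]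

theorem dgsum_rev (M : ι → ι → K) (Φ F Φ' F' : Multiset ι → Multiset ι → K) :
    dgsum V E (fun i j => M j i) (fun I J => Φ J I) (fun I J => F J I) (fun I J => Φ' J I)
      (fun I J => F' J I) = dgsum V E M Φ F Φ' F' := by
  classical
  unfold dgsum
  refine (Fintype.sum_equiv (Equiv.prodComm _ _) _ _ fun G => ?_).symm
  change _ = if (DG.rev G).SC then ((DG.rev G).sgn : K) * dcontraction _ _ _ (DG.rev G) else 0
  simp only [DG.SC_rev, DG.sgn_rev]
  have : dcontraction (fun i j => M j i) (vfac (fun I J => Φ J I) fun I J => F J I)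
      (vfac (fun I J => Φ' J I) fun I J => F' J I) (DG.rev G) =
      dcontraction M (vfac Φ F) (vfac Φ' F') G := by
    unfold dcontraction
    rw [sum_comm]
    refine sum_congr rfl fun a _ => sum_congr rfl fun b _ => ?_
    congr 1
    refine sum_congr rfl fun v _ => ?_
    congr 1
    · cases v <;> rfl
    · exact prod_congr rfl fun w _ => by cases w <;> rfl
  rw [this]

end InfinitesimalInvariance

/-! ### Linear changes of coordinates -/

section Linear

variable {V E X ι : Type*} {K : Type*} [CommRing K] [Fintype ι]
  [Fintype V] [DecidableEq V] [Fintype X] [DecidableEq X]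

/-- A product of sums over the labellings of the fibres of `f` is a sum over the labellings of all
edges. -/
theorem prod_sum_fiber [Fintype E] [DecidableEq E] (f : E → X)
    (Q : ∀ x, ({e // f e = x} → ι) → K) :
    ∏ x, ∑ c, Q x c = ∑ c : E → ι, ∏ x, Q x fun e => c e := by
  rw [prod_univ_sum, Fintype.piFinset_univ]
  refine (Function.Bijective.sum_comp (e := fun (c : E → ι) x (e : {e // f e = x}) => c e)
    ⟨fun c c' h => funext fun e => congrFun (congrFun h (f e)) ⟨e, rfl⟩, fun p =>
      ⟨fun e => p (f e) ⟨e, rfl⟩, ?_⟩⟩ _).symm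
  funext x ⟨e, he⟩
  subst he
  rfl

/-- The tensor `Φ'` arises from `Φ` by the linear changes `L` and `Lb` of the unbarred and of the
barred indices. -/
def LinChange (L Lb : ι → ι → K) (Φ Φ' : Multiset ι → Multiset ι → K) : Prop :=
  ∀ (S T : Type) [Fintype S] [Fintype T] [DecidableEq S] [DecidableEq T] (a : S → ι) (b : T → ι),
    Φ' (univ.val.map a) (univ.val.map b) = ∑ c : S → ι, ∑ d : T → ι,
      (∏ e, L (a e) (c e)) * (∏ e, Lb (b e) (d e)) * Φ (univ.val.map c) (univ.val.map d)

theorem contraction_linChange {E : Type} [Fintype E] [DecidableEq E] {L Lb M M' : ι → ι → K}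
    (hM : ∀ c d, ∑ i, ∑ j, L i c * Lb j d * M' i j = M c d)
    {Ψ Ψ' : Option V → Multiset ι → Multiset ι → K} (h : ∀ v, LinChange L Lb (Ψ v) (Ψ' v))
    (G : DG V E) : contraction M' Ψ' G = contraction M Ψ G := by
  have h1 : ∀ a b : E → ι, ∏ v, Ψ' v (fib G.1 v a) (fib G.2 v b) = ∑ c : E → ι, ∑ d : E → ι,
      (∏ e, L (a e) (c e)) * (∏ e, Lb (b e) (d e)) *
        ∏ v, Ψ v (fib G.1 v c) (fib G.2 v d) := by
    intro a b
    simp only [fib_subtype]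
    rw [prod_congr rfl fun v _ => h v _ _ _ _]
    rw [prod_sum_fiber G.1 fun v c => ∑ d : {e // G.2 e = v} → ι,
      (∏ e : {e // G.1 e = v}, L (a e) (c e)) * (∏ e : {e // G.2 e = v}, Lb (b e) (d e)) *
        Ψ v (univ.val.map c) (univ.val.map d)]
    refine sum_congr rfl fun c _ => ?_
    rw [prod_sum_fiber G.2 fun v d => (∏ e : {e // G.1 e = v}, L (a e) (c e)) *
      (∏ e : {e // G.2 e = v}, Lb (b e) (d e)) *
        Ψ v (univ.val.map fun e : {e // G.1 e = v} => c e) (univ.val.map d)]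
    refine sum_congr rfl fun d _ => ?_
    rw [prod_mul_distrib, prod_mul_distrib,
      Fintype.prod_fiberwise G.1 fun e => L (a e) (c e),
      Fintype.prod_fiberwise G.2 fun e => Lb (b e) (d e)]
  unfold contraction
  simp only [h1, mul_sum]
  have h2 : ∀ f : (E → ι) → (E → ι) → (E → ι) → (E → ι) → K, ∑ a, ∑ b, ∑ c, ∑ d, f a b c d =
      ∑ c, ∑ d, ∑ a, ∑ b, f a b c d := by
    intro f
    rw [sum_congr rfl fun v _ => sum_comm, sum_comm]
    refine sum_congr rfl fun a _ => ?_
    rw [sum_congr rfl fun v _ => sum_comm, sum_comm]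
  rw [h2]
  refine sum_congr rfl fun c _ => sum_congr rfl fun d _ => ?_
  have h3 : ∑ a : E → ι, ∑ b : E → ι, ∏ e, (L (a e) (c e) * Lb (b e) (d e) * M' (a e) (b e)) =
      ∏ e, M (c e) (d e) := by
    rw [prod_congr rfl fun e _ => (hM (c e) (d e)).symm, prod_univ_sum, Fintype.piFinset_univ]
    refine sum_congr rfl fun a _ => ?_
    rw [prod_univ_sum, Fintype.piFinset_univ]
  rw [← h3, sum_mul]
  refine sum_congr rfl fun a _ => ?_
  rw [sum_mul]
  refine sum_congr rfl fun b _ => ?_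
  rw [prod_mul_distrib, prod_mul_distrib]
  ring

theorem graphTotal_linChange [Algebra ℂ K] (k : ℕ) {L Lb M M' : ι → ι → K}
    (hM : ∀ c d, ∑ i, ∑ j, L i c * Lb j d * M' i j = M c d)
    {Φ Φ' F F' : Multiset ι → Multiset ι → K} (hΦ : LinChange L Lb Φ Φ')
    (hF : LinChange L Lb F F') : graphTotal k M' Φ' F' = graphTotal k M Φ F := by
  unfold graphTotal gsum
  refine sum_congr rfl fun p _ => congrArg _ (sum_congr rfl fun G _ => ?_)
  rw [contraction_linChange hM (Ψ := vfac Φ F)]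
  intro v
  cases v
  · exact hF
  · exact hΦ

end Linear

/-! ### Three-pointed graphs -/

section ThreePointed

variable {V E V' E' V₁ E₁ V₂ E₂ ι : Type*}

namespace DG

/-- An edge between ordinary vertices of a three-pointed graph. The three points are encoded in a
graph `H : DG (Option V) E` as follows: the source `none` is the third point, the target `none`
is the first one, and `some none` is the second one, as a source and as a target. -/
def TStep (H : DG (Option V) E) (u v : V) : Prop :=
  ∃ e, H.1 e = some (some u) ∧ H.2 e = some (some v)

/-- `v` is the end of a path of ordinary vertices beginning with an edge that leaves `x`. -/
def From (H : DG (Option V) E) (x : Option (Option V)) (v : V) : Prop :=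
  ∃ u, (∃ e, H.1 e = x ∧ H.2 e = some (some u)) ∧ Relation.ReflTransGen H.TStep u v

/-- `v` is the beginning of a path of ordinary vertices ending with an edge that enters `y`. -/
def To (H : DG (Option V) E) (y : Option (Option V)) (v : V) : Prop :=
  ∃ u, (∃ e, H.1 e = some (some u) ∧ H.2 e = y) ∧ Relation.ReflTransGen H.TStep v u

/-- The three-pointed graphs which contribute to a product of three functions: the second point
does not lie on a cycle, every vertex can be reached from the second or the third point, and
the first or the second point can be reached from every vertex. -/
def Good (H : DG (Option V) E) : Prop :=
  (∀ e, ¬(H.1 e = some none ∧ H.2 e = some none)) ∧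
  (∀ v, ¬(H.From (some none) v ∧ H.To (some none) v)) ∧
  (∀ v, H.From (some none) v ∨ H.From none v) ∧ ∀ v, H.To none v ∨ H.To (some none) v

theorem TStep_rev (H : DG (Option V) E) (u v : V) : H.rev.TStep u v ↔ H.TStep v u :=
  exists_congr fun _ => and_comm

theorem From_rev (H : DG (Option V) E) (x : Option (Option V)) (v : V) :
    H.rev.From x v ↔ H.To x v := by
  refine exists_congr fun u => and_congr (exists_congr fun e => and_comm) ?_
  have : H.rev.TStep = Function.swap H.TStep := by ext u v; exact TStep_rev H u v
  rw [this, Relation.reflTransGen_swap]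

theorem To_rev (H : DG (Option V) E) (x : Option (Option V)) (v : V) :
    H.rev.To x v ↔ H.From x v := (From_rev H.rev x v).symm

theorem Good_rev (H : DG (Option V) E) : H.rev.Good ↔ H.Good := by
  unfold Good
  simp only [From_rev, To_rev]
  refine and_congr (forall_congr' fun e => not_congr and_comm) (and_congr (forall_congr' fun v =>
    not_congr and_comm) ?_)
  constructor
  · exact fun h => ⟨fun v => (h.2 v).symm, fun v => (h.1 v).symm⟩
  · exact fun h => ⟨fun v => (h.2 v).symm, fun v => (h.1 v).symm⟩

theorem From.of_relabel {σ : V ≃ V'} {τ : E ≃ E'} {H : DG (Option V) E} {x : Option (Option V)}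
    {v : V} (h : H.From x v) : (relabel σ.optionCongr τ H).From (x.map σ.optionCongr) (σ v) := by
  obtain ⟨u, ⟨e, h1, h2⟩, h3⟩ := h
  refine ⟨σ u, ⟨τ e, by simp [h1], by simp [h2]⟩, reflTransGen_lift σ ?_ h3⟩
  rintro a b ⟨e, h1, h2⟩
  exact ⟨τ e, by simp [h1], by simp [h2]⟩

theorem map_optionCongr_symm (σ : V ≃ V') (x : Option (Option V)) :
    (x.map σ.optionCongr).map σ.symm.optionCongr = x := by
  rcases x with _ | _ | x
  · rfl
  · rfl
  · exact congrArg (fun y => some (some y)) (σ.symm_apply_apply x)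

theorem relabel_symm_relabel (σ : V ≃ V') (τ : E ≃ E') (H : DG (Option V) E) :
    relabel σ.symm.optionCongr τ.symm (relabel σ.optionCongr τ H) = H := by
  refine Prod.ext (funext fun e => ?_) (funext fun e => ?_) <;>
  · obtain ⟨e, rfl⟩ := τ.symm.surjective e
    first
    | rw [relabel_fst]
    | rw [relabel_snd]
    obtain ⟨e, rfl⟩ := τ.surjective e
    simp only [relabel_fst, relabel_snd, map_optionCongr_symm, Equiv.symm_apply_apply]

theorem From_relabel (σ : V ≃ V') (τ : E ≃ E') (H : DG (Option V) E) (x : Option (Option V))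
    (v : V) : (relabel σ.optionCongr τ H).From (x.map σ.optionCongr) (σ v) ↔ H.From x v := by
  refine ⟨fun h => ?_, From.of_relabel⟩
  have := h.of_relabel (σ := σ.symm) (τ := τ.symm)
  rwa [relabel_symm_relabel, σ.symm_apply_apply, map_optionCongr_symm] at this

theorem To_relabel (σ : V ≃ V') (τ : E ≃ E') (H : DG (Option V) E) (x : Option (Option V))
    (v : V) : (relabel σ.optionCongr τ H).To (x.map σ.optionCongr) (σ v) ↔ H.To x v := by
  rw [← From_rev, ← From_rev, ← From_relabel σ τ]
  rfl

theorem Good_relabel (σ : V ≃ V') (τ : E ≃ E') (H : DG (Option V) E) :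
    (relabel σ.optionCongr τ H).Good ↔ H.Good := by
  unfold Good
  have h1 := fun v => From_relabel σ τ H none v
  have h2 := fun v => From_relabel σ τ H (some none) v
  have h3 := fun v => To_relabel σ τ H none v
  have h4 := fun v => To_relabel σ τ H (some none) v
  simp only [Option.map_none, Option.map_some, Equiv.optionCongr_apply] at h1 h2 h3 h4
  simp only [← σ.forall_congr_right (q := fun v => ¬((relabel _ τ H).From (some none) v ∧ _)),
    ← σ.forall_congr_right (q := fun v => (relabel _ τ H).From (some none) v ∨ _),
    ← σ.forall_congr_right (q := fun v => (relabel _ τ H).To none v ∨ _), ← τ.forall_congr_right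
    (q := fun e => ¬((relabel _ τ H).1 e = some none ∧ _)), h1, h2, h3, h4, relabel_fst,
    relabel_snd]
  have h5 : ∀ x : Option (Option V), x.map σ.optionCongr = some none ↔ x = some none := by
    rintro (_ | _ | x) <;> simp
  simp only [h5]

/-- The three-pointed graph composed of a pointed graph `G`, whose distinguished vertex is split
into the first point (for the incoming edges) and the second point (for the outgoing edges),
and of a pointed graph with source map `s`, of whose edges those which enter the
distinguished vertex are made to end at the two points or at the vertices of `G`. -/
def glue (G : DG V₁ E₁) (s : E₂ → Option V₂) (h : E₂ → V₂ ⊕ Option (Option V₁)) :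
    DG (Option (V₁ ⊕ V₂)) (E₁ ⊕ E₂) :=
  (Sum.elim (fun e => some ((G.1 e).map Sum.inl)) fun e => (s e).map fun v => some (Sum.inr v),
    Sum.elim (fun e => (G.2 e).map fun v => some (Sum.inl v)) fun e =>
      Sum.elim (fun v => some (some (Sum.inr v))) (Option.map (Option.map Sum.inl)) (h e))

/-- The target map of a graph of which the edges entering the distinguished vertex are decorated.
-/
def collapse {W : Type*} (h : E → V ⊕ W) (e : E) : Option V := Sum.elim some (fun _ => none) (h e)

section glue

variable {G : DG V₁ E₁} {s : E₂ → Option V₂} {h : E₂ → V₂ ⊕ Option (Option V₁)}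

theorem glue_TStep_inl {u : V₁} {y : V₁ ⊕ V₂} :
    (glue G s h).TStep (Sum.inl u) y ↔ ∃ v, y = Sum.inl v ∧ G.Step u v := by
  constructor
  · rintro ⟨e | e, h1, h2⟩
    · simp only [glue, Sum.elim_inl, Option.some.injEq, Option.map_eq_some_iff,
        Sum.inl.injEq, exists_eq_right] at h1 h2
      obtain ⟨v, hv, rfl⟩ := h2
      exact ⟨v, rfl, e, h1, hv⟩
    · simp [glue] at h1
  · rintro ⟨v, rfl, e, h1, h2⟩
    exact ⟨Sum.inl e, by simp [glue, h1], by simp [glue, h2]⟩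

theorem glue_TStep_inr {x : V₁ ⊕ V₂} {v : V₂} :
    (glue G s h).TStep x (Sum.inr v) ↔ ∃ u, x = Sum.inr u ∧ Step (s, collapse h) u v := by
  constructor
  · rintro ⟨e | e, h1, h2⟩
    · simp [glue] at h2
    · simp only [glue, Sum.elim_inr, Option.map_eq_some_iff, Option.some.injEq] at h1
      obtain ⟨u, hu, rfl⟩ := h1
      refine ⟨u, rfl, e, hu, ?_⟩
      simp only [glue, Sum.elim_inr] at h2
      rcases hh : h e with w | _ | _ | w <;> simp_all [collapse]
  · rintro ⟨u, rfl, e, h1, h2⟩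
    refine ⟨Sum.inr e, by simpa [glue] using h1, ?_⟩
    rcases hh : h e with w | w <;> simp_all [collapse, glue]

theorem glue_rtg_inl {u : V₁} {y : V₁ ⊕ V₂} :
    Relation.ReflTransGen (glue G s h).TStep (Sum.inl u) y ↔
      ∃ v, y = Sum.inl v ∧ Relation.ReflTransGen G.Step u v := by
  constructor
  · intro hy
    induction hy with
    | refl => exact ⟨u, rfl, .refl⟩
    | tail _ hyz ih =>
      obtain ⟨v, rfl, hv⟩ := ih
      obtain ⟨w, rfl, hw⟩ := glue_TStep_inl.1 hyz
      exact ⟨w, rfl, hv.tail hw⟩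
  · rintro ⟨v, rfl, hv⟩
    exact reflTransGen_lift Sum.inl (fun a b hab => glue_TStep_inl.2 ⟨b, rfl, hab⟩) hv

theorem glue_rtg_inr {x : V₁ ⊕ V₂} {v : V₂} :
    Relation.ReflTransGen (glue G s h).TStep x (Sum.inr v) ↔
      ∃ u, x = Sum.inr u ∧ Relation.ReflTransGen (Step (s, collapse h)) u v := by
  constructor
  · intro hx
    induction hx using Relation.ReflTransGen.head_induction_on with
    | refl => exact ⟨v, rfl, .refl⟩
    | head hyz _ ih =>
      obtain ⟨v, rfl, hv⟩ := ih
      obtain ⟨w, rfl, hw⟩ := glue_TStep_inr.1 hyz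
      exact ⟨w, rfl, hv.head hw⟩
  · rintro ⟨u, rfl, hu⟩
    exact reflTransGen_lift Sum.inr (fun a b hab => glue_TStep_inr.2 ⟨a, rfl, hab⟩) hu

theorem glue_From_second {y : V₁ ⊕ V₂} : (glue G s h).From (some none) y ↔
    ∃ v, y = Sum.inl v ∧
      ∃ u, (∃ e, G.1 e = none ∧ G.2 e = some u) ∧ Relation.ReflTransGen G.Step u v := by
  constructor
  · rintro ⟨u, ⟨e | e, h1, h2⟩, h3⟩
    · simp only [glue, Sum.elim_inl, Option.some.injEq, Option.map_eq_none_iff,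
        Option.map_eq_some_iff] at h1 h2
      obtain ⟨u, hu, rfl⟩ := h2
      obtain ⟨v, rfl, hv⟩ := glue_rtg_inl.1 h3
      exact ⟨v, rfl, u, ⟨e, h1, hu⟩, hv⟩
    · simp [glue] at h1
  · rintro ⟨v, rfl, u, ⟨e, h1, h2⟩, h3⟩
    exact ⟨Sum.inl u, ⟨Sum.inl e, by simp [glue, h1], by simp [glue, h2]⟩,
      glue_rtg_inl.2 ⟨v, rfl, h3⟩⟩

theorem glue_From_third {v : V₂} : (glue G s h).From none (Sum.inr v) ↔
    ∃ u, (∃ e, s e = none ∧ collapse h e = some u) ∧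
      Relation.ReflTransGen (Step (s, collapse h)) u v := by
  constructor
  · rintro ⟨u, ⟨e, h1, h2⟩, h3⟩
    obtain ⟨u, rfl, hu⟩ := glue_rtg_inr.1 h3
    rcases e with e | e
    · simp [glue] at h1
    · refine ⟨u, ⟨e, by simpa [glue] using h1, ?_⟩, hu⟩
      simp only [glue, Sum.elim_inr] at h2
      rcases hh : h e with w | _ | _ | w <;> simp_all [collapse]
  · rintro ⟨u, ⟨e, h1, h2⟩, h3⟩
    refine ⟨Sum.inr u, ⟨Sum.inr e, by simp [glue, h1], ?_⟩, glue_rtg_inr.2 ⟨u, rfl, h3⟩⟩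
    rcases hh : h e with w | w <;> simp_all [collapse, glue]

theorem glue_To_first_inl {v : V₁} : (glue G s h).To none (Sum.inl v) ↔
    ∃ u, (∃ e, G.1 e = some u ∧ G.2 e = none) ∧ Relation.ReflTransGen G.Step v u := by
  constructor
  · rintro ⟨u, ⟨e, h1, h2⟩, h3⟩
    obtain ⟨u, rfl, hu⟩ := glue_rtg_inl.1 h3
    rcases e with e | e
    · exact ⟨u, ⟨e, by simpa [glue] using h1, by simpa [glue] using h2⟩, hu⟩
    · simp [glue] at h1
  · rintro ⟨u, ⟨e, h1, h2⟩, h3⟩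
    exact ⟨Sum.inl u, ⟨Sum.inl e, by simp [glue, h1], by simp [glue, h2]⟩,
      glue_rtg_inl.2 ⟨u, rfl, h3⟩⟩

theorem not_glue_To_second_inl {v : V₁} : ¬(glue G s h).To (some none) (Sum.inl v) := by
  rintro ⟨u, ⟨e, h1, h2⟩, h3⟩
  obtain ⟨u, rfl, hu⟩ := glue_rtg_inl.1 h3
  rcases e with e | e
  · simp [glue] at h2
  · simp [glue] at h1

theorem glue_To_inr (hG : ∀ v, ∃ u, (∃ e, G.1 e = some u ∧ G.2 e = none) ∧
      Relation.ReflTransGen G.Step v u) {v : V₂} :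
    (glue G s h).To none (Sum.inr v) ∨ (glue G s h).To (some none) (Sum.inr v) ↔
    ∃ u, (∃ e, s e = some u ∧ collapse h e = none) ∧
      Relation.ReflTransGen (Step (s, collapse h)) v u := by
  constructor
  · have key : ∀ x y, Relation.ReflTransGen (glue G s h).TStep x y → ∀ v : V₂, x = Sum.inr v →
        (∃ e, (glue G s h).1 e = some (some y) ∧
          ((glue G s h).2 e = none ∨ (glue G s h).2 e = some none)) →
        ∃ u, (∃ e, s e = some u ∧ collapse h e = none) ∧
          Relation.ReflTransGen (Step (s, collapse h)) v u := by
      intro x y hxy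
      induction hxy using Relation.ReflTransGen.head_induction_on with
      | refl =>
        rintro v rfl ⟨e | e, h1, h2⟩
        · simp [glue] at h1
        · refine ⟨v, ⟨e, by simpa [glue] using h1, ?_⟩, .refl⟩
          simp only [glue, Sum.elim_inr] at h2
          rcases hh : h e with w | w <;> simp_all [collapse]
      | @head x z hxz _ ih =>
        rintro v rfl hy
        rcases z with z | z
        · obtain ⟨e | e, h1, h2⟩ := hxz
          · simp [glue] at h1
          · refine ⟨v, ⟨e, by simpa [glue] using h1, ?_⟩, .refl⟩
            simp only [glue, Sum.elim_inr] at h2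
            rcases hh : h e with w | w <;> simp_all [collapse]
        · obtain ⟨u, hu, hzu⟩ := ih z rfl hy
          obtain ⟨v', hv', hs⟩ := glue_TStep_inr.1 hxz
          cases hv'
          exact ⟨u, hu, hzu.head hs⟩
    rintro (⟨u, ⟨e, h1, h2⟩, h3⟩ | ⟨u, ⟨e, h1, h2⟩, h3⟩)
    · exact key _ _ h3 v rfl ⟨e, h1, Or.inl h2⟩
    · exact key _ _ h3 v rfl ⟨e, h1, Or.inr h2⟩
  · rintro ⟨u, ⟨e, h1, h2⟩, h3⟩
    have h4 := (glue_rtg_inr (G := G) (x := Sum.inr v)).2 ⟨v, rfl, h3⟩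
    have h5 : (glue G s h).1 (Sum.inr e) = some (some (Sum.inr u)) := by simp [glue, h1]
    rcases hh : h e with w | _ | _ | w
    · simp [collapse, hh] at h2
    · exact Or.inl ⟨_, ⟨Sum.inr e, h5, by simp [glue, hh]⟩, h4⟩
    · exact Or.inr ⟨_, ⟨Sum.inr e, h5, by simp [glue, hh]⟩, h4⟩
    · obtain ⟨x, ⟨e', h6, h7⟩, h8⟩ := hG w
      have h9 : (glue G s h).TStep (Sum.inr u) (Sum.inl w) :=
        ⟨Sum.inr e, h5, by simp [glue, hh]⟩
      exact Or.inl ⟨Sum.inl x, ⟨Sum.inl e', by simp [glue, h6], by simp [glue, h7]⟩,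
        (h4.tail h9).trans (glue_rtg_inl.2 ⟨x, rfl, h8⟩)⟩

/-- A composition of two graphs is good, and the vertices of the first graph are those which can be
reached from the second point, if and only if both graphs are strongly connected. -/
theorem glue_good : ((glue G s h).Good ∧ ∀ v, (glue G s h).From (some none) v ↔ v.isLeft) ↔
    G.SC ∧ SC (s, collapse h) := by
  rw [SC_iff, SC_iff]
  have hD : (∀ v, (glue G s h).From (some none) v ↔ v.isLeft) ↔
      ∀ v, ∃ u, (∃ e, G.1 e = none ∧ G.2 e = some u) ∧ Relation.ReflTransGen G.Step u v := by
    simp [glue_From_second]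
  rw [hD]
  constructor
  · rintro ⟨⟨-, -, h3, h4⟩, h5⟩
    have h6 : ∀ v, ∃ u, (∃ e, G.1 e = some u ∧ G.2 e = none) ∧
        Relation.ReflTransGen G.Step v u := fun v =>
      glue_To_first_inl.1 ((h4 (Sum.inl v)).resolve_right not_glue_To_second_inl)
    refine ⟨⟨h5, h6⟩, fun v => glue_From_third.1 ((h3 (Sum.inr v)).resolve_left ?_),
      fun v => (glue_To_inr h6).1 (h4 (Sum.inr v))⟩
    rw [glue_From_second]
    rintro ⟨_, h, -⟩
    cases h
  · rintro ⟨⟨h5, h6⟩, h7, h8⟩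
    refine ⟨⟨?_, ?_, ?_, ?_⟩, h5⟩
    · rintro (e | e) ⟨h1, h2⟩
      · simp [glue] at h2
      · simp [glue] at h1
    · rintro v ⟨h1, h2⟩
      obtain ⟨v, rfl, -⟩ := glue_From_second.1 h1
      exact not_glue_To_second_inl h2
    · rintro (v | v)
      · exact Or.inl (hD.2 h5 _ |>.2 rfl)
      · exact Or.inr (glue_From_third.2 (h7 v))
    · rintro (v | v)
      · exact Or.inl (glue_To_first_inl.2 (h6 v))
      · exact (glue_To_inr h6).2 (h8 v)

end glue

end DG
end ThreePointed

/-! ### Signs and contractions of compositions of graphs -/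

section ThreePointedSums

variable {V E V' E' V₁ E₁ V₂ E₂ ι : Type*} {K : Type*} [CommRing K] [Fintype ι]
  [Fintype V] [DecidableEq V] [Fintype E] [DecidableEq E]
  [Fintype V'] [DecidableEq V'] [Fintype E'] [DecidableEq E']
  [Fintype V₁] [DecidableEq V₁] [Fintype E₁] [DecidableEq E₁]
  [Fintype V₂] [DecidableEq V₂] [Fintype E₂] [DecidableEq E₂]

/-- The adjacency matrix of the ordinary vertices of a three-pointed graph. -/
def tadj (H : DG (Option V) E) : Matrix V V ℤ := fun i j =>
  ((univ.filter fun e => H.1 e = some (some i) ∧ H.2 e = some (some j)).card : ℤ)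

/-- The integer `det (A - I)` for the adjacency matrix `A` of the ordinary vertices of a
three-pointed graph. -/
def tsgn (H : DG (Option V) E) : ℤ := (tadj H - 1).det

/-- The contraction of the tensors `Φ` at the ordinary vertices and `f₁`, `f₂`, `f₃` at the three
points along the edges of a three-pointed graph. -/
def tcontraction (Φ : Multiset ι → Multiset ι → K) (f₁ : Multiset ι → K)
    (f₂ : Multiset ι → Multiset ι → K) (f₃ : Multiset ι → K) (H : DG (Option V) E) : K :=
  ∑ a : E → ι, f₁ (fib H.2 none a) * f₂ (fib H.1 (some none) a) (fib H.2 (some none) a) *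
    f₃ (fib H.1 none a) * ∏ v : V, Φ (fib H.1 (some (some v)) a) (fib H.2 (some (some v)) a)

theorem tsgn_rev (H : DG (Option V) E) : tsgn H.rev = tsgn H := by
  have : tadj H.rev - 1 = (tadj H - 1).transpose := by
    ext i j
    simp only [Matrix.sub_apply, Matrix.transpose_apply, tadj, DG.rev, Matrix.one_apply,
      eq_comm (a := i), and_comm]
  rw [tsgn, this, Matrix.det_transpose, tsgn]

theorem tcontraction_rev (Φ : Multiset ι → Multiset ι → K) (f₁ : Multiset ι → K)
    (f₂ : Multiset ι → Multiset ι → K) (f₃ : Multiset ι → K) (H : DG (Option V) E) :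
    tcontraction (fun I J => Φ J I) f₃ (fun I J => f₂ J I) f₁ H.rev =
      tcontraction Φ f₁ f₂ f₃ H := by
  unfold tcontraction
  refine sum_congr rfl fun a _ => ?_
  simp only [DG.rev]
  ring

theorem tsgn_relabel (σ : V ≃ V') (τ : E ≃ E') (H : DG (Option V) E) :
    tsgn (DG.relabel σ.optionCongr τ H) = tsgn H := by
  have : tadj (DG.relabel σ.optionCongr τ H) - 1 = Matrix.reindex σ σ (tadj H - 1) := by
    ext i j
    obtain ⟨i, rfl⟩ := σ.surjective i
    obtain ⟨j, rfl⟩ := σ.surjective j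
    simp only [Matrix.sub_apply, Matrix.reindex_apply, Matrix.submatrix_apply,
      Equiv.symm_apply_apply, Matrix.one_apply, σ.injective.eq_iff, tadj]
    congr 2
    refine (Finset.card_equiv τ fun e => ?_).symm
    have : ∀ (x : Option (Option V)) i, x.map σ.optionCongr = some (some (σ i)) ↔
        x = some (some i) := by
      rintro (_ | _ | x) i <;> simp
    simp only [mem_filter, mem_univ, true_and, DG.relabel_fst, DG.relabel_snd, this]
  rw [tsgn, this, Matrix.det_reindex_self, tsgn]

theorem tcontraction_relabel (Φ : Multiset ι → Multiset ι → K) (f₁ : Multiset ι → K)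
    (f₂ : Multiset ι → Multiset ι → K) (f₃ : Multiset ι → K) (σ : V ≃ V') (τ : E ≃ E')
    (H : DG (Option V) E) : tcontraction Φ f₁ f₂ f₃ (DG.relabel σ.optionCongr τ H) =
      tcontraction Φ f₁ f₂ f₃ H := by
  unfold tcontraction
  rw [← sum_relabel τ]
  refine sum_congr rfl fun a _ => ?_
  have h1 := fun x => fib_relabel σ.optionCongr τ H.1 x a
  have h2 := fun x => fib_relabel σ.optionCongr τ H.2 x a
  change ∀ x, fib (DG.relabel σ.optionCongr τ H).1 _ _ = _ at h1
  change ∀ x, fib (DG.relabel σ.optionCongr τ H).2 _ _ = _ at h2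
  rw [← σ.prod_comp]
  have h3 := h1 none
  have h4 := h1 (some none)
  have h5 := h2 none
  have h6 := h2 (some none)
  simp only [Option.map_none, Option.map_some, Equiv.optionCongr_apply] at h3 h4 h5 h6
  rw [h3, h4, h5, h6]
  congr 1
  refine prod_congr rfl fun v _ => ?_
  have h7 := h1 (some (some v))
  have h8 := h2 (some (some v))
  simp only [Option.map_none, Option.map_some, Equiv.optionCongr_apply] at h7 h8
  rw [h7, h8]

/-- No edge leads from the vertices of the first graph to those of the second one, so that the
matrix is block triangular. -/
theorem tsgn_glue (G : DG V₁ E₁) (s : E₂ → Option V₂) (h : E₂ → V₂ ⊕ Option (Option V₁)) :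
    tsgn (DG.glue G s h) = G.sgn * DG.sgn (s, DG.collapse h) := by
  have hcard : ∀ (P : E₁ ⊕ E₂ → Prop) [DecidablePred P], (univ.filter P).card =
      (univ.filter fun e => P (Sum.inl e)).card + (univ.filter fun e => P (Sum.inr e)).card := by
    intro P _
    simp only [Finset.card_filter, Fintype.sum_sum_type]
  let c : Matrix V₂ V₁ ℤ := fun i j =>
    ((univ.filter fun e => s e = some i ∧ h e = Sum.inr (some (some j))).card : ℤ)
  have h1 : tadj (DG.glue G s h) - 1 = Matrix.fromBlocks (G.adjM - 1) 0 c
        (DG.adjM (s, DG.collapse h) - 1) := by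
    ext i j
    rcases i with i | i <;> rcases j with j | j <;>
      simp only [Matrix.fromBlocks_apply₁₁, Matrix.fromBlocks_apply₁₂, Matrix.fromBlocks_apply₂₁,
        Matrix.fromBlocks_apply₂₂, Matrix.sub_apply, DG.adjM, hcard, Matrix.one_apply, tadj]
    · simp [DG.glue]
    · simp [DG.glue]
    · simp only [DG.glue, Sum.elim_inl, Sum.elim_inr]
      have : ∀ e, Sum.elim (fun v => some (some (Sum.inr v)))
          (Option.map (Option.map (Sum.inl : V₁ → V₁ ⊕ V₂))) (h e) =
          some (some (Sum.inl j)) ↔ h e = Sum.inr (some (some j)) := by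
        intro e
        rcases h e with w | _ | _ | w <;> simp
      simp [this, c]
    · simp only [DG.glue, Sum.elim_inl, Sum.elim_inr]
      have : ∀ e, Sum.elim (fun v => some (some (Sum.inr v)))
          (Option.map (Option.map (Sum.inl : V₁ → V₁ ⊕ V₂))) (h e) =
          some (some (Sum.inr j)) ↔ DG.collapse h e = some j := by
        intro e
        unfold DG.collapse
        rcases h e with w | _ | _ | w <;> simp
      simp [this]
  rw [tsgn, h1, Matrix.det_fromBlocks_zero₁₂, DG.sgn, DG.sgn]

theorem tcontraction_glue (Φ : Multiset ι → Multiset ι → K) (f₁ : Multiset ι → K)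
    (f₂ : Multiset ι → Multiset ι → K) (f₃ : Multiset ι → K) (G : DG V₁ E₁) (s : E₂ → Option V₂)
    (h : E₂ → V₂ ⊕ Option (Option V₁)) :
    tcontraction Φ f₁ f₂ f₃ (DG.glue G s h) = ∑ a : E₂ → ι, (f₃ (fib s none a) *
      ∏ v : V₂, Φ (fib s (some v) a) (fib (DG.collapse h) (some v) a)) *
      ∑ b : E₁ → ι, f₁ (fib G.2 none b + fib h (Sum.inr none) a) *
        f₂ (fib G.1 none b) (fib h (Sum.inr (some none)) a) *
        ∏ v : V₁, Φ (fib G.1 (some v) b)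
          (fib G.2 (some v) b + fib h (Sum.inr (some (some v))) a) := by
  unfold tcontraction
  rw [← (Equiv.sumArrowEquivProdArrow E₁ E₂ ι).symm.sum_comp, Fintype.sum_prod_type, sum_comm]
  refine sum_congr rfl fun a _ => ?_
  rw [mul_sum]
  refine sum_congr rfl fun b _ => ?_
  have e1 : (Equiv.sumArrowEquivProdArrow E₁ E₂ ι).symm (b, a) ∘ Sum.inl = b := rfl
  have e2 : (Equiv.sumArrowEquivProdArrow E₁ E₂ ι).symm (b, a) ∘ Sum.inr = a := rfl
  simp only [fib_sum, e1, e2, Fintype.prod_sum_type]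
  have i1 : fib ((DG.glue G s h).2 ∘ Sum.inl) none b = fib G.2 none b :=
    fib_congr (fun e => by simp [DG.glue]) _
  have i2 : fib ((DG.glue G s h).2 ∘ Sum.inr) none a = fib h (Sum.inr none) a :=
    fib_congr (fun e => by
      simp only [DG.glue, Function.comp, Sum.elim_inr]
      rcases h e with w | _ | _ | w <;> simp) _
  have i3 : fib ((DG.glue G s h).1 ∘ Sum.inl) (some none) b = fib G.1 none b :=
    fib_congr (fun e => by simp [DG.glue]) _
  have i4 : fib ((DG.glue G s h).1 ∘ Sum.inr) (some none) a = 0 :=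
    fib_eq_zero (fun e => by simp [DG.glue]) _
  have i5 : fib ((DG.glue G s h).2 ∘ Sum.inl) (some none) b = 0 :=
    fib_eq_zero (fun e => by simp [DG.glue]) _
  have i6 : fib ((DG.glue G s h).2 ∘ Sum.inr) (some none) a = fib h (Sum.inr (some none)) a :=
    fib_congr (fun e => by
      simp only [DG.glue, Function.comp, Sum.elim_inr]
      rcases h e with w | _ | _ | w <;> simp) _
  have i7 : fib ((DG.glue G s h).1 ∘ Sum.inl) none b = 0 :=
    fib_eq_zero (fun e => by simp [DG.glue]) _
  have i8 : fib ((DG.glue G s h).1 ∘ Sum.inr) none a = fib s none a :=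
    fib_congr (fun e => by simp [DG.glue]) _
  have j1 : ∀ v, fib ((DG.glue G s h).1 ∘ Sum.inl) (some (some (Sum.inl v))) b =
      fib G.1 (some v) b := fun v => fib_congr (fun e => by simp [DG.glue]) _
  have j2 : ∀ v, fib ((DG.glue G s h).1 ∘ Sum.inr) (some (some (Sum.inl v))) a = 0 :=
    fun v => fib_eq_zero (fun e => by simp [DG.glue]) _
  have j3 : ∀ v, fib ((DG.glue G s h).2 ∘ Sum.inl) (some (some (Sum.inl v))) b =
      fib G.2 (some v) b := fun v => fib_congr (fun e => by simp [DG.glue]) _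
  have j4 : ∀ v, fib ((DG.glue G s h).2 ∘ Sum.inr) (some (some (Sum.inl v))) a =
      fib h (Sum.inr (some (some v))) a := fun v =>
    fib_congr (fun e => by
      simp only [DG.glue, Function.comp, Sum.elim_inr]
      rcases h e with w | _ | _ | w <;> simp) _
  have k1 : ∀ v, fib ((DG.glue G s h).1 ∘ Sum.inl) (some (some (Sum.inr v))) b = 0 :=
    fun v => fib_eq_zero (fun e => by simp [DG.glue]) _
  have k2 : ∀ v, fib ((DG.glue G s h).1 ∘ Sum.inr) (some (some (Sum.inr v))) a =
      fib s (some v) a := fun v => fib_congr (fun e => by simp [DG.glue]) _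
  have k3 : ∀ v, fib ((DG.glue G s h).2 ∘ Sum.inl) (some (some (Sum.inr v))) b = 0 :=
    fun v => fib_eq_zero (fun e => by simp [DG.glue]) _
  have k4 : ∀ v, fib ((DG.glue G s h).2 ∘ Sum.inr) (some (some (Sum.inr v))) a =
      fib (DG.collapse h) (some v) a := fun v =>
    fib_congr (fun e => by
      simp only [DG.glue, Function.comp, Sum.elim_inr, DG.collapse]
      rcases h e with w | _ | _ | w <;> simp) _
  simp only [i1, i2, i3, i4, i5, i6, i7, i8, j1, j2, j3, j4, k1, k2, k3, k4, add_zero, zero_add]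
  ring

/-- The good graph `H` has the vertices `P` and the edges `Q` as the first graph of a composition:
`P` consists of the vertices which can be reached from the second point, and `Q` of the edges which
leave these vertices or the second point. -/
def DG.IsFirst (H : DG (Option V) E) (P : V → Prop) (Q : E → Prop) : Prop :=
  H.Good ∧ (∀ v, H.From (some none) v ↔ P v) ∧
    ∀ e, (H.1 e = some none ∨ ∃ v, P v ∧ H.1 e = some (some v)) ↔ Q e

theorem DG.isFirst_glue (G : DG V₁ E₁) (s : E₂ → Option V₂)
    (h : E₂ → V₂ ⊕ Option (Option V₁)) :
    (glue G s h).IsFirst (fun v => v.isLeft) (fun e => e.isLeft) ↔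
      G.SC ∧ SC (s, collapse h) := by
  rw [← glue_good, IsFirst, ← and_assoc, and_iff_left]
  rintro (e | e)
  · simp only [glue, Sum.elim_inl, Sum.isLeft_inl, iff_true]
    rcases G.1 e with _ | v <;> simp
  · simp only [glue, Sum.elim_inr, Sum.isLeft_inr, Bool.false_eq_true, iff_false]
    rcases s e with _ | v <;> simp

/-- A good graph is the composition of the graph made up of the vertices which can be reached from
the second point and of the graph in which these vertices and the three points are collapsed to the
distinguished vertex. -/
theorem DG.exists_glue {H : DG (Option (V₁ ⊕ V₂)) (E₁ ⊕ E₂)}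
    (hH : H.IsFirst (fun v => v.isLeft) (fun e => e.isLeft)) :
    ∃ (G : DG V₁ E₁) (s : E₂ → Option V₂) (h : E₂ → V₂ ⊕ Option (Option V₁)),
      glue G s h = H := by
  obtain ⟨⟨h1, h2, -, -⟩, h3, h4⟩ := hH
  have s1 : ∀ e : E₁, ∃ x : Option V₁, some (x.map Sum.inl) = H.1 (Sum.inl e) := by
    intro e
    rcases (h4 (Sum.inl e)).2 rfl with h | ⟨v | v, hv, h⟩
    · exact ⟨none, h.symm⟩
    · exact ⟨some v, h.symm⟩
    · simp at hv
  have s2 : ∀ e : E₂, ∃ x : Option V₂, x.map (fun v => some (Sum.inr v)) = H.1 (Sum.inr e) := by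
    intro e
    have := mt (h4 (Sum.inr e)).1 (by simp)
    push Not at this
    rcases he : H.1 (Sum.inr e) with _ | _ | v | v
    · exact ⟨none, rfl⟩
    · exact absurd he this.1
    · exact absurd he (this.2 (Sum.inl v) rfl)
    · exact ⟨some v, rfl⟩
  -- An edge of the first graph cannot end at the second point, nor at a vertex outside the first
  -- graph.
  have t1 : ∀ e : E₁, ∃ x : Option V₁, x.map (fun v => some (Sum.inl v)) = H.2 (Sum.inl e) := by
    intro e
    rcases he : H.2 (Sum.inl e) with _ | _ | v | v
    · exact ⟨none, rfl⟩
    · exfalso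
      rcases (h4 (Sum.inl e)).2 rfl with h | ⟨v, hv, h⟩
      · exact h1 _ ⟨h, he⟩
      · exact h2 v ⟨(h3 v).2 hv, v, ⟨_, h, he⟩, .refl⟩
    · exact ⟨some v, rfl⟩
    · exfalso
      have : H.From (some none) (Sum.inr v) := by
        rcases (h4 (Sum.inl e)).2 rfl with h | ⟨u, hu, h⟩
        · exact ⟨_, ⟨_, h, he⟩, .refl⟩
        · obtain ⟨w, hw, hwu⟩ := (h3 u).2 hu
          exact ⟨w, hw, hwu.tail ⟨_, h, he⟩⟩
      simpa using (h3 _).1 this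
  have t2 : ∀ e : E₂, ∃ x : V₂ ⊕ Option (Option V₁), Sum.elim
      (fun v => some (some (Sum.inr v))) (Option.map (Option.map Sum.inl)) x =
      H.2 (Sum.inr e) := by
    intro e
    rcases H.2 (Sum.inr e) with _ | _ | v | v
    · exact ⟨Sum.inr none, rfl⟩
    · exact ⟨Sum.inr (some none), rfl⟩
    · exact ⟨Sum.inr (some (some v)), rfl⟩
    · exact ⟨Sum.inl v, rfl⟩
  choose s₁ hs₁ using s1
  choose s₂ hs₂ using s2
  choose t₁ ht₁ using t1
  choose t₂ ht₂ using t2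
  refine ⟨(s₁, t₁), s₂, t₂, Prod.ext (funext fun e => ?_) (funext fun e => ?_)⟩
  · rcases e with e | e
    · exact hs₁ e
    · exact hs₂ e
  · rcases e with e | e
    · exact ht₁ e
    · exact ht₂ e

theorem DG.glue_injective {G G' : DG V₁ E₁} {s s' : E₂ → Option V₂}
    {h h' : E₂ → V₂ ⊕ Option (Option V₁)} (hh : glue G s h = glue G' s' h') :
    (G, s, h) = (G', s', h') := by
  have h1 := fun e => congrFun (congrArg Prod.fst hh) (Sum.inl e)
  have h2 := fun e => congrFun (congrArg Prod.fst hh) (Sum.inr e)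
  have h3 := fun e => congrFun (congrArg Prod.snd hh) (Sum.inl e)
  have h4 := fun e => congrFun (congrArg Prod.snd hh) (Sum.inr e)
  simp only [glue, Sum.elim_inl, Sum.elim_inr, Option.some.injEq] at h1 h2 h3 h4
  refine Prod.ext (Prod.ext (funext fun e => ?_) (funext fun e => ?_))
    (Prod.ext (funext fun e => ?_) (funext fun e => ?_))
  · exact Option.map_injective Sum.inl_injective (h1 e)
  · exact Option.map_injective ((Option.some_injective _).comp Sum.inl_injective) (h3 e)
  · exact Option.map_injective ((Option.some_injective _).comp Sum.inr_injective) (h2 e)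
  · have := h4 e
    dsimp only
    generalize h e = x at this ⊢
    generalize h' e = y at this ⊢
    rcases x with w | _ | _ | w <;> rcases y with w' | _ | _ | w' <;> simp_all

open Classical in
theorem sum_glue {A : Type*} [AddCommMonoid A] (X : DG (Option (V₁ ⊕ V₂)) (E₁ ⊕ E₂) → A) :
    (∑ H, if H.IsFirst (fun v => v.isLeft) (fun e => e.isLeft) then X H else 0) =
      ∑ G : DG V₁ E₁, ∑ s : E₂ → Option V₂, ∑ h : E₂ → V₂ ⊕ Option (Option V₁),
        if G.SC ∧ DG.SC (s, DG.collapse h) then X (DG.glue G s h) else 0 := by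
  simp only [← DG.isFirst_glue]
  rw [← sum_congr rfl fun G _ => Fintype.sum_prod_type
      (f := fun p : (E₂ → Option V₂) × (E₂ → V₂ ⊕ Option (Option V₁)) =>
      if (DG.glue G p.1 p.2).IsFirst (fun v => v.isLeft) (fun e => e.isLeft) then
        X (DG.glue G p.1 p.2) else 0),
    ← Fintype.sum_prod_type (f := fun p : DG V₁ E₁ × (E₂ → Option V₂) ×
      (E₂ → V₂ ⊕ Option (Option V₁)) =>
      if (DG.glue p.1 p.2.1 p.2.2).IsFirst (fun v => v.isLeft) (fun e => e.isLeft) then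
        X (DG.glue p.1 p.2.1 p.2.2) else 0)]
  symm
  rw [← sum_filter, ← sum_filter]
  refine sum_nbij (fun p => DG.glue p.1 p.2.1 p.2.2) ?_ ?_ ?_ ?_
  · intro p hp
    simpa using hp
  · intro p _ p' _ hh
    exact DG.glue_injective hh
  · intro H hH
    simp only [coe_filter, mem_univ, true_and, Set.mem_ofPred_eq] at hH
    obtain ⟨G, s, h, rfl⟩ := DG.exists_glue hH
    exact ⟨(G, s, h), by simpa using hH, rfl⟩
  · intro p _
    rfl

end ThreePointedSums

/-! ### Decomposition of three-pointed graphs -/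

section TripleProduct

variable {V E V' E' V₁ E₁ V₂ E₂ ι : Type*} {K : Type*} [CommRing K] [Fintype ι]
  [Fintype V] [DecidableEq V] [Fintype E] [DecidableEq E]
  [Fintype V'] [DecidableEq V'] [Fintype E'] [DecidableEq E']
  [Fintype V₁] [DecidableEq V₁] [Fintype E₁] [DecidableEq E₁]
  [Fintype V₂] [DecidableEq V₂] [Fintype E₂] [DecidableEq E₂]

theorem DG.isFirst_relabel (σ : V ≃ V') (τ : E ≃ E') (H : DG (Option V) E) (P : V' → Prop)
    (Q : E' → Prop) : (relabel σ.optionCongr τ H).IsFirst P Q ↔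
      H.IsFirst (fun v => P (σ v)) (fun e => Q (τ e)) := by
  unfold IsFirst
  have h1 := fun v => From_relabel σ τ H (some none) v
  simp only [Option.map_none, Option.map_some, Equiv.optionCongr_apply] at h1
  refine and_congr (Good_relabel σ τ H) (and_congr ?_ ?_)
  · rw [← σ.forall_congr_right]
    exact forall_congr' fun v => by rw [h1]
  · rw [← τ.forall_congr_right]
    refine forall_congr' fun e => iff_congr (or_congr ?_ ?_) Iff.rfl
    · rw [relabel_fst]
      rcases H.1 e with _ | _ | x <;> simp
    · rw [← σ.exists_congr_right]
      refine exists_congr fun v => and_congr Iff.rfl ?_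
      rw [relabel_fst]
      rcases H.1 e with _ | _ | x <;> simp

open Classical in
variable (V E) in
/-- The sum of the contractions of all good three-pointed graphs, with the weights `det (A - I)`. -/
noncomputable def tsum (Φ : Multiset ι → Multiset ι → K) (f₁ : Multiset ι → K)
    (f₂ : Multiset ι → Multiset ι → K) (f₃ : Multiset ι → K) : K :=
  ∑ H : DG (Option V) E, if H.Good then (tsgn H : K) * tcontraction Φ f₁ f₂ f₃ H else 0

open Classical in
variable (V₁ E₁ V₂ E₂) in
/-- The sum of the contractions of all compositions of two strongly connected graphs, with the
weights `det (A - I)` of the compositions. -/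
noncomputable def glueSum (Φ : Multiset ι → Multiset ι → K) (f₁ : Multiset ι → K)
    (f₂ : Multiset ι → Multiset ι → K) (f₃ : Multiset ι → K) : K :=
  ∑ G : DG V₁ E₁, ∑ s : E₂ → Option V₂, ∑ h : E₂ → V₂ ⊕ Option (Option V₁),
    if G.SC ∧ DG.SC (s, DG.collapse h) then
      (tsgn (DG.glue G s h) : K) * tcontraction Φ f₁ f₂ f₃ (DG.glue G s h) else 0

variable (Φ : Multiset ι → Multiset ι → K) (f₁ : Multiset ι → K)
  (f₂ : Multiset ι → Multiset ι → K) (f₃ : Multiset ι → K)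

/-- Reversing all edges exchanges the first and the third point, and preserves the class of good
graphs. -/
theorem tsum_rev : tsum V E (fun I J => Φ J I) f₃ (fun I J => f₂ J I) f₁ =
    tsum V E Φ f₁ f₂ f₃ := by
  classical
  unfold tsum
  refine (Fintype.sum_equiv (Equiv.prodComm _ _) _ _ fun G => ?_).symm
  change _ = if (DG.rev G).Good then (tsgn (DG.rev G) : K) * tcontraction _ _ _ _ (DG.rev G) else 0
  simp only [DG.Good_rev, tsgn_rev, tcontraction_rev]

open Classical in
theorem sum_isFirst (σ : V ≃ V₁ ⊕ V₂) (τ : E ≃ E₁ ⊕ E₂) :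
    (∑ H : DG (Option V) E, if H.IsFirst (fun v => (σ v).isLeft) (fun e => (τ e).isLeft) then
      (tsgn H : K) * tcontraction Φ f₁ f₂ f₃ H else 0) = glueSum V₁ E₁ V₂ E₂ Φ f₁ f₂ f₃ := by
  rw [glueSum, ← sum_glue fun H => (tsgn H : K) * tcontraction Φ f₁ f₂ f₃ H]
  refine Fintype.sum_equiv (DG.relabel σ.optionCongr τ) _ _ fun H => ?_
  rw [tsgn_relabel, tcontraction_relabel, DG.isFirst_relabel]

theorem exists_equiv_sum {P s : ℕ} (S : Finset (Fin P)) (hS : S.card = s) :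
    ∃ σ : Fin P ≃ Fin s ⊕ Fin (P - s), ∀ v, (σ v).isLeft ↔ v ∈ S := by
  have h1 : Fintype.card {v // v ∉ S} = P - s := by
    rw [Fintype.card_subtype_compl, Fintype.card_fin, Fintype.card_coe, hS]
  refine ⟨(Equiv.sumCompl (· ∈ S)).symm.trans
    (Equiv.sumCongr (S.equivFinOfCardEq hS) (Fintype.equivFinOfCardEq h1)), fun v => ?_⟩
  by_cases h : v ∈ S
  · simp [h]
  · simp [h]

/-- A good graph determines the vertices and edges of its first part. With `s` of the vertices and
`t` of the edges in this part, all choices of these subsets give the same sum. -/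
theorem tsum_eq_sum_glueSum (P Q : ℕ) : tsum (Fin P) (Fin Q) Φ f₁ f₂ f₃ =
    ∑ s ∈ range (P + 1), P.choose s • ∑ t ∈ range (Q + 1), Q.choose t •
      glueSum (Fin s) (Fin t) (Fin (P - s)) (Fin (Q - t)) Φ f₁ f₂ f₃ := by
  classical
  have h1 : ∀ H : DG (Option (Fin P)) (Fin Q), (if H.Good then
      (tsgn H : K) * tcontraction Φ f₁ f₂ f₃ H else 0) =
      ∑ S ∈ (univ : Finset (Fin P)).powerset, ∑ T ∈ (univ : Finset (Fin Q)).powerset,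
        if H.IsFirst (fun v => v ∈ S) (fun e => e ∈ T) then
          (tsgn H : K) * tcontraction Φ f₁ f₂ f₃ H else 0 := by
    intro H
    -- The subsets `S` and `T` are determined by `H`, so that exactly one summand is not zero.
    have h2 : ∀ S T, H.IsFirst (fun v => v ∈ S) (fun e => e ∈ T) ↔ H.Good ∧
        S = univ.filter (fun v => H.From (some none) v) ∧
        T = univ.filter (fun e => H.1 e = some none ∨
          ∃ v, H.From (some none) v ∧ H.1 e = some (some v)) := by
      intro S T
      unfold DG.IsFirst
      constructor
      · rintro ⟨h1, h2, h3⟩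
        refine ⟨h1, ?_, ?_⟩
        · ext v; simp [h2]
        · ext e; simp [h2, h3]
      · rintro ⟨h1, rfl, rfl⟩
        exact ⟨h1, fun v => by simp, fun e => by simp⟩
    simp only [h2]
    rw [sum_eq_single (univ.filter (fun v => H.From (some none) v)), sum_eq_single
      (univ.filter (fun e => H.1 e = some none ∨
          ∃ v, H.From (some none) v ∧ H.1 e = some (some v)))]
    · simp
    · intro T _ hT; simp [hT]
    · simp
    · intro S _ hS; simp [hS]
    · simp
  unfold tsum
  simp only [h1]
  rw [sum_comm]
  have h3 : ∀ S ∈ (univ : Finset (Fin P)).powerset, ∑ H : DG (Option (Fin P)) (Fin Q),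
      ∑ T ∈ (univ : Finset (Fin Q)).powerset, (if H.IsFirst (fun v => v ∈ S) (fun e => e ∈ T) then
        (tsgn H : K) * tcontraction Φ f₁ f₂ f₃ H else 0) =
      ∑ t ∈ range (Q + 1), Q.choose t •
      glueSum (Fin S.card) (Fin t) (Fin (P - S.card)) (Fin (Q - t)) Φ f₁ f₂ f₃ := by
    intro S _
    rw [sum_comm]
    obtain ⟨σ, hσ⟩ := exists_equiv_sum S rfl
    have h4 : ∀ T ∈ (univ : Finset (Fin Q)).powerset, ∑ H : DG (Option (Fin P)) (Fin Q),
        (if H.IsFirst (fun v => v ∈ S) (fun e => e ∈ T) then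
        (tsgn H : K) * tcontraction Φ f₁ f₂ f₃ H else 0) =
        glueSum (Fin S.card) (Fin T.card) (Fin (P - S.card)) (Fin (Q - T.card)) Φ f₁ f₂ f₃ := by
      intro T _
      obtain ⟨τ, hτ⟩ := exists_equiv_sum T rfl
      rw [← sum_isFirst Φ f₁ f₂ f₃ σ τ]
      simp only [hσ, hτ]
    rw [sum_congr rfl h4, sum_powerset_apply_card (fun t => glueSum (Fin S.card) (Fin t)
      (Fin (P - S.card)) (Fin (Q - t)) Φ f₁ f₂ f₃)]
    simp
  rw [sum_congr rfl h3, sum_powerset_apply_card (fun s => ∑ t ∈ range (Q + 1), Q.choose t •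
      glueSum (Fin s) (Fin t) (Fin (P - s)) (Fin (Q - t)) Φ f₁ f₂ f₃)]
  simp

theorem DG.SC.card_le {G : DG V E} (h : G.SC) : Fintype.card V ≤ Fintype.card E := by
  choose e he using h.exists_out
  refine Fintype.card_le_of_injective e fun u v huv => ?_
  have := he u
  rw [huv, he v] at this
  exact (Option.some.inj this).symm

variable {Φ}

theorem tcontraction_eq_zero (hΦ : ∀ I J, Multiset.card I < 2 → Φ I J = 0) {H : DG (Option V) E}
    (h : Fintype.card E < 2 * Fintype.card V) : tcontraction Φ f₁ f₂ f₃ H = 0 := by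
  have hs : ∑ v : V, (univ.filter fun e => H.1 e = some (some v)).card ≤ Fintype.card E := by
    rw [← Finset.card_biUnion]
    · exact Finset.card_le_univ _
    · intro a _ b _ hab
      refine Finset.disjoint_left.2 fun e he he' => hab ?_
      simp only [mem_filter, mem_univ, true_and] at he he'
      exact Option.some.inj (Option.some.inj (he.symm.trans he'))
  obtain ⟨v, hv⟩ : ∃ v : V, (univ.filter fun e => H.1 e = some (some v)).card < 2 := by
    by_contra! hcon
    have h2 := Finset.sum_le_sum fun v (_ : v ∈ univ) => hcon v
    simp only [sum_const, card_univ, smul_eq_mul] at h2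
    omega
  unfold tcontraction
  refine sum_eq_zero fun a _ => ?_
  rw [prod_eq_zero (mem_univ v) (hΦ _ _ (by rwa [card_fib])), mul_zero]

variable [Algebra ℂ K]

/-- The binomial coefficients of `tsum_eq_sum_glueSum` turn the weight `1 / (P! Q!)` of labelled
graphs into the product of the weights of the two parts. -/
theorem smul_tsum (P Q : ℕ) : ((P.factorial * Q.factorial : ℕ) : ℂ)⁻¹ •
    tsum (Fin P) (Fin Q) Φ f₁ f₂ f₃ =
      ∑ p ∈ HasAntidiagonal.antidiagonal P, ∑ q ∈ HasAntidiagonal.antidiagonal Q,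
      (((p.1.factorial * q.1.factorial : ℕ) : ℂ)⁻¹ *
        ((p.2.factorial * q.2.factorial : ℕ) : ℂ)⁻¹) •
      glueSum (Fin p.1) (Fin q.1) (Fin p.2) (Fin q.2) Φ f₁ f₂ f₃ := by
  have hchoose : ∀ {n k : ℕ}, k ≤ n → (n.choose k : ℂ) =
      (n.factorial : ℂ) * ((k.factorial : ℂ)⁻¹ * ((n - k).factorial : ℂ)⁻¹) := by
    intro n k hk
    rw [Nat.cast_choose ℂ hk]
    field_simp
  rw [tsum_eq_sum_glueSum, Finset.Nat.sum_antidiagonal_eq_sum_range_succ_mk, smul_sum]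
  refine sum_congr rfl fun s hs => ?_
  rw [Finset.Nat.sum_antidiagonal_eq_sum_range_succ_mk, smul_sum, smul_sum]
  refine sum_congr rfl fun t ht => ?_
  rw [← Nat.cast_smul_eq_nsmul ℂ, ← Nat.cast_smul_eq_nsmul ℂ, smul_smul, smul_smul,
    hchoose (Nat.lt_succ_iff.1 (mem_range.1 hs)), hchoose (Nat.lt_succ_iff.1 (mem_range.1 ht))]
  congr 1
  have := Nat.factorial_ne_zero P
  have := Nat.factorial_ne_zero Q
  push_cast
  field_simp

theorem glueSum_eq_zero (h : Fintype.card E₁ < Fintype.card V₁ ∨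
    Fintype.card E₂ < Fintype.card V₂) : glueSum V₁ E₁ V₂ E₂ Φ f₁ f₂ f₃ = 0 := by
  unfold glueSum
  refine sum_eq_zero fun G _ => sum_eq_zero fun s _ => sum_eq_zero fun t _ => if_neg ?_
  rintro ⟨h1, h2⟩
  have := h1.card_le
  have := h2.card_le
  omega

theorem glueSum_eq_zero' (hΦ : ∀ I J, Multiset.card I < 2 → Φ I J = 0)
    (h : Fintype.card E₁ + Fintype.card E₂ < 2 * (Fintype.card V₁ + Fintype.card V₂)) :
    glueSum V₁ E₁ V₂ E₂ Φ f₁ f₂ f₃ = 0 := by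
  unfold glueSum
  refine sum_eq_zero fun G _ => sum_eq_zero fun s _ => sum_eq_zero fun t _ => ?_
  rw [tcontraction_eq_zero f₁ f₂ f₃ hΦ (by simpa using h), mul_zero, ite_self]

/-- The good three-pointed graphs are the compositions of two strongly connected graphs. -/
theorem sum_tsum (hΦ : ∀ I J, Multiset.card I < 2 → Φ I J = 0) {m B : ℕ} (hB : m < B) :
    ∑ P ∈ range (m + 1), ((P.factorial * (P + m).factorial : ℕ) : ℂ)⁻¹ •
      tsum (Fin P) (Fin (P + m)) Φ f₁ f₂ f₃ =
    ∑ q ∈ HasAntidiagonal.antidiagonal m, ∑ s ∈ range B, ∑ s' ∈ range B,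
      (((s.factorial * (s + q.1).factorial : ℕ) : ℂ)⁻¹ *
        ((s'.factorial * (s' + q.2).factorial : ℕ) : ℂ)⁻¹) •
      glueSum (Fin s) (Fin (s + q.1)) (Fin s') (Fin (s' + q.2)) Φ f₁ f₂ f₃ := by
  -- The weights of the two parts are nonnegative, since a strongly connected graph has at least as
  -- many edges as vertices; they add up to `m`.
  have h1 : ∀ P, ∀ p ∈ HasAntidiagonal.antidiagonal P, ∑ q ∈ HasAntidiagonal.antidiagonal (P + m),
      (((p.1.factorial * q.1.factorial : ℕ) : ℂ)⁻¹ *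
        ((p.2.factorial * q.2.factorial : ℕ) : ℂ)⁻¹) •
      glueSum (Fin p.1) (Fin q.1) (Fin p.2) (Fin q.2) Φ f₁ f₂ f₃ =
      ∑ q ∈ HasAntidiagonal.antidiagonal m, (((p.1.factorial * (p.1 + q.1).factorial : ℕ) : ℂ)⁻¹ *
        ((p.2.factorial * (p.2 + q.2).factorial : ℕ) : ℂ)⁻¹) •
      glueSum (Fin p.1) (Fin (p.1 + q.1)) (Fin p.2) (Fin (p.2 + q.2)) Φ f₁ f₂ f₃ := by
    intro P p hp
    symm
    refine sum_of_injOn (fun q => (p.1 + q.1, p.2 + q.2)) ?_ ?_ ?_ ?_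
    · rintro ⟨a, b⟩ - ⟨c, d⟩ - h
      simpa using h
    · rintro ⟨a, b⟩ h
      rw [mem_coe, HasAntidiagonal.mem_antidiagonal] at *
      simp only at *
      omega
    · rintro ⟨a, b⟩ h h'
      rw [HasAntidiagonal.mem_antidiagonal] at h hp
      simp only at h
      rw [glueSum_eq_zero, smul_zero]
      simp only [Fintype.card_fin]
      by_contra! hcon
      refine h' ⟨(a - p.1, b - p.2), ?_, ?_⟩
      · rw [mem_coe, HasAntidiagonal.mem_antidiagonal]
        simp only
        omega
      · simp only [Prod.mk.injEq]
        omega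
    · intro q _
      rfl
  simp only [smul_tsum]
  rw [sum_congr rfl fun P _ => sum_congr rfl (h1 P), sum_congr rfl fun P _ => sum_comm, sum_comm]
  refine sum_congr rfl fun q hq => ?_
  rw [HasAntidiagonal.mem_antidiagonal] at hq
  -- Choosing the total number of vertices and its decomposition is the same as choosing the numbers
  -- of vertices of both parts, if one disregards parts with too many vertices.
  rw [sum_sigma', ← sum_product']
  refine sum_of_injOn (fun x => x.2) ?_ ?_ ?_ ?_
  · rintro ⟨P, p⟩ hp ⟨P', p'⟩ hp' h
    simp only [coe_sigma, Set.mem_sigma_iff, mem_coe, HasAntidiagonal.mem_antidiagonal] at hp hp'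
    obtain rfl : p = p' := h
    obtain rfl : P = P' := hp.2.symm.trans hp'.2
    rfl
  · rintro ⟨P, p⟩ hp
    simp only [coe_sigma, Set.mem_sigma_iff, mem_coe, HasAntidiagonal.mem_antidiagonal,
      mem_range] at hp
    simp only [mem_coe, mem_product, mem_range]
    omega
  · rintro ⟨s, s'⟩ - h'
    rw [glueSum_eq_zero' f₁ f₂ f₃ hΦ, smul_zero]
    simp only [Fintype.card_fin]
    by_contra! hcon
    refine h' ⟨⟨s + s', (s, s')⟩, ?_, rfl⟩
    simp only [coe_sigma, Set.mem_sigma_iff, mem_coe, HasAntidiagonal.mem_antidiagonal,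
      mem_range, and_true]
    omega
  · intro x _
    rfl

end TripleProduct

/-! ### Composition of graph sums -/

section Composition

variable {V E V₁ E₁ V₂ E₂ ι : Type*} {K : Type*} [CommRing K] [Fintype ι]
  [Fintype V] [DecidableEq V] [Fintype E] [DecidableEq E]
  [Fintype V₁] [DecidableEq V₁] [Fintype E₁] [DecidableEq E₁]
  [Fintype V₂] [DecidableEq V₂] [Fintype E₂] [DecidableEq E₂]

theorem fib_ne_zero {X : Type*} [DecidableEq X] {f : E → X} {x : X} (h : ∃ e, f e = x)
    (a : E → ι) : fib f x a ≠ 0 := by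
  obtain ⟨e, he⟩ := h
  rw [← Multiset.card_pos, card_fib, card_pos]
  exact ⟨e, by simpa using he⟩

theorem card_fib_le {X : Type*} [DecidableEq X] (f : E → X) (x : X) (a : E → ι) :
    Multiset.card (fib f x a) ≤ Fintype.card E := by
  rw [card_fib]
  exact card_le_univ _

/-- A graph sum depends on the tensors for boundedly many indices only; for strongly connected
graphs no vertex lacks incoming or outgoing edges. -/
theorem gsum_congr {M : ι → ι → K} {Φ Φ' F F' : Multiset ι → Multiset ι → K}
    (hΦ : ∀ I J, I ≠ 0 → J ≠ 0 → Multiset.card I ≤ Fintype.card E →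
      Multiset.card J ≤ Fintype.card E → Φ I J = Φ' I J)
    (hF : ∀ I J, Multiset.card I ≤ Fintype.card E → Multiset.card J ≤ Fintype.card E →
      F I J = F' I J) : gsum V E M Φ F = gsum V E M Φ' F' := by
  unfold gsum
  refine sum_congr rfl fun G _ => ?_
  split_ifs with hG
  · congr 1
    unfold contraction
    refine sum_congr rfl fun a _ => sum_congr rfl fun b _ => congrArg _ (prod_congr rfl ?_)
    rintro (_ | v) -
    · exact hF _ _ (card_fib_le _ _ _) (card_fib_le _ _ _)
    · exact hΦ _ _ (fib_ne_zero (hG.exists_out v) _) (fib_ne_zero (hG.exists_in v) _)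
        (card_fib_le _ _ _) (card_fib_le _ _ _)
  · rfl

theorem graphTotal_congr [Algebra ℂ K] {k : ℕ} {M : ι → ι → K}
    {Φ Φ' F F' : Multiset ι → Multiset ι → K}
    (hΦ : ∀ I J, I ≠ 0 → J ≠ 0 → Multiset.card I ≤ 3 * k →
      Multiset.card J ≤ 3 * k → Φ I J = Φ' I J)
    (hF : ∀ I J, Multiset.card I ≤ 3 * k → Multiset.card J ≤ 3 * k →
      F I J = F' I J) : graphTotal k M Φ F = graphTotal k M Φ' F' := by
  unfold graphTotal
  refine sum_congr rfl fun p hp => congrArg _ (gsum_congr ?_ ?_)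
  · intro I J hI hJ h1 h2
    simp only [mem_range, Fintype.card_fin] at *
    exact hΦ I J hI hJ (by omega) (by omega)
  · intro I J h1 h2
    simp only [mem_range, Fintype.card_fin] at *
    exact hF I J (by omega) (by omega)

/-- If there are fewer than two edges per vertex, some vertex has fewer than two outgoing edges. -/
theorem exists_out_lt_two (G : DG V E) (h : Fintype.card E < 2 * Fintype.card V) :
    ∃ v : V, (univ.filter fun e => G.1 e = some v).card < 2 := by
  have hs : ∑ v : V, (univ.filter fun e => G.1 e = some v).card ≤ Fintype.card E := by
    rw [← Finset.card_biUnion]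
    · exact Finset.card_le_univ _
    · intro a _ b _ hab
      refine Finset.disjoint_left.2 fun e he he' => hab ?_
      simp only [mem_filter, mem_univ, true_and] at he he'
      exact Option.some.inj (he.symm.trans he')
  by_contra! hcon
  have h2 := Finset.sum_le_sum fun v (_ : v ∈ univ) => hcon v
  simp only [sum_const, card_univ, smul_eq_mul] at h2
  omega

theorem gsum_eq_zero {M : ι → ι → K} {Φ F : Multiset ι → Multiset ι → K}
    (hΦ : ∀ I J, Multiset.card I < 2 → Φ I J = 0)
    (h : Fintype.card E < 2 * Fintype.card V) : gsum V E M Φ F = 0 := by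
  unfold gsum
  refine sum_eq_zero fun G _ => ?_
  obtain ⟨v, hv⟩ := exists_out_lt_two G h
  rw [contraction_eq_zero (some v) fun a b => hΦ _ _ (by rwa [card_fib]), mul_zero, ite_self]

theorem graphTotal_eq_sum_range [Algebra ℂ K] {k B : ℕ} (hB : 2 * k + 1 ≤ B) {M : ι → ι → K}
    {Φ F : Multiset ι → Multiset ι → K} (hΦ : ∀ I J, Multiset.card I < 2 → Φ I J = 0) :
    graphTotal k M Φ F = ∑ p ∈ range B, ((p.factorial * (p + k).factorial : ℕ) : ℂ)⁻¹ •
      gsum (Fin p) (Fin (p + k)) M Φ F := by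
  unfold graphTotal
  refine sum_subset (range_mono hB) fun p _ hp => ?_
  rw [gsum_eq_zero hΦ, smul_zero]
  simp only [mem_range, Fintype.card_fin] at *
  omega

/-- Decorate the edges entering the distinguished vertex. -/
def DG.decorate {W : Type*} (g : E → Option V) (t : {e // g e = none} → W) (e : E) : V ⊕ W :=
  match h : g e with
  | some v => Sum.inl v
  | none => Sum.inr (t ⟨e, h⟩)

theorem DG.decorate_some {W : Type*} {g : E → Option V} {t : {e // g e = none} → W} {e : E} {v : V}
    (h : g e = some v) : decorate g t e = Sum.inl v := by
  unfold decorate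
  split <;> simp_all

theorem DG.decorate_none {W : Type*} {g : E → Option V} {t : {e // g e = none} → W}
    (e : {e // g e = none}) : decorate g t e = Sum.inr (t e) := by
  unfold decorate
  split
  · have := e.2; simp_all
  · rfl

theorem DG.collapse_decorate {W : Type*} (g : E → Option V) (t : {e // g e = none} → W) :
    collapse (decorate g t) = g := by
  funext e
  unfold collapse
  rcases he : g e with _ | v
  · rw [decorate_none ⟨e, he⟩]; rfl
  · rw [decorate_some he]; rfl

theorem DG.sum_decorate {W A : Type*} [Fintype W] [DecidableEq W] [AddCommMonoid A]
    (f : (E → V ⊕ W) → A) :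
    ∑ h, f h = ∑ g : E → Option V, ∑ t : {e // g e = none} → W, f (decorate g t) := by
  rw [← sum_fiberwise (univ : Finset (E → V ⊕ W)) collapse]
  refine sum_congr rfl fun g _ => (sum_nbij (decorate g) ?_ ?_ ?_ ?_).symm
  · intro t _
    simp [collapse_decorate]
  · intro t _ t' _ h
    funext e
    have := congrFun h e
    rwa [decorate_none, decorate_none, Sum.inr.injEq] at this
  · intro h hh
    simp only [coe_filter, mem_univ, true_and, Set.mem_ofPred_eq] at hh
    subst hh
    have h1 : ∀ e : {e // collapse h e = none}, ∃ w, h e = Sum.inr w := by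
      rintro ⟨e, he⟩
      unfold collapse at he
      rcases hh : h e with v | w
      · simp [hh] at he
      · exact ⟨w, rfl⟩
    choose t ht using h1
    refine ⟨t, by simp, funext fun e => ?_⟩
    rcases he : collapse h e with _ | v
    · rw [decorate_none ⟨e, he⟩, ← ht]
    · rw [decorate_some he]
      unfold collapse at he
      rcases hh : h e with v | w
      · simp [hh] at he; simp [he]
      · simp [hh] at he
  · intro t _
    rfl

theorem DG.fib_decorate {W : Type*} [DecidableEq W] (g : E → Option V)
    (t : {e // g e = none} → W) (w : W) (a : E → ι) :
    fib (decorate g t) (Sum.inr w) a = fib t w fun e => a e := by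
  have : (univ.filter fun e => decorate g t e = Sum.inr w) =
      (univ.filter fun e : {e // g e = none} => t e = w).map (Function.Embedding.subtype _) := by
    ext e
    simp only [mem_filter, mem_univ, true_and, mem_map, Function.Embedding.subtype_apply]
    constructor
    · intro h
      rcases he : g e with _ | v
      · rw [decorate_none ⟨e, he⟩, Sum.inr.injEq] at h
        exact ⟨⟨e, he⟩, h, rfl⟩
      · rw [decorate_some he] at h
        cases h
    · rintro ⟨e, h, rfl⟩
      rw [decorate_none, h]
  rw [fib, fib, this, Finset.map_val, Multiset.map_map]
  rfl

open Classical in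
variable (V E) in
/-- The value at a point of the derivatives, labelled by `S`, of a graph sum. Each of the
derivatives falls on an ordinary vertex or on one of the two functions at the distinguished
vertex. -/
noncomputable def firstSum (Φ : Multiset ι → Multiset ι → K) (f₁ : Multiset ι → K)
    (f₂ : Multiset ι → Multiset ι → K) {S : Type*} [Fintype S] [DecidableEq S] (a : S → ι) : K :=
  ∑ G : DG V E, if G.SC then (G.sgn : K) * ∑ t : S → Option (Option V), ∑ b : E → ι,
    f₁ (fib G.2 none b + fib t none a) * f₂ (fib G.1 none b) (fib t (some none) a) *
      ∏ v : V, Φ (fib G.1 (some v) b) (fib G.2 (some v) b + fib t (some (some v)) a) else 0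

variable (Φ : Multiset ι → Multiset ι → K) (f₁ : Multiset ι → K)
  (f₂ : Multiset ι → Multiset ι → K) (f₃ : Multiset ι → K)

theorem firstSum_eq_zero {Φ} (hΦ : ∀ I J, Multiset.card I < 2 → Φ I J = 0)
    (h : Fintype.card E < 2 * Fintype.card V) {S : Type*} [Fintype S] [DecidableEq S]
    (a : S → ι) : firstSum V E Φ f₁ f₂ a = 0 := by
  unfold firstSum
  refine sum_eq_zero fun G _ => ?_
  obtain ⟨v, hv⟩ := exists_out_lt_two G h
  split_ifs
  · refine mul_eq_zero_of_right _ (sum_eq_zero fun t _ => sum_eq_zero fun b _ => ?_)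
    rw [prod_eq_zero (mem_univ v), mul_zero]
    exact hΦ _ _ (by rwa [card_fib])
  · rfl

/-- In a composition, the edges of the second graph which enter its distinguished vertex act as
derivatives on the graph sum of the first graph. -/
theorem glueSum_eq : glueSum V₁ E₁ V₂ E₂ Φ f₁ f₂ f₃ = ∑ G : DG V₂ E₂,
    open Classical in if G.SC then (G.sgn : K) * ∑ a : E₂ → ι, (f₃ (fib G.1 none a) *
      ∏ v : V₂, Φ (fib G.1 (some v) a) (fib G.2 (some v) a)) *
      firstSum V₁ E₁ Φ f₁ f₂ (fun e : {e // G.2 e = none} => a e) else 0 := by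
  classical
  -- A decorated target map amounts to a target map together with a decoration of the edges which
  -- enter the distinguished vertex.
  unfold glueSum
  rw [sum_comm]
  conv_rhs => rw [Fintype.sum_prod_type]
  refine sum_congr rfl fun s _ => ?_
  simp only [DG.sum_decorate, DG.collapse_decorate]
  rw [sum_comm]
  refine sum_congr rfl fun g _ => ?_
  by_cases hg : DG.SC (s, g)
  · simp only [hg, and_true, if_true]
    simp only [firstSum, tsgn_glue, tcontraction_glue, DG.collapse_decorate, DG.fib_decorate]
    simp only [mul_sum, mul_ite, mul_zero]
    rw [sum_comm' (s := (univ : Finset (E₂ → ι))) (t := fun _ => (univ : Finset (DG V₁ E₁)))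
      (t' := univ) (s' := fun _ => univ) (by simp)]
    refine sum_congr rfl fun G _ => ?_
    split_ifs
    · rw [sum_comm]
      refine sum_congr rfl fun a _ => ?_
      refine sum_congr rfl fun t _ => sum_congr rfl fun b _ => ?_
      push_cast
      ring
    · simp
  · simp only [hg, and_false, if_false, sum_const_zero]

/-- If the derivatives of a function are given by graph sums `firstSum`, then inserting it into a
graph sum gives the sum over compositions of graphs. -/
theorem gsum_comp [DecidableEq ι] {V₂ E₂ : Type} [Fintype V₂] [DecidableEq V₂] [Fintype E₂]
    [DecidableEq E₂] [Algebra ℂ K] {Φ f₁ f₂} {l B : ℕ} {L : Multiset ι → K} {c : ℕ → ℂ}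
    (hL : ∀ (S : Type) [Fintype S] [DecidableEq S] (a : S → ι),
      Fintype.card S ≤ Fintype.card E₂ → L (univ.val.map a) =
      ∑ s ∈ range B, c s • firstSum (Fin s) (Fin (s + l)) Φ f₁ f₂ a) :
    gsum V₂ E₂ (fun i j => if i = j then 1 else 0) Φ (fun I J => f₃ I * L J) =
      ∑ s ∈ range B, c s • glueSum (Fin s) (Fin (s + l)) V₂ E₂ Φ f₁ f₂ f₃ := by
  classical
  simp only [glueSum_eq, smul_sum]
  rw [sum_comm]
  unfold gsum
  refine sum_congr rfl fun G _ => ?_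
  split_ifs
  · rw [contraction_one]
    simp only [mul_sum, smul_sum]
    rw [sum_comm]
    refine sum_congr rfl fun a _ => ?_
    rw [Fintype.prod_option, vfac, fib_subtype G.2 none a,
      hL _ _ (Fintype.card_subtype_le _)]
    simp only [mul_sum, sum_mul, Algebra.smul_def, vfac]
    refine sum_congr rfl fun s _ => ?_
    ring
  · simp

/-- The version of `gsum_comp` for graph sums of given weight. -/
theorem graphTotal_comp [DecidableEq ι] [Algebra ℂ K] {Φ f₁ f₂} {k l B : ℕ} (hB : 2 * k + 1 ≤ B)
    (hΦ : ∀ I J, Multiset.card I < 2 → Φ I J = 0) {L : Multiset ι → K} {c : ℕ → ℂ}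
    (hL : ∀ (S : Type) [Fintype S] [DecidableEq S] (a : S → ι),
      Fintype.card S ≤ B + k → L (univ.val.map a) =
      ∑ s ∈ range B, c s • firstSum (Fin s) (Fin (s + l)) Φ f₁ f₂ a) :
    graphTotal k (fun i j => if i = j then 1 else 0) Φ (fun I J => f₃ I * L J) =
      ∑ s ∈ range B, ∑ s' ∈ range B, (c s * ((s'.factorial * (s' + k).factorial : ℕ) : ℂ)⁻¹) •
        glueSum (Fin s) (Fin (s + l)) (Fin s') (Fin (s' + k)) Φ f₁ f₂ f₃ := by
  rw [graphTotal_eq_sum_range hB hΦ, sum_comm]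
  refine sum_congr rfl fun s' hs' => ?_
  rw [gsum_comp (l := l) (B := B) (c := c) f₃ fun S _ _ a hS => hL S a ?_, smul_sum]
  · refine sum_congr rfl fun s _ => ?_
    rw [smul_smul, mul_comm]
  · rw [mem_range] at hs'
    simp only [Fintype.card_fin] at hS
    omega

end Composition

/-! ### Jets of graph sums and associativity at a point -/

section Jets

variable {κ ι R K : Type*} [CommRing R] [Algebra ℂ R] [CommRing K] [Algebra ℂ K]
  [Fintype ι] [DecidableEq ι]
  {d : κ → Derivation ℂ R R}

/-- The elements whose iterated derivatives up to order `N` are mapped to zero by `π`. -/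
def jetIdeal (hd : ∀ i j x, d i (d j x) = d j (d i x)) (π : R →ₐ[ℂ] K) (N : ℕ) : Ideal R where
  carrier := {u | ∀ m, Multiset.card m ≤ N → π (it d m u) = 0}
  add_mem' {u v} hu hv m hm := by rw [it_add, map_add, hu m hm, hv m hm, add_zero]
  zero_mem' m _ := by rw [it_map_zero, map_zero]
  -- This is an ideal by the Leibniz rule, since `π` is multiplicative.
  smul_mem' c u hu m hm := by
    rw [smul_eq_mul, it_mul hd, map_multiset_sum, Multiset.map_map]
    refine Multiset.sum_eq_zero fun x hx => ?_
    obtain ⟨p, hp, rfl⟩ := Multiset.mem_map.1 hx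
    rw [Multiset.mem_antidiagonal] at hp
    have := congrArg Multiset.card hp
    rw [Multiset.card_add] at this
    simp only [Function.comp, map_mul]
    rw [hu p.2 (by omega), mul_zero]

theorem it_algebraMap [DecidableEq κ] (hd : ∀ i j x, d i (d j x) = d j (d i x)) (m : Multiset κ)
    (c : ℂ) :
    it d m (algebraMap ℂ R c) = if m = 0 then algebraMap ℂ R c else 0 := by
  split_ifs with h
  · rw [h, it_zero]
  · obtain ⟨i, m, rfl⟩ : ∃ i m', m = i ::ₘ m' := by
      obtain ⟨i, hi⟩ := Multiset.exists_mem_of_ne_zero h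
      exact ⟨i, m.erase i, (Multiset.cons_erase hi).symm⟩
    rw [it_cons' hd, Derivation.map_algebraMap, it_map_zero]

/-- The derivatives of a graph sum at a point at which all derivatives of the inverse metric
vanish. -/
theorem it_graphTotal {d : ι → Derivation ℂ R R} (hd : ∀ i j x, d i (d j x) = d j (d i x))
    (π : R →ₐ[ℂ] K) {N l B : ℕ}
    {M : ι → ι → R} (hM : ∀ m i j, Multiset.card m ≤ N →
      π (it d m (M i j)) = if m = 0 ∧ i = j then 1 else 0)
    {Φ : Multiset ι → Multiset ι → R} {Φ' : Multiset ι → Multiset ι → K}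
    (hΦ : ∀ I J m, I ≠ 0 → J ≠ 0 → Multiset.card I ≤ N → Multiset.card (J + m) ≤ N →
      π (it d m (Φ I J)) = Φ' I (J + m))
    (hΦ' : ∀ I J, Multiset.card I < 2 → Φ' I J = 0)
    {u₁ u₂ : Multiset ι → R} {f₁ : Multiset ι → K} {f₂ : Multiset ι → Multiset ι → K}
    (hu₁ : ∀ J m, π (it d m (u₁ J)) = f₁ (J + m)) (hu₂ : ∀ I m, π (it d m (u₂ I)) = f₂ I m)
    (hB : 2 * l + 1 ≤ B)
    (S : Type) [Fintype S] [DecidableEq S] (a : S → ι) (hS : 3 * l + Fintype.card S ≤ N) :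
    π (it d (univ.val.map a) (graphTotal l M Φ fun I J => u₁ J * u₂ I)) =
      ∑ s ∈ range B, ((s.factorial * (s + l).factorial : ℕ) : ℂ)⁻¹ •
        firstSum (Fin s) (Fin (s + l)) Φ' f₁ f₂ a := by
  -- Up to order `N` the matrix `M` may be replaced by the identity matrix: the elements whose
  -- derivatives vanish up to this order form an ideal.
  have hI : graphTotal l M Φ (fun I J => u₁ J * u₂ I) -
      graphTotal l (fun i j => if i = j then 1 else 0) Φ (fun I J => u₁ J * u₂ I) ∈
      jetIdeal hd π N := by
    rw [← Ideal.Quotient.eq]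
    change Ideal.Quotient.mkₐ ℂ _ _ = Ideal.Quotient.mkₐ ℂ _ _
    rw [map_graphTotal, map_graphTotal]
    congr 1
    ext i j
    change Ideal.Quotient.mk _ _ = Ideal.Quotient.mk _ _
    rw [Ideal.Quotient.eq]
    intro m hm
    have h1 : (if i = j then (1 : R) else 0) = algebraMap ℂ R (if i = j then 1 else 0) := by
      split_ifs <;> simp
    rw [sub_eq_add_neg, it_add, ← neg_one_smul ℂ, it_smul, map_add, map_smul, hM m i j hm, h1,
      it_algebraMap hd]
    by_cases h2 : m = 0 <;> by_cases h3 : i = j <;> simp [h2, h3]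
  have hcard : Multiset.card ((univ : Finset S).val.map a) = Fintype.card S := by simp
  have h0 := hI (univ.val.map a) (by omega)
  rw [sub_eq_add_neg, it_add, ← neg_one_smul ℂ, it_smul, map_add, map_smul, neg_one_smul,
    ← sub_eq_add_neg, sub_eq_zero] at h0
  rw [h0]
  rw [← sum_subset (range_mono hB) fun s _ hs => ?_]
  · unfold graphTotal
    rw [it_sum, map_sum]
    refine sum_congr rfl fun s hs => ?_
    rw [it_smul, map_smul]
    congr 1
    unfold gsum firstSum
    rw [it_sum, map_sum]
    refine sum_congr rfl fun G _ => ?_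
    split_ifs with hG
    · rw [contraction_one, ← map_intCast (algebraMap ℂ R), ← Algebra.smul_def, it_smul, map_smul,
        Algebra.smul_def, map_intCast]
      congr 1
      rw [it_sum, map_sum, sum_comm]
      refine sum_congr rfl fun b _ => ?_
      have h1 : ∏ v : Option (Fin s), vfac Φ (fun I J => u₁ J * u₂ I) v (fib G.1 v b)
          (fib G.2 v b) = ∏ x : Option (Option (Fin s)), Option.elim x (u₁ (fib G.2 none b))
            fun x => Option.elim x (u₂ (fib G.1 none b)) fun v =>
              Φ (fib G.1 (some v) b) (fib G.2 (some v) b) := by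
        simp only [Fintype.prod_option, vfac, Option.elim, mul_assoc]
      -- Each of the derivatives falls on one of the two functions at the distinguished vertex or on
      -- an ordinary vertex.
      rw [h1, it_prod hd, map_sum]
      refine sum_congr rfl fun t _ => ?_
      rw [map_prod]
      simp only [Fintype.prod_option, Option.elim, hu₁, hu₂, mul_assoc]
      congr 2
      refine prod_congr rfl fun v _ => ?_
      have c1 := card_fib_le G.1 (some v) b
      have c2 := card_fib_le G.2 (some v) b
      have c3 := card_fib_le t (some (some v)) a
      simp only [Fintype.card_fin, mem_range] at c1 c2 hs
      rw [hΦ _ _ _ (fib_ne_zero (hG.exists_out v) _) (fib_ne_zero (hG.exists_in v) _)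
        (by omega) (by rw [Multiset.card_add]; omega)]
    · rw [it_map_zero, map_zero]
  · rw [firstSum_eq_zero f₁ f₂ hΦ', smul_zero]
    simp only [mem_range, Fintype.card_fin] at *
    omega

/-- Associativity of the graph sums at a point with normal coordinates. Both sides are equal to the
sum over all good three-pointed graphs. -/
theorem sum_graphTotal_assoc {d d' : ι → Derivation ℂ R R}
    (hd : ∀ i j x, d i (d j x) = d j (d i x)) (hd' : ∀ i j x, d' i (d' j x) = d' j (d' i x))
    (hdd' : ∀ i j x, d i (d' j x) = d' j (d i x))
    (π : R →ₐ[ℂ] K) {N m : ℕ} (hN : 7 * m + 1 ≤ N) {M : ι → ι → R}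
    (hM : ∀ I i j, Multiset.card I ≤ N →
      π (it d I (M i j)) = if I = 0 ∧ i = j then 1 else 0)
    (hM' : ∀ I i j, Multiset.card I ≤ N →
      π (it d' I (M i j)) = if I = 0 ∧ i = j then 1 else 0)
    {Φ : Multiset ι → Multiset ι → R} {Φ' : Multiset ι → Multiset ι → K}
    (hΦ : ∀ I J m, I ≠ 0 → J ≠ 0 → Multiset.card (I + m) ≤ N → Multiset.card J ≤ N →
      π (it d m (Φ I J)) = Φ' (I + m) J)
    (hΦd' : ∀ I J m, I ≠ 0 → J ≠ 0 → Multiset.card I ≤ N → Multiset.card (J + m) ≤ N →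
      π (it d' m (Φ I J)) = Φ' I (J + m))
    (hΦ₁ : ∀ I J, Multiset.card I < 2 → Φ' I J = 0)
    (hΦ₂ : ∀ I J, Multiset.card J < 2 → Φ' I J = 0) (u₁ u₂ u₃ : R) :
    ∑ q ∈ HasAntidiagonal.antidiagonal m,
      graphTotal q.2 (fun i j => if i = j then 1 else 0) Φ' (fun I J => π (it d I u₃) *
        π (it d' J (graphTotal q.1 M Φ fun I J => it d' J u₁ * it d I u₂))) =
    ∑ q ∈ HasAntidiagonal.antidiagonal m,
      graphTotal q.2 (fun i j => if i = j then 1 else 0) Φ' (fun I J => π (it d' J u₁) *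
        π (it d I (graphTotal q.1 M Φ fun I J => it d' J u₂ * it d I u₃))) := by
  have hcomm : ∀ I J u, it d I (it d' J u) = it d' J (it d I u) := by
    intro I J u
    induction I using Multiset.induction_on with
    | empty => simp
    | cons i I ih =>
      rw [it_cons hd, ih, it_cons hd, it_comm_derivation (d i) (hdd' i)]
  -- The first bracketing. An inner graph sum has weight at most `m`, so that it depends on the
  -- metric up to order `3 * m`, and it is differentiated at most `3 * m + 1` times.
  have e1 : ∀ q ∈ HasAntidiagonal.antidiagonal m,
      graphTotal q.2 (fun i j => if i = j then 1 else 0) Φ' (fun I J => π (it d I u₃) *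
        π (it d' J (graphTotal q.1 M Φ fun I J => it d' J u₁ * it d I u₂))) =
      ∑ s ∈ range (2 * m + 1), ∑ s' ∈ range (2 * m + 1),
      (((s.factorial * (s + q.1).factorial : ℕ) : ℂ)⁻¹ *
        ((s'.factorial * (s' + q.2).factorial : ℕ) : ℂ)⁻¹) •
      glueSum (Fin s) (Fin (s + q.1)) (Fin s') (Fin (s' + q.2)) Φ' (fun J => π (it d' J u₁))
        (fun I J => π (it d' J (it d I u₂))) (fun I => π (it d I u₃)) := by
    intro q hq
    rw [HasAntidiagonal.mem_antidiagonal] at hq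
    refine graphTotal_comp _ (by omega) hΦ₁ fun S _ _ a hS => ?_
    refine it_graphTotal hd' π (N := N) hM' hΦd' hΦ₁ ?_ ?_ (by omega) S a (by omega)
    · intro J m
      rw [add_comm, it_add_index hd']
    · intro I m
      rfl
  -- The second bracketing, which becomes a sum of the same kind after reversing all edges, that is,
  -- after exchanging holomorphic and antiholomorphic derivatives.
  have e2 : ∀ q ∈ HasAntidiagonal.antidiagonal m,
      graphTotal q.2 (fun i j => if i = j then 1 else 0) Φ' (fun I J => π (it d' J u₁) *
        π (it d I (graphTotal q.1 M Φ fun I J => it d' J u₂ * it d I u₃))) =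
      ∑ s ∈ range (2 * m + 1), ∑ s' ∈ range (2 * m + 1),
      (((s.factorial * (s + q.1).factorial : ℕ) : ℂ)⁻¹ *
        ((s'.factorial * (s' + q.2).factorial : ℕ) : ℂ)⁻¹) •
      glueSum (Fin s) (Fin (s + q.1)) (Fin s') (Fin (s' + q.2)) (fun I J => Φ' J I)
        (fun J => π (it d J u₃)) (fun I J => π (it d J (it d' I u₂)))
        (fun I => π (it d' I u₁)) := by
    intro q hq
    rw [HasAntidiagonal.mem_antidiagonal] at hq
    rw [← graphTotal_rev]
    have h1 : (fun i j : ι => if j = i then (1 : K) else 0) = fun i j => if i = j then 1 else 0 := by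
      ext i j; simp only [eq_comm]
    rw [h1]
    refine graphTotal_comp _ (by omega) (fun I J h => hΦ₂ J I h) fun S _ _ a hS => ?_
    rw [← graphTotal_rev]
    simp only [mul_comm (it d' _ u₂)]
    refine it_graphTotal hd π (N := N) (fun I i j hI => ?_) (fun I J m hI hJ h1 h2 => ?_)
      (fun I J h => hΦ₂ J I h) ?_ ?_ (by omega) S a (by omega)
    · simp only [hM I j i hI, eq_comm]
    · exact hΦ J I m hJ hI h2 h1
    · intro J m
      rw [add_comm, it_add_index hd]
    · intro I m
      rfl
  -- Both sides are sums over good graphs with edges in opposite directions.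
  rw [sum_congr rfl e1, sum_congr rfl e2, ← sum_tsum _ _ _ hΦ₁ (by omega),
    ← sum_tsum _ _ _ (fun I J h => hΦ₂ J I h) (by omega)]
  refine sum_congr rfl fun P _ => ?_
  rw [← tsum_rev]
  simp only [hcomm]

end Jets

/-! ### The ring of smooth functions on an open set -/

section SmoothFunctions

open TopologicalSpace (Opens)

variable {E E' : Type*} [NormedAddCommGroup E] [NormedSpace ℝ E]
  [NormedAddCommGroup E'] [NormedSpace ℝ E']

/-- The algebra of smooth complex valued functions on the open set `U`. -/
def smoothAlg (U : Opens E) : Subalgebra ℂ (U → ℂ) where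
  carrier := {u | ∃ f : E → ℂ, ContDiffOn ℝ ∞ f U ∧ ∀ x : U, f x = u x}
  mul_mem' := by
    rintro u v ⟨f, hf, hfu⟩ ⟨g, hg, hgv⟩
    exact ⟨fun x => f x * g x, hf.mul hg, fun x => by simp [hfu, hgv]⟩
  add_mem' := by
    rintro u v ⟨f, hf, hfu⟩ ⟨g, hg, hgv⟩
    exact ⟨fun x => f x + g x, hf.add hg, fun x => by simp [hfu, hgv]⟩
  algebraMap_mem' c := ⟨fun _ => c, contDiffOn_const, fun x => rfl⟩

/-- The type of smooth complex valued functions on the open set `U`, where smooth means to be the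
restriction of a function on `E` which is smooth on `U`. It is a separate type in order to carry
derivations. -/
def Fn (U : Opens E) : Type _ := smoothAlg U

namespace Fn

variable {U : Opens E} {U' : Opens E'}

noncomputable instance : CommRing (Fn U) := inferInstanceAs (CommRing (smoothAlg U))

noncomputable instance : Algebra ℂ (Fn U) := inferInstanceAs (Algebra ℂ (smoothAlg U))

@[simp] theorem add_apply (u w : Fn U) (x : U) : (u + w).1 x = u.1 x + w.1 x := rfl
@[simp] theorem mul_apply (u w : Fn U) (x : U) : (u * w).1 x = u.1 x * w.1 x := rfl
@[simp] theorem zero_apply (x : U) : (0 : Fn U).1 x = 0 := rfl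
@[simp] theorem one_apply (x : U) : (1 : Fn U).1 x = 1 := rfl
@[simp] theorem smul_apply (c : ℂ) (u : Fn U) (x : U) : (c • u).1 x = c * u.1 x := rfl

/-- The restriction of a function which is smooth on `U`. -/
def of (f : E → ℂ) (hf : ContDiffOn ℝ ∞ f U) : Fn U := ⟨fun x => f x, f, hf, fun _ => rfl⟩

@[simp] theorem of_apply (f : E → ℂ) (hf : ContDiffOn ℝ ∞ f U) (x : U) :
    (of f hf).1 x = f x := rfl

/-- A function on the whole space with the given restriction to `U`. Its values outside of `U` are
arbitrary. -/
noncomputable def rep (u : Fn U) : E → ℂ := u.2.choose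

theorem contDiffOn_rep (u : Fn U) : ContDiffOn ℝ ∞ u.rep U := u.2.choose_spec.1

@[simp] theorem rep_apply (u : Fn U) (x : U) : u.rep x = u.1 x := u.2.choose_spec.2 x

theorem rep_apply' (u : Fn U) {x : E} (hx : x ∈ U) : u.rep x = u.1 ⟨x, hx⟩ :=
  rep_apply u ⟨x, hx⟩

theorem differentiableAt {f : E → ℂ} (hf : ContDiffOn ℝ ∞ f U) (x : U) :
    DifferentiableAt ℝ f x :=
  (hf.contDiffAt (U.2.mem_nhds x.2)).differentiableAt (by simp)

theorem contDiffOn_fderiv {f : E → ℂ} (hf : ContDiffOn ℝ ∞ f U) (v : E) :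
    ContDiffOn ℝ ∞ (fun x => fderiv ℝ f x v) U :=
  (hf.fderiv_of_isOpen U.2 (by simp)).clm_apply contDiffOn_const

theorem fderiv_rep (u : Fn U) {f : E → ℂ} (h : ∀ x : U, f x = u.1 x) (x : U) :
    fderiv ℝ u.rep x = fderiv ℝ f x := by
  refine Filter.EventuallyEq.fderiv_eq ?_
  filter_upwards [U.2.mem_nhds x.2] with y hy
  rw [rep_apply' u hy, ← h ⟨y, hy⟩]

/-- The directional derivative. -/
noncomputable def dirDer (v : E) : Derivation ℂ (Fn U) (Fn U) :=
  Derivation.mk'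
    { toFun := fun u => of (fun x => fderiv ℝ u.rep x v) (contDiffOn_fderiv u.contDiffOn_rep v)
      map_add' := fun u w => Subtype.ext <| funext fun x => by
        rw [of_apply, fderiv_rep (u + w) (f := fun x => u.rep x + w.rep x) (fun x => by simp),
          fderiv_fun_add (differentiableAt u.contDiffOn_rep x)
            (differentiableAt w.contDiffOn_rep x)]
        rfl
      map_smul' := fun c u => Subtype.ext <| funext fun x => by
        rw [of_apply, fderiv_rep (c • u) (f := fun x => c • u.rep x) (fun x => by simp),
          fderiv_fun_const_smul (differentiableAt u.contDiffOn_rep x)]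
        rfl }
    fun u w => Subtype.ext <| funext fun x => by
      change fderiv ℝ (u * w).rep x v = _
      rw [fderiv_rep (u * w) (f := fun x => u.rep x * w.rep x) (fun x => by simp),
          fderiv_fun_mul (differentiableAt u.contDiffOn_rep x)
            (differentiableAt w.contDiffOn_rep x)]
      simp
      rfl

theorem dirDer_apply (v : E) (u : Fn U) (x : U) :
    (dirDer v u).1 x = fderiv ℝ u.rep x v := rfl

theorem dirDer_of (v : E) {f : E → ℂ} (hf : ContDiffOn ℝ ∞ f U) (x : U) :
    (dirDer v (of f hf)).1 x = fderiv ℝ f x v := by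
  rw [dirDer_apply, fderiv_rep _ (f := f) fun _ => rfl]

theorem dirDer_comm (v w : E) (u : Fn U) : dirDer v (dirDer w u) = dirDer w (dirDer v u) := by
  have key : ∀ (v w : E) (x : U), (dirDer v (dirDer w u)).1 x =
      fderiv ℝ (fderiv ℝ u.rep) x v w := by
    intro v w x
    have h1 : dirDer w u = of (fun x => fderiv ℝ u.rep x w)
      (contDiffOn_fderiv u.contDiffOn_rep w) := rfl
    rw [h1, dirDer_of]
    have h2 : DifferentiableAt ℝ (fderiv ℝ u.rep) x :=
      ((u.contDiffOn_rep.fderiv_of_isOpen (m := ∞) U.2 (by simp)).contDiffAt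
        (U.2.mem_nhds x.2)).differentiableAt (by simp)
    rw [fderiv_clm_apply h2 (differentiableAt_const _)]
    simp
  refine Subtype.ext (funext fun x => ?_)
  rw [key, key]
  have := (u.contDiffOn_rep.contDiffAt (U.2.mem_nhds x.2)).isSymmSndFDerivAt
    (by
      rw [minSmoothness_of_isRCLikeNormedField]
      exact WithTop.coe_le_coe.2 le_top)
  exact this v w

/-- Complex linear combinations of two directional derivatives. -/
noncomputable def der (a : ℂ) (v : E) (b : ℂ) (w : E) : Derivation ℂ (Fn U) (Fn U) :=
  a • dirDer v + b • dirDer w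

theorem der_apply (a : ℂ) (v : E) (b : ℂ) (w : E) (u : Fn U) :
    der a v b w u = a • dirDer v u + b • dirDer w u := rfl

theorem der_comm (a : ℂ) (v : E) (b : ℂ) (w : E) (a' : ℂ) (v' : E) (b' : ℂ) (w' : E) (u : Fn U) :
    der a v b w (der a' v' b' w' u) = der a' v' b' w' (der a v b w u) := by
  simp only [der_apply, map_add, Derivation.map_smul, dirDer_comm v, dirDer_comm w]
  module

theorem dirDer_eq_der (v : E) : (dirDer v : Derivation ℂ (Fn U) (Fn U)) = der 1 v 0 0 := by
  ext u
  simp [der_apply]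

/-- Complex conjugation of functions. -/
noncomputable def conj (u : Fn U) : Fn U :=
  ⟨fun x => starRingEnd ℂ (u.1 x), fun x => starRingEnd ℂ (u.rep x),
    Complex.conjCLE.contDiff.comp_contDiffOn u.contDiffOn_rep, fun x => by simp⟩

@[simp] theorem conj_apply (u : Fn U) (x : U) : (conj u).1 x = starRingEnd ℂ (u.1 x) := rfl

theorem dirDer_conj (v : E) (u : Fn U) : dirDer v (conj u) = conj (dirDer v u) := by
  refine Subtype.ext (funext fun x => ?_)
  rw [dirDer_apply, fderiv_rep (conj u) (f := fun x => starRingEnd ℂ (u.rep x)) (by simp),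
    conj_apply, dirDer_apply]
  have := (Complex.conjCLE.toContinuousLinearMap.hasFDerivAt.comp x.1
    (differentiableAt u.contDiffOn_rep x).hasFDerivAt).fderiv
  change fderiv ℝ (fun x => starRingEnd ℂ (u.rep x)) x = _ at this
  rw [this]
  rfl

theorem conj_add (u w : Fn U) : conj (u + w) = conj u + conj w :=
  Subtype.ext (funext fun x => by simp)

theorem conj_mul (u w : Fn U) : conj (u * w) = conj u * conj w :=
  Subtype.ext (funext fun x => by simp)

theorem conj_smul (c : ℂ) (u : Fn U) : conj (c • u) = (starRingEnd ℂ c) • conj u :=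
  Subtype.ext (funext fun x => by simp)

theorem conj_zero : conj (0 : Fn U) = 0 := Subtype.ext (funext fun x => by simp)

theorem conj_conj (u : Fn U) : conj (conj u) = u := Subtype.ext (funext fun x => by simp)

theorem conj_sum {α : Type*} (s : Finset α) (u : α → Fn U) :
    conj (∑ i ∈ s, u i) = ∑ i ∈ s, conj (u i) :=
  map_sum (AddMonoidHom.mk' conj conj_add) u s

theorem der_conj (a : ℂ) (v : E) (b : ℂ) (w : E) (u : Fn U) :
    der a v b w (conj u) = conj (der (starRingEnd ℂ a) v (starRingEnd ℂ b) w u) := by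
  simp only [der_apply, dirDer_conj, conj_add, conj_smul, starRingEnd_self_apply]

/-- Composition with a smooth map. -/
noncomputable def pull (h : E → E') (hh : ContDiffOn ℝ ∞ h U) (hU : ∀ x : U, h x ∈ U') :
    Fn U' →ₐ[ℂ] Fn U where
  toFun u := ⟨fun x => u.1 ⟨h x, hU x⟩, fun x => u.rep (h x),
    u.contDiffOn_rep.comp hh fun x hx => hU ⟨x, hx⟩, fun x => rep_apply' u (hU x)⟩
  map_one' := rfl
  map_mul' _ _ := rfl
  map_zero' := rfl
  map_add' _ _ := rfl
  commutes' _ := rfl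

@[simp] theorem pull_apply (h : E → E') (hh : ContDiffOn ℝ ∞ h U) (hU : ∀ x : U, h x ∈ U')
    (u : Fn U') (x : U) : (pull h hh hU u).1 x = u.1 ⟨h x, hU x⟩ := rfl

theorem conj_pull (h : E → E') (hh : ContDiffOn ℝ ∞ h U) (hU : ∀ x : U, h x ∈ U') (u : Fn U') :
    conj (pull h hh hU u) = pull h hh hU (conj u) := rfl

theorem dirDer_pull_apply (h : E → E') (hh : ContDiffOn ℝ ∞ h U) (hU : ∀ x : U, h x ∈ U')
    (u : Fn U') (v : E) (x : U) :
    (dirDer v (pull h hh hU u)).1 x = fderiv ℝ u.rep (h x) (fderiv ℝ h x v) := by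
  rw [dirDer_apply, fderiv_rep (pull h hh hU u) (f := u.rep ∘ h)
    (fun x => rep_apply' u (hU x))]
  have h1 : DifferentiableAt ℝ h x :=
    (hh.contDiffAt (U.2.mem_nhds x.2)).differentiableAt (by simp)
  rw [fderiv_comp x.1 (differentiableAt u.contDiffOn_rep ⟨h x, hU x⟩) h1]
  rfl

/-- Composition with a map whose derivative maps the vector `v` to `v'`. -/
theorem dirDer_pull_of_const (h : E → E') (hh : ContDiffOn ℝ ∞ h U) (hU : ∀ x : U, h x ∈ U')
    {v : E} {v' : E'} (hv : ∀ x : U, fderiv ℝ h x v = v') (u : Fn U') :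
    dirDer v (pull h hh hU u) = pull h hh hU (dirDer v' u) := by
  refine Subtype.ext (funext fun x => ?_)
  rw [dirDer_pull_apply, hv, pull_apply]
  rfl

theorem der_pull_of_const (h : E → E') (hh : ContDiffOn ℝ ∞ h U) (hU : ∀ x : U, h x ∈ U')
    {v w : E} {v' w' : E'} (hv : ∀ x : U, fderiv ℝ h x v = v')
    (hw : ∀ x : U, fderiv ℝ h x w = w') (a b : ℂ) (u : Fn U') :
    der a v b w (pull h hh hU u) = pull h hh hU (der a v' b w' u) := by
  simp only [der_apply, dirDer_pull_of_const h hh hU hv, dirDer_pull_of_const h hh hU hw, map_add,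
    map_smul]

theorem isUnit_of_ne_zero {u : Fn U} (h : ∀ x, u.1 x ≠ 0) : IsUnit u := by
  refine IsUnit.of_mul_eq_one ⟨fun x => (u.1 x)⁻¹, fun x => (u.rep x)⁻¹,
    u.contDiffOn_rep.inv fun x hx => ?_, fun x => by simp⟩ ?_
  · rw [rep_apply' u hx]; exact h _
  · exact Subtype.ext (funext fun x => mul_inv_cancel₀ (h x))

/-- The value at a point. -/
noncomputable def ev (x : U) : Fn U →ₐ[ℂ] ℂ :=
  (Pi.evalAlgHom ℂ (fun _ : U => ℂ) x).comp (smoothAlg U).val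

@[simp] theorem ev_apply (x : U) (u : Fn U) : ev x u = u.1 x := rfl

end Fn

/-! ### Wirtinger derivatives -/

section Wirtinger

namespace Fn

variable {n : ℕ} {U : Opens E} {U' : Opens (Fin n → ℂ)} {Ω : Opens E}

/-- The derivation `∂/∂zᵢ` for complex coordinates in the directions of the image of `ℓ`. Taking `ℓ`
to be an inclusion allows for further real parameters. -/
noncomputable def D (ℓ : (Fin n → ℂ) →L[ℝ] E) (i : Fin n) : Derivation ℂ (Fn U) (Fn U) :=
  der (1 / 2) (ℓ (Pi.single i 1)) (-(1 / 2) * Complex.I) (ℓ (Pi.single i Complex.I))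

/-- The derivation `∂/∂z̄ᵢ` for complex coordinates in the directions of the image of `ℓ`. -/
noncomputable def Db (ℓ : (Fin n → ℂ) →L[ℝ] E) (i : Fin n) : Derivation ℂ (Fn U) (Fn U) :=
  der (1 / 2) (ℓ (Pi.single i 1)) ((1 / 2) * Complex.I) (ℓ (Pi.single i Complex.I))

variable (ℓ : (Fin n → ℂ) →L[ℝ] E)

theorem D_comm (i j : Fin n) (u : Fn U) : D ℓ i (D ℓ j u) = D ℓ j (D ℓ i u) := der_comm ..
theorem Db_comm (i j : Fin n) (u : Fn U) : Db ℓ i (Db ℓ j u) = Db ℓ j (Db ℓ i u) := der_comm ..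
theorem D_Db_comm (i j : Fin n) (u : Fn U) : D ℓ i (Db ℓ j u) = Db ℓ j (D ℓ i u) := der_comm ..
theorem dirDer_D (v : E) (i : Fin n) (u : Fn U) : dirDer v (D ℓ i u) = D ℓ i (dirDer v u) := by
  rw [dirDer_eq_der]; exact der_comm ..
theorem dirDer_Db (v : E) (i : Fin n) (u : Fn U) : dirDer v (Db ℓ i u) = Db ℓ i (dirDer v u) := by
  rw [dirDer_eq_der]; exact der_comm ..

theorem D_conj (i : Fin n) (u : Fn U) : D ℓ i (conj u) = conj (Db ℓ i u) := by
  rw [D, der_conj, Db]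
  have : starRingEnd ℂ 2 = 2 := Complex.conj_ofNat 2
  congr 3 <;> simp [this]

theorem Db_conj (i : Fin n) (u : Fn U) : Db ℓ i (conj u) = conj (D ℓ i u) := by
  rw [Db, der_conj, D]
  have : starRingEnd ℂ 2 = 2 := Complex.conj_ofNat 2
  congr 3 <;> simp [this]

/-- The coordinate functions of a smooth map. -/
noncomputable def coords (h : E → Fin n → ℂ) (hh : ContDiffOn ℝ ∞ h U) (k : Fin n) : Fn U :=
  of (fun x => h x k) (contDiffOn_pi.1 hh k)

theorem dirDer_coords (h : E → Fin n → ℂ) (hh : ContDiffOn ℝ ∞ h U) (k : Fin n) (v : E) (x : U) :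
    (dirDer v (coords h hh k)).1 x = fderiv ℝ h x v k := by
  rw [coords, dirDer_of]
  have h1 : DifferentiableAt ℝ h x :=
    (hh.contDiffAt (U.2.mem_nhds x.2)).differentiableAt (by simp)
  rw [fderiv_apply h1]
  rfl

theorem sum_wirtinger (A : (Fin n → ℂ) →L[ℝ] ℂ) (c : Fin n → ℂ) :
    A c = ∑ k, (((1 / 2) * A (Pi.single k 1) + (-(1 / 2) * Complex.I) * A (Pi.single k Complex.I)) * c k
      + ((1 / 2) * A (Pi.single k 1) + ((1 / 2) * Complex.I) * A (Pi.single k Complex.I)) *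
        starRingEnd ℂ (c k)) := by
  have h1 : c = ∑ k, ((c k).re • (Pi.single k 1 : Fin n → ℂ) + (c k).im •
      (Pi.single k Complex.I : Fin n → ℂ)) := by
    ext j
    rw [Finset.sum_apply, Finset.sum_eq_single j]
    · simp [Complex.re_add_im]
    · intro b _ hb; simp [Pi.single_eq_of_ne hb.symm]
    · simp
  conv_lhs => rw [h1, map_sum]
  refine sum_congr rfl fun k _ => ?_
  rw [map_add, map_smul, map_smul, Complex.real_smul, Complex.real_smul]
  have h2 : c k = (c k).re + (c k).im * Complex.I := (Complex.re_add_im _).symm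
  have h3 : starRingEnd ℂ (c k) = (c k).re - (c k).im * Complex.I := by
    conv_lhs => rw [h2]
    rw [map_add, map_mul, Complex.conj_ofReal, Complex.conj_ofReal, Complex.conj_I]; ring
  rw [h3]
  conv_rhs => rw [h2]
  generalize A (Pi.single k 1) = p
  generalize A (Pi.single k Complex.I) = q
  simp only [Complex.add_re, Complex.ofReal_re, Complex.mul_re, Complex.I_re, mul_zero,
    Complex.ofReal_im, Complex.I_im, mul_one, sub_zero, add_zero, Complex.add_im,
    Complex.mul_im, zero_add, sub_self]
  linear_combination ((c k).im * q) * Complex.I_mul_I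

/-- The chain rule for a smooth map into `ℂⁿ`. -/
theorem der_pull (h : E → Fin n → ℂ) (hh : ContDiffOn ℝ ∞ h U) (hU : ∀ x : U, h x ∈ U')
    (u : Fn U') (a : ℂ) (v : E) (b : ℂ) (w : E) :
    der a v b w (pull h hh hU u) =
      ∑ k, (pull h hh hU (D (.id ℝ _) k u) * der a v b w (coords h hh k) +
        pull h hh hU (Db (.id ℝ _) k u) * der a v b w (conj (coords h hh k))) := by
  have key : ∀ v : E, dirDer v (pull h hh hU u) =
      ∑ k, (pull h hh hU (D (.id ℝ _) k u) * dirDer v (coords h hh k) +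
        pull h hh hU (Db (.id ℝ _) k u) * dirDer v (conj (coords h hh k))) := by
    intro v
    refine Subtype.ext (funext fun x => ?_)
    rw [dirDer_pull_apply, sum_wirtinger]
    have : ∀ (s : Finset (Fin n)) (f : Fin n → Fn U), (∑ k ∈ s, f k).1 x = ∑ k ∈ s, (f k).1 x :=
      fun s f => map_sum (ev x) f s
    rw [this]
    refine sum_congr rfl fun k _ => ?_
    change _ = (pull h hh hU (D (.id ℝ _) k u)).1 x * (dirDer v (coords h hh k)).1 x +
        (pull h hh hU (Db (.id ℝ _) k u)).1 x * (dirDer v (conj (coords h hh k))).1 x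
    rw [dirDer_conj, conj_apply, dirDer_coords]
    rfl
  rw [der_apply, key, key, smul_sum, smul_sum, ← sum_add_distrib]
  refine sum_congr rfl fun k _ => ?_
  simp only [der_apply, Algebra.smul_def]
  ring

end Fn

end Wirtinger

end SmoothFunctions

/-! ### The derivatives of a metric as a tensor -/

section Tensors

variable {κ ι R R' K : Type*} [CommRing R] [Algebra ℂ R] [CommRing R'] [Algebra ℂ R']
  [CommRing K] [Algebra ℂ K] [Fintype ι] [DecidableEq ι]

/-- Two families of derivations, all of which commute with each other. They stand for the
derivatives `∂/∂zᵢ` and `∂/∂z̄ᵢ`. -/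
structure CommDer (d d' : ι → Derivation ℂ R R) : Prop where
  comm : ∀ i j x, d i (d j x) = d j (d i x)
  comm' : ∀ i j x, d' i (d' j x) = d' j (d' i x)
  mixed : ∀ i j x, d i (d' j x) = d' j (d i x)

theorem CommDer.swap {d d' : ι → Derivation ℂ R R} (h : CommDer d d') : CommDer d' d :=
  ⟨h.comm', h.comm, fun i j x => (h.mixed j i x).symm⟩

theorem CommDer.der_it {d d' : ι → Derivation ℂ R R} (h : CommDer d d') (i : ι) (J : Multiset ι)
    (x : R) : d i (it d' J x) = it d' J (d i x) :=
  it_comm_derivation (d i) (fun j x => h.mixed i j x) J x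

theorem CommDer.it_it {d d' : ι → Derivation ℂ R R} (h : CommDer d d') (I J : Multiset ι) (x : R) :
    it d I (it d' J x) = it d' J (it d I x) := by
  induction I using Multiset.induction_on with
  | empty => simp
  | cons i I ih => rw [it_cons h.comm, ih, it_cons h.comm, h.der_it]

/-- The derivatives of a family `X` with `d k (X i) = d i (X k)`: to the indices `i :: I` belongs
the derivative of `X i` along `I`, and the value for the empty multiset is zero. By the symmetry of
`X` it does not matter which index is singled out (`pot_cons`). -/
noncomputable def pot (d : κ → Derivation ℂ R R) (X : κ → R) (I : Multiset κ) : R :=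
  match I.toList with
  | [] => 0
  | i :: l => it d (l : Multiset κ) (X i)

@[simp] theorem pot_zero (d : κ → Derivation ℂ R R) (X : κ → R) : pot d X 0 = 0 := by
  simp [pot]

theorem pot_cons {d : κ → Derivation ℂ R R} (hd : ∀ i j x, d i (d j x) = d j (d i x)) {X : κ → R}
    (hX : ∀ i k, d k (X i) = d i (X k)) (i : κ) (I : Multiset κ) :
    pot d X (i ::ₘ I) = it d I (X i) := by
  have key : ∀ k (J : Multiset κ), k ::ₘ J = i ::ₘ I → it d J (X k) = it d I (X i) := by
    intro k J h
    rcases Multiset.cons_eq_cons.1 h with ⟨rfl, rfl⟩ | ⟨-, L, rfl, rfl⟩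
    · rfl
    · rw [it_cons' hd, it_cons' hd, hX]
  unfold pot
  split
  · rename_i h
    simp at h
  · rename_i k l h
    refine key k l ?_
    rw [Multiset.cons_coe, ← h, Multiset.coe_toList]

theorem pot_smul (d : κ → Derivation ℂ R R) (c : ℂ) (X : κ → R) (I : Multiset κ) :
    pot d (fun i => c • X i) I = c • pot d X I := by
  unfold pot
  split
  · simp
  · rw [it_smul]

theorem pot_sum {α : Type*} (s : Finset α) (d : κ → Derivation ℂ R R) (X : α → κ → R)
    (I : Multiset κ) : pot d (fun i => ∑ x ∈ s, X x i) I = ∑ x ∈ s, pot d (X x) I := by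
  unfold pot
  split
  · simp
  · rw [it_sum]

theorem pot_comm_derivation {d : κ → Derivation ℂ R R} (δ : Derivation ℂ R R)
    (h : ∀ i x, δ (d i x) = d i (δ x)) (X : κ → R) (I : Multiset κ) :
    δ (pot d X I) = pot d (fun i => δ (X i)) I := by
  unfold pot
  split
  · simp
  · rw [it_comm_derivation δ h]

theorem it_map {d : κ → Derivation ℂ R R} {e : κ → Derivation ℂ R' R'} (π : R →ₗ[ℂ] R')
    (h : ∀ i x, π (d i x) = e i (π x)) (I : Multiset κ) (x : R) :
    π (it d I x) = it e I (π x) := by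
  unfold it
  induction I.toList with
  | nil => rfl
  | cons i l ih => simp only [List.foldr_cons, h, ih]

theorem pot_map {d : κ → Derivation ℂ R R} {e : κ → Derivation ℂ R' R'} (π : R →ₗ[ℂ] R')
    (h : ∀ i x, π (d i x) = e i (π x)) (X : κ → R) (I : Multiset κ) :
    π (pot d X I) = pot e (fun i => π (X i)) I := by
  unfold pot
  split
  · simp
  · rw [it_map π h]

theorem it_pot {d : κ → Derivation ℂ R R} (hd : ∀ i j x, d i (d j x) = d j (d i x)) {X : κ → R}
    (hX : ∀ i k, d k (X i) = d i (X k)) {I : Multiset κ} (hI : I ≠ 0) (m : Multiset κ) :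
    it d m (pot d X I) = pot d X (I + m) := by
  obtain ⟨i, hi⟩ := Multiset.exists_mem_of_ne_zero hI
  obtain ⟨I, rfl⟩ := Multiset.exists_cons_of_mem hi
  rw [pot_cons hd hX, Multiset.cons_add, pot_cons hd hX, add_comm, it_add_index hd]

/-- The behaviour of the derivatives of a closed family under a linear change of coordinates. -/
theorem pot_linear_change {κ' : Type*} [Fintype κ] {d : κ → Derivation ℂ R R}
    {e : κ' → Derivation ℂ R' R'} (hd : ∀ i j x, d i (d j x) = d j (d i x))
    (he : ∀ i j x, e i (e j x) = e j (e i x)) (π : R →ₗ[ℂ] R') (L : κ' → κ → ℂ)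
    (h : ∀ i x, e i (π x) = ∑ k, L i k • π (d k x)) {X : κ → R} {Y : κ' → R'}
    (hX : ∀ i k, d k (X i) = d i (X k)) (hY : ∀ i k, e k (Y i) = e i (Y k))
    (hXY : ∀ i, Y i = ∑ k, L i k • π (X k)) (S : Type) [Fintype S] [DecidableEq S]
    (a : S → κ') :
    pot e Y (univ.val.map a) =
      ∑ c : S → κ, (∏ x, L (a x) (c x)) • π (pot d X (univ.val.map c)) := by
  rcases isEmpty_or_nonempty S with hS | hS
  · simp
  obtain ⟨m, hm⟩ : ∃ m, Fintype.card S = m + 1 := Nat.exists_eq_succ_of_ne_zero Fintype.card_ne_zero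
  let σ : Option (Fin m) ≃ S := ((Fintype.equivFinOfCardEq hm).trans (finSuccEquiv m)).symm
  rw [← univ_map_equiv σ, ← (Equiv.arrowCongr σ (Equiv.refl κ)).sum_comp]
  have h1 : ∀ c : Option (Fin m) → κ, (Equiv.arrowCongr σ (Equiv.refl κ)) c ∘ σ = c := by
    intro c; ext; simp
  simp only [← univ_map_equiv σ, ← σ.prod_comp, h1]
  rw [univ_map_option, pot_cons he hY, hXY, it_sum,
    ← (Equiv.piOptionEquivProd (β := fun _ : Option (Fin m) => κ)).symm.sum_comp,
      Fintype.sum_prod_type]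
  refine sum_congr rfl fun k _ => ?_
  rw [it_smul, it_linear_change hd he π L h, smul_sum]
  refine sum_congr rfl fun c _ => ?_
  rw [univ_map_option, pot_cons hd hX, Fintype.prod_option, smul_smul]
  simp [Equiv.piOptionEquivProd]

/-- The components `g_{i j̄ I J̄}` of the derivatives of a metric; they vanish by convention if
there are no unbarred or no barred indices. -/
noncomputable def tens (d d' : ι → Derivation ℂ R R) (g : ι → ι → R) (I J : Multiset ι) : R :=
  pot d (fun i => pot d' (g i) J) I

/-- The derivatives of a metric of positive order: the components with one unbarred and one barred
index, which are those of the metric itself, are replaced by zero. -/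
noncomputable def tensPos (d d' : ι → Derivation ℂ R R) (g : ι → ι → R) (I J : Multiset ι) : R :=
  if Multiset.card I = 1 ∧ Multiset.card J = 1 then 0 else tens d d' g I J

/-- The tensor at the distinguished vertex of a pointed graph. -/
noncomputable def pointTens (d d' : ι → Derivation ℂ R R) (u₁ u₂ : R) (I J : Multiset ι) : R :=
  it d' J u₁ * it d I u₂

/-- The inverse of the transposed matrix of a metric, with which indices are contracted. -/
noncomputable def invMetric (g : ι → ι → R) (i j : ι) : R := (Matrix.of g).transpose⁻¹ i j

/-- The graph sum of weight `k` for the two functions `u₁` and `u₂`, in arbitrary coordinates. All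
strongly connected graphs contribute, with derivatives of the metric of positive order at the
ordinary vertices, and the edges are contracted with the inverse metric. -/
noncomputable def locSum (d d' : ι → Derivation ℂ R R) (g : ι → ι → R) (k : ℕ) (u₁ u₂ : R) : R :=
  graphTotal k (invMetric g) (tensPos d d' g) (pointTens d d' u₁ u₂)

/-- An invertible matrix with the symmetries `∂ₖ g_{i j̄} = ∂ᵢ g_{k j̄}` and `∂̄ₖ g_{i j̄} = ∂̄ⱼ
g_{i k̄}`, which express that the Kähler form is closed. -/
structure IsKahler (d d' : ι → Derivation ℂ R R) (g : ι → ι → R) : Prop where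
  closed : ∀ i j k, d k (g i j) = d i (g k j)
  closed' : ∀ i j k, d' k (g i j) = d' j (g i k)
  unit : IsUnit (Matrix.of g).det

theorem tens_zero_left (d d' : ι → Derivation ℂ R R) (g : ι → ι → R) (J : Multiset ι) :
    tens d d' g 0 J = 0 := pot_zero _ _

theorem tens_zero_right (d d' : ι → Derivation ℂ R R) (g : ι → ι → R) (I : Multiset ι) :
    tens d d' g I 0 = 0 := by
  unfold tens
  simp only [pot_zero]
  unfold pot
  split
  · rfl
  · rw [it_map_zero]

section

variable {d d' : ι → Derivation ℂ R R} {g : ι → ι → R}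

theorem invMetric_mul (hg : IsUnit (Matrix.of g).det) (i m : ι) :
    ∑ j, invMetric g i j * g m j = if i = m then 1 else 0 := by
  have h : (Matrix.of g).transpose⁻¹ * (Matrix.of g).transpose = 1 :=
    Matrix.nonsing_inv_mul _ (by rwa [Matrix.det_transpose])
  have h1 := congrFun (congrFun h i) m
  rwa [Matrix.mul_apply, Matrix.one_apply] at h1

theorem map_isUnit_det (π : R →ₐ[ℂ] R') (hg : IsUnit (Matrix.of g).det) :
    IsUnit (Matrix.of fun i j => π (g i j)).det := by
  have : (Matrix.of fun i j => π (g i j)) = (π : R →+* R').mapMatrix (Matrix.of g) := rfl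
  rw [this, ← RingHom.map_det]
  exact hg.map _

theorem map_invMetric (π : R →ₐ[ℂ] R') (hg : IsUnit (Matrix.of g).det) (i j : ι) :
    π (invMetric g i j) = invMetric (fun i j => π (g i j)) i j := by
  have h : (Matrix.of g).transpose⁻¹ * (Matrix.of g).transpose = 1 :=
    Matrix.nonsing_inv_mul _ (by rwa [Matrix.det_transpose])
  have h2 := congrArg (π : R →+* R').mapMatrix h
  rw [map_mul, map_one] at h2
  have h3 := Matrix.inv_eq_left_inv h2
  exact (congrFun (congrFun h3 i) j).symm

theorem tens_map {e e' : ι → Derivation ℂ R' R'} (π : R →ₐ[ℂ] R')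
    (h : ∀ i x, π (d i x) = e i (π x)) (h' : ∀ i x, π (d' i x) = e' i (π x)) (I J : Multiset ι) :
    π (tens d d' g I J) = tens e e' (fun i j => π (g i j)) I J := by
  have h1 := fun X I => pot_map (d := d) (e := e) π.toLinearMap h X I
  have h2 := fun X I => pot_map (d := d') (e := e') π.toLinearMap h' X I
  simp only [AlgHom.toLinearMap_apply] at h1 h2
  unfold tens
  rw [h1]
  simp only [h2]

theorem tensPos_map {e e' : ι → Derivation ℂ R' R'} (π : R →ₐ[ℂ] R')
    (h : ∀ i x, π (d i x) = e i (π x)) (h' : ∀ i x, π (d' i x) = e' i (π x)) (I J : Multiset ι) :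
    π (tensPos d d' g I J) = tensPos e e' (fun i j => π (g i j)) I J := by
  unfold tensPos
  split_ifs
  · simp
  · exact tens_map π h h' I J

/-- Graph sums commute with restrictions. -/
theorem map_locSum {e e' : ι → Derivation ℂ R' R'} (π : R →ₐ[ℂ] R')
    (h : ∀ i x, π (d i x) = e i (π x)) (h' : ∀ i x, π (d' i x) = e' i (π x))
    (hg : IsUnit (Matrix.of g).det) (k : ℕ) (u₁ u₂ : R) :
    π (locSum d d' g k u₁ u₂) = locSum e e' (fun i j => π (g i j)) k (π u₁) (π u₂) := by
  have h1 := fun X I => it_map (d := d) (e := e) π.toLinearMap h I X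
  have h2 := fun X I => it_map (d := d') (e := e') π.toLinearMap h' I X
  simp only [AlgHom.toLinearMap_apply] at h1 h2
  unfold locSum
  rw [map_graphTotal]
  congr 1
  · ext i j
    exact map_invMetric π hg i j
  · ext I J
    exact tensPos_map π h h' I J
  · ext I J
    rw [pointTens, map_mul, h1, h2]
    rfl

theorem tens_cons_cons (hd : CommDer d d') (hg : IsKahler d d' g) (i j : ι) (I J : Multiset ι) :
    tens d d' g (i ::ₘ I) (j ::ₘ J) = it d I (it d' J (g i j)) := by
  unfold tens
  rw [pot_cons hd.comm, pot_cons hd.comm' fun _ _ => hg.closed' _ _ _]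
  intro i k
  rw [pot_comm_derivation (d k) (hd.mixed k), pot_comm_derivation (d i) (hd.mixed i)]
  simp only [hg.closed]

theorem tens_single (hd : CommDer d d') (hg : IsKahler d d' g) (i j : ι) :
    tens d d' g {i} {j} = g i j := by
  rw [← Multiset.cons_zero, ← Multiset.cons_zero, tens_cons_cons hd hg, it_zero, it_zero]

theorem tens_eq (hd : CommDer d d') (hg : IsKahler d d' g) (I J : Multiset ι) :
    tens d d' g I J = tensPos d d' g I J + singleTensor g I J := by
  unfold tensPos
  split_ifs with h
  · obtain ⟨i, rfl⟩ := Multiset.card_eq_one.1 h.1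
    obtain ⟨j, rfl⟩ := Multiset.card_eq_one.1 h.2
    rw [tens_single hd hg, singleTensor_single, zero_add]
  · rw [singleTensor_eq_zero _ (by tauto), add_zero]

theorem closed_pot (hd : CommDer d d') (hg : IsKahler d d' g) (J : Multiset ι) (i k : ι) :
    d k (pot d' (g i) J) = d i (pot d' (g k) J) := by
  rw [pot_comm_derivation (d k) (hd.mixed k), pot_comm_derivation (d i) (hd.mixed i)]
  simp only [hg.closed]

theorem it_tens (hd : CommDer d d') (hg : IsKahler d d' g) {I : Multiset ι} (J m : Multiset ι)
    (hI : I ≠ 0) : it d m (tens d d' g I J) = tens d d' g (I + m) J :=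
  it_pot hd.comm (closed_pot hd hg J) hI m

theorem it_tens' (hd : CommDer d d') (hg : IsKahler d d' g) (I : Multiset ι) {J : Multiset ι}
    (m : Multiset ι) (hJ : J ≠ 0) : it d' m (tens d d' g I J) = tens d d' g I (J + m) := by
  rcases eq_or_ne I 0 with rfl | hI
  · rw [tens_zero_left, tens_zero_left, it_map_zero]
  obtain ⟨i, hi⟩ := Multiset.exists_mem_of_ne_zero hI
  obtain ⟨I, rfl⟩ := Multiset.exists_cons_of_mem hi
  unfold tens
  rw [pot_cons hd.comm (closed_pot hd hg J), pot_cons hd.comm (closed_pot hd hg _),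
    ← hd.it_it, it_pot hd.comm' (fun _ _ => hg.closed' _ _ _) hJ]

theorem IsKahler.swap (hg : IsKahler d d' g) : IsKahler d' d fun i j => g j i :=
  ⟨fun i j k => hg.closed' j i k, fun i j k => hg.closed j i k, by
    have : (Matrix.of fun i j => g j i) = (Matrix.of g).transpose := rfl
    rw [this, Matrix.det_transpose]
    exact hg.unit⟩

theorem tens_swap (hd : CommDer d d') (hg : IsKahler d d' g) (I J : Multiset ι) :
    tens d' d (fun i j => g j i) J I = tens d d' g I J := by
  rcases eq_or_ne I 0 with rfl | hI
  · rw [tens_zero_left, tens_zero_right]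
  rcases eq_or_ne J 0 with rfl | hJ
  · rw [tens_zero_left, tens_zero_right]
  obtain ⟨i, hi⟩ := Multiset.exists_mem_of_ne_zero hI
  obtain ⟨I, rfl⟩ := Multiset.exists_cons_of_mem hi
  obtain ⟨j, hj⟩ := Multiset.exists_mem_of_ne_zero hJ
  obtain ⟨J, rfl⟩ := Multiset.exists_cons_of_mem hj
  rw [tens_cons_cons hd hg, tens_cons_cons hd.swap hg.swap, hd.it_it]

end

/-! ### Changes of coordinates: linear maps -/

section Linear

variable {d d' : ι → Derivation ℂ R R} {e e' : ι → Derivation ℂ R' R'}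

theorem tens_linear_change (hd : CommDer d d') (he : CommDer e e') (π : R →ₐ[ℂ] R')
    (L Lb : ι → ι → ℂ) (h : ∀ i x, e i (π x) = ∑ k, L i k • π (d k x))
    (h' : ∀ i x, e' i (π x) = ∑ k, Lb i k • π (d' k x)) {g : ι → ι → R} {g' : ι → ι → R'}
    (hg : IsKahler d d' g) (hg' : IsKahler e e' g')
    (hgg' : ∀ i j, g' i j = ∑ k, ∑ l, (L i k * Lb j l) • π (g k l)) :
    LinChange (fun i k => algebraMap ℂ R' (L i k)) (fun i k => algebraMap ℂ R' (Lb i k))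
      (fun I J => π (tens d d' g I J)) (tens e e' g') := by
  intro S T _ _ _ _ a b
  have h1 : ∀ i, pot e' (g' i) (univ.val.map b) = ∑ k, L i k • π.toLinearMap
      (∑ c : T → ι, (∏ x, Lb (b x) (c x)) • pot d' (g k) (univ.val.map c)) := by
    intro i
    rw [pot_linear_change hd.comm' he.comm' π.toLinearMap Lb h'
      (X := fun l => ∑ k, L i k • g k l) (fun l m => ?_) (fun l m => hg'.closed' _ _ _)
      (fun l => ?_) T b]
    · simp only [pot_sum, pot_smul, map_sum, map_smul, smul_sum]
      rw [sum_comm]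
      refine sum_congr rfl fun k _ => sum_congr rfl fun c _ => ?_
      rw [smul_comm]
    · simp only [map_sum, Derivation.map_smul, hg.closed' _ l m]
    · rw [hgg', sum_comm]
      simp only [map_sum, map_smul, smul_sum, smul_smul]
      refine sum_congr rfl fun k _ => sum_congr rfl fun c _ => ?_
      rw [mul_comm]; rfl
  have h2 := pot_linear_change hd.comm he.comm π.toLinearMap L h
    (X := fun k => ∑ c : T → ι, (∏ x, Lb (b x) (c x)) • pot d' (g k) (univ.val.map c))
    (Y := fun i => pot e' (g' i) (univ.val.map b)) (fun i k => ?_)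
    (fun i k => closed_pot he hg' _ _ _) h1 S a
  · change pot e _ _ = _
    rw [h2]
    simp only [pot_sum, pot_smul, map_sum, map_smul, smul_sum, smul_smul]
    refine sum_congr rfl fun c _ => sum_congr rfl fun c' _ => ?_
    rw [Algebra.smul_def, map_mul, map_prod, map_prod]
    rfl
  · simp only [map_sum, Derivation.map_smul, closed_pot hd hg _ i k]

/-- Graph sums do not change under linear changes of coordinates. -/
theorem locSum_linear_change (hd : CommDer d d') (he : CommDer e e') (π : R →ₐ[ℂ] R')
    (L Lb : ι → ι → ℂ) (h : ∀ i x, e i (π x) = ∑ k, L i k • π (d k x))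
    (h' : ∀ i x, e' i (π x) = ∑ k, Lb i k • π (d' k x)) {g : ι → ι → R} {g' : ι → ι → R'}
    (hg : IsKahler d d' g) (hg' : IsKahler e e' g')
    (hgg' : ∀ i j, g' i j = ∑ k, ∑ l, (L i k * Lb j l) • π (g k l)) (k : ℕ) (u₁ u₂ : R) :
    locSum e e' g' k (π u₁) (π u₂) = π (locSum d d' g k u₁ u₂) := by
  unfold locSum
  rw [map_graphTotal]
  refine graphTotal_linChange k (L := fun i k => algebraMap ℂ R' (L i k))
    (Lb := fun i k => algebraMap ℂ R' (Lb i k)) ?_ ?_ ?_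
  · intro c c'
    rw [map_invMetric π hg.unit]
    let A : Matrix ι ι R' := Matrix.of fun i k => algebraMap ℂ R' (L i k)
    let B : Matrix ι ι R' := Matrix.of fun i k => algebraMap ℂ R' (Lb i k)
    let G : Matrix ι ι R' := Matrix.of fun i j => π (g i j)
    have h1 : (Matrix.of g').transpose = B * (G.transpose * A.transpose) := by
      ext i j
      simp only [Matrix.transpose_apply, Matrix.of_apply, hgg', Matrix.mul_apply, A, B, G, mul_sum]
      rw [sum_comm]
      refine sum_congr rfl fun k _ => sum_congr rfl fun l _ => ?_
      rw [Algebra.smul_def, map_mul]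
      ring
    have h2 : (Matrix.of g').transpose * (Matrix.of g').transpose⁻¹ = 1 :=
      Matrix.mul_nonsing_inv _ (by rw [Matrix.det_transpose]; exact hg'.unit)
    rw [h1, Matrix.mul_assoc, mul_eq_one_comm, Matrix.mul_assoc, Matrix.mul_assoc, ← h1] at h2
    have h3 := Matrix.inv_eq_right_inv h2
    change _ = G.transpose⁻¹ c c'
    rw [h3]
    simp only [Matrix.mul_apply, Matrix.transpose_apply, mul_sum, A, B, Matrix.of_apply,
      invMetric]
    refine sum_congr rfl fun i _ => ?_
    refine sum_congr rfl fun j _ => ?_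
    ring
  · intro S T _ _ _ _ a b
    by_cases hST : Fintype.card S = 1 ∧ Fintype.card T = 1
    · simp [tensPos, hST]
    · have := tens_linear_change hd he π L Lb h h' hg hg' hgg' S T a b
      simpa [tensPos, hST] using this
  · intro S T _ _ _ _ a b
    have h1 := it_linear_change hd.comm he.comm π.toLinearMap L h S a u₂
    have h2 := it_linear_change hd.comm' he.comm' π.toLinearMap Lb h' T b u₁
    simp only [AlgHom.toLinearMap_apply] at h1 h2
    simp only [pointTens, h1, h2, sum_mul, mul_sum, map_mul]
    refine sum_congr rfl fun c _ => sum_congr rfl fun c' _ => ?_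
    simp only [Algebra.smul_def, map_prod]
    ring

end Linear

end Tensors

/-! ### Changes of coordinates: flows -/

section Flow

variable {ι R K : Type*} [CommRing R] [Algebra ℂ R]
  [CommRing K] [Algebra ℂ K] [Fintype ι] [DecidableEq ι]
  {d d' : ι → Derivation ℂ R R}

theorem map_lie (π : R →ₐ[ℂ] K) (ξ : ι → Multiset ι → R) (Φ : Multiset ι → Multiset ι → R)
    (I J : Multiset ι) :
    π (lie ξ Φ I J) = lie (fun m A => π (ξ m A)) (fun I J => π (Φ I J)) I J := by
  simp only [lie, map_multiset_sum, Multiset.map_map, Function.comp_def, map_sum, map_mul]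

theorem sum_it_mul (hd : ∀ i j x, d i (d j x) = d j (d i x)) (ξ : ι → R) (X : ι → R)
    (I : Multiset ι) : ∑ m, it d I (ξ m * X m) =
      (I.antidiagonal.map fun p => ∑ m, it d p.1 (ξ m) * it d p.2 (X m)).sum := by
  simp only [it_mul hd]
  induction I.antidiagonal using Multiset.induction_on with
  | empty => simp
  | cons p s ih => simp only [Multiset.map_cons, Multiset.sum_cons, sum_add_distrib, ih]

/-- The derivatives of `∑ m, ∂ᵢ (ξ m * g m j)`. The symmetry of the derivatives of `g` turns
derivatives of the `m`-th row of `g` into components of the tensor with the index `m`. -/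
theorem sum_it_eq_lie (hd : CommDer d d') {ξ : ι → R} (hξ : ∀ i m, d' i (ξ m) = 0)
    {g : ι → ι → R} (hg : IsKahler d d' g) (i j : ι) (I J : Multiset ι) :
    it d I (it d' J (∑ m, d i (ξ m * g m j))) =
      lie (fun m A => it d A (ξ m)) (tens d d' g) (i ::ₘ I) (j ::ₘ J) := by
  have h1 : it d I (it d' J (∑ m, d i (ξ m * g m j))) =
      ∑ m, it d (i ::ₘ I) (ξ m * it d' J (g m j)) := by
    rw [it_sum, it_sum]
    refine sum_congr rfl fun m _ => ?_
    rw [← hd.der_it, it_const_mul hd.comm' _ _ _ fun k _ => hξ k m, it_cons' hd.comm]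
  rw [h1, sum_it_mul hd.comm, lie]
  simp only [tens_cons_cons hd hg]

/-- The infinitesimal change of the derivatives of a metric. -/
theorem der_tens (hd : CommDer d d') (δ : Derivation ℂ R R) (hδ : ∀ i x, δ (d i x) = d i (δ x))
    (hδ' : ∀ i x, δ (d' i x) = d' i (δ x)) {ξ ξ' : ι → R} (hξ : ∀ i m, d' i (ξ m) = 0)
    (hξ' : ∀ i m, d i (ξ' m) = 0) {g : ι → ι → R} (hg : IsKahler d d' g)
    (hδg : ∀ i j, δ (g i j) = ∑ m, d i (ξ m * g m j) + ∑ m, d' j (ξ' m * g i m))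
    {I J : Multiset ι} (hI : I ≠ 0) (hJ : J ≠ 0) :
    δ (tens d d' g I J) = lie (fun m A => it d A (ξ m)) (tens d d' g) I J +
      lie (fun m A => it d' A (ξ' m)) (fun J I => tens d d' g I J) J I := by
  obtain ⟨i, hi⟩ := Multiset.exists_mem_of_ne_zero hI
  obtain ⟨I, rfl⟩ := Multiset.exists_cons_of_mem hi
  obtain ⟨j, hj⟩ := Multiset.exists_mem_of_ne_zero hJ
  obtain ⟨J, rfl⟩ := Multiset.exists_cons_of_mem hj
  rw [tens_cons_cons hd hg, it_comm_derivation δ hδ, it_comm_derivation δ hδ', hδg, it_add, it_add,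
    sum_it_eq_lie hd hξ hg]
  congr 1
  have h := sum_it_eq_lie hd.swap hξ' hg.swap j i J I
  rw [← hd.it_it] at h
  have h2 : tens d' d (fun i j => g j i) = fun J I => tens d d' g I J := by
    ext J I
    exact tens_swap hd hg I J
  rw [h, h2]

theorem der_it_eq_lie (hd : CommDer d d') (δ : Derivation ℂ R R)
    (hδ : ∀ i x, δ (d i x) = d i (δ x)) {ξ ξ' : ι → R} (hξ' : ∀ i m, d i (ξ' m) = 0) {u : R}
    (hu : δ u = ∑ m, ξ m * d m u + ∑ m, ξ' m * d' m u) (I : Multiset ι) :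
    δ (it d I u) = (I.antidiagonal.map fun p => ∑ m, it d p.1 (ξ m) * it d (m ::ₘ p.2) u).sum +
      ∑ m, ξ' m * it d I (d' m u) := by
  rw [it_comm_derivation δ hδ, hu, it_add, it_sum, sum_it_mul hd.comm, it_sum]
  congr 1
  · simp only [it_cons' hd.comm]
  · exact sum_congr rfl fun m _ => it_const_mul hd.comm _ _ _ fun k _ => hξ' k m

theorem lie_zero_left (ξ : ι → Multiset ι → K) (Φ : Multiset ι → Multiset ι → K)
    (hξ : ∀ m I, Multiset.card I ≤ 1 → ξ m I = 0) {I : Multiset ι} (hI : Multiset.card I ≤ 1)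
    (J : Multiset ι) : lie ξ Φ I J = 0 := by
  unfold lie
  refine Multiset.sum_eq_zero fun x hx => ?_
  obtain ⟨p, hp, rfl⟩ := Multiset.mem_map.1 hx
  refine sum_eq_zero fun m _ => ?_
  rw [Multiset.mem_antidiagonal] at hp
  have := congrArg Multiset.card hp
  rw [Multiset.card_add] at this
  rw [hξ m _ (by omega), zero_mul]

/-- Graph sums do not change under a flow of coordinate changes which agree up to first order at
a point. Here `R` is a ring of functions of the coordinates and of the time, `δ` is the derivative
with respect to the time, `ξ` is the vector field of the flow, and `π` is the restriction to a
fixed value of the coordinates. -/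
theorem der_locSum_eq_zero (hd : CommDer d d') {δ : Derivation ℂ R R}
    (hδ : ∀ i x, δ (d i x) = d i (δ x)) (hδ' : ∀ i x, δ (d' i x) = d' i (δ x)) {ξ ξ' : ι → R}
    (hξ : ∀ i m, d' i (ξ m) = 0) (hξ' : ∀ i m, d i (ξ' m) = 0) {g : ι → ι → R}
    (hg : IsKahler d d' g)
    (hδg : ∀ i j, δ (g i j) = ∑ m, d i (ξ m * g m j) + ∑ m, d' j (ξ' m * g i m))
    {u₁ u₂ : R} (hu₁ : δ u₁ = ∑ m, ξ m * d m u₁ + ∑ m, ξ' m * d' m u₁)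
    (hu₂ : δ u₂ = ∑ m, ξ m * d m u₂ + ∑ m, ξ' m * d' m u₂) (π : R →ₐ[ℂ] K)
    {δ₀ : Derivation ℂ K K} (hπ : ∀ x, π (δ x) = δ₀ (π x))
    (h0 : ∀ m, π (ξ m) = 0) (h0' : ∀ m, π (ξ' m) = 0) (h1 : ∀ i m, π (d i (ξ m)) = 0)
    (h1' : ∀ i m, π (d' i (ξ' m)) = 0) (k : ℕ) : δ₀ (π (locSum d d' g k u₁ u₂)) = 0 := by
  have hξ1 : ∀ m I, Multiset.card I ≤ 1 → π (it d I (ξ m)) = 0 := by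
    intro m I hI
    rcases Nat.le_one_iff_eq_zero_or_eq_one.1 hI with h | h
    · rw [Multiset.card_eq_zero.1 h, it_zero, h0]
    · obtain ⟨i, rfl⟩ := Multiset.card_eq_one.1 h
      rw [it_singleton hd.comm, h1]
  have hξ1' : ∀ m I, Multiset.card I ≤ 1 → π (it d' I (ξ' m)) = 0 := by
    intro m I hI
    rcases Nat.le_one_iff_eq_zero_or_eq_one.1 hI with h | h
    · rw [Multiset.card_eq_zero.1 h, it_zero, h0']
    · obtain ⟨i, rfl⟩ := Multiset.card_eq_one.1 h
      rw [it_singleton hd.comm', h1']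
  have hπg : ∀ i j, δ₀ (π (g i j)) = 0 := by
    intro i j
    rw [← hπ, hδg]
    simp [h0, h0', h1, h1']
  -- The metric at the point is constant in time, hence so is its inverse.
  have hM : ∀ i j, δ₀ (invMetric (fun i j => π (g i j)) i j) = 0 := by
    let M : Matrix ι ι K := (Matrix.of fun i j => π (g i j)).transpose⁻¹
    let N : Matrix ι ι K := Matrix.of fun i j => δ₀ (M i j)
    have hu : IsUnit ((Matrix.of fun i j => π (g i j)).transpose).det := by
      rw [Matrix.det_transpose]; exact map_isUnit_det π hg.unit
    have e1 : N * (Matrix.of fun i j => π (g i j)).transpose = 0 := by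
      ext i m
      have h := congrArg δ₀ (invMetric_mul (map_isUnit_det π hg.unit) i m)
      rw [map_sum] at h
      simp only [Derivation.leibniz, hπg, smul_zero, zero_add, smul_eq_mul] at h
      rw [Matrix.mul_apply, Matrix.zero_apply]
      have h2 : δ₀ (if i = m then (1 : K) else 0) = 0 := by split_ifs <;> simp
      rw [h2] at h
      rw [← h]
      refine sum_congr rfl fun j _ => ?_
      rw [mul_zero, zero_add, mul_comm]
      rfl
    have e2 : N = 0 := by
      have := congrArg (· * (Matrix.of fun i j => π (g i j)).transpose⁻¹) e1
      simp only [Matrix.mul_assoc, Matrix.mul_nonsing_inv _ hu, Matrix.mul_one,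
        Matrix.zero_mul] at this
      exact this
    exact fun i j => congrFun (congrFun e2 i) j
  let Ξ : ι → Multiset ι → K := fun m A => π (it d A (ξ m))
  let Ξ' : ι → Multiset ι → K := fun m A => π (it d' A (ξ' m))
  let P : Multiset ι → Multiset ι → K := fun I J => π (tensPos d d' g I J)
  let F : Multiset ι → Multiset ι → K := fun I J => π (pointTens d d' u₁ u₂ I J)
  let G : ι → ι → K := fun i j => π (g i j)
  have hP : ∀ I J, Multiset.card I = 1 → Multiset.card J = 1 → P I J = 0 := by
    intro I J hI hJ
    simp [P, tensPos, hI, hJ]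
  have hsing : ∀ I J, π (singleTensor g I J) = singleTensor G I J := by
    intro I J
    simp only [singleTensor, map_sum, G]
    refine sum_congr rfl fun i _ => sum_congr rfl fun j _ => ?_
    split_ifs <;> simp
  have hT : ∀ I J, π (tens d d' g I J) = P I J + singleTensor G I J := by
    intro I J
    rw [tens_eq hd hg, map_add, hsing]
  -- The derivative of the tensors at the vertices. Where `tensPos` vanishes by definition, the
  -- right hand side vanishes since the fields vanish up to first order.
  have dP : ∀ I J, δ₀ (P I J) = lie Ξ (fun I J => P I J + singleTensor G I J) I J +
      lie Ξ' (fun J I => P I J + singleTensor G I J) J I := by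
    intro I J
    by_cases hc : Multiset.card I = 0 ∨ Multiset.card J = 0 ∨
        (Multiset.card I = 1 ∧ Multiset.card J = 1)
    · have hz : P I J = 0 := by
        rcases hc with h | h | h
        · rw [Multiset.card_eq_zero.1 h]
          simp [P, tensPos, tens_zero_left]
        · rw [Multiset.card_eq_zero.1 h]
          simp [P, tensPos, tens_zero_right]
        · exact hP I J h.1 h.2
      have z1 : lie Ξ (fun I J => P I J + singleTensor G I J) I J = 0 := by
        rcases hc with h | h | h
        · exact lie_zero_left _ _ hξ1 (by omega) _
        · simp only [← hT]
          rw [Multiset.card_eq_zero.1 h]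
          simp [lie, tens_zero_right]
        · exact lie_zero_left _ _ hξ1 (by omega) _
      have z2 : lie Ξ' (fun J I => P I J + singleTensor G I J) J I = 0 := by
        rcases hc with h | h | h
        · simp only [← hT]
          rw [Multiset.card_eq_zero.1 h]
          simp [lie, tens_zero_left]
        · exact lie_zero_left _ _ hξ1' (by omega) _
        · exact lie_zero_left _ _ hξ1' (by omega) _
      rw [hz, z1, z2, map_zero, add_zero]
    · push Not at hc
      have h2 : tensPos d d' g I J = tens d d' g I J := by
        unfold tensPos
        rw [if_neg]
        tauto
      have hI : I ≠ 0 := fun h => hc.1 (by simp [h])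
      have hJ : J ≠ 0 := fun h => hc.2.1 (by simp [h])
      simp only [P, h2]
      rw [← hπ, der_tens hd δ hδ hδ' hξ hξ' hg hδg hI hJ, map_add, map_lie, map_lie]
      simp only [hT]
      rfl
  -- The derivative of the tensor at the distinguished vertex.
  have dF : ∀ I J, δ₀ (F I J) = lie Ξ F I J + lie Ξ' (fun J I => F I J) J I := by
    intro I J
    have e2 := der_it_eq_lie hd δ hδ hξ' hu₂ I
    have e1 := der_it_eq_lie hd.swap δ hδ' (ξ := ξ') (ξ' := ξ) hξ (by rw [hu₁, add_comm]) J
    simp only [F, pointTens]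
    rw [← hπ, Derivation.leibniz, e1, e2]
    simp only [smul_eq_mul, map_add, map_mul, map_sum, h0, h0', zero_mul, sum_const_zero, add_zero]
    simp only [lie, map_multiset_sum, Multiset.map_map, Function.comp_def, map_sum, map_mul]
    rw [← Multiset.sum_map_mul_left, ← Multiset.sum_map_mul_left]
    simp only [mul_sum, Ξ, Ξ', mul_left_comm, mul_comm, mul_assoc]
  -- The holomorphic and the antiholomorphic part of the derivative vanish separately; the latter is
  -- the former for the graphs with reversed edges.
  unfold locSum
  rw [map_graphTotal, derivation_graphTotal]
  · have hinv : ∀ i m, ∑ j, invMetric G i j * G m j = if i = m then 1 else 0 := fun i m =>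
      invMetric_mul (map_isUnit_det π hg.unit) i m
    have hinv' : ∀ i m, ∑ j, invMetric G j i * G j m = if i = m then 1 else 0 := by
      have hu := map_isUnit_det π hg.unit
      have h : (Matrix.of G).transpose * (Matrix.of G).transpose⁻¹ = 1 :=
        Matrix.mul_nonsing_inv _ (by rwa [Matrix.det_transpose])
      intro i m
      have h1 := congrFun (congrFun h m) i
      rw [Matrix.mul_apply, Matrix.one_apply] at h1
      simp only [eq_comm (a := i)]
      rw [← h1]
      exact sum_congr rfl fun j _ => mul_comm _ _
    have s1 := sum_dgsum_lie (K := K) hinv hξ1 hP F k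
    have s2 := sum_dgsum_lie (K := K) (M := fun i j => invMetric G j i) (g := fun i j => G j i)
      hinv' hξ1' (Φ := fun I J => P J I) (fun I J hI hJ => hP J I hJ hI) (fun I J => F J I) k
    have hs : ∀ I J, singleTensor (fun i j => G j i) I J = singleTensor G J I := by
      intro I J
      unfold singleTensor
      rw [sum_comm]
      simp only [and_comm]
    simp only [hs] at s2
    have s3 : ∀ p, dgsum (Fin p) (Fin (p + k)) (fun i j => invMetric G j i) (fun I J => P J I)
        (fun I J => F J I) (lie Ξ' fun I J => P J I + singleTensor G J I)
        (lie Ξ' fun I J => F J I) = dgsum (Fin p) (Fin (p + k)) (invMetric G) P F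
        (fun I J => lie Ξ' (fun J I => P I J + singleTensor G I J) J I)
        fun I J => lie Ξ' (fun J I => F I J) J I := by
      intro p
      exact dgsum_rev (V := Fin p) (E := Fin (p + k)) (invMetric G) P F
        (fun I J => lie Ξ' (fun J I => P I J + singleTensor G I J) J I)
        fun I J => lie Ξ' (fun J I => F I J) J I
    have hM' : (fun i j => π (invMetric g i j)) = invMetric G := by
      ext i j
      exact map_invMetric π hg.unit i j
    have hdP : (fun I J => δ₀ (π (tensPos d d' g I J))) = fun I J =>
        lie Ξ (fun I J => P I J + singleTensor G I J) I J +
        lie Ξ' (fun J I => P I J + singleTensor G I J) J I := by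
      ext I J; exact dP I J
    have hdF : (fun I J => δ₀ (π (pointTens d d' u₁ u₂ I J))) = fun I J =>
        lie Ξ F I J + lie Ξ' (fun J I => F I J) J I := by
      ext I J; exact dF I J
    rw [hM', hdP, hdF]
    simp only [dgsum_add, smul_add, sum_add_distrib]
    rw [sum_congr rfl fun p _ => congrArg _ (s3 p)] at s2
    exact (congrArg₂ (· + ·) s1 s2).trans (add_zero 0)
  · intro i j
    rw [map_invMetric π hg.unit]
    exact hM i j

end Flow

/-! ### Pulling back a Kähler metric -/

section PullBack

open TopologicalSpace (Opens)

open Fn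

theorem sum_rotate {α A : Type*} [Fintype α] [AddCommMonoid A] (f : α → α → α → A) :
    ∑ k, ∑ l, ∑ m, f k l m = ∑ m, ∑ k, ∑ l, f k l m := by
  exact (sum_congr rfl fun k _ => sum_comm).trans sum_comm

theorem eq_zero_of_sum_mul_eq_zero {ι K : Type*} [CommRing K] [Fintype ι] [DecidableEq ι]
    {P : ι → ι → K} (hP : IsUnit (Matrix.of P).det) {x : ι → K} (hx : ∀ k, ∑ m, x m * P m k = 0) :
    x = 0 := by
  have h1 : Matrix.vecMul x (Matrix.of P) = 0 := funext hx
  have h2 := congrArg (fun y => Matrix.vecMul y (Matrix.of P)⁻¹) h1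
  simpa [Matrix.vecMul_vecMul, Matrix.mul_nonsing_inv _ hP] using h2

variable {E : Type*} [NormedAddCommGroup E] [NormedSpace ℝ E] {n : ℕ} {Ω : Opens E}
  {U : Opens (Fin n → ℂ)} (ℓ : (Fin n → ℂ) →L[ℝ] E)

theorem commDer : CommDer (D ℓ : Fin n → Derivation ℂ (Fn Ω) (Fn Ω)) (Db ℓ) :=
  ⟨D_comm ℓ, Db_comm ℓ, D_Db_comm ℓ⟩

/-- The components of the pull-back of a metric under a map `H`, which is meant to be holomorphic in
the coordinates given by `ℓ`. -/
noncomputable def pullMetric (H : E → Fin n → ℂ) (hH : ContDiffOn ℝ ∞ H Ω)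
    (hU : ∀ x : Ω, H x ∈ U) (g : Fin n → Fin n → Fn U) (i j : Fin n) : Fn Ω :=
  ∑ k, ∑ l, pull H hH hU (g k l) * (D ℓ i (coords H hH k) * conj (D ℓ j (coords H hH l)))

variable {ℓ} {H : E → Fin n → ℂ} {hH : ContDiffOn ℝ ∞ H Ω} {hU : ∀ x : Ω, H x ∈ U}

theorem D_pull (hol : ∀ i k, Db ℓ i (coords H hH k) = 0) (i : Fin n) (u : Fn U) :
    D ℓ i (pull H hH hU u) =
    ∑ k, pull H hH hU (D (.id ℝ _) k u) * D ℓ i (coords H hH k) := by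
  conv_lhs => rw [D, der_pull]
  refine sum_congr rfl fun k _ => ?_
  change _ * D ℓ i (coords H hH k) + _ * D ℓ i (conj (coords H hH k)) = _
  rw [D_conj, hol, conj_zero, mul_zero, add_zero]

theorem Db_pull (hol : ∀ i k, Db ℓ i (coords H hH k) = 0) (i : Fin n) (u : Fn U) :
    Db ℓ i (pull H hH hU u) =
    ∑ k, pull H hH hU (Db (.id ℝ _) k u) * conj (D ℓ i (coords H hH k)) := by
  conv_lhs => rw [Db, der_pull]
  refine sum_congr rfl fun k _ => ?_
  change _ * Db ℓ i (coords H hH k) + _ * Db ℓ i (conj (coords H hH k)) = _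
  rw [Db_conj, hol, mul_zero, zero_add]

theorem Db_D_coords (hol : ∀ i k, Db ℓ i (coords H hH k) = 0) (i j k : Fin n) :
    Db ℓ i (D ℓ j (coords H hH k)) = 0 := by
  rw [← D_Db_comm, hol, map_zero]

theorem D_conj_D_coords (hol : ∀ i k, Db ℓ i (coords H hH k) = 0) (i j k : Fin n) :
    D ℓ i (conj (D ℓ j (coords H hH k))) = 0 := by
  rw [D_conj, Db_D_coords hol, conj_zero]

theorem pullMetric_isKahler (hol : ∀ i k, Db ℓ i (coords H hH k) = 0)
    (hP : IsUnit (Matrix.of fun i k => D ℓ i (coords H hH k)).det)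
    {g : Fin n → Fin n → Fn U} (hg : IsKahler (D (.id ℝ _)) (Db (.id ℝ _)) g) :
    IsKahler (D ℓ) (Db ℓ) (pullMetric ℓ H hH hU g) := by
  refine ⟨fun i j k => ?_, fun i j k => ?_, ?_⟩
  · have key : ∀ k i, D ℓ k (pullMetric ℓ H hH hU g i j) = ∑ l, ∑ a,
        (∑ b, pull H hH hU (D (.id ℝ _) b (g a l)) * D ℓ k (coords H hH b) *
          D ℓ i (coords H hH a) * conj (D ℓ j (coords H hH l)) +
        pull H hH hU (g a l) * D ℓ k (D ℓ i (coords H hH a)) *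
          conj (D ℓ j (coords H hH l))) := by
      intro k i
      unfold pullMetric
      rw [sum_comm, map_sum]
      refine sum_congr rfl fun l _ => ?_
      rw [map_sum]
      refine sum_congr rfl fun a _ => ?_
      rw [Derivation.leibniz, Derivation.leibniz, D_conj_D_coords hol, D_pull hol]
      simp only [smul_eq_mul, mul_zero, zero_add, mul_sum]
      rw [add_comm]
      congr 1
      · exact sum_congr rfl fun b _ => by ring
      · ring
    rw [key, key]
    refine sum_congr rfl fun l _ => ?_
    rw [sum_add_distrib, sum_add_distrib]
    congr 1
    · rw [sum_comm]
      refine sum_congr rfl fun a _ => sum_congr rfl fun b _ => ?_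
      rw [hg.closed b l a]
      ring
    · refine sum_congr rfl fun a _ => ?_
      rw [D_comm]
  · have key : ∀ k j, Db ℓ k (pullMetric ℓ H hH hU g i j) = ∑ a, ∑ l,
        (∑ b, pull H hH hU (Db (.id ℝ _) b (g a l)) * conj (D ℓ k (coords H hH b)) *
          D ℓ i (coords H hH a) * conj (D ℓ j (coords H hH l)) +
        pull H hH hU (g a l) * D ℓ i (coords H hH a) *
          conj (D ℓ k (D ℓ j (coords H hH l)))) := by
      intro k j
      unfold pullMetric
      rw [map_sum]
      refine sum_congr rfl fun a _ => ?_
      rw [map_sum]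
      refine sum_congr rfl fun l _ => ?_
      rw [Derivation.leibniz, Derivation.leibniz, Db_D_coords hol, Db_pull hol, Db_conj]
      simp only [smul_eq_mul, mul_zero, zero_add, add_zero, mul_sum]
      rw [add_comm]
      congr 1
      · exact sum_congr rfl fun b _ => by ring
      · ring
    rw [key, key]
    refine sum_congr rfl fun a _ => ?_
    rw [sum_add_distrib, sum_add_distrib]
    congr 1
    · rw [sum_comm]
      refine sum_congr rfl fun l _ => sum_congr rfl fun b _ => ?_
      rw [hg.closed' a b l]
      ring
    · refine sum_congr rfl fun l _ => ?_
      rw [D_comm]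
  · let A : Matrix (Fin n) (Fin n) (Fn Ω) := Matrix.of fun i k => D ℓ i (coords H hH k)
    let B : Matrix (Fin n) (Fin n) (Fn Ω) := Matrix.of fun i k => conj (D ℓ i (coords H hH k))
    let G : Matrix (Fin n) (Fin n) (Fn Ω) := Matrix.of fun i k => pull H hH hU (g i k)
    have h1 : Matrix.of (pullMetric ℓ H hH hU g) = A * (G * B.transpose) := by
      ext1 i j
      simp only [Matrix.of_apply, pullMetric, Matrix.mul_apply, Matrix.transpose_apply, A, B, G,
        mul_sum]
      refine sum_congr rfl fun a _ => sum_congr rfl fun l _ => ?_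
      ring
    have h2 : IsUnit B.det := by
      let c : Fn Ω →+* Fn Ω := RingHom.mk' ⟨⟨conj, Subtype.ext (funext fun x => by simp)⟩, Fn.conj_mul⟩
        conj_add
      have : B = c.mapMatrix A := rfl
      rw [this, ← RingHom.map_det]
      exact hP.map c
    rw [h1, Matrix.det_mul, Matrix.det_mul, Matrix.det_transpose]
    exact hP.mul ((map_isUnit_det (pull H hH hU) hg.unit).mul h2)

/-- A derivation for which functions of `H` are constants acts on the pull-back of a metric through
the derivatives of `H` only. -/
theorem der_pullMetric (η : Derivation ℂ (Fn Ω) (Fn Ω)) {a a' : Fin n → Fin n → Fn Ω}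
    (h1 : ∀ u : Fn U, η (pull H hH hU u) = 0)
    (h2 : ∀ i k, η (D ℓ i (coords H hH k)) = ∑ m, a i m * D ℓ m (coords H hH k))
    (h3 : ∀ j l, η (conj (D ℓ j (coords H hH l))) = ∑ m, a' j m * conj (D ℓ m (coords H hH l)))
    (g : Fin n → Fin n → Fn U) (i j : Fin n) :
    η (pullMetric ℓ H hH hU g i j) = ∑ m, a i m * pullMetric ℓ H hH hU g m j +
      ∑ m, a' j m * pullMetric ℓ H hH hU g i m := by
  have e1 : η (pullMetric ℓ H hH hU g i j) =
      ∑ k, ∑ l, ∑ m, a i m *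
        (pull H hH hU (g k l) * (D ℓ m (coords H hH k) * conj (D ℓ j (coords H hH l)))) +
      ∑ k, ∑ l, ∑ m, a' j m *
        (pull H hH hU (g k l) * (D ℓ i (coords H hH k) * conj (D ℓ m (coords H hH l)))) := by
    unfold pullMetric
    rw [map_sum, ← sum_add_distrib]
    refine sum_congr rfl fun k _ => ?_
    rw [map_sum, ← sum_add_distrib]
    refine sum_congr rfl fun l _ => ?_
    rw [Derivation.leibniz, Derivation.leibniz, h1, h2, h3, smul_zero, add_zero, add_comm]
    simp only [smul_eq_mul, mul_sum, mul_add]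
    refine congrArg₂ _ (sum_congr rfl fun m _ => ?_) (sum_congr rfl fun m _ => ?_) <;> ring
  rw [e1]
  simp only [pullMetric, mul_sum]
  refine congrArg₂ (· + ·) ?_ ?_ <;> rw [sum_rotate]

/-- Graph sums do not change under a holomorphic flow: `H` is a family of holomorphic maps, the
derivative with respect to the time being that in the direction `v`. The hypotheses on `π` say that
the flow is trivial up to first order at a point. -/
theorem der_locSum_pullMetric_eq_zero (hol : ∀ i k, Db ℓ i (coords H hH k) = 0)
    (hP : IsUnit (Matrix.of fun i k => D ℓ i (coords H hH k)).det)
    {g : Fin n → Fin n → Fn U} (hg : IsKahler (D (.id ℝ _)) (Db (.id ℝ _)) g) (v : E)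
    {K : Type*} [CommRing K] [Algebra ℂ K] (π : Fn Ω →ₐ[ℂ] K)
    {δ₀ : Derivation ℂ K K} (hπ : ∀ x, π (dirDer v x) = δ₀ (π x))
    (hc : ∀ x, π x = 0 → π (conj x) = 0)
    (h0 : ∀ k, π (dirDer v (coords H hH k)) = 0)
    (h1 : ∀ i k, π (D ℓ i (dirDer v (coords H hH k))) = 0) (k : ℕ) (u₁ u₂ : Fn U) :
    δ₀ (π (locSum (D ℓ) (Db ℓ) (pullMetric ℓ H hH hU g) k (pull H hH hU u₁)
      (pull H hH hU u₂))) = 0 := by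
  -- The vector field `ξ` is obtained by expressing the velocity of the flow in the frame given by
  -- the derivatives of `H`.
  obtain ⟨ξ, hξτ⟩ : ∃ ξ : Fin n → Fn Ω, ∀ k, ∑ m, ξ m * D ℓ m (coords H hH k) =
      dirDer v (coords H hH k) := by
    refine ⟨Matrix.vecMul (fun k => dirDer v (coords H hH k))
      (Matrix.of fun i k => D ℓ i (coords H hH k))⁻¹, fun k => ?_⟩
    have : Matrix.vecMul (Matrix.vecMul (fun k => dirDer v (coords H hH k))
          (Matrix.of fun i k => D ℓ i (coords H hH k))⁻¹)
        (Matrix.of fun i k => D ℓ i (coords H hH k)) = fun k => dirDer v (coords H hH k) := by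
      rw [Matrix.vecMul_vecMul, Matrix.nonsing_inv_mul _ hP, Matrix.vecMul_one]
    exact congrFun this k
  have hτ : ∀ i k, Db ℓ i (dirDer v (coords H hH k)) = 0 := fun i k => by
    rw [← dirDer_Db, hol, map_zero]
  have hξ : ∀ i m, Db ℓ i (ξ m) = 0 := by
    intro i m
    refine congrFun (eq_zero_of_sum_mul_eq_zero hP (x := fun m => Db ℓ i (ξ m)) fun k => ?_) m
    have h := congrArg (Db ℓ i) (hξτ k)
    rw [hτ, map_sum] at h
    rw [← h]
    refine sum_congr rfl fun m _ => ?_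
    rw [Derivation.leibniz, Db_D_coords hol, smul_zero, zero_add, smul_eq_mul, mul_comm]
  have hξ' : ∀ i m, D ℓ i (conj (ξ m)) = 0 := fun i m => by rw [D_conj, hξ, conj_zero]
  have hDP : ∀ i m k, D ℓ i (D ℓ m (coords H hH k)) = D ℓ m (D ℓ i (coords H hH k)) :=
    fun i m k => D_comm ℓ _ _ _
  have hDτ : ∀ i k, D ℓ i (dirDer v (coords H hH k)) =
      ∑ m, (ξ m * D ℓ m (D ℓ i (coords H hH k)) + D ℓ i (ξ m) * D ℓ m (coords H hH k)) := by
    intro i k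
    rw [← hξτ, map_sum]
    refine sum_congr rfl fun m _ => ?_
    rw [Derivation.leibniz, smul_eq_mul, smul_eq_mul, hDP, mul_comm (D ℓ m (coords H hH k))]
  -- The derivation `η`, along the flow and back along `ξ`, does not move the values of `H`. Hence
  -- it annihilates all functions pulled back under `H`.
  obtain ⟨η, hη⟩ : ∃ η : Derivation ℂ (Fn Ω) (Fn Ω), ∀ x, η x = dirDer v x -
      ∑ m, ξ m * D ℓ m x - ∑ m, conj (ξ m) * Db ℓ m x := by
    refine ⟨dirDer v - ∑ m, ξ m • D ℓ m - ∑ m, conj (ξ m) • Db ℓ m, fun x => ?_⟩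
    simp only [Derivation.sub_apply]
    congr 1
    · congr 1
      rw [← Derivation.coeFnAddMonoidHom_apply, map_sum, Finset.sum_apply]
      rfl
    · rw [← Derivation.coeFnAddMonoidHom_apply, map_sum, Finset.sum_apply]
      rfl
  have hηc : ∀ x, η (conj x) = conj (η x) := by
    intro x
    have hsub : ∀ a b : Fn Ω, conj (a - b) = conj a - conj b := fun a b =>
      Subtype.ext (funext fun y => map_sub (starRingEnd ℂ) (a.1 y) (b.1 y))
    rw [hη, hη, hsub, hsub, conj_sum, conj_sum]
    simp only [Fn.conj_mul, conj_conj, D_conj, Db_conj, dirDer_conj]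
    ring
  have hηt : ∀ k, η (coords H hH k) = 0 := by
    intro k
    rw [hη]
    simp only [hol, mul_zero, sum_const_zero, sub_zero]
    exact sub_eq_zero.2 (hξτ k).symm
  have hηpull : ∀ u : Fn U, η (pull H hH hU u) = 0 := by
    intro u
    have e1 := der_pull H hH hU u 1 v 0 0
    rw [← dirDer_eq_der] at e1
    have e2 := fun k => hηt k
    have e3 : ∀ k, η (conj (coords H hH k)) = 0 := fun k => by rw [hηc, hηt, conj_zero]
    have e4 : η (pull H hH hU u) = ∑ k, (pull H hH hU (D (.id ℝ _) k u) * η (coords H hH k) +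
        pull H hH hU (Db (.id ℝ _) k u) * η (conj (coords H hH k))) := by
      rw [hη, e1]
      have f1 : ∀ m, D ℓ m (pull H hH hU u) = _ := fun m => der_pull H hH hU u _ _ _ _
      have f2 : ∀ m, Db ℓ m (pull H hH hU u) = _ := fun m => der_pull H hH hU u _ _ _ _
      have f3 : ∀ m, der (1 / 2) (ℓ (Pi.single m 1)) (-(1 / 2) * Complex.I)
        (ℓ (Pi.single m Complex.I)) = (D ℓ m : Derivation ℂ (Fn Ω) (Fn Ω)) := fun _ => rfl
      have f4 : ∀ m, der (1 / 2) (ℓ (Pi.single m 1)) (1 / 2 * Complex.I)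
        (ℓ (Pi.single m Complex.I)) = (Db ℓ m : Derivation ℂ (Fn Ω) (Fn Ω)) := fun _ => rfl
      have c : ∀ (X y : Fin n → Fn Ω) (z : Fin n → Fin n → Fn Ω),
          ∑ k, ∑ m, X k * (y m * z m k) = ∑ m, ∑ k, y m * (X k * z m k) := fun X y z => by
        rw [sum_comm]
        exact sum_congr rfl fun m _ => sum_congr rfl fun k _ => mul_left_comm _ _ _
      simp only [f1, f2, f3, f4, hη, mul_sum, mul_sub, mul_add, sum_add_distrib, sum_sub_distrib]
      rw [c _ ξ fun m k => D ℓ m (coords H hH k), c _ ξ fun m k => D ℓ m (conj (coords H hH k)),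
        c _ (fun m => conj (ξ m)) fun m k => Db ℓ m (coords H hH k),
        c _ (fun m => conj (ξ m)) fun m k => Db ℓ m (conj (coords H hH k))]
      ring
    rw [e4]
    simp [hηt, e3]
  have hηP : ∀ i k, η (D ℓ i (coords H hH k)) = ∑ m, D ℓ i (ξ m) * D ℓ m (coords H hH k) := by
    intro i k
    rw [hη, sum_eq_zero fun m _ => (by rw [Db_D_coords hol, mul_zero] :
      conj (ξ m) * Db ℓ m (D ℓ i (coords H hH k)) = 0), sub_zero, dirDer_D]
    rw [hDτ, sum_add_distrib]
    ring
  have hηg : ∀ i j, η (pullMetric ℓ H hH hU g i j) =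
      ∑ m, D ℓ i (ξ m) * pullMetric ℓ H hH hU g m j +
      ∑ m, Db ℓ j (conj (ξ m)) * pullMetric ℓ H hH hU g i m := by
    intro i j
    refine der_pullMetric η (a := fun i m => D ℓ i (ξ m))
      (a' := fun j m => Db ℓ j (conj (ξ m))) hηpull hηP (fun j l => ?_) g i j
    rw [hηc]
    exact (congrArg conj (hηP j l)).trans (by simp only [conj_sum, Fn.conj_mul, Db_conj])
  have hu : ∀ u : Fn U, dirDer v (pull H hH hU u) = ∑ m, ξ m * D ℓ m (pull H hH hU u) +
      ∑ m, conj (ξ m) * Db ℓ m (pull H hH hU u) := by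
    intro u
    have := hηpull u
    rw [hη] at this
    linear_combination this
  have hK := pullMetric_isKahler hol (hU := hU) hP hg
  -- The metric changes by the Lie derivative along `ξ`; its symmetries bring the derivatives of `g`
  -- into the required form.
  have hδg : ∀ i j, dirDer v (pullMetric ℓ H hH hU g i j) =
      ∑ m, D ℓ i (ξ m * pullMetric ℓ H hH hU g m j) +
      ∑ m, Db ℓ j (conj (ξ m) * pullMetric ℓ H hH hU g i m) := by
    intro i j
    have := hηg i j
    rw [hη] at this
    simp only [Derivation.leibniz, smul_eq_mul, sum_add_distrib, ← hK.closed i j,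
      ← hK.closed' i j, hK.closed _ j i, hK.closed' i _ j]
    have c : ∀ a b : Fin n → Fn Ω, ∑ m, a m * b m = ∑ m, b m * a m := fun a b =>
      sum_congr rfl fun m _ => mul_comm _ _
    rw [c _ (fun m => D ℓ i (ξ m)), c _ (fun m => Db ℓ j (conj (ξ m)))]
    linear_combination this
  have hπP := map_isUnit_det π (g := fun i k => D ℓ i (coords H hH k)) hP
  have p0 : ∀ m, π (ξ m) = 0 := by
    intro m
    refine congrFun (eq_zero_of_sum_mul_eq_zero hπP (x := fun m => π (ξ m)) fun k => ?_) m
    simp only [← map_mul, ← map_sum]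
    rw [hξτ]
    exact h0 k
  have p1 : ∀ i m, π (D ℓ i (ξ m)) = 0 := by
    intro i m
    refine congrFun (eq_zero_of_sum_mul_eq_zero hπP (x := fun m => π (D ℓ i (ξ m)))
      fun k => ?_) m
    have := h1 i k
    rw [hDτ, map_sum] at this
    rw [← this]
    refine sum_congr rfl fun m _ => ?_
    rw [map_add, map_mul, map_mul, p0, zero_mul, zero_add]
  exact der_locSum_eq_zero (commDer ℓ) (fun i x => dirDer_D ℓ v i x) (fun i x => dirDer_Db ℓ v i x)
    hξ hξ' hK hδg (hu u₁) (hu u₂) π hπ p0 (fun m => hc _ (p0 m)) p1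
    (fun i m => by rw [Db_conj]; exact hc _ (p1 i m)) k

end PullBack

/-! ### Invariance of graph sums under holomorphic changes of coordinates -/

section HolomorphicInvariance

open TopologicalSpace (Opens)

open Fn

variable {E : Type*} [NormedAddCommGroup E] [NormedSpace ℝ E] {n : ℕ} {Ω : Opens E}
  {U : Opens (Fin n → ℂ)} {ℓ : (Fin n → ℂ) →L[ℝ] E}

theorem single_I (i : Fin n) :
    (Pi.single i Complex.I : Fin n → ℂ) = Complex.I • (Pi.single i 1 : Fin n → ℂ) := by
  rw [← Pi.single_smul', smul_eq_mul, mul_one]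

theorem D_apply (i : Fin n) (u : Fn Ω) (x : Ω) : (D ℓ i u).1 x =
    (1 / 2) * (dirDer (ℓ (Pi.single i 1)) u).1 x + (-(1 / 2) * Complex.I) *
      (dirDer (ℓ (Pi.single i Complex.I)) u).1 x := rfl

theorem Db_apply (i : Fin n) (u : Fn Ω) (x : Ω) : (Db ℓ i u).1 x =
    (1 / 2) * (dirDer (ℓ (Pi.single i 1)) u).1 x + ((1 / 2) * Complex.I) *
      (dirDer (ℓ (Pi.single i Complex.I)) u).1 x := rfl

section

variable {H : E → Fin n → ℂ} {hH : ContDiffOn ℝ ∞ H Ω} {x : Ω}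
  {B : (Fin n → ℂ) →L[ℂ] (Fin n → ℂ)}

/-- For a map whose derivative in the directions of `ℓ` is complex linear, the holomorphic
derivatives are the entries of the Jacobian matrix. -/
theorem D_coords_apply (hB : ∀ v, fderiv ℝ H x (ℓ v) = B v) (i k : Fin n) :
    (D ℓ i (coords H hH k)).1 x = B (Pi.single i 1) k := by
  rw [D_apply, dirDer_coords, dirDer_coords, hB, hB, single_I, map_smul, Pi.smul_apply,
    smul_eq_mul]
  linear_combination (-1 / 2 * B (Pi.single i 1) k) * Complex.I_mul_I

/-- For a map whose derivative in the directions of `ℓ` is complex linear, the antiholomorphic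
derivatives vanish. -/
theorem Db_coords_apply (hB : ∀ v, fderiv ℝ H x (ℓ v) = B v) (i k : Fin n) :
    (Db ℓ i (coords H hH k)).1 x = 0 := by
  rw [Db_apply, dirDer_coords, dirDer_coords, hB, hB, single_I, map_smul, Pi.smul_apply,
    smul_eq_mul]
  linear_combination (1 / 2 * B (Pi.single i 1) k) * Complex.I_mul_I

end

theorem isUnit_det_of_ne_zero {P : Fin n → Fin n → Fn Ω}
    (h : ∀ x, (Matrix.of fun i k => (P i k).1 x).det ≠ 0) : IsUnit (Matrix.of P).det := by
  refine isUnit_of_ne_zero fun x => ?_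
  have h1 : (ev x : Fn Ω →+* ℂ) (Matrix.of P).det = _ := RingHom.map_det _ _
  change (Matrix.of P).det.1 x = _ at h1
  rw [h1]
  exact h x

section Restrict

variable {H : E → Fin n → ℂ} {hH : ContDiffOn ℝ ∞ H Ω} {hU : ∀ x : Ω, H x ∈ U}
  {W : Opens (Fin n → ℂ)} {j : (Fin n → ℂ) → E}

theorem D_pull_of_affine (hj : ContDiffOn ℝ ∞ j W) (hjΩ : ∀ x : W, j x ∈ Ω)
    (hd : ∀ (x : W) v, fderiv ℝ j x v = ℓ v) (i : Fin n) (u : Fn Ω) :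
    pull j hj hjΩ (D ℓ i u) = D (.id ℝ _) i (pull j hj hjΩ u) :=
  (der_pull_of_const j hj hjΩ (fun x => hd x _) (fun x => hd x _) _ _ u).symm

theorem Db_pull_of_affine (hj : ContDiffOn ℝ ∞ j W) (hjΩ : ∀ x : W, j x ∈ Ω)
    (hd : ∀ (x : W) v, fderiv ℝ j x v = ℓ v) (i : Fin n) (u : Fn Ω) :
    pull j hj hjΩ (Db ℓ i u) = Db (.id ℝ _) i (pull j hj hjΩ u) :=
  (der_pull_of_const j hj hjΩ (fun x => hd x _) (fun x => hd x _) _ _ u).symm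

/-- The restriction of a graph sum to a slice on which the map `H` restricts to `H'`. -/
theorem locSum_slice (hj : ContDiffOn ℝ ∞ j W) (hjΩ : ∀ x : W, j x ∈ Ω)
    (hd : ∀ (x : W) v, fderiv ℝ j x v = ℓ v) {H' : (Fin n → ℂ) → Fin n → ℂ}
    (hHH' : ∀ w, H (j w) = H' w) (hH' : ContDiffOn ℝ ∞ H' W) (hU' : ∀ x : W, H' x ∈ U)
    (g : Fin n → Fin n → Fn U) (hg : IsUnit (Matrix.of (pullMetric ℓ H hH hU g)).det)
    (k : ℕ) (u₁ u₂ : Fn U) (x : W) :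
    (locSum (D ℓ) (Db ℓ) (pullMetric ℓ H hH hU g) k (pull H hH hU u₁) (pull H hH hU u₂)).1
      ⟨j x, hjΩ x⟩ = (locSum (D (.id ℝ _)) (Db (.id ℝ _)) (pullMetric (.id ℝ _) H' hH' hU' g) k
        (pull H' hH' hU' u₁) (pull H' hH' hU' u₂)).1 x := by
  obtain rfl : H' = H ∘ j := funext fun w => (hHH' w).symm
  have h := map_locSum (pull j hj hjΩ) (D_pull_of_affine hj hjΩ hd) (Db_pull_of_affine hj hjΩ hd)
    hg k (pull H hH hU u₁) (pull H hH hU u₂)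
  have hm : (fun a b => pull j hj hjΩ (pullMetric ℓ H hH hU g a b)) =
      pullMetric (.id ℝ _) (H ∘ j) hH' hU' g := by
    ext1 a; ext1 b
    unfold pullMetric
    rw [map_sum]
    refine sum_congr rfl fun k _ => ?_
    rw [map_sum]
    refine sum_congr rfl fun l _ => ?_
    rw [map_mul, map_mul, D_pull_of_affine hj hjΩ hd, ← conj_pull, D_pull_of_affine hj hjΩ hd]
    rfl
  rw [hm] at h
  exact congrArg (fun f : Fn W => f.1 x) h

end Restrict

/-- The Jacobian matrix of a holomorphic map. -/
noncomputable def jacobian (T : (Fin n → ℂ) → Fin n → ℂ) (w : Fin n → ℂ) :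
    Matrix (Fin n) (Fin n) ℂ := Matrix.of fun i k => fderiv ℂ T w (Pi.single i 1) k

/-- The path from the linearisation of `T` at `w₀` (for `p.1 = 0`) to `T` (for `p.1 = 1`). All its
members have the same value and the same derivative at `w₀`. -/
noncomputable def linePath (T : (Fin n → ℂ) → Fin n → ℂ) (w₀ : Fin n → ℂ)
    (p : ℝ × (Fin n → ℂ)) : Fin n → ℂ :=
  (1 - p.1) • (T w₀ + fderiv ℂ T w₀ (p.2 - w₀)) + p.1 • T p.2

/-- The derivatives with respect to the coordinates of the members of the path. -/
noncomputable def lineDer (T : (Fin n → ℂ) → Fin n → ℂ) (w₀ : Fin n → ℂ)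
    (p : ℝ × (Fin n → ℂ)) : (Fin n → ℂ) →L[ℂ] (Fin n → ℂ) :=
  (1 - p.1) • fderiv ℂ T w₀ + p.1 • fderiv ℂ T p.2

section Path

variable {W : Opens (Fin n → ℂ)} {T : (Fin n → ℂ) → Fin n → ℂ}

theorem contDiffOn_real (hT : ContDiffOn ℂ ∞ T W) : ContDiffOn ℝ ∞ T W := hT.restrict_scalars ℝ

theorem fderiv_real (hT : ContDiffOn ℂ ∞ T W) {w : Fin n → ℂ} (hw : w ∈ W) (v : Fin n → ℂ) :
    fderiv ℝ T w v = fderiv ℂ T w v := by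
  rw [((hT.contDiffAt (W.2.mem_nhds hw)).differentiableAt (by simp)).fderiv_restrictScalars ℝ]
  rfl

theorem hasFDerivAt_linePath (hT : ContDiffOn ℂ ∞ T W) (w₀ : Fin n → ℂ) {p : ℝ × (Fin n → ℂ)}
    (hp : p.2 ∈ W) (σ : ℝ) (v : Fin n → ℂ) : fderiv ℝ (linePath T w₀) p (σ, v) =
      σ • (T p.2 - (T w₀ + fderiv ℂ T w₀ (p.2 - w₀))) + lineDer T w₀ p v := by
  have h1 : HasFDerivAt (fun p : ℝ × (Fin n → ℂ) => p.1)
    (ContinuousLinearMap.fst ℝ ℝ (Fin n → ℂ)) p := hasFDerivAt_fst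
  have hs : HasFDerivAt (fun p : ℝ × (Fin n → ℂ) => p.2)
    (ContinuousLinearMap.snd ℝ ℝ (Fin n → ℂ)) p := hasFDerivAt_snd
  have h2 : HasFDerivAt (fun p : ℝ × (Fin n → ℂ) => T p.2)
      ((fderiv ℝ T p.2).comp (ContinuousLinearMap.snd ℝ ℝ (Fin n → ℂ))) p := by
    refine HasFDerivAt.comp p (f := fun p : ℝ × (Fin n → ℂ) => p.2) (g := T) ?_ hs
    exact (((contDiffOn_real hT).contDiffAt (W.2.mem_nhds hp)).differentiableAt
      (by simp)).hasFDerivAt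
  have h3 : HasFDerivAt (fun p : ℝ × (Fin n → ℂ) => T w₀ + fderiv ℂ T w₀ (p.2 - w₀))
      (((fderiv ℂ T w₀).restrictScalars ℝ).comp
        (ContinuousLinearMap.snd ℝ ℝ (Fin n → ℂ))) p := by
    refine HasFDerivAt.const_add _ ?_
    exact ((fderiv ℂ T w₀).restrictScalars ℝ).hasFDerivAt.comp p (hs.sub_const w₀)
  have h4 := ((h1.const_sub 1).smul h3).add (h1.smul h2)
  have h5 : fderiv ℝ (linePath T w₀) p = _ := h4.fderiv
  rw [h5]
  simp only [_root_.add_apply, _root_.smul_apply,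
    ContinuousLinearMap.comp_apply, ContinuousLinearMap.smulRight_apply,
    ContinuousLinearMap.coe_fst', ContinuousLinearMap.coe_snd', _root_.neg_apply,
    ContinuousLinearMap.coe_restrictScalars', lineDer, fderiv_real hT hp]
  module

theorem contDiffOn_linePath (hT : ContDiffOn ℂ ∞ T W) (w₀ : Fin n → ℂ) :
    ContDiffOn ℝ ∞ (linePath T w₀) {p | p.2 ∈ W} := by
  unfold linePath
  refine ContDiffOn.add
    (ContDiffOn.smul (contDiff_const.sub contDiff_fst).contDiffOn ?_)
    (ContDiffOn.smul contDiff_fst.contDiffOn ?_)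
  · have : ContDiff ℝ ∞ fun p : ℝ × (Fin n → ℂ) => T w₀ +
        ((fderiv ℂ T w₀).restrictScalars ℝ) (p.2 - w₀) := by fun_prop
    exact this.contDiffOn
  · exact (contDiffOn_real hT).comp contDiff_snd.contDiffOn fun p hp => hp

theorem continuousOn_lineDer (hT : ContDiffOn ℂ ∞ T W) (w₀ : Fin n → ℂ) :
    ContinuousOn (fun p => (Matrix.of fun i k => lineDer T w₀ p (Pi.single i 1) k).det)
      {p : ℝ × (Fin n → ℂ) | p.2 ∈ W} := by
  refine (continuous_id.matrix_det (A := fun A : Matrix (Fin n) (Fin n) ℂ => A)).comp_continuousOn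
    (continuousOn_pi.2 fun i => continuousOn_pi.2 fun k => ?_)
  have h1 : ContinuousOn (fun p : ℝ × (Fin n → ℂ) => fderiv ℂ T p.2) {p | p.2 ∈ W} :=
    (hT.continuousOn_fderiv_of_isOpen W.2 (by simp)).comp continuous_snd.continuousOn
      fun p hp => hp
  have h2 : ContinuousOn (fun p : ℝ × (Fin n → ℂ) => lineDer T w₀ p) {p | p.2 ∈ W} := by
    unfold lineDer
    exact ((by fun_prop : Continuous fun p : ℝ × (Fin n → ℂ) => 1 - p.1).continuousOn.smul
      continuousOn_const).add (continuous_fst.continuousOn.smul h1)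
  exact (continuous_apply k).comp_continuousOn (h2.clm_apply continuousOn_const)

/-- The domain of the path, on which its members are local isomorphisms. -/
def pathDomain (hT : ContDiffOn ℂ ∞ T W) (w₀ : Fin n → ℂ) (U : Opens (Fin n → ℂ)) :
    Opens (ℝ × (Fin n → ℂ)) where
  carrier := {p | p.2 ∈ W} ∩ (fun p => (linePath T w₀ p,
    (Matrix.of fun i k => lineDer T w₀ p (Pi.single i 1) k).det)) ⁻¹' ((U : Set _) ×ˢ {0}ᶜ)
  is_open' := ((contDiffOn_linePath hT w₀).continuousOn.prodMk
    (continuousOn_lineDer hT w₀)).isOpen_inter_preimage (W.2.preimage continuous_snd)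
    (U.2.prod isOpen_compl_singleton)

theorem lineDer_self (w₀ : Fin n → ℂ) (s : ℝ) : lineDer T w₀ (s, w₀) = fderiv ℂ T w₀ := by
  unfold lineDer
  module

theorem linePath_self (w₀ : Fin n → ℂ) (s : ℝ) : linePath T w₀ (s, w₀) = T w₀ := by
  simp only [linePath, sub_self, map_zero, add_zero]
  module

theorem linePath_one (w₀ w : Fin n → ℂ) : linePath T w₀ (1, w) = T w := by
  simp [linePath]

theorem linePath_zero (w₀ w : Fin n → ℂ) :
    linePath T w₀ (0, w) = T w₀ + fderiv ℂ T w₀ (w - w₀) := by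
  simp [linePath]

variable {hT : ContDiffOn ℂ ∞ T W} {w₀ : W}

theorem contDiffOn_pathDomain : ContDiffOn ℝ ∞ (linePath T w₀) (pathDomain hT w₀ U) :=
  (contDiffOn_linePath hT w₀).mono fun _ hp => hp.1

theorem linePath_mem (p : pathDomain hT w₀ U) : linePath T w₀ p ∈ U := p.2.2.1

theorem fderiv_linePath (p : pathDomain hT w₀ U) (v : Fin n → ℂ) :
    fderiv ℝ (linePath T w₀) p (ContinuousLinearMap.inr ℝ ℝ _ v) = lineDer T w₀ p v := by
  rw [ContinuousLinearMap.inr_apply, hasFDerivAt_linePath hT _ p.2.1, zero_smul, zero_add]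

theorem Db_linePath (i k : Fin n) : Db (ContinuousLinearMap.inr ℝ ℝ _) i
    (coords (linePath T w₀) (contDiffOn_pathDomain (hT := hT) (U := U)) k) = 0 :=
  Subtype.ext (funext fun p => Db_coords_apply (fderiv_linePath p) i k)

theorem isUnit_linePath : IsUnit (Matrix.of fun i k => D (ContinuousLinearMap.inr ℝ ℝ _) i
    (coords (linePath T w₀) (contDiffOn_pathDomain (hT := hT) (U := U)) k)).det := by
  refine isUnit_det_of_ne_zero fun p => ?_
  have : (Matrix.of fun i k => (D (ContinuousLinearMap.inr ℝ ℝ _) i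
      (coords (linePath T w₀) (contDiffOn_pathDomain (hT := hT) (U := U)) k)).1 p) =
      Matrix.of fun i k => lineDer T w₀ p (Pi.single i 1) k := by
    ext i k
    exact D_coords_apply (fderiv_linePath p) i k
  rw [this]
  exact p.2.2.2

variable (hT w₀) in
/-- The graph sum for the members of the path. -/
noncomputable def pathSum (g : Fin n → Fin n → Fn U) (k : ℕ) (u₁ u₂ : Fn U) :
    Fn (pathDomain hT w₀ U) :=
  locSum (D (ContinuousLinearMap.inr ℝ ℝ _)) (Db (ContinuousLinearMap.inr ℝ ℝ _))
    (pullMetric (ContinuousLinearMap.inr ℝ ℝ _) (linePath T w₀) contDiffOn_pathDomain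
      linePath_mem g) k
    (pull _ contDiffOn_pathDomain linePath_mem u₁) (pull _ contDiffOn_pathDomain linePath_mem u₂)

theorem mem_pathDomain (hTU : ∀ x : W, T x ∈ U) (hJ : ∀ x : W, (jacobian T x).det ≠ 0) (s : ℝ) :
    (s, w₀.1) ∈ pathDomain hT w₀ U := by
  refine ⟨w₀.2, ?_, ?_⟩
  · change linePath T w₀ (s, w₀) ∈ U
    rw [linePath_self]
    exact hTU w₀
  · change (Matrix.of fun i k => lineDer T w₀ (s, w₀) (Pi.single i 1) k).det ≠ 0
    rw [lineDer_self]
    exact hJ w₀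

theorem fderiv_prodMk_right (a : Fin n → ℂ) (s : ℝ) :
    fderiv ℝ (fun s : ℝ => (s, a)) s 1 = (1, 0) := by
  have : HasFDerivAt (fun s : ℝ => (s, a)) ((ContinuousLinearMap.id ℝ ℝ).prod 0) s :=
    (hasFDerivAt_id s).prodMk (hasFDerivAt_const _ _)
  rw [this.fderiv]
  rfl

theorem fderiv_prodMk_left (s : ℝ) (x v : Fin n → ℂ) :
    fderiv ℝ (fun w : Fin n → ℂ => (s, w)) x v = ContinuousLinearMap.inr ℝ ℝ _ v := by
  have : HasFDerivAt (fun w : Fin n → ℂ => (s, w))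
      ((0 : (Fin n → ℂ) →L[ℝ] ℝ).prod (ContinuousLinearMap.id ℝ _)) x :=
    (hasFDerivAt_const _ _).prodMk (hasFDerivAt_id x)
  rw [this.fderiv]
  rfl

/-- The members of the path agree at `w₀` up to first order, so that by
`der_locSum_pullMetric_eq_zero` the graph sum at `w₀` has derivative zero along the path. -/
theorem pathSum_const (hTU : ∀ x : W, T x ∈ U) (hJ : ∀ x : W, (jacobian T x).det ≠ 0)
    {g : Fin n → Fin n → Fn U} (hg : IsKahler (D (.id ℝ _)) (Db (.id ℝ _)) g) (k : ℕ)
    (u₁ u₂ : Fn U) : (pathSum hT w₀ g k u₁ u₂).1 ⟨(1, w₀.1), mem_pathDomain hTU hJ 1⟩ =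
      (pathSum hT w₀ g k u₁ u₂).1 ⟨(0, w₀.1), mem_pathDomain hTU hJ 0⟩ := by
  have hι : ContDiffOn ℝ ∞ (fun s : ℝ => (s, w₀.1)) (⊤ : Opens ℝ) := by fun_prop
  -- Restrict to the line `{w₀}`, along which the time is the only variable.
  obtain ⟨π, hπx⟩ : ∃ π : Fn (pathDomain hT w₀ U) →ₐ[ℂ] Fn (⊤ : Opens ℝ),
      π = pull _ hι fun s => mem_pathDomain hTU hJ s := ⟨_, rfl⟩
  have hev : ∀ x (s : (⊤ : Opens ℝ)), (π x).1 s =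
      x.1 ⟨(s.1, w₀.1), mem_pathDomain hTU hJ s⟩ := fun x s => by rw [hπx]; rfl
  have hπ : ∀ x, π (dirDer (1, 0) x) = dirDer (1 : ℝ) (π x) := fun x => by
    rw [hπx]
    exact (dirDer_pull_of_const _ hι _ (fun s => fderiv_prodMk_right _ _) x).symm
  have hD : ∀ i k, π (D (ContinuousLinearMap.inr ℝ ℝ _) i
      (coords (linePath T w₀) contDiffOn_pathDomain k)) =
      algebraMap ℂ _ (jacobian T w₀ i k) := by
    intro i k
    refine Subtype.ext (funext fun s => ?_)
    rw [hev, D_coords_apply (fderiv_linePath _) i k, lineDer_self]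
    rfl
  have h0 := der_locSum_pullMetric_eq_zero Db_linePath (hU := linePath_mem) isUnit_linePath hg
    (1, 0) π hπ
    (fun x hx => Subtype.ext (funext fun s => by
      have := congrArg (fun f : Fn (⊤ : Opens ℝ) => f.1 s) hx
      simp only [hev] at this
      rw [hev, conj_apply, this, Fn.zero_apply, map_zero]))
    (fun k => Subtype.ext (funext fun s => by
      rw [hev, dirDer_coords, hasFDerivAt_linePath hT _ w₀.2]
      simp))
    (fun i k => by rw [← dirDer_D, hπ, hD, Derivation.map_algebraMap]) k u₁ u₂
  change dirDer (1 : ℝ) (π (pathSum hT w₀ g k u₁ u₂)) = 0 at h0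
  have h1 : ∀ s : ℝ, deriv (π (pathSum hT w₀ g k u₁ u₂)).rep s = 0 := by
    intro s
    rw [← fderiv_apply_one_eq_deriv]
    exact congrFun (congrArg Subtype.val h0) ⟨s, show s ∈ (⊤ : Opens ℝ) from trivial⟩
  have h2 : Differentiable ℝ (π (pathSum hT w₀ g k u₁ u₂)).rep := fun s =>
    differentiableAt (Fn.contDiffOn_rep _) ⟨s, show s ∈ (⊤ : Opens ℝ) from trivial⟩
  have h3 := is_const_of_deriv_eq_zero h2 h1 1 0
  rw [rep_apply' _ (show (1 : ℝ) ∈ (⊤ : Opens ℝ) from trivial),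
    rep_apply' _ (show (0 : ℝ) ∈ (⊤ : Opens ℝ) from trivial), hev, hev] at h3
  exact h3

theorem isUnit_pathSum {g : Fin n → Fin n → Fn U}
    (hg : IsKahler (D (.id ℝ _)) (Db (.id ℝ _)) g) :
    IsUnit (Matrix.of (pullMetric (ContinuousLinearMap.inr ℝ ℝ _) (linePath T w₀)
      (contDiffOn_pathDomain (hT := hT)) linePath_mem g)).det :=
  (pullMetric_isKahler Db_linePath isUnit_linePath hg).unit

variable (hT w₀ U) in
/-- The member of the family of domains for the time `s`. -/
def pathSlice (s : ℝ) : Opens (Fin n → ℂ) :=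
  ⟨(fun w => (s, w)) ⁻¹' (pathDomain hT w₀ U), (pathDomain hT w₀ U).2.preimage (by fun_prop)⟩

variable (hT) in
theorem pullMetric_isKahler_of_jacobian (hTU : ∀ x : W, T x ∈ U)
    (hJ : ∀ x : W, (jacobian T x).det ≠ 0) {g : Fin n → Fin n → Fn U}
    (hg : IsKahler (D (.id ℝ _)) (Db (.id ℝ _)) g) :
    IsKahler (D (.id ℝ _)) (Db (.id ℝ _))
      (pullMetric (.id ℝ _) T (contDiffOn_real hT) hTU g) := by
  have hBT : ∀ (x : W) v, fderiv ℝ T x (ContinuousLinearMap.id ℝ _ v) = fderiv ℂ T x v :=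
    fun x v => fderiv_real hT x.2 v
  refine pullMetric_isKahler (fun i k => Subtype.ext (funext fun x =>
    Db_coords_apply (hBT x) i k)) (isUnit_det_of_ne_zero fun x => ?_) hg
  simp only [D_coords_apply (hBT x)]
  exact hJ x

/-- The end of the path is `T` itself. -/
theorem pathSum_one (hTU : ∀ x : W, T x ∈ U) (hJ : ∀ x : W, (jacobian T x).det ≠ 0)
    {g : Fin n → Fin n → Fn U} (hg : IsKahler (D (.id ℝ _)) (Db (.id ℝ _)) g) (k : ℕ)
    (u₁ u₂ : Fn U) : (pathSum hT w₀ g k u₁ u₂).1 ⟨(1, w₀.1), mem_pathDomain hTU hJ 1⟩ =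
      (locSum (D (.id ℝ _)) (Db (.id ℝ _)) (pullMetric (.id ℝ _) T (contDiffOn_real hT) hTU g) k
      (pull T (contDiffOn_real hT) hTU u₁) (pull T (contDiffOn_real hT) hTU u₂)).1 w₀ := by
  have hj : ContDiffOn ℝ ∞ (fun w : Fin n → ℂ => ((1 : ℝ), w)) (pathSlice U hT w₀ 1) := by fun_prop
  have hT1 : ContDiffOn ℝ ∞ T (pathSlice U hT w₀ 1) := (contDiffOn_real hT).mono fun w hw => hw.1
  have hTU1 : ∀ x : pathSlice U hT w₀ 1, T x ∈ U := fun x => hTU ⟨x, x.2.1⟩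
  have e1 := locSum_slice hj (fun x => x.2) (fun x v => fderiv_prodMk_left 1 x v)
    (linePath_one w₀.1) hT1 hTU1 g (isUnit_pathSum (hT := hT) (w₀ := w₀) hg) k u₁ u₂
    ⟨w₀, mem_pathDomain (hT := hT) hTU hJ 1⟩
  have e2 := locSum_slice (j := id) (W := pathSlice U hT w₀ 1) contDiffOn_id (fun x => x.2.1)
    (fun x v => by rw [fderiv_id]) (fun w => rfl)
    hT1 hTU1 g (pullMetric_isKahler_of_jacobian hT hTU hJ hg).unit k u₁ u₂
    ⟨w₀, mem_pathDomain (hT := hT) hTU hJ 1⟩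
  exact e1.trans e2.symm

/-- The path begins with an affine map, under which graph sums are invariant by
`locSum_linear_change`. -/
theorem pathSum_zero (hTU : ∀ x : W, T x ∈ U) (hJ : ∀ x : W, (jacobian T x).det ≠ 0)
    {g : Fin n → Fin n → Fn U} (hg : IsKahler (D (.id ℝ _)) (Db (.id ℝ _)) g) (k : ℕ)
    (u₁ u₂ : Fn U) : (pathSum hT w₀ g k u₁ u₂).1 ⟨(0, w₀.1), mem_pathDomain hTU hJ 0⟩ =
      (locSum (D (.id ℝ _)) (Db (.id ℝ _)) g k u₁ u₂).1 ⟨T w₀, hTU w₀⟩ := by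
  have hj : ContDiffOn ℝ ∞ (fun w : Fin n → ℂ => ((0 : ℝ), w)) (pathSlice U hT w₀ 0) := by fun_prop
  have hA : ContDiff ℝ ∞ fun w => T w₀ + fderiv ℂ T w₀ (w - w₀.1) := by
    have : ContDiff ℝ ∞ fun w => T w₀ + (fderiv ℂ T w₀).restrictScalars ℝ (w - w₀.1) := by
      fun_prop
    exact this
  have hAU : ∀ x : pathSlice U hT w₀ 0, T w₀ + fderiv ℂ T w₀ (x - w₀.1) ∈ U := by
    intro x
    rw [← linePath_zero]
    exact x.2.2.1
  have e3 := locSum_slice hj (fun x => x.2) (fun x v => fderiv_prodMk_left 0 x v)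
    (linePath_zero w₀.1) hA.contDiffOn hAU g (isUnit_pathSum (hT := hT) (w₀ := w₀) hg) k u₁ u₂
    ⟨w₀, mem_pathDomain (hT := hT) hTU hJ 0⟩
  have hBA : ∀ (x : pathSlice U hT w₀ 0) v,
      fderiv ℝ (fun w => T w₀ + fderiv ℂ T w₀ (w - w₀.1)) x
      (ContinuousLinearMap.id ℝ _ v) = fderiv ℂ T w₀ v := by
    intro x v
    have : HasFDerivAt (fun w => T w₀ + fderiv ℂ T w₀ (w - w₀.1))
        ((fderiv ℂ T w₀).restrictScalars ℝ) x := by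
      refine HasFDerivAt.const_add _ ?_
      exact ((fderiv ℂ T w₀).restrictScalars ℝ).hasFDerivAt.comp x.1
        ((hasFDerivAt_id x.1).sub_const w₀.1)
    rw [this.fderiv]
    rfl
  have hcA : ∀ i k, D (.id ℝ _) i (coords (U := pathSlice U hT w₀ 0) _ hA.contDiffOn k) =
      algebraMap ℂ _ (jacobian T w₀ i k) := fun i k =>
    Subtype.ext (funext fun x => D_coords_apply (hBA x) i k)
  have holA : ∀ i k, Db (.id ℝ _) i (coords (U := pathSlice U hT w₀ 0) _ hA.contDiffOn k) = 0 :=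
    fun i k => Subtype.ext (funext fun x => Db_coords_apply (hBA x) i k)
  have hconjA : ∀ c : ℂ, conj (algebraMap ℂ (Fn (pathSlice U hT w₀ 0)) c) =
      algebraMap ℂ _ (starRingEnd ℂ c) := fun c => rfl
  have hunit : IsUnit (Matrix.of fun i k => D (.id ℝ _) i
      (coords (U := pathSlice U hT w₀ 0) _ hA.contDiffOn k)).det := by
    refine isUnit_det_of_ne_zero fun x => ?_
    simp only [hcA]
    exact hJ w₀
  have e4 := locSum_linear_change (commDer (.id ℝ _)) (commDer (.id ℝ _))
    (pull (U := pathSlice U hT w₀ 0) _ hA.contDiffOn hAU) (fun i k => jacobian T w₀ i k)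
    (fun i k => starRingEnd ℂ (jacobian T w₀ i k))
    (fun i x => by
      rw [D_pull holA]
      refine sum_congr rfl fun k _ => ?_
      rw [hcA, mul_comm, Algebra.smul_def])
    (fun i x => by
      rw [Db_pull holA]
      refine sum_congr rfl fun k _ => ?_
      rw [hcA, hconjA, mul_comm, Algebra.smul_def]) hg
    (pullMetric_isKahler (hU := hAU) holA hunit hg)
    (fun i j => by
      unfold pullMetric
      refine sum_congr rfl fun k _ => sum_congr rfl fun l _ => ?_
      rw [hcA, hcA, hconjA, Algebra.smul_def, map_mul]
      ring) k u₁ u₂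
  have e5 := congrArg (fun f : Fn (pathSlice U hT w₀ 0) =>
    f.1 ⟨w₀, mem_pathDomain (hT := hT) hTU hJ 0⟩) e4
  refine (e3.trans e5).trans ?_
  simp only [pull_apply]
  simp

variable (hT) in
/-- Graph sums do not change under holomorphic changes of coordinates. -/
theorem locSum_pullMetric (hTU : ∀ x : W, T x ∈ U)
    (hJ : ∀ x : W, (jacobian T x).det ≠ 0) {g : Fin n → Fin n → Fn U}
    (hg : IsKahler (D (.id ℝ _)) (Db (.id ℝ _)) g) (k : ℕ) (u₁ u₂ : Fn U) (w₀ : W) :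
    (locSum (D (.id ℝ _)) (Db (.id ℝ _)) (pullMetric (.id ℝ _) T (contDiffOn_real hT) hTU g) k
      (pull T (contDiffOn_real hT) hTU u₁) (pull T (contDiffOn_real hT) hTU u₂)).1 w₀ =
    (locSum (D (.id ℝ _)) (Db (.id ℝ _)) g k u₁ u₂).1 ⟨T w₀, hTU w₀⟩ :=
  (pathSum_one (hT := hT) hTU hJ hg k u₁ u₂).symm.trans
    ((pathSum_const hTU hJ hg k u₁ u₂).trans (pathSum_zero hTU hJ hg k u₁ u₂))

end Path

end HolomorphicInvariance

/-! ### Graph sums in the charts of a manifold -/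

section Charts

open TopologicalSpace (Opens)

variable {n : ℕ}

section Wirtinger

variable {U : Opens (Fin n → ℂ)}

theorem D_eq_dz (i : Fin n) (u : Fn U) {f : (Fin n → ℂ) → ℂ} (h : ∀ x : U, f x = u.1 x) (x : U) :
    (Fn.D (.id ℝ _) i u).1 x = dz i f x := by
  rw [D_apply, Fn.dirDer_apply, Fn.dirDer_apply, Fn.fderiv_rep u h]
  simp only [dz, ContinuousLinearMap.id_apply]
  ring

theorem Db_eq_dzbar (i : Fin n) (u : Fn U) {f : (Fin n → ℂ) → ℂ} (h : ∀ x : U, f x = u.1 x)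
    (x : U) : (Fn.Db (.id ℝ _) i u).1 x = dzbar i f x := by
  rw [Db_apply, Fn.dirDer_apply, Fn.dirDer_apply, Fn.fderiv_rep u h]
  simp only [dzbar, ContinuousLinearMap.id_apply]
  ring

theorem iterDz_eq (l : List (Fin n)) (u : Fn U) {f : (Fin n → ℂ) → ℂ}
    (h : ∀ x : U, f x = u.1 x) (x : U) :
    iterDz l f x = (it (fun i => Fn.D (.id ℝ _) i) (l : Multiset (Fin n)) u).1 x := by
  rw [it_coe (Fn.D_comm (.id ℝ _))]
  induction l generalizing x with
  | nil => exact h x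
  | cons i l ih => exact (D_eq_dz i _ ih x).symm

theorem iterDzbar_eq (l : List (Fin n)) (u : Fn U) {f : (Fin n → ℂ) → ℂ}
    (h : ∀ x : U, f x = u.1 x) (x : U) :
    iterDzbar l f x = (it (fun i => Fn.Db (.id ℝ _) i) (l : Multiset (Fin n)) u).1 x := by
  rw [it_coe (Fn.Db_comm (.id ℝ _))]
  induction l generalizing x with
  | nil => exact h x
  | cons i l ih => exact (Db_eq_dzbar i _ ih x).symm

end Wirtinger

variable {M : Type*} [TopologicalSpace M] [ChartedSpace (Fin n → ℂ) M]
  {φ ψ : OpenPartialHomeomorph M (Fin n → ℂ)}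

/-- The domain of the coordinates of a chart, an open subset of `ℂⁿ`. -/
noncomputable def chartDomain (φ : OpenPartialHomeomorph M (Fin n → ℂ)) : Opens (Fin n → ℂ) :=
  ⟨φ.target, φ.open_target⟩

/-- The coordinates of a point in the domain of a chart. -/
noncomputable def chartPoint (φ : OpenPartialHomeomorph M (Fin n → ℂ)) {x : M} (hx : x ∈ φ.source) :
    chartDomain φ := ⟨φ x, φ.map_source hx⟩

/-- The coordinates of the points which lie in the domains of two charts. -/
noncomputable def overlap (φ ψ : OpenPartialHomeomorph M (Fin n → ℂ)) : Opens (Fin n → ℂ) :=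
  ⟨(φ.symm.trans ψ).source, (φ.symm.trans ψ).open_source⟩

theorem mem_overlap {z : Fin n → ℂ} : z ∈ overlap φ ψ ↔ z ∈ φ.target ∧ φ.symm z ∈ ψ.source := by
  change z ∈ (φ.symm.trans ψ).source ↔ _
  simp

section Manifold

variable [IsManifold 𝓘(ℂ, Fin n → ℂ) ω M]

theorem contDiffOn_transition (hφ : φ ∈ holoCharts n M) (hψ : ψ ∈ holoCharts n M) :
    ContDiffOn ℂ ∞ (ψ ∘ φ.symm) (overlap φ ψ) := by
  have h1 := contMDiffOn_symm_of_mem_maximalAtlas hφ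
  have h2 := contMDiffOn_of_mem_maximalAtlas hψ
  have h3 : ContMDiffOn 𝓘(ℂ, Fin n → ℂ) 𝓘(ℂ, Fin n → ℂ) ω (ψ ∘ φ.symm) (overlap φ ψ) :=
    h2.comp (h1.mono fun z hz => (mem_overlap.1 hz).1) fun z hz => (mem_overlap.1 hz).2
  exact (contMDiffOn_iff_contDiffOn.1 h3).of_le le_top

theorem mdifferentiable_chart (hφ : φ ∈ holoCharts n M) :
    φ.MDifferentiable 𝓘(ℂ, Fin n → ℂ) 𝓘(ℂ, Fin n → ℂ) :=
  ⟨(contMDiffOn_of_mem_maximalAtlas hφ).mdifferentiableOn (by simp),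
    (contMDiffOn_symm_of_mem_maximalAtlas hφ).mdifferentiableOn (by simp)⟩

/-- The derivative of the inverse of a chart, as a linear map from `ℂⁿ` to the tangent space, which
as a type is `ℂⁿ`. -/
noncomputable def frame (φ : OpenPartialHomeomorph M (Fin n → ℂ)) (z : Fin n → ℂ) :
    (Fin n → ℂ) →L[ℂ] (Fin n → ℂ) :=
  mfderiv 𝓘(ℂ, Fin n → ℂ) 𝓘(ℂ, Fin n → ℂ) φ.symm z

theorem frame_injective (hφ : φ ∈ holoCharts n M) {z : Fin n → ℂ} (hz : z ∈ φ.target) :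
    Function.Injective (frame φ z) :=
  (mdifferentiable_chart hφ).symm.mfderiv_injective hz

/-- The chain rule for the frames of two charts. -/
theorem frame_eq (hφ : φ ∈ holoCharts n M) (hψ : ψ ∈ holoCharts n M) {z : Fin n → ℂ}
    (hz : z ∈ overlap φ ψ) (v : Fin n → ℂ) :
    frame φ z v = frame ψ ((ψ ∘ φ.symm) z) (fderiv ℂ (ψ ∘ φ.symm) z v) := by
  have hT := ((contDiffOn_transition hφ hψ).contDiffAt
    ((overlap φ ψ).2.mem_nhds hz)).differentiableAt (by simp)
  have h1 : MDifferentiableAt 𝓘(ℂ, Fin n → ℂ) 𝓘(ℂ, Fin n → ℂ) ψ.symm ((ψ ∘ φ.symm) z) :=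
    (mdifferentiable_chart hψ).mdifferentiableAt_symm (ψ.map_source (mem_overlap.1 hz).2)
  have h2 : φ.symm =ᶠ[nhds z] ψ.symm ∘ (ψ ∘ φ.symm) := by
    filter_upwards [(overlap φ ψ).2.mem_nhds hz] with w hw
    exact (ψ.left_inv (mem_overlap.1 hw).2).symm
  have h3 := h2.mfderiv_eq (I := 𝓘(ℂ, Fin n → ℂ)) (I' := 𝓘(ℂ, Fin n → ℂ))
  have h4 := mfderiv_comp z h1 hT.mdifferentiableAt
  rw [mfderiv_eq_fderiv] at h4
  unfold frame
  rw [h3, h4]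
  rfl

theorem form_congr (g : KahlerMetric n M) {x y : M} (h : x = y) (u v : Fin n → ℂ) :
    (g.form x u : _ →ₗ⋆[ℂ] ℂ) v = (g.form y u : _ →ₗ⋆[ℂ] ℂ) v := by
  subst h; rfl

/-- The Hermitian form in the coordinates of a chart. -/
noncomputable def frameForm (g : KahlerMetric n M) (φ : OpenPartialHomeomorph M (Fin n → ℂ))
    (z : Fin n → ℂ) : (Fin n → ℂ) →ₗ[ℂ] (Fin n → ℂ) →ₗ⋆[ℂ] ℂ :=
  ((g.form (φ.symm z)).comp (frame φ z).toLinearMap).compl₂ (frame φ z).toLinearMap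

theorem frameForm_apply (g : KahlerMetric n M) (z u v : Fin n → ℂ) :
    frameForm g φ z u v = g.form (φ.symm z) (frame φ z u) (frame φ z v) := rfl

theorem comp_eq_frameForm (g : KahlerMetric n M) (i j : Fin n) (z : Fin n → ℂ) :
    g.comp φ i j z = frameForm g φ z (Pi.single i 1) (Pi.single j 1) := rfl

theorem frameForm_eq_sum (g : KahlerMetric n M) (z u v : Fin n → ℂ) :
    frameForm g φ z u v = ∑ k, ∑ l, g.comp φ k l z * (u k * starRingEnd ℂ (v l)) := by
  have hu : ∀ u : Fin n → ℂ, u = ∑ k, u k • Pi.single k (1 : ℂ) := fun u => by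
    ext j
    simp [Finset.sum_apply, Pi.single_apply]
  conv_lhs => rw [hu u, hu v]
  simp only [map_sum, map_smul, LinearMap.sum_apply, LinearMap.smul_apply, smul_eq_mul,
    map_smulₛₗ, mul_sum]
  rw [sum_comm]
  refine sum_congr rfl fun k _ => sum_congr rfl fun l _ => ?_
  rw [comp_eq_frameForm]
  ring

theorem frameForm_transition (g : KahlerMetric n M) (hφ : φ ∈ holoCharts n M)
    (hψ : ψ ∈ holoCharts n M) {z : Fin n → ℂ} (hz : z ∈ overlap φ ψ) (u v : Fin n → ℂ) :
    frameForm g φ z u v = frameForm g ψ ((ψ ∘ φ.symm) z) (fderiv ℂ (ψ ∘ φ.symm) z u)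
      (fderiv ℂ (ψ ∘ φ.symm) z v) := by
  rw [frameForm_apply, frameForm_apply, frame_eq hφ hψ hz, frame_eq hφ hψ hz]
  exact form_congr g (ψ.left_inv (mem_overlap.1 hz).2).symm _ _

theorem frameForm_pos (g : KahlerMetric n M) (hφ : φ ∈ holoCharts n M) {z : Fin n → ℂ}
    (hz : z ∈ φ.target) {u : Fin n → ℂ} (hu : u ≠ 0) : 0 < (frameForm g φ z u u).re :=
  g.posDef _ _ fun h => hu (frame_injective hφ hz (h.trans (map_zero _).symm))

theorem det_comp_ne_zero (g : KahlerMetric n M) (hφ : φ ∈ holoCharts n M) {z : Fin n → ℂ}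
    (hz : z ∈ φ.target) : (Matrix.of fun i j => g.comp φ i j z).det ≠ 0 := by
  intro h
  obtain ⟨v, hv, h0⟩ := Matrix.exists_vecMul_eq_zero_iff.2 h
  have := frameForm_pos g hφ hz hv
  rw [frameForm_eq_sum, sum_comm] at this
  rw [sum_eq_zero, Complex.zero_re] at this
  · exact lt_irrefl _ this
  · intro l _
    have h1 : ∑ k, v k * g.comp φ k l z = 0 := congrFun h0 l
    have h2 : ∑ k, g.comp φ k l z * (v k * starRingEnd ℂ (v l)) =
        (∑ k, v k * g.comp φ k l z) * starRingEnd ℂ (v l) := by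
      rw [sum_mul]
      exact sum_congr rfl fun k _ => by ring
    rw [h2, h1, zero_mul]

theorem det_jacobian_ne_zero (hφ : φ ∈ holoCharts n M) (hψ : ψ ∈ holoCharts n M)
    {z : Fin n → ℂ} (hz : z ∈ overlap φ ψ) : (jacobian (ψ ∘ φ.symm) z).det ≠ 0 := by
  intro h
  obtain ⟨v, hv, h0⟩ := Matrix.exists_vecMul_eq_zero_iff.2 h
  have h1 : fderiv ℂ (ψ ∘ φ.symm) z v = 0 := by
    have hu : v = ∑ k, v k • Pi.single k (1 : ℂ) := by
      ext j
      simp [Finset.sum_apply, Pi.single_apply]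
    rw [hu, map_sum]
    ext j
    rw [← congrFun h0 j]
    simp only [map_smul, Finset.sum_apply, Pi.smul_apply, smul_eq_mul]
    rfl
  refine hv (frame_injective hφ (mem_overlap.1 hz).1 ?_)
  rw [frame_eq hφ hψ hz, h1, map_zero, map_zero]

/-- The components of the metric in a chart, as smooth functions of the coordinates. -/
noncomputable def chartMetric (g : KahlerMetric n M) (hφ : φ ∈ holoCharts n M) (i j : Fin n) :
    Fn (chartDomain φ) := Fn.of (g.comp φ i j) (g.smooth φ hφ i j)

theorem conj_chartMetric (g : KahlerMetric n M) (hφ : φ ∈ holoCharts n M) (i j : Fin n) :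
    Fn.conj (chartMetric g hφ i j) = chartMetric g hφ j i :=
  Subtype.ext (funext fun z => (g.hermitian (φ.symm z) _ _).symm)

theorem chartMetric_isKahler (g : KahlerMetric n M) (hφ : φ ∈ holoCharts n M) :
    IsKahler (Fn.D (.id ℝ _)) (Fn.Db (.id ℝ _)) (chartMetric g hφ) := by
  have hc : ∀ i j k, Fn.D (.id ℝ _) k (chartMetric g hφ i j) =
      Fn.D (.id ℝ _) i (chartMetric g hφ k j) := fun i j k =>
    Subtype.ext (funext fun z => by
      rw [D_eq_dz k (chartMetric g hφ i j) (f := g.comp φ i j) (fun x => rfl),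
        D_eq_dz i (chartMetric g hφ k j) (f := g.comp φ k j) (fun x => rfl)]
      exact g.closed φ hφ i j k z z.2)
  refine ⟨hc, fun i j k => ?_, isUnit_det_of_ne_zero fun z => det_comp_ne_zero g hφ z.2⟩
  rw [← conj_chartMetric g hφ j i, Fn.Db_conj, hc, ← Fn.Db_conj, conj_chartMetric]

/-- A smooth function on the manifold in the coordinates of a chart. -/
noncomputable def chartFun (φ : OpenPartialHomeomorph M (Fin n → ℂ)) (f : M → ℂ)
    (hf : ContDiffOn ℝ ∞ (f ∘ φ.symm) φ.target) : Fn (chartDomain φ) := Fn.of (f ∘ φ.symm) hf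

theorem contDiffOn_of_smoothFun {f : M → ℂ} (hf : SmoothFun n f) (hφ : φ ∈ holoCharts n M) :
    ContDiffOn ℝ ∞ (f ∘ φ.symm) φ.target := by
  intro z hz
  refine ContDiffAt.contDiffWithinAt ?_
  have h1 := (contMDiffAt_iff.1 (hf (φ.symm z))).2
  simp only [mfld_simps] at h1
  rw [contDiffWithinAt_univ] at h1
  have hψ : chartAt (Fin n → ℂ) (φ.symm z) ∈ holoCharts n M :=
    IsManifold.chart_mem_maximalAtlas _
  have hzW : z ∈ overlap φ (chartAt (Fin n → ℂ) (φ.symm z)) :=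
    mem_overlap.2 ⟨hz, mem_chart_source _ _⟩
  have h2 := (contDiffOn_real (contDiffOn_transition hφ hψ)).contDiffAt
    ((overlap _ _).2.mem_nhds hzW)
  have h3 := ContDiffAt.comp z h1 h2
  refine h3.congr_of_eventuallyEq ?_
  filter_upwards [(overlap _ _).2.mem_nhds hzW] with w hw
  exact congrArg f ((chartAt (Fin n → ℂ) (φ.symm z)).left_inv (mem_overlap.1 hw).2).symm

theorem smoothFun_of_contDiffAt {f : M → ℂ}
    (h : ∀ x, ContDiffAt ℝ ∞ (f ∘ (chartAt (Fin n → ℂ) x).symm) (chartAt (Fin n → ℂ) x x)) :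
    SmoothFun n f := by
  intro x
  refine contMDiffAt_iff.2 ⟨?_, ?_⟩
  · have h1 := ContinuousAt.comp (h x).continuousAt
      ((chartAt (Fin n → ℂ) x).continuousAt (mem_chart_source _ x))
    refine h1.congr ?_
    filter_upwards [(chartAt (Fin n → ℂ) x).open_source.mem_nhds (mem_chart_source _ x)] with y hy
    simp only [Function.comp_apply]
    rw [(chartAt (Fin n → ℂ) x).left_inv hy]
  · simp only [mfld_simps]
    exact (h x).contDiffWithinAt

theorem mem_chartDomain_of_overlap (z : overlap φ ψ) : id z.1 ∈ chartDomain φ :=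
  (mem_overlap.1 z.2).1

theorem transition_mem_chartDomain (z : overlap φ ψ) : (ψ ∘ φ.symm) z ∈ chartDomain ψ :=
  ψ.map_source (mem_overlap.1 z.2).2

theorem fderiv_id_eq (z v : Fin n → ℂ) : fderiv ℝ id z v = ContinuousLinearMap.id ℝ _ v := by
  rw [fderiv_id]

/-- The transformation of the components of the metric. -/
theorem pull_chartMetric (g : KahlerMetric n M) (hφ : φ ∈ holoCharts n M)
    (hψ : ψ ∈ holoCharts n M) (i j : Fin n) :
    Fn.pull (id : (Fin n → ℂ) → _) contDiffOn_id (mem_chartDomain_of_overlap (ψ := ψ))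
      (chartMetric g hφ i j) = pullMetric (.id ℝ _) (ψ ∘ φ.symm)
        (contDiffOn_real (contDiffOn_transition hφ hψ)) transition_mem_chartDomain
        (chartMetric g hψ) i j := by
  have hT := contDiffOn_transition hφ hψ
  refine Subtype.ext (funext fun z => ?_)
  have h6 : (pullMetric (.id ℝ _) (ψ ∘ φ.symm) (contDiffOn_real hT) transition_mem_chartDomain
      (chartMetric g hψ) i j).1 z = ∑ k, ∑ l, g.comp ψ k l ((ψ ∘ φ.symm) z) *
        ((fderiv ℂ (ψ ∘ φ.symm) z (Pi.single i 1)) k *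
          starRingEnd ℂ ((fderiv ℂ (ψ ∘ φ.symm) z (Pi.single j 1)) l)) := by
    have hB : ∀ v, fderiv ℝ (ψ ∘ φ.symm) z (ContinuousLinearMap.id ℝ _ v) =
      fderiv ℂ (ψ ∘ φ.symm) z v := fun v => fderiv_real hT z.2 v
    change Fn.ev z _ = _
    unfold pullMetric
    rw [map_sum]
    refine sum_congr rfl fun k _ => ?_
    rw [map_sum]
    refine sum_congr rfl fun l _ => ?_
    rw [map_mul, map_mul, Fn.ev_apply, Fn.ev_apply, Fn.ev_apply, Fn.conj_apply,
      D_coords_apply hB, D_coords_apply hB]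
    rfl
  rw [h6, ← frameForm_eq_sum, ← frameForm_transition g hφ hψ z.2]
  rfl

/-- The graph sum at a point does not depend on the chart. -/
theorem locSum_chart_eq (g : KahlerMetric n M) (hφ : φ ∈ holoCharts n M)
    (hψ : ψ ∈ holoCharts n M) {f₁ f₂ : M → ℂ} (h₁ : SmoothFun n f₁) (h₂ : SmoothFun n f₂) (k : ℕ)
    {x : M} (hx : x ∈ φ.source) (hx' : x ∈ ψ.source) :
    (locSum (Fn.D (.id ℝ _)) (Fn.Db (.id ℝ _)) (chartMetric g hφ) k
      (chartFun φ f₁ (contDiffOn_of_smoothFun h₁ hφ))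
      (chartFun φ f₂ (contDiffOn_of_smoothFun h₂ hφ))).1 (chartPoint φ hx) =
    (locSum (Fn.D (.id ℝ _)) (Fn.Db (.id ℝ _)) (chartMetric g hψ) k
      (chartFun ψ f₁ (contDiffOn_of_smoothFun h₁ hψ))
      (chartFun ψ f₂ (contDiffOn_of_smoothFun h₂ hψ))).1 (chartPoint ψ hx') := by
  have hw : φ x ∈ overlap φ ψ := mem_overlap.2 ⟨φ.map_source hx, by rwa [φ.left_inv hx]⟩
  have hT := contDiffOn_transition hφ hψ
  have h3 := locSum_pullMetric hT transition_mem_chartDomain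
    (fun z => det_jacobian_ne_zero hφ hψ z.2)
    (chartMetric_isKahler g hψ) k (chartFun ψ f₁ (contDiffOn_of_smoothFun h₁ hψ))
    (chartFun ψ f₂ (contDiffOn_of_smoothFun h₂ hψ)) ⟨φ x, hw⟩
  have hid := mem_chartDomain_of_overlap (φ := φ) (ψ := ψ)
  have h4 := map_locSum (Fn.pull (id : (Fin n → ℂ) → _) contDiffOn_id hid)
    (D_pull_of_affine contDiffOn_id hid fun z v => fderiv_id_eq z.1 v)
    (Db_pull_of_affine contDiffOn_id hid fun z v => fderiv_id_eq z.1 v)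
    (chartMetric_isKahler g hφ).unit k (chartFun φ f₁ (contDiffOn_of_smoothFun h₁ hφ))
      (chartFun φ f₂ (contDiffOn_of_smoothFun h₂ hφ))
  have h5 : (fun i j => Fn.pull (id : (Fin n → ℂ) → _) contDiffOn_id hid (chartMetric g hφ i j)) =
      pullMetric (.id ℝ _) (ψ ∘ φ.symm) (contDiffOn_real hT)
      transition_mem_chartDomain (chartMetric g hψ) := by
    ext1 i; ext1 j
    exact pull_chartMetric g hφ hψ i j
  have h7 : ∀ {f : M → ℂ} (h : SmoothFun n f), Fn.pull (id : (Fin n → ℂ) → _) contDiffOn_id hid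
      (chartFun φ f (contDiffOn_of_smoothFun h hφ)) = Fn.pull (ψ ∘ φ.symm) (contDiffOn_real hT)
      transition_mem_chartDomain
      (chartFun ψ f (contDiffOn_of_smoothFun h hψ)) := fun {f} h =>
    Subtype.ext (funext fun z => by
      change f (φ.symm z) = f (ψ.symm (ψ (φ.symm z)))
      rw [ψ.left_inv (mem_overlap.1 z.2).2])
  rw [h5, h7 h₁, h7 h₂] at h4
  have h8 := congrArg (fun f : Fn (overlap φ ψ) => f.1 ⟨φ x, hw⟩) h4
  have h9 : (⟨(ψ ∘ φ.symm) (φ x), transition_mem_chartDomain (φ := φ) (ψ := ψ) ⟨φ x, hw⟩⟩ :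
      chartDomain ψ) = chartPoint ψ hx' :=
    Subtype.ext (congrArg ψ (φ.left_inv hx))
  exact h8.trans (h3.trans (congrArg _ h9))

end Manifold

end Charts

/-! ### Graph sums at the centre of normal coordinates -/

section NormalPoint

variable {ι R K : Type*} [CommRing R] [Algebra ℂ R] [CommRing K] [Algebra ℂ K]
  [Fintype ι] [DecidableEq ι] {d d' : ι → Derivation ℂ R R}

/-- At a point with normal coordinates all derivatives of the inverse metric in the holomorphic
directions vanish. -/
theorem map_it_invMetric (hd : ∀ i j x, d i (d j x) = d j (d i x)) (π : R →ₐ[ℂ] K) {N : ℕ}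
    {g : ι → ι → R} (hg : IsUnit (Matrix.of g).det)
    (h : ∀ I i j, Multiset.card I ≤ N → π (it d I (g i j)) = if I = 0 ∧ i = j then 1 else 0)
    (I : Multiset ι) (i j : ι) (hI : Multiset.card I ≤ N) :
    π (it d I (invMetric g i j)) = if I = 0 ∧ i = j then 1 else 0 := by
  have key : ∀ x : ι → ι → R, (∀ i j, x i j - (if i = j then 1 else 0) ∈ jetIdeal hd π N) ↔
      ∀ I i j, Multiset.card I ≤ N → π (it d I (x i j)) = if I = 0 ∧ i = j then 1 else 0 := by
    intro x
    have h1 : ∀ i j : ι, (if i = j then (1 : R) else 0) = algebraMap ℂ R (if i = j then 1 else 0) := by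
      intro i j
      split_ifs <;> simp
    have h2 : ∀ I i j, π (it d I (x i j - (if i = j then 1 else 0))) = π (it d I (x i j)) -
        if I = 0 ∧ i = j then 1 else 0 := by
      intro I i j
      rw [sub_eq_add_neg, it_add, ← neg_one_smul ℂ, it_smul, map_add, map_smul, h1,
        it_algebraMap hd]
      by_cases h2 : I = 0 <;> by_cases h3 : i = j <;> simp [h2, h3, sub_eq_add_neg]
    constructor
    · intro hx I i j hI
      have := hx i j I hI
      rwa [h2, sub_eq_zero] at this
    · intro hx i j I hI
      rw [h2, hx I i j hI, sub_self]
  refine (key _).1 (fun i j => ?_) I i j hI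
  rw [← Ideal.Quotient.eq]
  have h3 : ∀ i j, Ideal.Quotient.mk (jetIdeal hd π N) (g i j) = if i = j then 1 else 0 := by
    intro i j
    have := Ideal.Quotient.eq.2 ((key g).2 h i j)
    rw [this]
    split_ifs <;> simp
  have h4 := map_invMetric (Ideal.Quotient.mkₐ ℂ (jetIdeal hd π N)) hg i j
  change Ideal.Quotient.mk _ _ = _ at h4
  rw [h4]
  have h5 : (Matrix.of fun i j => Ideal.Quotient.mkₐ ℂ (jetIdeal hd π N) (g i j)) = 1 := by
    ext i j
    rw [Matrix.one_apply]
    exact h3 i j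
  rw [invMetric, h5, Matrix.transpose_one, inv_one, Matrix.one_apply]
  split_ifs <;> simp

/-- The tensors at the vertices of stable graphs: the derivatives of the metric at a point, and zero
for fewer than two unbarred or fewer than two barred indices. With these tensors, only stable graphs
contribute to graph sums. -/
noncomputable def stableTens (π : R →ₐ[ℂ] K) (d d' : ι → Derivation ℂ R R) (g : ι → ι → R)
    (I J : Multiset ι) : K :=
  if Multiset.card I < 2 ∨ Multiset.card J < 2 then 0 else π (tens d d' g I J)

variable {π : R →ₐ[ℂ] K} {N : ℕ} {g : ι → ι → R}

/-- In normal coordinates, the derivatives of the metric with fewer than two unbarred or fewer than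
two barred indices are purely holomorphic or purely antiholomorphic derivatives of the metric, and
vanish. -/
theorem map_tensPos (hd : CommDer d d') (hg : IsKahler d d' g)
    (h : ∀ I i j, Multiset.card I ≤ N → π (it d I (g i j)) = if I = 0 ∧ i = j then 1 else 0)
    (h' : ∀ I i j, Multiset.card I ≤ N → π (it d' I (g i j)) = if I = 0 ∧ i = j then 1 else 0)
    {I J : Multiset ι} (hI : I ≠ 0) (hJ : J ≠ 0) (hIN : Multiset.card I ≤ N)
    (hJN : Multiset.card J ≤ N) : π (tensPos d d' g I J) = stableTens π d d' g I J := by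
  unfold tensPos stableTens
  have hI1 := Multiset.card_pos.2 hI
  have hJ1 := Multiset.card_pos.2 hJ
  by_cases h1 : Multiset.card I = 1 ∧ Multiset.card J = 1
  · rw [if_pos h1, if_pos (by omega), map_zero]
  rw [if_neg h1]
  split_ifs with h2
  · obtain ⟨i, hi⟩ := Multiset.exists_mem_of_ne_zero hI
    obtain ⟨I, rfl⟩ := Multiset.exists_cons_of_mem hi
    obtain ⟨j, hj⟩ := Multiset.exists_mem_of_ne_zero hJ
    obtain ⟨J, rfl⟩ := Multiset.exists_cons_of_mem hj
    rw [tens_cons_cons hd hg]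
    simp only [Multiset.card_cons] at *
    rcases Nat.eq_zero_or_pos (Multiset.card I) with h3 | h3
    · rw [Multiset.card_eq_zero] at h3
      subst h3
      rw [it_zero, h' _ _ _ (by omega), if_neg]
      rintro ⟨rfl, -⟩
      simp at h1
    · have h4 : J = 0 := by
        rw [← Multiset.card_eq_zero]
        omega
      subst h4
      rw [it_zero, h _ _ _ (by omega), if_neg]
      rintro ⟨rfl, -⟩
      simp at h3
  · rfl

/-- In normal coordinates the edges are contracted with the identity matrix and only stable graphs
contribute. -/
theorem map_locSum_of_normal (hd : CommDer d d') (hg : IsKahler d d' g)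
    (h : ∀ I i j, Multiset.card I ≤ N → π (it d I (g i j)) = if I = 0 ∧ i = j then 1 else 0)
    (h' : ∀ I i j, Multiset.card I ≤ N → π (it d' I (g i j)) = if I = 0 ∧ i = j then 1 else 0)
    {k : ℕ} (hk : 3 * k ≤ N) (u₁ u₂ : R) :
    π (locSum d d' g k u₁ u₂) = graphTotal k (fun i j => if i = j then 1 else 0)
      (stableTens π d d' g) fun I J => π (it d' J u₁) * π (it d I u₂) := by
  unfold locSum
  rw [map_graphTotal]
  have h1 : (fun i j => π (invMetric g i j)) = fun i j => if i = j then 1 else 0 := by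
    ext i j
    have := map_it_invMetric hd.comm π hg.unit h 0 i j (by simp)
    simpa using this
  rw [h1]
  refine graphTotal_congr (fun I J hI hJ hIk hJk => ?_) fun I J _ _ => map_mul _ _ _
  exact map_tensPos hd hg h h' hI hJ (by omega) (by omega)

/-- Associativity of graph sums at the centre of normal coordinates. -/
theorem sum_map_locSum_assoc (hd : CommDer d d') (hg : IsKahler d d' g) {m : ℕ}
    (hN : 7 * m + 1 ≤ N)
    (h : ∀ I i j, Multiset.card I ≤ N → π (it d I (g i j)) = if I = 0 ∧ i = j then 1 else 0)
    (h' : ∀ I i j, Multiset.card I ≤ N → π (it d' I (g i j)) = if I = 0 ∧ i = j then 1 else 0)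
    (u₁ u₂ u₃ : R) :
    ∑ q ∈ HasAntidiagonal.antidiagonal m,
      π (locSum d d' g q.2 (locSum d d' g q.1 u₁ u₂) u₃) =
    ∑ q ∈ HasAntidiagonal.antidiagonal m,
      π (locSum d d' g q.2 u₁ (locSum d d' g q.1 u₂ u₃)) := by
  have h1 := sum_graphTotal_assoc hd.comm hd.comm' hd.mixed π hN
    (map_it_invMetric hd.comm π hg.unit h) (map_it_invMetric hd.comm' π hg.unit h')
    (Φ := tensPos d d' g) (Φ' := stableTens π d d' g)
    (fun I J m hI hJ hIm hJN => ?_) (fun I J m hI hJ hIN hJm => ?_)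
    (fun I J hI => if_pos (Or.inl hI)) (fun I J hJ => if_pos (Or.inr hJ)) u₁ u₂ u₃
  · refine Eq.trans (sum_congr rfl fun q hq => ?_) (h1.trans (sum_congr rfl fun q hq => ?_))
    · rw [HasAntidiagonal.mem_antidiagonal] at hq
      rw [map_locSum_of_normal hd hg h h' (by omega)]
      simp only [mul_comm _ (π (it d _ u₃))]
      rfl
    · rw [HasAntidiagonal.mem_antidiagonal] at hq
      rw [map_locSum_of_normal hd hg h h' (by omega)]
      rfl
  · by_cases h2 : Multiset.card I = 1 ∧ Multiset.card J = 1
    · rw [tensPos, if_pos h2, it_map_zero, map_zero, stableTens, if_pos (by omega)]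
    · have h3 : I + m ≠ 0 := fun h => hI (by
        rw [← Multiset.card_eq_zero] at h ⊢
        rw [Multiset.card_add] at h
        omega)
      have h4 : ¬ (Multiset.card (I + m) = 1 ∧ Multiset.card J = 1) := by
        have := Multiset.card_pos.2 hI
        rw [Multiset.card_add]
        omega
      rw [← map_tensPos hd hg h h' h3 hJ hIm hJN, tensPos, tensPos, if_neg h2, if_neg h4,
        it_tens hd hg J m hI]
  · by_cases h2 : Multiset.card I = 1 ∧ Multiset.card J = 1
    · rw [tensPos, if_pos h2, it_map_zero, map_zero, stableTens, if_pos (by omega)]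
    · have h3 : J + m ≠ 0 := fun h => hJ (by
        rw [← Multiset.card_eq_zero] at h ⊢
        rw [Multiset.card_add] at h
        omega)
      have h4 : ¬ (Multiset.card I = 1 ∧ Multiset.card (J + m) = 1) := by
        have := Multiset.card_pos.2 hJ
        rw [Multiset.card_add]
        omega
      rw [← map_tensPos hd hg h h' hI h3 hIN hJm, tensPos, tensPos, if_neg h2, if_neg h4,
        it_tens' hd hg I m hJ]

end NormalPoint

/-! ### Sums over isomorphism classes and sums over labelled graphs -/

section Classes

variable {p q : ℕ}

namespace PointedGraph

/-- The source and the target map of a pointed graph. -/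
def toDG : PointedGraph p q ≃ DG (Fin p) (Fin q) where
  toFun G := (G.src, G.tgt)
  invFun G := ⟨G.1, G.2⟩
  left_inv _ := rfl
  right_inv _ := rfl

theorem isIso_iff {G H : PointedGraph p q} {s : Equiv.Perm (Fin p) × Equiv.Perm (Fin q)} :
    G.IsIso H s ↔ DG.relabel s.1 s.2 (toDG G) = toDG H := by
  constructor
  · rintro ⟨h1, h2⟩
    refine Prod.ext (funext fun e => ?_) (funext fun e => ?_) <;>
    obtain ⟨e, rfl⟩ := s.2.surjective e
    · rw [DG.relabel_fst]
      exact (h1 e).symm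
    · rw [DG.relabel_snd]
      exact (h2 e).symm
  · intro h
    constructor <;> intro e
    · have := DG.relabel_fst s.1 s.2 (toDG G) e
      rw [h] at this
      exact this
    · have := DG.relabel_snd s.1 s.2 (toDG G) e
      rw [h] at this
      exact this

theorem relabel_mul (s t : Equiv.Perm (Fin p) × Equiv.Perm (Fin q)) (G : DG (Fin p) (Fin q)) :
    DG.relabel (s * t).1 (s * t).2 G = DG.relabel s.1 s.2 (DG.relabel t.1 t.2 G) := by
  refine Prod.ext (funext fun e => ?_) (funext fun e => ?_) <;>
  · simp only [DG.relabel, Equiv.prodCongr_apply, Prod.map, Equiv.arrowCongr_apply,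
      Function.comp_apply, Equiv.optionCongr_apply, Option.map_map]
    rfl

theorem relabel_one (G : DG (Fin p) (Fin q)) :
    DG.relabel (1 : Equiv.Perm (Fin p) × Equiv.Perm (Fin q)).1
      (1 : Equiv.Perm (Fin p) × Equiv.Perm (Fin q)).2 G = G := by
  refine Prod.ext (funext fun e => ?_) (funext fun e => ?_)
  · exact congrFun Option.map_id (G.1 e)
  · exact congrFun Option.map_id (G.2 e)

open Classical in
/-- The isomorphisms from `G` to an isomorphic graph are as many as the automorphisms of `G`. -/
theorem card_isIso {G H : PointedGraph p q} (h : ∃ s, G.IsIso H s) :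
    (univ.filter fun s => G.IsIso H s).card = Nat.card G.Aut := by
  obtain ⟨t, ht⟩ := h
  have hA : Nat.card G.Aut = (univ.filter fun s => G.IsIso G s).card := by
    rw [Nat.card_eq_fintype_card, ← Fintype.card_subtype]
    rfl
  rw [isIso_iff] at ht
  rw [hA]
  refine card_bij (fun s _ => t⁻¹ * s) ?_ ?_ ?_
  · intro s hs
    simp only [mem_filter, mem_univ, true_and, isIso_iff] at hs ⊢
    rw [relabel_mul, hs, ← ht, ← relabel_mul, inv_mul_cancel, relabel_one]
  · intro s _ s' _ h
    exact mul_left_cancel h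
  · intro s hs
    simp only [mem_filter, mem_univ, true_and, isIso_iff] at hs
    refine ⟨t * s, ?_, inv_mul_cancel_left _ _⟩
    simp only [mem_filter, mem_univ, true_and, isIso_iff]
    rw [relabel_mul, hs, ht]

/-- The isomorphism class of a pointed graph. -/
def isoClass (G : PointedGraph p q) : IsoClass p q := Quotient.mk (isoSetoid p q) G

open Classical in
/-- The sum over isomorphism classes, weighted by the inverse orders of the automorphism groups,
as a sum over labelled graphs. -/
theorem sum_isoClass (F : DG (Fin p) (Fin q) → ℂ)
    (hF : ∀ (σ : Equiv.Perm (Fin p)) (τ : Equiv.Perm (Fin q)) G, F (DG.relabel σ τ G) = F G) :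
    ∑ c : IsoClass p q, F (toDG (Quotient.out c)) / ((Nat.card (Quotient.out c).Aut : ℕ) : ℂ) =
      ((p.factorial * q.factorial : ℕ) : ℂ)⁻¹ * ∑ G, F G := by
  have hcard : (p.factorial * q.factorial : ℕ) =
      Fintype.card (Equiv.Perm (Fin p) × Equiv.Perm (Fin q)) := by
    simp [Fintype.card_prod, Fintype.card_perm]
  have h0 : ((p.factorial * q.factorial : ℕ) : ℂ) ≠ 0 :=
    Nat.cast_ne_zero.2 (mul_ne_zero p.factorial_ne_zero q.factorial_ne_zero)
  have h1 : ∀ c : IsoClass p q, ((p.factorial * q.factorial : ℕ) : ℂ) *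
      (F (toDG (Quotient.out c)) / ((Nat.card (Quotient.out c).Aut : ℕ) : ℂ)) =
      ∑ G : DG (Fin p) (Fin q), if isoClass (toDG.symm G) = c then F G else 0 := by
    intro c
    have hA : ((Nat.card (Quotient.out c).Aut : ℕ) : ℂ) ≠ 0 := by
      rw [← card_isIso ⟨1, isIso_iff.2 (relabel_one _)⟩, Nat.cast_ne_zero]
      exact (card_pos.2 ⟨1, by simpa [isIso_iff] using relabel_one (toDG (Quotient.out c))⟩).ne'
    -- Orbit and stabiliser: each pair of permutations maps the representative of the class to one
    -- graph of the class.
    have h2 : ((p.factorial * q.factorial : ℕ) : ℂ) = ∑ G : DG (Fin p) (Fin q),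
        (((univ.filter fun s => (Quotient.out c).IsIso (toDG.symm G) s).card : ℕ) : ℂ) := by
      rw [hcard, ← card_univ, card_eq_sum_card_fiberwise (t := univ)
        (f := fun s : Equiv.Perm (Fin p) × Equiv.Perm (Fin q) =>
          DG.relabel s.1 s.2 (toDG (Quotient.out c))) (fun _ _ => mem_coe.2 (mem_univ _)),
        Nat.cast_sum]
      refine sum_congr rfl fun G _ => ?_
      simp only [isIso_iff, Equiv.apply_symm_apply]
    rw [h2, sum_mul]
    refine sum_congr rfl fun G _ => ?_
    by_cases h3 : ∃ s, (Quotient.out c).IsIso (toDG.symm G) s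
    · rw [card_isIso h3, mul_div_cancel₀ _ hA, if_pos]
      · obtain ⟨s, hs⟩ := h3
        rw [isIso_iff, Equiv.apply_symm_apply] at hs
        rw [← hs, hF]
      · rw [← Quotient.out_eq c]
        exact (Quotient.sound (s := isoSetoid p q) h3).symm
    · rw [if_neg, filter_false_of_mem fun s _ hs => h3 ⟨s, hs⟩]
      · simp
      · intro h4
        rw [← Quotient.out_eq c] at h4
        exact h3 (Quotient.exact (s := isoSetoid p q) h4.symm)
  rw [eq_inv_mul_iff_mul_eq₀ h0, mul_sum, sum_congr rfl fun c _ => h1 c, sum_comm]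
  refine sum_congr rfl fun G _ => ?_
  simp

theorem coe_map_outEdges {ι : Type*} (G : PointedGraph p q) (v : Option (Fin p)) (a : Fin q → ι) :
    (((G.outEdges v).map a : List ι) : Multiset ι) = fib G.src v a := rfl

theorem coe_map_inEdges {ι : Type*} (G : PointedGraph p q) (v : Option (Fin p)) (a : Fin q → ι) :
    (((G.inEdges v).map a : List ι) : Multiset ι) = fib G.tgt v a := rfl

theorem coefficient_eq (G : PointedGraph p q) :
    G.coefficient = ((DG.sgn (toDG G) : ℤ) : ℂ) / ((Nat.card G.Aut : ℕ) : ℂ) := rfl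

end PointedGraph

section

variable {n : ℕ} {M : Type*} [TopologicalSpace M] [ChartedSpace (Fin n → ℂ) M]
  [IsManifold 𝓘(ℂ, Fin n → ℂ) ω M] {φ : OpenPartialHomeomorph M (Fin n → ℂ)}

open PointedGraph

theorem commDer_id {U : TopologicalSpace.Opens (Fin n → ℂ)} :
    CommDer (R := Fn U) (fun i => Fn.D (.id ℝ _) i) (fun i => Fn.Db (.id ℝ _) i) :=
  ⟨Fn.D_comm _, Fn.Db_comm _, Fn.D_Db_comm _⟩

theorem vertexFactor_eq (g : KahlerMetric n M) (hφ : φ ∈ holoCharts n M) {x : M}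
    (hx : x ∈ φ.source) (l l' : List (Fin n)) :
    vertexFactor g φ x l l' = Fn.ev (chartPoint φ hx) (tens (fun i => Fn.D (.id ℝ _) i)
      (fun i => Fn.Db (.id ℝ _) i) (chartMetric g hφ) (l : Multiset _) (l' : Multiset _)) := by
  rcases l with _ | ⟨i, l⟩
  · rw [Multiset.coe_nil, tens_zero_left, map_zero]
    rfl
  rcases l' with _ | ⟨j, l'⟩
  · rw [Multiset.coe_nil, tens_zero_right, map_zero]
    rfl
  rw [← Multiset.cons_coe, ← Multiset.cons_coe,
    tens_cons_cons commDer_id (chartMetric_isKahler g hφ)]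
  have h1 := iterDzbar_eq l' (chartMetric g hφ i j) (f := g.comp φ i j) fun _ => rfl
  exact iterDz_eq l _ h1 (chartPoint φ hx)

/-- The graph formula in a chart as a sum over labelled graphs. -/
theorem graphSum_eq (g : KahlerMetric n M) (hφ : φ ∈ holoCharts n M) {x : M} (hx : x ∈ φ.source)
    (k : ℕ) {f₁ f₂ : M → ℂ} (h₁ : SmoothFun n f₁) (h₂ : SmoothFun n f₂) :
    graphSum g φ x k f₁ f₂ = graphTotal k (fun i j => if i = j then 1 else 0)
      (stableTens (Fn.ev (chartPoint φ hx)) (fun i => Fn.D (.id ℝ _) i)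
        (fun i => Fn.Db (.id ℝ _) i) (chartMetric g hφ)) fun I J =>
      Fn.ev (chartPoint φ hx) (it (fun i => Fn.Db (.id ℝ _) i) J
        (chartFun φ f₁ (contDiffOn_of_smoothFun h₁ hφ))) *
      Fn.ev (chartPoint φ hx) (it (fun i => Fn.D (.id ℝ _) i) I
        (chartFun φ f₂ (contDiffOn_of_smoothFun h₂ hφ))) := by
  classical
  obtain ⟨Φ, hΦ⟩ : ∃ Φ, Φ = stableTens (Fn.ev (chartPoint φ hx)) (fun i => Fn.D (.id ℝ _) i)
    (fun i => Fn.Db (.id ℝ _) i) (chartMetric g hφ) := ⟨_, rfl⟩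
  obtain ⟨F, hF⟩ : ∃ F : Multiset (Fin n) → Multiset (Fin n) → ℂ, F = fun I J =>
      Fn.ev (chartPoint φ hx) (it (fun i => Fn.Db (.id ℝ _) i) J
        (chartFun φ f₁ (contDiffOn_of_smoothFun h₁ hφ))) *
      Fn.ev (chartPoint φ hx) (it (fun i => Fn.D (.id ℝ _) i) I
        (chartFun φ f₂ (contDiffOn_of_smoothFun h₂ hφ))) := ⟨_, rfl⟩
  rw [← hΦ, ← hF]
  have hΦ0 : ∀ I J, Multiset.card I < 2 → Φ I J = 0 := fun I J h => by
    rw [hΦ]; exact if_pos (Or.inl h)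
  unfold graphSum graphTotal
  -- Stable graphs of weight `k` have at most `k` ordinary vertices, while the graphs which
  -- contribute to the general graph sums may have up to `2 * k`.
  have h3 : ∑ p ∈ range (2 * k + 1), ((p.factorial * (p + k).factorial : ℕ) : ℂ)⁻¹ •
      gsum (Fin p) (Fin (p + k)) (fun i j => if i = j then 1 else 0) Φ F =
      ∑ p ∈ range (k + 1), ((p.factorial * (p + k).factorial : ℕ) : ℂ)⁻¹ •
      gsum (Fin p) (Fin (p + k)) (fun i j => if i = j then 1 else 0) Φ F := by
    refine (sum_subset (range_mono (by omega)) fun p _ hp => ?_).symm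
    rw [gsum_eq_zero hΦ0, smul_zero]
    simp only [mem_range, Fintype.card_fin] at *
    omega
  rw [h3]
  refine sum_congr rfl fun p _ => ?_
  rw [smul_eq_mul, gsum, ← sum_isoClass]
  · refine sum_congr rfl fun c _ => ?_
    generalize Quotient.out c = G
    by_cases hSC : G.StronglyConnected
    · have hSC' : DG.SC (toDG G) := hSC
      rw [if_pos hSC', contraction_one]
      by_cases hst : G.Stable
      · rw [if_pos ⟨hst, hSC⟩, coefficient_eq, div_mul_eq_mul_div]
        congr 2
        unfold partitionFunction
        refine sum_congr rfl fun a _ => ?_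
        rw [Fintype.prod_option, mul_assoc, mul_comm]
        congr 1
        · rw [hF]
          simp only [vfac]
          exact congrArg₂ _ (iterDzbar_eq _ (chartFun φ f₁ (contDiffOn_of_smoothFun h₁ hφ))
            (f := f₁ ∘ φ.symm) (fun _ => rfl) (chartPoint φ hx))
            (iterDz_eq _ (chartFun φ f₂ (contDiffOn_of_smoothFun h₂ hφ))
            (f := f₂ ∘ φ.symm) (fun _ => rfl) (chartPoint φ hx))
        · refine prod_congr rfl fun v _ => ?_
          rw [vertexFactor_eq g hφ hx, coe_map_outEdges, coe_map_inEdges]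
          simp only [vfac, hΦ]
          rw [stableTens, if_neg]
          · rfl
          · have h4 := hst v
            rw [not_or, not_lt, not_lt]
            refine ⟨h4.2.trans_eq ?_, h4.1.trans_eq ?_⟩
            · change _ = Multiset.card (fib G.src (some v) a)
              rw [← coe_map_outEdges, Multiset.coe_card, List.length_map]
            · change _ = Multiset.card (fib G.tgt (some v) a)
              rw [← coe_map_inEdges, Multiset.coe_card, List.length_map]
      · rw [if_neg fun h => hst h.1, sum_eq_zero, mul_zero, zero_div]
        intro a _
        unfold PointedGraph.Stable at hst
        push Not at hst
        obtain ⟨v, hv⟩ := hst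
        refine prod_eq_zero (mem_univ (some v)) ?_
        simp only [vfac, hΦ]
        refine if_pos ?_
        change Multiset.card (fib G.src (some v) a) < 2 ∨ Multiset.card (fib G.tgt (some v) a) < 2
        rw [← coe_map_outEdges, Multiset.coe_card, List.length_map,
          ← coe_map_inEdges, Multiset.coe_card, List.length_map]
        by_cases h5 : 2 ≤ (G.inEdges (some v)).length
        · exact Or.inl (hv h5)
        · exact Or.inr (not_le.1 h5)
    · have hSC' : ¬ DG.SC (toDG G) := hSC
      rw [if_neg hSC', if_neg fun h => hSC h.2, zero_div]
  · intro σ τ G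
    simp only [DG.SC_relabel, DG.sgn_relabel]
    rw [contraction_relabel (σ := σ) (τ := τ) (Ψ := vfac Φ F)]
    rintro (_ | v) <;> rfl

theorem IsNormalAt.ev_it_D {g : KahlerMetric n M} {N : ℕ} {x : M} (hφ : IsNormalAt g N x φ)
    (I : Multiset (Fin n)) (i j : Fin n) (hI : Multiset.card I ≤ N) :
    Fn.ev (chartPoint φ hφ.mem_source) (it (fun i => Fn.D (.id ℝ _) i) I
      (chartMetric g hφ.mem_charts i j)) = if I = 0 ∧ i = j then 1 else 0 := by
  induction I using Quotient.inductionOn with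
  | h l =>
    refine (iterDz_eq l (chartMetric g hφ.mem_charts i j) (f := g.comp φ i j) (fun _ => rfl)
      (chartPoint φ hφ.mem_source)).symm.trans ?_
    rcases l with _ | ⟨a, l⟩
    · refine (hφ.metric_eq i j).trans ?_
      simp
    · rw [if_neg (by simp)]
      exact hφ.holo_eq_zero i j _ (by simp) hI

theorem IsNormalAt.ev_it_Db {g : KahlerMetric n M} {N : ℕ} {x : M} (hφ : IsNormalAt g N x φ)
    (I : Multiset (Fin n)) (i j : Fin n) (hI : Multiset.card I ≤ N) :
    Fn.ev (chartPoint φ hφ.mem_source) (it (fun i => Fn.Db (.id ℝ _) i) I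
      (chartMetric g hφ.mem_charts i j)) = if I = 0 ∧ i = j then 1 else 0 := by
  induction I using Quotient.inductionOn with
  | h l =>
    refine (iterDzbar_eq l (chartMetric g hφ.mem_charts i j) (f := g.comp φ i j) (fun _ => rfl)
      (chartPoint φ hφ.mem_source)).symm.trans ?_
    rcases l with _ | ⟨a, l⟩
    · refine (hφ.metric_eq i j).trans ?_
      simp
    · rw [if_neg (by simp)]
      exact hφ.antiholo_eq_zero i j _ (by simp) hI

/-- In normal coordinates the graph formula is the graph sum in arbitrary coordinates. -/
theorem graphSum_eq_locSum (g : KahlerMetric n M) {N k : ℕ} (hk : 3 * k ≤ N) {x : M}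
    (hφ : IsNormalAt g N x φ) {f₁ f₂ : M → ℂ} (h₁ : SmoothFun n f₁) (h₂ : SmoothFun n f₂) :
    graphSum g φ x k f₁ f₂ =
    (locSum (fun i => Fn.D (.id ℝ _) i) (fun i => Fn.Db (.id ℝ _) i)
      (chartMetric g hφ.mem_charts) k (chartFun φ f₁ (contDiffOn_of_smoothFun h₁ hφ.mem_charts))
      (chartFun φ f₂ (contDiffOn_of_smoothFun h₂ hφ.mem_charts))).1
        (chartPoint φ hφ.mem_source) :=
  (graphSum_eq g hφ.mem_charts hφ.mem_source k h₁ h₂).trans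
    (map_locSum_of_normal commDer_id (chartMetric_isKahler g hφ.mem_charts) hφ.ev_it_D
      hφ.ev_it_Db hk _ _).symm

end

end Classes

/-! ### Polynomials with prescribed derivatives -/

section Taylor

variable {ι R R' K : Type*} [Fintype ι] [CommRing R] [Algebra ℂ R] [CommRing R'] [Algebra ℂ R']
  [CommRing K] [Algebra ℂ K]

/-- The homogeneous polynomial of degree `r` in the coordinates `t` whose partial derivatives of
order `r` are `c`. -/
noncomputable def homPoly (t : ι → R) : ℕ → (Multiset ι → ℂ) → R
  | 0, c => algebraMap ℂ R (c 0)
  | r + 1, c => ((r : ℂ) + 1)⁻¹ • ∑ i, t i * homPoly t r fun I => c (i ::ₘ I)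

/-- The polynomial in the coordinates `t` whose partial derivatives of order at most `m` are
`c`. -/
noncomputable def jetPoly (t : ι → R) (m : ℕ) (c : Multiset ι → ℂ) : R :=
  ∑ r ∈ range (m + 1), homPoly t r c

theorem map_homPoly (π : R →ₐ[ℂ] R') (t : ι → R) (r : ℕ) (c : Multiset ι → ℂ) :
    π (homPoly t r c) = homPoly (fun i => π (t i)) r c := by
  induction r generalizing c with
  | zero => exact π.commutes _
  | succ r ih => simp only [homPoly, map_smul, map_sum, map_mul, ih]

theorem map_jetPoly (π : R →ₐ[ℂ] R') (t : ι → R) (m : ℕ) (c : Multiset ι → ℂ) :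
    π (jetPoly t m c) = jetPoly (fun i => π (t i)) m c := by
  simp only [jetPoly, map_sum, map_homPoly]

variable [DecidableEq ι] {d : ι → Derivation ℂ R R} {t : ι → R}

theorem der_homPoly (ht : ∀ k i, d k (t i) = if k = i then 1 else 0) (k : ι) (r : ℕ)
    (c : Multiset ι → ℂ) :
    d k (homPoly t (r + 1) c) = homPoly t r fun I => c (k ::ₘ I) := by
  induction r generalizing c with
  | zero =>
    simp only [homPoly, Derivation.map_smul, map_sum, Derivation.leibniz, ht,
      Derivation.map_algebraMap, smul_zero, zero_add, Nat.cast_zero, inv_one, one_smul, smul_eq_mul,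
      mul_ite, mul_one, mul_zero, sum_ite_eq, mem_univ, if_true]
  | succ r ih =>
    have h0 : (((r + 1 : ℕ) : ℂ) + 1) ≠ 0 := by exact_mod_cast (r + 1).succ_ne_zero
    have h1 : (r : ℂ) + 1 ≠ 0 := by exact_mod_cast r.succ_ne_zero
    rw [homPoly, Derivation.map_smul, map_sum, inv_smul_eq_iff₀ h0]
    have h2 : ∀ i, d k (t i * homPoly t (r + 1) fun I => c (i ::ₘ I)) =
        t i * homPoly t r (fun I => c (k ::ₘ i ::ₘ I)) +
          if k = i then homPoly t (r + 1) fun I => c (i ::ₘ I) else 0 := by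
      intro i
      rw [Derivation.leibniz, ih, ht]
      simp only [smul_eq_mul, mul_ite, mul_one, mul_zero, Multiset.cons_swap]
    simp only [h2, sum_add_distrib, sum_ite_eq, mem_univ, if_true]
    rw [add_smul, one_smul]
    congr 1
    rw [homPoly, Nat.cast_add, Nat.cast_one, smul_inv_smul₀ h1]

theorem der_jetPoly (ht : ∀ k i, d k (t i) = if k = i then 1 else 0) (k : ι) (m : ℕ)
    (c : Multiset ι → ℂ) :
    d k (jetPoly t (m + 1) c) = jetPoly t m fun I => c (k ::ₘ I) := by
  unfold jetPoly
  rw [sum_range_succ', map_add, map_sum]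
  simp only [der_homPoly ht]
  rw [homPoly, Derivation.map_algebraMap, add_zero]

theorem map_it_jetPoly (hd : ∀ i j x, d i (d j x) = d j (d i x))
    (ht : ∀ k i, d k (t i) = if k = i then 1 else 0) (π : R →ₐ[ℂ] ℂ) (h0 : ∀ i, π (t i) = 0)
    (I : Multiset ι) (m : ℕ) (hI : Multiset.card I ≤ m) (c : Multiset ι → ℂ) :
    π (it d I (jetPoly t m c)) = c I := by
  induction I using Multiset.induction_on generalizing m c with
  | empty =>
    rw [it_zero, map_jetPoly, jetPoly, sum_range_succ', sum_eq_zero, zero_add]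
    · rfl
    · intro r _
      simp [homPoly, h0]
  | cons k I ih =>
    obtain ⟨m, rfl⟩ : ∃ m', m = m' + 1 := ⟨m - 1, by
      rw [Multiset.card_cons] at hI
      omega⟩
    rw [it_cons' hd, der_jetPoly ht, ih]
    rw [Multiset.card_cons] at hI
    omega

end Taylor

/-! ### Jets and changes of coordinates -/

section JetCriterion

variable {ι R R' K : Type*} [Fintype ι] [DecidableEq ι] [CommRing R] [Algebra ℂ R] [CommRing R']
  [Algebra ℂ R'] [CommRing K] [Algebra ℂ K] {d : ι → Derivation ℂ R R}
  {d' : ι → Derivation ℂ R' R'}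

/-- The vanishing of derivatives at a point does not depend on the coordinates. -/
theorem mem_jetIdeal_of_map (hd : ∀ i j x, d i (d j x) = d j (d i x))
    (hd' : ∀ i j x, d' i (d' j x) = d' j (d' i x)) (π : R →ₐ[ℂ] K) (q : R' →ₐ[ℂ] R)
    (P : Matrix ι ι R) (hP : IsUnit P.det) (h : ∀ i u, d i (q u) = ∑ k, P i k * q (d' k u))
    (N : ℕ) (u : R') (hu : q u ∈ jetIdeal hd π N) : u ∈ jetIdeal hd' (π.comp q) N := by
  induction N generalizing u with
  | zero =>
    intro m hm
    rw [Nat.le_zero, Multiset.card_eq_zero] at hm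
    subst hm
    have := hu 0 (by simp)
    rwa [it_zero] at this ⊢
  | succ N ih =>
    intro m hm
    induction m using Multiset.induction_on with
    | empty =>
      have := hu 0 (by simp)
      rwa [it_zero] at this ⊢
    | cons k m =>
      rw [it_cons' hd']
      rw [Multiset.card_cons] at hm
      refine ih (d' k u) ?_ m (by omega)
      have h1 : ∀ i, d i (q u) ∈ jetIdeal hd π N := fun i m hm => by
        rw [← it_cons' hd]
        exact hu _ (by rw [Multiset.card_cons]; omega)
      have h2 : q (d' k u) = ∑ i, P⁻¹ k i * d i (q u) := by
        have h3 : (fun i => d i (q u)) = P.mulVec fun k => q (d' k u) := funext fun i => h i u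
        have h4 : P⁻¹.mulVec (fun i => d i (q u)) = fun k => q (d' k u) := by
          rw [h3, Matrix.mulVec_mulVec, Matrix.nonsing_inv_mul _ hP, Matrix.one_mulVec]
        exact (congrFun h4 k).symm
      rw [h2]
      exact Ideal.sum_mem _ fun i _ => Ideal.mul_mem_left _ _ (h1 i)

/-- If `g = P H C̄ᵀ`, modulo an ideal, and `P = g κ` with `C̄ᵀ κ = 1`, then `H` is the identity. -/
theorem sub_one_mem_of_factorization {J : Ideal R} {g P H Pb : ι → ι → R} {C κ : ι → ι → ℂ}
    (hg : ∀ i j, g i j = ∑ a, ∑ b, H a b * (P i a * Pb j b))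
    (hPb : ∀ j b, Pb j b - algebraMap ℂ R (C j b) ∈ J)
    (hP : ∀ i b, P i b - ∑ j, g i j * algebraMap ℂ R (κ j b) ∈ J)
    (hκ : ∀ a b, ∑ j, C j a * κ j b = if a = b then 1 else 0)
    (hdet : IsUnit (Matrix.of P).det) (a b : ι) : H a b - (if a = b then 1 else 0) ∈ J := by
  obtain ⟨mk, hmk⟩ : ∃ mk, mk = Ideal.Quotient.mkₐ ℂ J := ⟨_, rfl⟩
  have hmem : ∀ {x y : R}, x - y ∈ J ↔ mk x = mk y := fun {x y} => by
    rw [hmk]; exact Ideal.Quotient.eq.symm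
  simp only [hmem] at *
  have h1 : Matrix.of (fun i b => mk (P i b)) * Matrix.of (fun a b => mk (H a b)) =
      Matrix.of (fun i b => mk (P i b)) := by
    ext i b
    simp only [Matrix.mul_apply, Matrix.of_apply]
    rw [hP i b]
    simp only [hg, map_sum, map_mul, hPb]
    have h2 : ∀ a' b', ∑ j, mk (H a' b') * (mk (P i a') * mk (algebraMap ℂ R (C j b'))) *
        mk (algebraMap ℂ R (κ j b)) = mk (H a' b') * mk (P i a') * if b' = b then 1 else 0 := by
      intro a' b'
      have h3 := congrArg (fun c => mk (algebraMap ℂ R c)) (hκ b' b)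
      simp only [map_sum, map_mul] at h3
      have h4 : mk (algebraMap ℂ R (if b' = b then 1 else 0)) = if b' = b then 1 else 0 := by
        split_ifs <;> simp
      rw [h4] at h3
      rw [← h3, mul_sum]
      exact sum_congr rfl fun j _ => by ring
    simp only [sum_mul]
    rw [sum_rotate, sum_rotate]
    simp only [h2, mul_ite, mul_one, mul_zero, sum_ite_eq', mem_univ, if_true]
    exact sum_congr rfl fun a' _ => mul_comm _ _
  have h2 : IsUnit (Matrix.of fun i b => mk (P i b)).det := map_isUnit_det mk hdet
  have h3 : Matrix.of (fun a b => mk (H a b)) = 1 := by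
    have := congrArg ((Matrix.of fun i b => mk (P i b))⁻¹ * ·) h1
    simpa only [← Matrix.mul_assoc, Matrix.nonsing_inv_mul _ h2, Matrix.one_mul] using this
  have h4 := congrFun (congrFun h3 a) b
  rw [Matrix.of_apply, Matrix.one_apply] at h4
  rw [h4]
  split_ifs <;> simp

end JetCriterion

/-! ### Existence of normal coordinates -/

section NormalCoordinates

open TopologicalSpace (Opens)

variable {n : ℕ}

theorem contDiff_homPoly (p : Fin n → ℂ) (r : ℕ) (c : Multiset (Fin n) → ℂ) :
    ContDiff ℂ ω fun z : Fin n → ℂ => homPoly (fun i => z i - p i) r c := by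
  induction r generalizing c with
  | zero => exact contDiff_const
  | succ r ih =>
    refine ContDiff.const_smul _ (ContDiff.sum fun i _ => ContDiff.mul ?_ (ih _))
    exact (contDiff_apply ℂ ℂ i).sub contDiff_const

theorem contDiff_jetPoly (p : Fin n → ℂ) (m : ℕ) (c : Multiset (Fin n) → ℂ) :
    ContDiff ℂ ω fun z : Fin n → ℂ => jetPoly (fun i => z i - p i) m c :=
  ContDiff.sum fun r _ => contDiff_homPoly p r c

theorem exists_continuousLinearEquiv (A : (Fin n → ℂ) →L[ℂ] (Fin n → ℂ))
    (hA : (Matrix.of fun i k => A (Pi.single i 1) k).det ≠ 0) :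
    ∃ e : (Fin n → ℂ) ≃L[ℂ] (Fin n → ℂ), (e : (Fin n → ℂ) →L[ℂ] (Fin n → ℂ)) = A := by
  have hinj : Function.Injective (A : (Fin n → ℂ) →ₗ[ℂ] (Fin n → ℂ)) := by
    rw [injective_iff_map_eq_zero]
    intro v hv
    by_contra hv0
    refine hA (Matrix.exists_vecMul_eq_zero_iff.1 ⟨v, hv0, ?_⟩)
    have hu : v = ∑ k, v k • Pi.single k (1 : ℂ) := by
      ext j
      simp [Finset.sum_apply, Pi.single_apply]
    rw [hu, map_sum] at hv
    ext j
    have := congrFun hv j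
    simp only [map_smul, Finset.sum_apply, Pi.smul_apply, smul_eq_mul] at this
    exact this
  refine ⟨(LinearEquiv.ofInjectiveEndo _ hinj).toContinuousLinearEquiv, ?_⟩
  ext v
  rfl

open scoped MatrixOrder ComplexOrder in
/-- A positive definite Hermitian matrix becomes the identity in a suitable basis. -/
theorem exists_normalizing_matrix (A : Matrix (Fin n) (Fin n) ℂ) (hA : A.PosDef) :
    ∃ κ : Matrix (Fin n) (Fin n) ℂ, (A * κ).conjTranspose * κ = 1 ∧ (A * κ).det ≠ 0 := by
  obtain ⟨B, rfl⟩ := CStarAlgebra.nonneg_iff_eq_star_mul_self.mp hA.posSemidef.nonneg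
  have hdet : IsUnit B.det := by
    rw [isUnit_iff_ne_zero]
    intro h
    have := hA.det_pos.ne'
    rw [Matrix.det_mul, h, mul_zero] at this
    exact this rfl
  refine ⟨B⁻¹, ?_, ?_⟩
  · rw [Matrix.mul_assoc, Matrix.mul_nonsing_inv _ hdet, Matrix.mul_one,
      Matrix.star_eq_conjTranspose, Matrix.conjTranspose_conjTranspose,
      Matrix.mul_nonsing_inv _ hdet]
  · rw [Matrix.mul_assoc, Matrix.mul_nonsing_inv _ hdet, Matrix.mul_one,
      Matrix.star_eq_conjTranspose, Matrix.det_conjTranspose]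
    exact star_ne_zero.2 hdet.ne_zero

/-- A holomorphic map with invertible derivative at a point restricts to a biholomorphic map between
open sets. -/
theorem exists_localBiholomorphism {W : (Fin n → ℂ) → Fin n → ℂ} (hW : ContDiff ℂ ω W)
    {p : Fin n → ℂ} (hp : (jacobian W p).det ≠ 0) :
    ∃ e ∈ contDiffGroupoid ω 𝓘(ℂ, Fin n → ℂ), p ∈ e.source ∧ ∀ z, e z = W z := by
  have hd : ∀ z, DifferentiableAt ℂ W z := fun z => hW.contDiffAt.differentiableAt (by simp)
  obtain ⟨f', hf'⟩ := exists_continuousLinearEquiv _ hp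
  have h1 : HasFDerivAt W (f' : (Fin n → ℂ) →L[ℂ] (Fin n → ℂ)) p := hf' ▸ (hd p).hasFDerivAt
  have hcont : Continuous fun z => (jacobian W z).det := by
    refine Continuous.matrix_det (continuous_pi fun i => continuous_pi fun k => ?_)
    exact (continuous_apply k).comp ((hW.continuous_fderiv (by simp)).clm_apply continuous_const)
  have hopen : IsOpen {z | (jacobian W z).det ≠ 0} := isOpen_ne_fun hcont continuous_const
  obtain ⟨e, he⟩ : ∃ e, e = (hW.contDiffAt.toOpenPartialHomeomorph W h1 (by simp)).restrOpen
      {z | (jacobian W z).det ≠ 0} hopen := ⟨_, rfl⟩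
  have hsrc : ∀ z ∈ e.source, (jacobian W z).det ≠ 0 := fun z hz => by
    rw [he] at hz
    exact hz.2
  have heW : ∀ z, e z = W z := fun z => by rw [he]; rfl
  refine ⟨e, ?_, ?_, heW⟩
  · rw [contDiffGroupoid, mem_groupoid_of_pregroupoid]
    constructor
    · change ContDiffOn ℂ ω _ _
      simp only [mfld_simps]
      exact hW.contDiffOn.congr fun z _ => heW z
    · change ContDiffOn ℂ ω _ _
      simp only [mfld_simps]
      intro w hw
      obtain ⟨f', hf'⟩ := exists_continuousLinearEquiv _ (hsrc _ (e.map_target hw))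
      have h2 : (e : (Fin n → ℂ) → Fin n → ℂ) = W := funext heW
      exact (e.contDiffAt_symm hw (f₀' := f') (by rw [hf', h2]; exact (hd _).hasFDerivAt)
        (by rw [h2]; exact hW.contDiffAt)).contDiffWithinAt
  · rw [he]
    exact ⟨hW.contDiffAt.mem_toOpenPartialHomeomorph_source h1 (by simp), hp⟩

variable {M : Type*} [TopologicalSpace M] [ChartedSpace (Fin n → ℂ) M]
  {φ ψ : OpenPartialHomeomorph M (Fin n → ℂ)}

theorem trans_mem_holoCharts (hψ : ψ ∈ holoCharts n M)
    {e : OpenPartialHomeomorph (Fin n → ℂ) (Fin n → ℂ)}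
    (he : e ∈ contDiffGroupoid ω 𝓘(ℂ, Fin n → ℂ)) : ψ.trans e ∈ holoCharts n M := by
  intro e' he'
  obtain ⟨h1, h2⟩ := hψ e' he'
  constructor
  · rw [OpenPartialHomeomorph.trans_symm_eq_symm_trans_symm, OpenPartialHomeomorph.trans_assoc]
    exact StructureGroupoid.trans _ (StructureGroupoid.symm _ he) h1
  · rw [← OpenPartialHomeomorph.trans_assoc]
    exact StructureGroupoid.trans _ h2 he

end NormalCoordinates

section NormalExistence

open TopologicalSpace (Opens)

variable {n : ℕ}

/-- The map whose components are the polynomials `jetPoly` has the prescribed derivatives at `p`. -/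
theorem ev_it_coords_jetPoly {U : Opens (Fin n → ℂ)} (p : U) (m : ℕ)
    (c : Fin n → Multiset (Fin n) → ℂ)
    (hW : ContDiffOn ℝ ∞ (fun (z : Fin n → ℂ) (b : Fin n) =>
      jetPoly (fun i => z i - p.1 i) m (c b)) U)
    (b : Fin n)
    (I : Multiset (Fin n)) (hI : Multiset.card I ≤ m) :
    Fn.ev p (it (fun i => Fn.D (.id ℝ _) i) I (Fn.coords _ hW b)) = c b I := by
  obtain ⟨t, ht⟩ : ∃ t : Fin n → Fn U, t = fun i => Fn.coords (U := U) id contDiffOn_id i -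
    algebraMap ℂ _ (p.1 i) := ⟨_, rfl⟩
  have htz : ∀ (z : U) i, Fn.ev z (t i) = z.1 i - p.1 i := fun z i => by rw [ht]; rfl
  have h1 : Fn.coords _ hW b = jetPoly t m (c b) := by
    refine Subtype.ext (funext fun z => ?_)
    have := map_jetPoly (Fn.ev z) t m (c b)
    simp only [htz] at this
    exact this.symm
  rw [h1]
  refine map_it_jetPoly (Fn.D_comm _) (fun k i => ?_) (Fn.ev p) (fun i => ?_) I m hI (c b)
  · rw [ht]
    simp only [map_sub, Derivation.map_algebraMap, sub_zero]
    refine Subtype.ext (funext fun z => ?_)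
    rw [D_coords_apply (B := ContinuousLinearMap.id ℂ _) fun v => by rw [fderiv_id]; rfl]
    rw [ContinuousLinearMap.id_apply, Pi.single_apply]
    split_ifs with h1 h2 h2
    · rfl
    · exact absurd h1.symm h2
    · exact absurd h2.symm h1
    · rfl
  · rw [htz, sub_self]

variable {M : Type*} [TopologicalSpace M] [ChartedSpace (Fin n → ℂ) M]
  [IsManifold 𝓘(ℂ, Fin n → ℂ) ω M] {φ ψ : OpenPartialHomeomorph M (Fin n → ℂ)}

open scoped ComplexOrder in
theorem posDef_comp (g : KahlerMetric n M) (hψ : ψ ∈ holoCharts n M) {z : Fin n → ℂ}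
    (hz : z ∈ ψ.target) : (Matrix.of fun i j => g.comp ψ i j z).PosDef := by
  have hherm : (Matrix.of fun i j => g.comp ψ i j z).IsHermitian := by
    ext i j
    exact (g.hermitian (ψ.symm z) _ _).symm
  refine Matrix.PosDef.of_dotProduct_mulVec_pos hherm fun v hv => ?_
  have h1 : Star.star v ⬝ᵥ (Matrix.of fun i j => g.comp ψ i j z).mulVec v =
      frameForm g ψ z (Star.star v) (Star.star v) := by
    rw [frameForm_eq_sum]
    simp only [dotProduct, Matrix.mulVec, Matrix.of_apply, mul_sum]
    refine sum_congr rfl fun k _ => sum_congr rfl fun l _ => ?_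
    simp only [Pi.star_apply, Complex.star_def, Complex.conj_conj]
    ring
  rw [h1, Complex.lt_def]
  refine ⟨frameForm_pos g hψ hz (star_ne_zero.2 hv), ?_⟩
  have h2 := g.hermitian (ψ.symm z) (frame ψ z (Star.star v)) (frame ψ z (Star.star v))
  have h3 := congrArg Complex.im h2
  rw [Complex.conj_im] at h3
  change (0 : ℝ) = (g.form (ψ.symm z) (frame ψ z (Star.star v)) (frame ψ z (Star.star v))).im
  linarith

theorem it_Db_conj {U : Opens (Fin n → ℂ)} (I : Multiset (Fin n)) (u : Fn U) :
    it (fun i => Fn.Db (.id ℝ _) i) I (Fn.conj u) =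
      Fn.conj (it (fun i => Fn.D (.id ℝ _) i) I u) := by
  induction I using Multiset.induction_on with
  | empty => simp
  | cons k I ih => rw [it_cons (Fn.Db_comm _), it_cons (Fn.D_comm _), ih, Fn.Db_conj]

/-- It is enough to know the derivatives of the metric in the holomorphic directions. -/
theorem isNormalAt_of_ev_it_D (g : KahlerMetric n M) {N : ℕ} {x : M} (hφ : φ ∈ holoCharts n M)
    (hx : x ∈ φ.source) (h : ∀ i j I, Multiset.card I ≤ N → Fn.ev (chartPoint φ hx)
      (it (fun i => Fn.D (.id ℝ _) i) I (chartMetric g hφ i j)) = if I = 0 ∧ i = j then 1 else 0) :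
    IsNormalAt g N x φ where
  mem_charts := hφ
  mem_source := hx
  metric_eq i j := by
    have h1 := h i j 0 (by simp)
    rw [it_zero] at h1
    exact h1.trans (by simp)
  holo_eq_zero i j l hl hN := by
    refine (iterDz_eq l (chartMetric g hφ i j) (f := g.comp φ i j) (fun _ => rfl)
      (chartPoint φ hx)).trans ((h i j l hN).trans (if_neg ?_))
    rintro ⟨h1, -⟩
    rw [Multiset.coe_eq_zero] at h1
    simp [h1] at hl
  antiholo_eq_zero i j l hl hN := by
    refine (iterDzbar_eq l (chartMetric g hφ i j) (f := g.comp φ i j) (fun _ => rfl)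
      (chartPoint φ hx)).trans ?_
    have h2 := h j i l hN
    rw [if_neg] at h2
    · rw [← conj_chartMetric g hφ j i, it_Db_conj, Fn.conj_apply]
      exact (congrArg _ h2).trans (map_zero _)
    · rintro ⟨h1, -⟩
      rw [Multiset.coe_eq_zero] at h1
      simp [h1] at hl

/-- The coordinates are given by polynomials `W` with `∂ᵢ W = ∑ⱼ g_{i j̄} κ_{j}` up to order `N`
in the holomorphic directions, which is possible since the metric is closed. -/
theorem exists_isNormalAt (g : KahlerMetric n M) (N : ℕ) (x : M) : ∃ φ, IsNormalAt g N x φ := by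
  obtain ⟨ψ, hψ, hx⟩ : ∃ ψ ∈ holoCharts n M, x ∈ ψ.source :=
    ⟨chartAt _ x, IsManifold.chart_mem_maximalAtlas x, mem_chart_source _ x⟩
  -- If `C = g κ` is the Jacobian matrix of the new coordinates at `x`, then the first property of
  -- `κ` says that the metric becomes the identity at `x`.
  obtain ⟨κ, hκ1, hκ2⟩ := exists_normalizing_matrix _ (posDef_comp g hψ (ψ.map_source hx))
  obtain ⟨d, hd⟩ : ∃ d : Fin n → Derivation ℂ (Fn (chartDomain ψ)) (Fn (chartDomain ψ)),
    d = fun i => Fn.D (.id ℝ _) i := ⟨_, rfl⟩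
  have hdc : ∀ i j x, d i (d j x) = d j (d i x) := by rw [hd]; exact Fn.D_comm _
  -- The functions which the derivatives `∂ᵢ W b` have to match up to order `N` at `x`.
  obtain ⟨X, hX⟩ : ∃ X : Fin n → Fin n → Fn (chartDomain ψ), X = fun b i =>
    ∑ j, κ j b • chartMetric g hψ i j := ⟨_, rfl⟩
  have hXc : ∀ b i k, d k (X b i) = d i (X b k) := fun b i k => by
    simp only [hX, map_sum, Derivation.map_smul, hd, (chartMetric_isKahler g hψ).closed i _ k]
  -- The derivatives of `W b` up to order `N + 1`; the closedness of the metric makes them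
  -- symmetric.
  obtain ⟨c, hc⟩ : ∃ c : Fin n → Multiset (Fin n) → ℂ, c = fun b I =>
    Fn.ev (chartPoint ψ hx) (pot d (X b) I) := ⟨_, rfl⟩
  obtain ⟨W, hWdef⟩ : ∃ W : (Fin n → ℂ) → Fin n → ℂ, W = fun z b =>
    jetPoly (fun i => z i - (chartPoint ψ hx).1 i) (N + 1) (c b) := ⟨_, rfl⟩
  have hW : ContDiff ℂ ω W := by
    rw [hWdef]
    exact contDiff_pi.2 fun b => contDiff_jetPoly _ _ _
  have hWU : ContDiffOn ℂ ∞ W (chartDomain ψ) := (hW.of_le le_top).contDiffOn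
  have hWr : ContDiffOn ℝ ∞ W (chartDomain ψ) := contDiffOn_real hWU
  have hjet : ∀ b I, Multiset.card I ≤ N + 1 → Fn.ev (chartPoint ψ hx)
      (it d I (Fn.coords W hWr b)) = c b I := by
    intro b I hI
    rw [hd]
    subst hWdef
    exact ev_it_coords_jetPoly (chartPoint ψ hx) (N + 1) c hWr b I hI
  have hDW : ∀ b i I, Multiset.card I ≤ N → Fn.ev (chartPoint ψ hx)
      (it d I (d i (Fn.coords W hWr b))) = Fn.ev (chartPoint ψ hx) (it d I (X b i)) := by
    intro b i I hI
    rw [← it_cons' hdc, hjet b _ (by rw [Multiset.card_cons]; omega), hc]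
    change Fn.ev _ (pot d (X b) (i ::ₘ I)) = _
    rw [pot_cons hdc (hXc b)]
  have hXx : ∀ b i, Fn.ev (chartPoint ψ hx) (X b i) =
      ((Matrix.of fun i j => g.comp ψ i j (ψ x)) * κ) i b := by
    intro b i
    rw [hX, map_sum, Matrix.mul_apply]
    refine sum_congr rfl fun j _ => ?_
    rw [map_smul, smul_eq_mul, mul_comm]
    rfl
  have hJ : (jacobian W (ψ x)).det ≠ 0 := by
    have : jacobian W (ψ x) = (Matrix.of fun i j => g.comp ψ i j (ψ x)) * κ := by
      ext i b
      have h1 := hDW b i 0 (by simp)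
      rw [it_zero, it_zero, hXx, hd] at h1
      rw [← h1]
      exact (D_coords_apply (x := chartPoint ψ hx) (B := fderiv ℂ W (ψ x))
        (fun v => fderiv_real hWU (chartPoint ψ hx).2 v) i b).symm
    rw [this]
    exact hκ2
  -- The new coordinates are those given by `W`, near `x`.
  obtain ⟨e, he, hxe, heW⟩ := exists_localBiholomorphism hW hJ
  obtain ⟨φ, hφe⟩ : ∃ φ, φ = ψ.trans e := ⟨_, rfl⟩
  have hφ : φ ∈ holoCharts n M := hφe ▸ trans_mem_holoCharts hψ he
  have hxφ : x ∈ φ.source := by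
    rw [hφe, OpenPartialHomeomorph.trans_source]
    exact ⟨hx, hxe⟩
  have hw : ψ x ∈ overlap ψ φ := mem_overlap.2 ⟨ψ.map_source hx, by rwa [ψ.left_inv hx]⟩
  have hT := contDiffOn_transition hψ hφ
  have hTW : ∀ z ∈ ψ.target, (φ ∘ ψ.symm) z = W z := fun z hz => by
    rw [hφe]
    change e (ψ (ψ.symm z)) = W z
    rw [ψ.right_inv hz, heW]
  obtain ⟨r, hr⟩ : ∃ r, r = Fn.pull (id : (Fin n → ℂ) → _) contDiffOn_id
    (mem_chartDomain_of_overlap (φ := ψ) (ψ := φ)) := ⟨_, rfl⟩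
  obtain ⟨q, hq⟩ : ∃ q, q = Fn.pull _ (contDiffOn_real hT) transition_mem_chartDomain := ⟨_, rfl⟩
  obtain ⟨P, hP⟩ : ∃ P : Fin n → Fin n → Fn (overlap ψ φ), P = fun i b => Fn.D (.id ℝ _) i
    (Fn.coords _ (contDiffOn_real hT) b) := ⟨_, rfl⟩
  have hrev : ∀ u, Fn.ev ⟨ψ x, hw⟩ (r u) = Fn.ev (chartPoint ψ hx) u := fun u => by rw [hr]; rfl
  have hrD : ∀ i u, r (d i u) = Fn.D (.id ℝ _) i (r u) := fun i u => by
    rw [hr, hd]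
    exact D_pull_of_affine contDiffOn_id mem_chartDomain_of_overlap
      (fun z v => fderiv_id_eq z.1 v) i u
  have hrW : ∀ b, r (Fn.coords W hWr b) = Fn.coords _ (contDiffOn_real hT) b := fun b =>
    Subtype.ext (funext fun z => by
      rw [hr]
      exact (congrFun (hTW z (mem_overlap.1 z.2).1) b).symm)
  have hrit : ∀ I u, r (it d I u) = it (fun i => Fn.D (.id ℝ _) i) I (r u) := fun I u =>
    it_map r.toLinearMap hrD I u
  have hB : ∀ (z : overlap ψ φ) v, fderiv ℝ (φ ∘ ψ.symm) z (ContinuousLinearMap.id ℝ _ v) =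
    fderiv ℂ (φ ∘ ψ.symm) z v := fun z v => fderiv_real hT z.2 v
  have hhol : ∀ i b, Fn.Db (.id ℝ _) i (Fn.coords _ (contDiffOn_real hT) b) = 0 := fun i b =>
    Subtype.ext (funext fun z => Db_coords_apply (hB z) i b)
  have hPr : ∀ i b, P i b = r (d i (Fn.coords W hWr b)) := fun i b => by rw [hrD, hrW, hP]
  have hdet : IsUnit (Matrix.of P).det := by
    refine isUnit_det_of_ne_zero fun z => ?_
    have : (Matrix.of fun i b => (P i b).1 z) = jacobian (φ ∘ ψ.symm) z := by
      ext i b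
      rw [hP]
      exact D_coords_apply (hB z) i b
    rw [this]
    exact det_jacobian_ne_zero hψ hφ z.2
  -- Modulo functions whose holomorphic derivatives vanish up to order `N` at `x`, the
  -- antiholomorphic functions `conj P` are constants and `P = g κ`. So the metric in the new
  -- coordinates is the identity.
  have key := sub_one_mem_of_factorization (J := jetIdeal (Fn.D_comm (.id ℝ _))
      (Fn.ev (⟨ψ x, hw⟩ : overlap ψ φ)) N) (g := fun i j => r (chartMetric g hψ i j)) (P := P)
    (H := fun a b => q (chartMetric g hφ a b)) (Pb := fun j b => Fn.conj (P j b))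
    (C := fun j b => starRingEnd ℂ (((Matrix.of fun i j => g.comp ψ i j (ψ x)) * κ) j b))
    (κ := fun j b => κ j b)
    (fun i j => by
      rw [hr, pull_chartMetric g hψ hφ, hP, hq]
      rfl)
    (fun j b => by
      intro I hI
      have h1 : Fn.ev (⟨ψ x, hw⟩ : overlap ψ φ) (it (fun i => Fn.D (.id ℝ _) i) I
          (Fn.conj (P j b))) = if I = 0 then starRingEnd ℂ
          (((Matrix.of fun i j => g.comp ψ i j (ψ x)) * κ) j b) else 0 := by
        split_ifs with h
        · rw [h, it_zero, Fn.ev_apply, Fn.conj_apply, ← Fn.ev_apply, hPr, hrev, ← hXx]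
          have := hDW b j 0 (by simp)
          rw [it_zero, it_zero] at this
          rw [this]
        · obtain ⟨k, I, rfl⟩ : ∃ k I', I = k ::ₘ I' := by
            obtain ⟨k, hk⟩ := Multiset.exists_mem_of_ne_zero h
            exact ⟨k, I.erase k, (Multiset.cons_erase hk).symm⟩
          rw [it_cons' (Fn.D_comm _), Fn.D_conj, hP]
          simp only []
          rw [← Fn.D_Db_comm, hhol, map_zero, Fn.conj_zero, it_map_zero, map_zero]
      rw [sub_eq_add_neg, it_add, ← neg_one_smul ℂ, it_smul, map_add, map_smul, h1,
        it_algebraMap (Fn.D_comm _)]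
      split_ifs <;> simp)
    (fun i b => by
      intro I hI
      have h1 : P i b - ∑ j, r (chartMetric g hψ i j) * algebraMap ℂ _ (κ j b) =
          r (d i (Fn.coords W hWr b) - X b i) := by
        rw [hPr, map_sub, hX, map_sum]
        congr 1
        refine sum_congr rfl fun j _ => ?_
        rw [map_smul, Algebra.smul_def, mul_comm]
      rw [h1, ← hrit, hrev, sub_eq_add_neg, it_add, ← neg_one_smul ℂ, it_smul, map_add,
        map_smul, hDW b i I hI, neg_one_smul, add_neg_cancel])
    (fun a b => by
      have := congrFun (congrFun hκ1 a) b
      rwa [Matrix.mul_apply, Matrix.one_apply] at this) hdet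
  refine ⟨φ, isNormalAt_of_ev_it_D g hφ hxφ fun a b I hI => ?_⟩
  have h1 : q (chartMetric g hφ a b - if a = b then 1 else 0) ∈
      jetIdeal (Fn.D_comm (.id ℝ _)) (Fn.ev (⟨ψ x, hw⟩ : overlap ψ φ)) N := by
    have h2 : q (if a = b then 1 else 0) = if a = b then 1 else 0 := by split_ifs <;> simp
    rw [map_sub, h2]
    exact key a b
  -- Pass from derivatives in the old coordinates to derivatives in the new ones.
  have h2 := mem_jetIdeal_of_map (Fn.D_comm (.id ℝ _)) (Fn.D_comm (.id ℝ _)) _ q (Matrix.of P)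
    hdet (fun i u => by
      rw [hq, hP]
      refine (D_pull hhol i u).trans (sum_congr rfl fun k _ => mul_comm _ _)) N _ h1 I hI
  have h3 : ∀ u, (Fn.ev (⟨ψ x, hw⟩ : overlap ψ φ)) (q u) = Fn.ev (chartPoint φ hxφ) u := by
    intro u
    rw [hq]
    change u.1 _ = u.1 _
    exact congrArg u.1 (Subtype.ext (congrArg φ (ψ.left_inv hx)))
  have h4 : (if a = b then (1 : Fn (chartDomain φ)) else 0) =
      algebraMap ℂ _ (if a = b then 1 else 0) := by split_ifs <;> simp
  rw [AlgHom.comp_apply, h3, h4, sub_eq_add_neg, it_add, ← neg_one_smul ℂ, it_smul, map_add,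
    map_smul, it_algebraMap (Fn.D_comm _), neg_one_smul, ← sub_eq_add_neg, sub_eq_zero] at h2
  rw [h2]
  by_cases h5 : I = 0 <;> by_cases h6 : a = b <;> simp [h5, h6]

end NormalExistence

/-! ### The star product -/

section Additivity

variable {V E ι α K R : Type*} [Fintype V] [DecidableEq V] [Fintype E] [DecidableEq E]
  [Fintype ι] [CommRing K] [CommRing R] [Algebra ℂ R]

theorem gsum_sum (s : Finset α) (M : ι → ι → K) (Φ : Multiset ι → Multiset ι → K)
    (F : α → Multiset ι → Multiset ι → K) :
    gsum V E M Φ (fun I J => ∑ x ∈ s, F x I J) = ∑ x ∈ s, gsum V E M Φ (F x) := by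
  classical
  unfold gsum
  rw [sum_comm]
  refine sum_congr rfl fun G _ => ?_
  split_ifs
  · rw [← mul_sum]
    congr 1
    unfold contraction
    simp only [Fintype.prod_option, vfac, sum_mul, mul_sum]
    rw [sum_comm (s := s)]
    exact sum_congr rfl fun a _ => sum_comm
  · simp

theorem graphTotal_sum [Algebra ℂ K] (s : Finset α) (k : ℕ) (M : ι → ι → K)
    (Φ : Multiset ι → Multiset ι → K) (F : α → Multiset ι → Multiset ι → K) :
    graphTotal k M Φ (fun I J => ∑ x ∈ s, F x I J) = ∑ x ∈ s, graphTotal k M Φ (F x) := by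
  unfold graphTotal
  rw [sum_comm]
  simp only [gsum_sum, smul_sum]

variable [DecidableEq ι] (d d' : ι → Derivation ℂ R R) (g : ι → ι → R) (k : ℕ)

theorem locSum_sum_right (s : Finset α) (u : R) (v : α → R) :
    locSum d d' g k u (∑ x ∈ s, v x) = ∑ x ∈ s, locSum d d' g k u (v x) := by
  unfold locSum
  rw [← graphTotal_sum]
  exact congrArg (graphTotal k _ _) (funext fun I => funext fun J => by
    simp only [pointTens, it_sum, mul_sum])

theorem locSum_sum_left (s : Finset α) (u : α → R) (v : R) :
    locSum d d' g k (∑ x ∈ s, u x) v = ∑ x ∈ s, locSum d d' g k (u x) v := by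
  unfold locSum
  rw [← graphTotal_sum]
  exact congrArg (graphTotal k _ _) (funext fun I => funext fun J => by
    simp only [pointTens, it_sum, sum_mul])

end Additivity

section Reindex

variable {A : Type*} [AddCommMonoid A]

/-- Nested sums over the antidiagonal, reordered by the total weight `u.1` of the two products. Here
`f a b c d e` stands for the term with the outer coefficient `a`, the inner coefficient `c`, and the
coefficients `b`, `d`, `e` of the three series. -/
theorem sum_antidiagonal_right (f : ℕ → ℕ → ℕ → ℕ → ℕ → A) (m : ℕ) :
    ∑ s ∈ HasAntidiagonal.antidiagonal m, ∑ t ∈ HasAntidiagonal.antidiagonal s.2,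
      ∑ s' ∈ HasAntidiagonal.antidiagonal t.2, ∑ t' ∈ HasAntidiagonal.antidiagonal s'.2,
        f s.1 t.1 s'.1 t'.1 t'.2 =
    ∑ u ∈ HasAntidiagonal.antidiagonal m, ∑ v ∈ HasAntidiagonal.antidiagonal u.2,
      ∑ w ∈ HasAntidiagonal.antidiagonal v.2, ∑ q ∈ HasAntidiagonal.antidiagonal u.1,
        f q.2 v.1 q.1 w.1 w.2 := by
  simp only [sum_sigma']
  refine sum_nbij' (fun y => ⟨(y.1.1 + y.2.2.1.1, y.2.1.1 + y.2.2.1.2), (y.2.1.1, y.2.2.1.2),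
    (y.2.2.2.1, y.2.2.2.2), (y.2.2.1.1, y.1.1)⟩) (fun y => ⟨(y.2.2.2.2, y.2.2.2.1 + y.1.2),
      (y.2.1.1, y.2.2.2.1 + y.2.1.2), (y.2.2.2.1, y.2.1.2), (y.2.2.1.1, y.2.2.1.2)⟩) ?_ ?_ ?_ ?_ ?_
  · rintro ⟨⟨a, b⟩, ⟨c, d⟩, ⟨e, f⟩, p, q⟩ h
    simp only [mem_sigma, HasAntidiagonal.mem_antidiagonal, true_and, and_true] at h ⊢
    omega
  · rintro ⟨⟨a, b⟩, ⟨c, d⟩, ⟨e, f⟩, p, q⟩ h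
    simp only [mem_sigma, HasAntidiagonal.mem_antidiagonal, true_and, and_true] at h ⊢
    omega
  · rintro ⟨⟨a, b⟩, ⟨c, d⟩, ⟨e, f⟩, p, q⟩ h
    simp only [mem_sigma, HasAntidiagonal.mem_antidiagonal] at h
    obtain ⟨h1, h2, h3, h4⟩ := h
    subst h4 h3 h2
    simp only [Sigma.mk.injEq, Prod.mk.injEq, heq_eq_eq, true_and, and_true]
    omega
  · rintro ⟨⟨a, b⟩, ⟨c, d⟩, ⟨e, f⟩, p, q⟩ h
    simp only [mem_sigma, HasAntidiagonal.mem_antidiagonal] at h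
    obtain ⟨h1, h2, h3, h4⟩ := h
    subst h4 h3 h2
    simp only [Sigma.mk.injEq, Prod.mk.injEq, heq_eq_eq, true_and, and_true]
    omega
  · rintro ⟨⟨a, b⟩, ⟨c, d⟩, ⟨e, f⟩, p, q⟩ h
    rfl

/-- The analogue of `sum_antidiagonal_right` for the other bracketing, with the inner coefficient
`b` and the coefficients `c`, `d`, `e` of the three series. -/
theorem sum_antidiagonal_left (f : ℕ → ℕ → ℕ → ℕ → ℕ → A) (m : ℕ) :
    ∑ s ∈ HasAntidiagonal.antidiagonal m, ∑ t ∈ HasAntidiagonal.antidiagonal s.2,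
      ∑ s' ∈ HasAntidiagonal.antidiagonal t.1, ∑ t' ∈ HasAntidiagonal.antidiagonal s'.2,
        f s.1 s'.1 t'.1 t'.2 t.2 =
    ∑ u ∈ HasAntidiagonal.antidiagonal m, ∑ v ∈ HasAntidiagonal.antidiagonal u.2,
      ∑ w ∈ HasAntidiagonal.antidiagonal v.2, ∑ q ∈ HasAntidiagonal.antidiagonal u.1,
        f q.2 q.1 v.1 w.1 w.2 := by
  simp only [sum_sigma']
  refine sum_nbij' (fun y => ⟨(y.1.1 + y.2.2.1.1, y.2.2.2.1 + (y.2.2.2.2 + y.2.1.2)),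
    (y.2.2.2.1, y.2.2.2.2 + y.2.1.2), (y.2.2.2.2, y.2.1.2), (y.2.2.1.1, y.1.1)⟩)
    (fun y => ⟨(y.2.2.2.2, y.2.2.2.1 + y.1.2), (y.2.2.2.1 + (y.2.1.1 + y.2.2.1.1), y.2.2.1.2),
      (y.2.2.2.1, y.2.1.1 + y.2.2.1.1), (y.2.1.1, y.2.2.1.1)⟩) ?_ ?_ ?_ ?_ ?_
  · rintro ⟨⟨a, b⟩, ⟨c, d⟩, ⟨e, f⟩, p, q⟩ h
    simp only [mem_sigma, HasAntidiagonal.mem_antidiagonal, true_and, and_true] at h ⊢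
    omega
  · rintro ⟨⟨a, b⟩, ⟨c, d⟩, ⟨e, f⟩, p, q⟩ h
    simp only [mem_sigma, HasAntidiagonal.mem_antidiagonal, true_and, and_true] at h ⊢
    omega
  · rintro ⟨⟨a, b⟩, ⟨c, d⟩, ⟨e, f⟩, p, q⟩ h
    simp only [mem_sigma, HasAntidiagonal.mem_antidiagonal] at h
    obtain ⟨h1, h2, h3, h4⟩ := h
    subst h4 h3 h2
    simp only [Sigma.mk.injEq, Prod.mk.injEq, heq_eq_eq, true_and, and_true]
    omega
  · rintro ⟨⟨a, b⟩, ⟨c, d⟩, ⟨e, f⟩, p, q⟩ h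
    simp only [mem_sigma, HasAntidiagonal.mem_antidiagonal] at h
    obtain ⟨h1, h2, h3, h4⟩ := h
    subst h4 h3 h2
    simp only [Sigma.mk.injEq, Prod.mk.injEq, heq_eq_eq, true_and, and_true]
    omega
  · rintro ⟨⟨a, b⟩, ⟨c, d⟩, ⟨e, f⟩, p, q⟩ h
    rfl

end Reindex

section Star

variable {n : ℕ} {M : Type*} [TopologicalSpace M] [ChartedSpace (Fin n → ℂ) M]
  [IsManifold 𝓘(ℂ, Fin n → ℂ) ω M] {φ : OpenPartialHomeomorph M (Fin n → ℂ)}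

/-- The coefficients of the star product as graph sums in an arbitrary chart. -/
theorem starCoeff_eq (g : KahlerMetric n M) (k : ℕ) {f₁ f₂ : M → ℂ} (h₁ : SmoothFun n f₁)
    (h₂ : SmoothFun n f₂) (hφ : φ ∈ holoCharts n M) {x : M} (hx : x ∈ φ.source) :
    starCoeff g k f₁ f₂ x =
      (locSum (fun i => Fn.D (.id ℝ _) i) (fun i => Fn.Db (.id ℝ _) i) (chartMetric g hφ) k
        (chartFun φ f₁ (contDiffOn_of_smoothFun h₁ hφ))
        (chartFun φ f₂ (contDiffOn_of_smoothFun h₂ hφ))).1 (chartPoint φ hx) := by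
  have H := exists_isNormalAt g (3 * k) x
  rw [starCoeff, dif_pos H, graphSum_eq_locSum g le_rfl H.choose_spec h₁ h₂]
  exact locSum_chart_eq g H.choose_spec.mem_charts hφ h₁ h₂ k _ hx

/-- The coefficients are smooth, being graph sums of smooth functions near each point. -/
theorem starCoeff_smoothFun (g : KahlerMetric n M) (k : ℕ) {f₁ f₂ : M → ℂ} (h₁ : SmoothFun n f₁)
    (h₂ : SmoothFun n f₂) : SmoothFun n (starCoeff g k f₁ f₂) := by
  refine smoothFun_of_contDiffAt fun x => ?_
  have hφ : chartAt (Fin n → ℂ) x ∈ holoCharts n M := IsManifold.chart_mem_maximalAtlas x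
  have h := (Fn.contDiffOn_rep (locSum (fun i => Fn.D (.id ℝ _) i) (fun i => Fn.Db (.id ℝ _) i)
    (chartMetric g hφ) k (chartFun _ f₁ (contDiffOn_of_smoothFun h₁ hφ))
    (chartFun _ f₂ (contDiffOn_of_smoothFun h₂ hφ)))).contDiffAt
    ((chartDomain (chartAt (Fin n → ℂ) x)).2.mem_nhds
      ((chartAt (Fin n → ℂ) x).map_source (mem_chart_source _ x)))
  refine h.congr_of_eventuallyEq ?_
  filter_upwards [(chartDomain (chartAt (Fin n → ℂ) x)).2.mem_nhds
    ((chartAt (Fin n → ℂ) x).map_source (mem_chart_source _ x))] with z hz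
  rw [Fn.rep_apply' _ hz, Function.comp_apply,
    starCoeff_eq g k h₁ h₂ hφ ((chartAt (Fin n → ℂ) x).map_target hz)]
  exact congrArg _ (Subtype.ext ((chartAt (Fin n → ℂ) x).right_inv hz))

theorem SmoothFun.sum {α : Type*} (s : Finset α) {f : α → M → ℂ}
    (hf : ∀ a ∈ s, SmoothFun n (f a)) : SmoothFun n (∑ a ∈ s, f a) :=
  contMDiff_finsetSum' hf

theorem star_smoothSeries (g : KahlerMetric n M) {F₁ F₂ : PowerSeries (M → ℂ)}
    (h₁ : SmoothSeries n F₁) (h₂ : SmoothSeries n F₂) : SmoothSeries n (star g F₁ F₂) := by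
  intro k
  rw [star, PowerSeries.coeff_mk]
  exact SmoothFun.sum _ fun s _ => SmoothFun.sum _ fun t _ => starCoeff_smoothFun g _ (h₁ _) (h₂ _)

/-- The coefficients of the star product of two series in a chart. -/
theorem chartFun_coeff_star (g : KahlerMetric n M) {F₁ F₂ : PowerSeries (M → ℂ)}
    (h₁ : SmoothSeries n F₁) (h₂ : SmoothSeries n F₂) (hφ : φ ∈ holoCharts n M) (m : ℕ) :
    chartFun φ (PowerSeries.coeff m (star g F₁ F₂))
      (contDiffOn_of_smoothFun (star_smoothSeries g h₁ h₂ m) hφ) =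
    ∑ s ∈ HasAntidiagonal.antidiagonal m, ∑ t ∈ HasAntidiagonal.antidiagonal s.2,
      locSum (fun i => Fn.D (.id ℝ _) i) (fun i => Fn.Db (.id ℝ _) i) (chartMetric g hφ) s.1
        (chartFun φ (PowerSeries.coeff t.1 F₁) (contDiffOn_of_smoothFun (h₁ _) hφ))
        (chartFun φ (PowerSeries.coeff t.2 F₂) (contDiffOn_of_smoothFun (h₂ _) hφ)) := by
  refine Subtype.ext (funext fun z => ?_)
  change _ = Fn.ev z _
  simp only [map_sum]
  change PowerSeries.coeff m (star g F₁ F₂) (φ.symm z) = _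
  rw [star, PowerSeries.coeff_mk]
  simp only [Finset.sum_apply]
  refine sum_congr rfl fun s _ => sum_congr rfl fun t _ => ?_
  rw [starCoeff_eq g s.1 (h₁ _) (h₂ _) hφ (φ.map_target z.2)]
  exact congrArg _ (Subtype.ext (φ.right_inv z.2))

theorem star_assoc (g : KahlerMetric n M) {F₁ F₂ F₃ : PowerSeries (M → ℂ)}
    (h₁ : SmoothSeries n F₁) (h₂ : SmoothSeries n F₂) (h₃ : SmoothSeries n F₃) :
    star g F₁ (star g F₂ F₃) = star g (star g F₁ F₂) F₃ := by
  ext m x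
  -- The coefficient of `h ^ m` contains graph sums of weight at most `m`, for which the
  -- associativity at the centre of coordinates normal up to this order applies.
  obtain ⟨φ, hφ⟩ := exists_isNormalAt g (7 * m + 1) x
  have hval : ∀ {f : M → ℂ} (hf : ContDiffOn ℝ ∞ (f ∘ φ.symm) φ.target),
      f x = Fn.ev (chartPoint φ hφ.mem_source) (chartFun φ f hf) := fun {f} hf =>
    congrArg f (φ.left_inv hφ.mem_source).symm
  rw [hval (contDiffOn_of_smoothFun (star_smoothSeries g h₁ (star_smoothSeries g h₂ h₃) m)
      hφ.mem_charts), hval (contDiffOn_of_smoothFun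
      (star_smoothSeries g (star_smoothSeries g h₁ h₂) h₃ m) hφ.mem_charts),
    chartFun_coeff_star g h₁ (star_smoothSeries g h₂ h₃) hφ.mem_charts,
    chartFun_coeff_star g (star_smoothSeries g h₁ h₂) h₃ hφ.mem_charts]
  simp only [chartFun_coeff_star g h₂ h₃ hφ.mem_charts, chartFun_coeff_star g h₁ h₂ hφ.mem_charts,
    locSum_sum_right, locSum_sum_left, map_sum]
  rw [sum_antidiagonal_right (fun a b c d e => Fn.ev (chartPoint φ hφ.mem_source)
      (locSum (fun i => Fn.D (.id ℝ _) i) (fun i => Fn.Db (.id ℝ _) i)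
      (chartMetric g hφ.mem_charts) a
      (chartFun φ (PowerSeries.coeff b F₁) (contDiffOn_of_smoothFun (h₁ _) hφ.mem_charts))
      (locSum (fun i => Fn.D (.id ℝ _) i) (fun i => Fn.Db (.id ℝ _) i)
      (chartMetric g hφ.mem_charts) c
      (chartFun φ (PowerSeries.coeff d F₂) (contDiffOn_of_smoothFun (h₂ _) hφ.mem_charts))
      (chartFun φ (PowerSeries.coeff e F₃) (contDiffOn_of_smoothFun (h₃ _) hφ.mem_charts))))),
    sum_antidiagonal_left (fun a b c d e => Fn.ev (chartPoint φ hφ.mem_source)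
      (locSum (fun i => Fn.D (.id ℝ _) i) (fun i => Fn.Db (.id ℝ _) i)
      (chartMetric g hφ.mem_charts) a
      (locSum (fun i => Fn.D (.id ℝ _) i) (fun i => Fn.Db (.id ℝ _) i)
      (chartMetric g hφ.mem_charts) b
      (chartFun φ (PowerSeries.coeff c F₁) (contDiffOn_of_smoothFun (h₁ _) hφ.mem_charts))
      (chartFun φ (PowerSeries.coeff d F₂) (contDiffOn_of_smoothFun (h₂ _) hφ.mem_charts)))
      (chartFun φ (PowerSeries.coeff e F₃) (contDiffOn_of_smoothFun (h₃ _) hφ.mem_charts))))]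
  refine sum_congr rfl fun u hu => sum_congr rfl fun v _ => sum_congr rfl fun w _ => ?_
  rw [HasAntidiagonal.mem_antidiagonal] at hu
  exact (sum_map_locSum_assoc commDer_id (chartMetric_isKahler g hφ.mem_charts) (by omega)
    hφ.ev_it_D hφ.ev_it_Db _ _ _).symm

end Star

end BerezinStar

theorem proposition3p9 (n : ℕ) (M : Type*) [TopologicalSpace M] [ChartedSpace (Fin n → ℂ) M]
    [IsManifold 𝓘(ℂ, Fin n → ℂ) ω M] (g : BerezinStar.KahlerMetric n M) :
    (∀ (N : ℕ) (x : M), ∃ φ, BerezinStar.IsNormalAt g N x φ) ∧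
    (∀ f₁ f₂ : M → ℂ, BerezinStar.SmoothFun n f₁ → BerezinStar.SmoothFun n f₂ →
      ∀ k N : ℕ, 3 * k ≤ N → ∀ x φ, BerezinStar.IsNormalAt g N x φ →
        BerezinStar.starCoeff g k f₁ f₂ x = BerezinStar.graphSum g φ x k f₁ f₂) ∧
    (∀ F₁ F₂ : PowerSeries (M → ℂ), BerezinStar.SmoothSeries n F₁ →
      BerezinStar.SmoothSeries n F₂ → BerezinStar.SmoothSeries n (BerezinStar.star g F₁ F₂)) ∧
    (∀ F₁ F₂ F₃ : PowerSeries (M → ℂ), BerezinStar.SmoothSeries n F₁ →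
      BerezinStar.SmoothSeries n F₂ → BerezinStar.SmoothSeries n F₃ →
        BerezinStar.star g F₁ (BerezinStar.star g F₂ F₃) =
          BerezinStar.star g (BerezinStar.star g F₁ F₂) F₃) := by
  refine ⟨fun N x => BerezinStar.exists_isNormalAt g N x,
    fun f₁ f₂ h₁ h₂ k N hk x φ hφ => ?_,
    fun F₁ F₂ h₁ h₂ => BerezinStar.star_smoothSeries g h₁ h₂,
    fun F₁ F₂ F₃ h₁ h₂ h₃ => BerezinStar.star_assoc g h₁ h₂ h₃⟩
  rw [BerezinStar.graphSum_eq_locSum g hk hφ h₁ h₂]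
  exact BerezinStar.starCoeff_eq g k h₁ h₂ hφ.mem_charts hφ.mem_source
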